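/- **Setting.** Let $d\ge 1$, $s>0$, $\beta>0$. We work in momentum space: $\epsilon$ is multiplication by $\epsilon(k)=|k|^s$ on $\mathcal X=L^2(\mathbb R^d;\mathbb R)$, where real functions of the position are the functions with $g(-k)=\overline{g(k)}$. Put $\rho=(e^{\beta\epsilon}-1)^{-1}$, so $1+2\rho=\coth\frac{\beta\epsilon}{2}$. For a positive injective operator $a$, $a\mathcal X$ denotes the completion of the range of $a$ in the norm $\|a^{-1}f\|$. *Path space.* Let $C=(D_t^2+\epsilon^2)^{-1}$, $D_t=-i\partial_t$, on $L^2(S_\beta;\mathcal X)$ with $\beta$-periodic boundary conditions, $S_\beta=[-\frac\beta2,\frac\beta2]$. Let $\mathcal Q^\#$ be the real Hilbert space of test functions obtained by completing the domain of $C^{1/2}$ in the norm $q(f)^{1/2}$, $q(f)=\|C^{1/2}f\|^2$. Let $\mathcal R=\bigl(2\epsilon\tanh\frac{\beta\epsilon}{2}\bigr)^{1/2}\mathcal X$, with norm $\|g\|_{\mathcal R}^2=\frac12\bigl(g\,\big|\,\epsilon^{-1}\coth\tfrac{\beta\epsilon}{2}\,g\bigr)$, and $j_t:\mathcal R\to\mathcal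 Q^\#$, $j_tg=\delta_t\otimes g$. The path space $\mathcal Q$ is the space of functionals $\phi$ on $\mathcal Q^\#$ with the $\sigma$-algebra $\mathfrak S$ generated by the evaluations $\phi\mapsto\phi(f)$, and $\mu$ is the probability measure for which $\phi(f)$ is almost surely linear in $f$ and $\mathbb E_\mu[e^{i\phi(f)}]=e^{-q(f)/4}$ for all $f\in\mathcal Q^\#$. Put $\phi_t(g)=\phi(j_tg)$, $(u_tf)(\tau)=f(\tau-t)$ and $(U_tF)(\phi)=F(\phi\circ u_t)$. Let $\mathfrak S_0$ be generated by $\{e^{i\phi_0(g)}:g\in\mathcal R\}$, and $\mathfrak S_I=\bigvee_{t\in I}U_t\mathfrak S_0$. The physical Hilbert space is $\mathcal H=L^2(\mathcal Q,\mathfrak S_{\{0,\beta/2\}},\mu)$, $E$ is the conditional expectation onto it, and $\mathcal N=L^\infty(\mathcal Q,\mathfrak S_0,\mu)$ acts on $\mathcal H$ by multiplication. *Liouvillian and modular conjugation of the path space.* For $0<r\le\frac\beta2$ and $F\in L^2(\mathfrak S_{[0,\beta/2-r]})$ put $P(t)EF=EU_tF$, $0\le t\le r$. The Liouvillian $L$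 is the closure of the operator $v\mapsto-\frac{d}{dt}P(t)v\big|_{t=0^+}$ (so that $P(t)\subset e^{-tL}$). Let $\mathfrak M$ be the von Neumann algebra generated by $e^{itL}Ae^{-itL}$, $t\in\mathbb R$, $A\in\mathcal N$. The modular conjugation of a von Neumann algebra with a vector $\Omega$ is the antiunitary $J$ in the polar decomposition $J\Delta^{1/2}$ of the closure of $A\Omega\mapsto A^*\Omega$. Let $J$ be the modular conjugation of $(\mathfrak M,1)$. *Araki–Woods side.* Let $\Gamma=\Gamma_{\mathrm b}\bigl((2\epsilon)^{1/2}\mathbb C\mathcal X\oplus(2\bar\epsilon)^{1/2}\overline{\mathbb C\mathcal X}\bigr)$ be the bosonic Fock space, with vacuum $\Omega$ and Weyl operators $W(f)=\exp\bigl(\tfrac{i}{\sqrt2}\,\overline{a^*(f)+a(f)}\bigr)$, where the bar means the closure from finite-particle vectors. The left Araki–Woods Weyl operators are $W_{\rho,\mathrm{left}}(h)=W\bigl((1+\rho)^{1/2}h\oplus\bar\rho^{1/2}\bar h\bigr)$, for $h\in(2\epsilon)^{1/2}\mathbb C\mathcal X$ with $\rho^{1/2}h\in(2\epsilon)^{1/2}\mathbb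 C\mathcal X$. Let $\mathfrak M_{\mathrm{left}}$ be the von Neumann algebra they generate, and $J_{\mathrm{AW}}$ the modular conjugation of $(\mathfrak M_{\mathrm{left}},\Omega)$. **Theorem.** The modular conjugations $J$ of $(\mathfrak M,1)$ and $J_{\mathrm{AW}}$ of $(\mathfrak M_{\mathrm{left}},\Omega)$ exist, and there is a unitary $T_{\mathrm{euclid}}:\mathcal H\to\Gamma$ such that 1. $T_{\mathrm{euclid}}1=\Omega$; 2. $T_{\mathrm{euclid}}\,e^{i\phi_0(g)}\,T_{\mathrm{euclid}}^{-1}=W_{\rho,\mathrm{left}}(g)$ for all $g\in\mathcal R$; 3. $T_{\mathrm{euclid}}L=d\Gamma(\epsilon\oplus-\bar\epsilon)\,T_{\mathrm{euclid}}$, including equality of the domains; 4. $T_{\mathrm{euclid}}J=J_{\mathrm{AW}}T_{\mathrm{euclid}}$. It is unique: a unitary $\mathcal H\to\Gamma$ that satisfies 1, 2 and at least one of 3 and 4 equals $T_{\mathrm{euclid}}$. -/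

import Mathlib

open MeasureTheory ProbabilityTheory Complex

namespace ThermalPath

/-! ### Gaussian fields -/


theorem norm_exp_sub_exp_le (a b : ℝ) : ‖cexp (I * a) - cexp (I * b)‖ ≤ |a - b| := by
  have h : cexp (I * a) - cexp (I * b) = cexp (I * b) * (cexp (I * ((a - b : ℝ))) - 1) := by
    rw [mul_sub, ← Complex.exp_add]; push_cast; ring_nf
  rw [h, norm_mul, mul_comm I (b : ℂ), Complex.norm_exp_ofReal_mul_I, one_mul]
  exact (Real.norm_exp_I_mul_ofReal_sub_one_le).trans (by simp)

theorem exists_isonormal (K : Type) [NormedAddCommGroup K] [InnerProductSpace ℝ K]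
    [CompleteSpace K] :
    ∃ (A : Type) (_ : MeasurableSpace A) (P : Measure A) (_ : IsProbabilityMeasure P)
      (X : K →ₗᵢ[ℝ] Lp ℝ 2 P),
      ∀ f : K, ∫ ω, cexp (I * ((X f ω : ℝ) : ℂ)) ∂P = cexp (-(‖f‖ ^ 2 / 2 : ℝ)) := by
  classical
  obtain ⟨w, b, -⟩ := exists_hilbertBasis ℝ K
  let P : Measure (w → ℝ) := Measure.infinitePi (fun _ : w => gaussianReal 0 1)
  have hP : IsProbabilityMeasure P := by infer_instance
  have hlaw : ∀ i : w, MeasurePreserving (fun ω : w → ℝ => ω i) P (gaussianReal 0 1) :=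
    fun i => measurePreserving_eval_infinitePi _ i
  have hmem : ∀ i : w, MemLp (fun ω : w → ℝ => ω i) 2 P := fun i =>
    (memLp_id_gaussianReal (μ := 0) (v := 1) 2).comp_measurePreserving (hlaw i)
  have hind : iIndepFun (fun (i : w) (ω : w → ℝ) => ω i) P :=
    iIndepFun_infinitePi (X := fun _ x => x) (fun _ => measurable_id)
  have hmean : ∀ i : w, ∫ ω, ω i ∂P = 0 := by
    intro i
    have := (hlaw i).map_eq
    rw [show (∫ ω, ω i ∂P) = ∫ x, x ∂(gaussianReal 0 1) by
      rw [← this, integral_map (hlaw i).measurable.aemeasurable (by fun_prop)]]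
    exact integral_id_gaussianReal
  have hsq : ∀ i : w, ∫ ω, ω i * ω i ∂P = 1 := by
    intro i
    have := (hlaw i).map_eq
    rw [show (∫ ω, ω i * ω i ∂P) = ∫ x, x * x ∂(gaussianReal 0 1) by
      rw [← this, integral_map (hlaw i).measurable.aemeasurable (by fun_prop)]]
    have hv := variance_id_gaussianReal (μ := 0) (v := 1)
    rw [variance_eq_integral (by fun_prop)] at hv
    simp only [id] at hv
    rw [integral_id_gaussianReal] at hv
    simpa [sq] using hv
  let e : w → Lp ℝ 2 P := fun i => (hmem i).toLp _
  have he : Orthonormal ℝ e := by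
    rw [orthonormal_iff_ite]
    intro i j
    rw [L2.inner_def]
    have h1 : ∫ ω, inner ℝ (e i ω) (e j ω) ∂P = ∫ ω, ω i * ω j ∂P := by
      apply integral_congr_ae
      filter_upwards [(hmem i).coeFn_toLp, (hmem j).coeFn_toLp] with ω h1 h2
      rw [show e i ω = ω i from h1, show e j ω = ω j from h2]
      simp [mul_comm]
    rw [h1]
    split_ifs with hij
    · subst hij; exact hsq i
    · have := (hind.indepFun hij).integral_fun_mul_eq_mul_integral
        (hmem i).1 (hmem j).1
      simp only [hmean, mul_zero] at this
      exact this
  obtain ⟨X, hXb⟩ : ∃ X : K →ₗᵢ[ℝ] Lp ℝ 2 P, ∀ i, X (b i) = e i := by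
    refine ⟨he.orthogonalFamily.linearIsometry.comp b.repr.toLinearIsometry, fun i => ?_⟩
    change he.orthogonalFamily.linearIsometry (b.repr (b i)) = e i
    rw [b.repr_self]
    exact (he.orthogonalFamily.linearIsometry_apply_single _).trans (by simp)
  refine ⟨w → ℝ, inferInstance, P, hP, X, ?_⟩
  -- continuity of the left-hand side
  have hint : ∀ g : Lp ℝ 2 P, Integrable (fun ω => cexp (I * ((g ω : ℝ) : ℂ))) P := by
    intro g
    refine Integrable.of_bound (C := 1) ?_ ?_
    · have := (Lp.aestronglyMeasurable g)
      exact (Continuous.comp_aestronglyMeasurable (g := fun x : ℝ => cexp (I * (x : ℂ)))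
        (by fun_prop) this)
    · filter_upwards with ω
      rw [mul_comm, Complex.norm_exp_ofReal_mul_I]
  have hcont : Continuous (fun g : Lp ℝ 2 P => ∫ ω, cexp (I * ((g ω : ℝ) : ℂ)) ∂P) := by
    have hL : LipschitzWith 1 (fun g : Lp ℝ 2 P => ∫ ω, cexp (I * ((g ω : ℝ) : ℂ)) ∂P) := by
      apply LipschitzWith.of_dist_le_mul
      intro g h
      rw [dist_eq_norm, dist_eq_norm, ← integral_sub (hint g) (hint h)]
      have hgh : MemLp (fun ω => g ω - h ω) 2 P := (Lp.memLp g).sub (Lp.memLp h)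
      calc ‖∫ ω, (cexp (I * ((g ω : ℝ) : ℂ)) - cexp (I * ((h ω : ℝ) : ℂ))) ∂P‖
          ≤ ∫ ω, ‖g ω - h ω‖ ∂P := by
            refine norm_integral_le_of_norm_le (hgh.integrable (by norm_num)).norm ?_
            filter_upwards with ω
            exact norm_exp_sub_exp_le _ _
        _ = (eLpNorm (fun ω => g ω - h ω) 1 P).toReal := by
            rw [integral_norm_eq_lintegral_enorm hgh.1, eLpNorm_one_eq_lintegral_enorm]
        _ ≤ (eLpNorm (fun ω => g ω - h ω) 2 P).toReal :=
            ENNReal.toReal_mono hgh.2.ne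
              (eLpNorm_le_eLpNorm_of_exponent_le (by norm_num) hgh.1)
        _ = ((1 : NNReal) : ℝ) * ‖g - h‖ := by
            rw [Lp.norm_def, NNReal.coe_one, one_mul]
            congr 1
            exact eLpNorm_congr_ae (Lp.coeFn_sub g h).symm
    exact hL.continuous
  have hdense := b.dense_span
  have hclosed : IsClosed {f : K | ∫ ω, cexp (I * ((X f ω : ℝ) : ℂ)) ∂P
      = cexp (-(‖f‖ ^ 2 / 2 : ℝ))} :=
    isClosed_eq (hcont.comp X.continuous) (by fun_prop)
  have hspan : ∀ f ∈ Submodule.span ℝ (Set.range b), ∫ ω, cexp (I * ((X f ω : ℝ) : ℂ)) ∂P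
      = cexp (-(‖f‖ ^ 2 / 2 : ℝ)) := by
    intro f hf
    obtain ⟨c, rfl⟩ := (Finsupp.mem_span_range_iff_exists_finsupp).1 hf
    have hX : X (c.sum fun i a => a • b i) = c.sum fun i a => a • e i := by
      simp [Finsupp.sum, map_sum, hXb]
    have hae : ∀ᵐ ω ∂P, (X (c.sum fun i a => a • b i)) ω = ∑ i ∈ c.support, c i * ω i := by
      rw [hX]
      have h1 : ∀ᵐ ω ∂P, (c.sum fun i a => a • e i : Lp ℝ 2 P) ω
          = ∑ i ∈ c.support, (c i • e i : Lp ℝ 2 P) ω := by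
        have := Lp.coeFn_finsetSum c.support (fun i => (c i • e i : Lp ℝ 2 P))
        filter_upwards [this] with ω hω
        simpa [Finsupp.sum] using hω
      have h2 : ∀ᵐ ω ∂P, ∀ i ∈ c.support, (c i • e i : Lp ℝ 2 P) ω = c i * ω i := by
        rw [Filter.eventually_all_finset]
        intro i _
        filter_upwards [Lp.coeFn_smul (c i) (e i), (hmem i).coeFn_toLp] with ω k1 k2
        rw [k1, Pi.smul_apply, show e i ω = ω i from k2, smul_eq_mul]
      filter_upwards [h1, h2] with ω k1 k2
      rw [k1]
      exact Finset.sum_congr rfl k2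
    have hnorm : ‖c.sum fun i a => a • b i‖ ^ 2 = ∑ i ∈ c.support, c i ^ 2 := by
      have := b.orthonormal.inner_sum c c c.support
      rw [← real_inner_self_eq_norm_sq, Finsupp.sum]
      rw [this]
      simp [sq]
    rw [hnorm]
    rw [integral_congr_ae (g := fun ω => ∏ i : c.support, cexp (I * ((c i * ω i : ℝ) : ℂ)))]
    · have hind' : iIndepFun (fun (i : c.support) (ω : w → ℝ) => ω i) P :=
        hind.precomp Subtype.val_injective
      have := hind'.integral_fun_prod_comp (f := fun (i : c.support) (x : ℝ) =>
        cexp (I * ((c i * x : ℝ) : ℂ))) (fun i => (measurable_pi_apply (i : w)).aemeasurable)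
        (fun i => by fun_prop)
      rw [this]
      have hone : ∀ i : c.support, ∫ ω, cexp (I * ((c i * ω (i : w) : ℝ) : ℂ)) ∂P
          = cexp (-((c i) ^ 2 / 2 : ℝ)) := by
        intro i
        have hm := (hlaw i).map_eq
        rw [show (∫ ω, cexp (I * ((c i * ω (i : w) : ℝ) : ℂ)) ∂P)
          = ∫ x, cexp (I * ((c i * x : ℝ) : ℂ)) ∂(gaussianReal 0 1) by
          rw [← hm, integral_map (hlaw i).measurable.aemeasurable (by fun_prop)]]
        have := charFun_gaussianReal (μ := 0) (v := 1) (c i)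
        rw [charFun_apply_real] at this
        rw [show (fun x : ℝ => cexp (I * ((c i * x : ℝ) : ℂ)))
          = fun x : ℝ => cexp ((c i : ℂ) * x * I) by
            funext x; push_cast; ring_nf]
        rw [this]; push_cast; simp
      simp_rw [hone]
      rw [← Complex.exp_sum]
      congr 1
      rw [← Finset.sum_coe_sort c.support]
      push_cast
      rw [Finset.sum_neg_distrib, Finset.sum_div]
    · filter_upwards [hae] with ω hω
      rw [hω, ← Complex.exp_sum]
      congr 1
      rw [← Finset.sum_coe_sort c.support]
      push_cast
      rw [Finset.mul_sum]
  intro f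
  have : f ∈ closure ((Submodule.span ℝ (Set.range b) : Submodule ℝ K) : Set K) := by
    have h := hdense
    rw [Submodule.topologicalClosure_coe .. |>.symm, h]; trivial
  exact hclosed.closure_subset_iff.2 hspan this

/-- For every family `v` of vectors of a Hilbert space there is a centred Gaussian field with the
covariance `Re ⟪v x, v y⟫ / 2`, realised as a measure on the space of functions of the index. -/
theorem exists_gaussianField {S K : Type} [NormedAddCommGroup K] [InnerProductSpace ℂ K]
    [CompleteSpace K] (v : S → K) :
    ∃ μ : Measure (S → ℝ), IsProbabilityMeasure μ ∧ ∀ c : S →₀ ℝ,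
      ∫ ω, cexp (I * ((∑ x ∈ c.support, c x * ω x : ℝ) : ℂ)) ∂μ
        = cexp (-(‖∑ x ∈ c.support, (c x : ℂ) • v x‖ ^ 2 / 4 : ℝ)) := by
  let _ : InnerProductSpace ℝ K := InnerProductSpace.complexToReal
  obtain ⟨A, mA, P, hP, X, hX⟩ := exists_isonormal K
  have hmeas : Measurable (fun (ω : A) (x : S) => X ((√2 : ℝ)⁻¹ • v x) ω) :=
    measurable_pi_lambda _ fun x => (Lp.stronglyMeasurable _).measurable
  refine ⟨P.map (fun ω x => X ((√2 : ℝ)⁻¹ • v x) ω),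
    Measure.isProbabilityMeasure_map hmeas.aemeasurable, fun c => ?_⟩
  rw [integral_map hmeas.aemeasurable]
  · have hae : ∀ᵐ ω ∂P, (X ((√2 : ℝ)⁻¹ • ∑ x ∈ c.support, (c x : ℂ) • v x)) ω
        = ∑ x ∈ c.support, c x * (X ((√2 : ℝ)⁻¹ • v x)) ω := by
      have hlin : X ((√2 : ℝ)⁻¹ • ∑ x ∈ c.support, (c x : ℂ) • v x)
          = ∑ x ∈ c.support, c x • X ((√2 : ℝ)⁻¹ • v x) := by
        rw [Finset.smul_sum, map_sum]
        refine Finset.sum_congr rfl fun x _ => ?_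
        rw [← map_smul, Complex.coe_smul, smul_comm]
      rw [hlin]
      have h1 := Lp.coeFn_finsetSum c.support (fun x => c x • X ((√2 : ℝ)⁻¹ • v x))
      have h2 : ∀ᵐ ω ∂P, ∀ x ∈ c.support, (c x • X ((√2 : ℝ)⁻¹ • v x) : Lp ℝ 2 P) ω
          = c x * (X ((√2 : ℝ)⁻¹ • v x)) ω := by
        rw [Filter.eventually_all_finset]
        intro x _
        filter_upwards [Lp.coeFn_smul (c x) (X ((√2 : ℝ)⁻¹ • v x))] with ω k
        rw [k, Pi.smul_apply, smul_eq_mul]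
      filter_upwards [h1, h2] with ω k1 k2
      rw [k1, Finset.sum_apply]
      exact Finset.sum_congr rfl k2
    rw [integral_congr_ae (g := fun ω => cexp (I * (((X ((√2 : ℝ)⁻¹ •
      ∑ x ∈ c.support, (c x : ℂ) • v x)) ω : ℝ) : ℂ)))
      (by filter_upwards [hae] with ω hω; rw [hω]), hX, norm_smul]
    congr 3
    rw [mul_pow, norm_inv, inv_pow, Real.norm_of_nonneg (Real.sqrt_nonneg 2),
      Real.sq_sqrt (by norm_num)]
    ring
  · refine Measurable.aestronglyMeasurable ?_
    fun_prop

/-! ### Unbounded operators, one-parameter groups and modular conjugations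

An unbounded operator is given by its graph, a subset of `H × H`. -/

section Operators

variable {H : Type*} [NormedAddCommGroup H] [InnerProductSpace ℂ H]

/-- `V` is the strongly continuous one-parameter unitary group with generator `A`:
`d/dt V t x = i A x` at `t = 0` exactly for the `x` in the domain of `A`. -/
structure IsUnitaryGroup (A : Set (H × H)) (V : ℝ → H →L[ℂ] H) : Prop where
  map_zero : V 0 = 1
  map_add : ∀ t u, V (t + u) = V t * V u
  norm_map : ∀ t x, ‖V t x‖ = ‖x‖
  continuous : ∀ x, Continuous fun t => V t x
  generator : ∀ x y, (x, y) ∈ A ↔ HasDerivAt (fun t => V t x) (I • y) 0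

open Classical in
/-- The unitary group `exp (i t A)` of a self-adjoint operator `A` (and `0` if `A` generates no
unitary group). -/
noncomputable def expI (A : Set (H × H)) (t : ℝ) : H →L[ℂ] H :=
  if h : ∃ V, IsUnitaryGroup A V then h.choose t else 0

/-- `G` is the graph of a positive self-adjoint operator. -/
structure IsPositiveSelfAdjoint (G : Set (H × H)) : Prop where
  single_valued : ∀ y, ((0 : H), y) ∈ G → y = 0
  adjoint_eq : ∀ x y, (x, y) ∈ G ↔ ∀ p ∈ G, inner ℂ p.1 y = inner ℂ p.2 x
  nonneg : ∀ p ∈ G, 0 ≤ (inner ℂ p.1 p.2).re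

/-- The double commutant of a set of bounded operators. -/
def doubleCommutant (N : Set (H →L[ℂ] H)) : Set (H →L[ℂ] H) :=
  Set.centralizer (Set.centralizer N)

/-- The closure of the Tomita operator `A Ω ↦ A* Ω`, `A ∈ N`. -/
def tomitaOperator [CompleteSpace H] (N : Set (H →L[ℂ] H)) (Ω : H) : Set (H × H) :=
  closure {p | ∃ A ∈ N, p = (A Ω, A.adjoint Ω)}

/-- `J` is the modular conjugation of the von Neumann algebra `N` and the vector `Ω`: the
antiunitary part in the polar decomposition `S = J Δ^{1/2}` of the closed Tomita operator `S`. -/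
def IsModularConjugation [CompleteSpace H] (N : Set (H →L[ℂ] H)) (Ω : H) (J : H ≃ₗᵢ⋆[ℂ] H) :
    Prop :=
  (∀ x, J (J x) = x) ∧
    IsPositiveSelfAdjoint {p : H × H | (p.1, J p.2) ∈ tomitaOperator N Ω}

end Operators

/-! ### The bosonic Fock space over `L²(M, m)` -/

section Fock

open Classical in
/-- The `L²` class of a function (and `0` if the function is not square integrable). -/
noncomputable def toL2 {M : Type*} [MeasurableSpace M] (m : Measure M) (f : M → ℂ) :
    Lp ℂ 2 m :=
  if h : MemLp f 2 m then h.toLp f else 0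

variable {M : Type} [MeasurableSpace M]

theorem measurePreserving_permute (m : Measure M) [SigmaFinite m] {n : ℕ}
    (σ : Equiv.Perm (Fin n)) :
    MeasurePreserving (fun x : Fin n → M => x ∘ σ) (Measure.pi fun _ : Fin n => m)
      (Measure.pi fun _ : Fin n => m) :=
  measurePreserving_arrowCongr' (fun _ => m) (fun _ => m) σ.symm (MeasurableEquiv.refl M)
    (fun _ => MeasurePreserving.id m)

/-- The full Fock space `⨁ₙ L²(Mⁿ)`. -/
abbrev FullFock (m : Measure M) : Type :=
  lp (fun n : ℕ => Lp ℂ 2 (Measure.pi fun _ : Fin n => m)) 2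

/-- The bosonic Fock space over `L²(M, m)`: the Hilbert sum over `n` of the symmetric `n`-fold
tensor powers of `L²(M, m)`, that is, of the permutation invariant functions in `L²(Mⁿ)`. -/
noncomputable def Fock (m : Measure M) [SigmaFinite m] : Submodule ℂ (FullFock m) where
  carrier := {ψ | ∀ (n : ℕ) (σ : Equiv.Perm (Fin n)),
    Lp.compMeasurePreservingₗᵢ ℂ _ (measurePreserving_permute m σ) (ψ n) = ψ n}
  add_mem' := fun {a b} ha hb n σ => by
    rw [lp.coeFn_add, Pi.add_apply, map_add, ha n σ, hb n σ]
  zero_mem' := fun n σ => by rw [lp.coeFn_zero, Pi.zero_apply, map_zero]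
  smul_mem' := fun c a ha n σ => by
    rw [lp.coeFn_smul, Pi.smul_apply, map_smul, ha n σ]

variable (m : Measure M) [SigmaFinite m]

instance : CompleteSpace (Fock m) := by
  have hc : IsClosed ((Fock m : Submodule ℂ (FullFock m)) : Set (FullFock m)) := by
    have : ((Fock m : Submodule ℂ (FullFock m)) : Set (FullFock m))
        = ⋂ (n : ℕ) (σ : Equiv.Perm (Fin n)), {ψ : FullFock m |
          Lp.compMeasurePreservingₗᵢ ℂ _ (measurePreserving_permute m σ) (ψ n) = ψ n} := by
      ext ψ; simp only [Set.mem_iInter]; rfl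
    rw [this]
    refine isClosed_iInter fun n => isClosed_iInter fun σ => ?_
    have he : Continuous fun ψ : FullFock m => ψ n := (lp.evalCLM ℂ _ 2 n).continuous
    exact isClosed_eq ((LinearIsometry.continuous _).comp he) he
  exact hc.completeSpace_coe

/-- The vacuum: `1` in the zero-particle space, `0` elsewhere. -/
noncomputable def vacuum : Fock m :=
  ⟨lp.single 2 0 (toL2 _ fun _ => 1), fun n σ => by
    rcases Nat.eq_zero_or_pos n with rfl | hn
    · apply Lp.ext
      refine (Lp.coeFn_compMeasurePreserving _ (measurePreserving_permute m σ)).trans ?_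
      refine Filter.Eventually.of_forall fun x => ?_
      rw [Function.comp_apply, Subsingleton.elim (x ∘ σ) x]
    · rw [lp.single_apply_ne _ _ _ hn.ne', map_zero]⟩

/-- `(a*(f) ψ)ₙ`, where `(a*(f) ψ)ₙ₊₁(x) = (n+1)^{-1/2} ∑ⱼ f(xⱼ) ψₙ(x with xⱼ omitted)`. -/
noncomputable def creation (f : Lp ℂ 2 m) (ψ : Fock m) : (n : ℕ) → (Fin n → M) → ℂ
  | 0, _ => 0
  | n + 1, x => (1 / √((n : ℝ) + 1) : ℝ) * ∑ j : Fin (n + 1), f (x j) * ψ.1 n (j.removeNth x)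

/-- `(a(f) ψ)ₙ(x) = (n+1)^{1/2} ∫ conj f(q) ψₙ₊₁(q, x) dm(q)`. -/
noncomputable def annihilation (f : Lp ℂ 2 m) (ψ : Fock m) (n : ℕ) (x : Fin n → M) : ℂ :=
  (√((n : ℝ) + 1) : ℝ) * ∫ q, starRingEnd ℂ (f q) * ψ.1 (n + 1) (Fin.cons q x) ∂m

/-- The Segal field operator `(a*(f) + a(f)) / √2`: the closure of its restriction to the vectors
with finitely many particles. -/
def segalField (f : Lp ℂ 2 m) : Set (Fock m × Fock m) :=
  closure {p | (∃ N : ℕ, ∀ n > N, p.1.1 n = 0) ∧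
    ∀ n, p.2.1 n =ᵐ[Measure.pi fun _ : Fin n => m] fun x =>
      (1 / √2 : ℝ) * (creation m f p.1 n x + annihilation m f p.1 n x)}

/-- The Weyl operator `exp (i φ(f))`, `φ(f)` the Segal field operator. -/
noncomputable def weyl (f : Lp ℂ 2 m) : Fock m →L[ℂ] Fock m := expI (segalField m f) 1

/-- The second quantisation `dΓ(a)` of the operator of multiplication by the real function `a`:
multiplication by `∑ⱼ a(xⱼ)` on the `n`-particle space, with its maximal domain. -/
def dGamma (a : M → ℝ) : Set (Fock m × Fock m) :=
  {p | ∀ n, p.2.1 n =ᵐ[Measure.pi fun _ : Fin n => m] fun x => (∑ j, a (x j) : ℝ) * p.1.1 n x}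

end Fock

/-! ### The one-particle objects, in momentum space -/

section OneParticle

/-- Momentum space. -/
abbrev Mom (d : ℕ) : Type := EuclideanSpace ℝ (Fin d)

/-- The one-particle Hamiltonian, multiplication by `|k|^s`. -/
noncomputable def energy {d : ℕ} (s : ℝ) (k : Mom d) : ℝ := ‖k‖ ^ s

/-- The density `1 / (exp (β ε) - 1)`. -/
noncomputable def density {d : ℕ} (s β : ℝ) (k : Mom d) : ℝ :=
  1 / (Real.exp (β * energy s k) - 1)

/-- `coth (β ε / 2)`. -/
noncomputable def cothHalf {d : ℕ} (s β : ℝ) (k : Mom d) : ℝ :=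
  Real.cosh (β * energy s k / 2) / Real.sinh (β * energy s k / 2)

/-- The measure `dk / (2 ε)`. Its complex `L²` space is the completion `(2 ε)^{1/2} L²(ℝᵈ, dk)` of
the range of `(2 ε)^{1/2}` in the norm `‖(2 ε)^{-1/2} f‖`. -/
noncomputable def energyMeasure (d : ℕ) (s : ℝ) : Measure (Mom d) :=
  volume.withDensity fun k => ENNReal.ofReal (1 / (2 * energy s k))

/-- The measure `coth (β ε / 2) / (2 ε) dk`. -/
noncomputable def thermalMeasure (d : ℕ) (s β : ℝ) : Measure (Mom d) :=
  volume.withDensity fun k => ENNReal.ofReal (cothHalf s β k / (2 * energy s k))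

instance (d : ℕ) (s : ℝ) : SigmaFinite (energyMeasure d s) := by
  unfold energyMeasure; infer_instance

/-- The real subspace of the functions in the complex `L²` space that satisfy
`h(-p) = conj h(p)`; in momentum space, these are the real functions of the position. -/
def hermitian {V : Type} [Neg V] [MeasurableSpace V] (m : Measure V) :
    Submodule ℝ (Lp ℂ 2 m) where
  carrier := {f | ∃ h : V → ℂ, (∀ p, h (-p) = starRingEnd ℂ (h p)) ∧ f =ᵐ[m] h}
  add_mem' := by
    rintro f g ⟨h, hh, hf⟩ ⟨k, hk, hg⟩
    refine ⟨h + k, fun p => ?_, (Lp.coeFn_add f g).trans (hf.add hg)⟩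
    rw [Pi.add_apply, Pi.add_apply, hh, hk, map_add]
  zero_mem' := ⟨0, fun _ => (map_zero _).symm, Lp.coeFn_zero ℂ 2 m⟩
  smul_mem' := by
    rintro c f ⟨h, hh, hf⟩
    refine ⟨c • h, fun p => ?_, (Lp.coeFn_smul c f).trans (hf.const_smul c)⟩
    rw [Pi.smul_apply, Pi.smul_apply, hh, Complex.real_smul, Complex.real_smul, map_mul,
      Complex.conj_ofReal]

/-- The real Hilbert space `(2 ε tanh (β ε / 2))^{1/2} L²(ℝᵈ; ℝ)`, that is, the completion of the
range of `(2 ε tanh (β ε / 2))^{1/2}` in the norm `(g | coth (β ε / 2) / (2 ε) g)^{1/2}`. -/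
abbrev TimeZero (d : ℕ) (s β : ℝ) : Type := hermitian (thermalMeasure d s β)

end OneParticle

/-! ### The path space -/

section PathSpace

variable (d : ℕ) (s β : ℝ)

/-- The Matsubara frequency `2 π n / β`. -/
noncomputable def matsubara (n : ℤ) : ℝ := 2 * Real.pi * n / β

/-- The measure on `ℤ × ℝᵈ` with the density `1 / (ωₙ² + ε²)`, the symbol of the covariance
`C = (D_t² + ε²)⁻¹` with `β`-periodic boundary conditions. -/
noncomputable def covMeasure : Measure (ℤ × Mom d) :=
  (Measure.count.prod volume).withDensity fun p =>
    ENNReal.ofReal (1 / (matsubara β p.1 ^ 2 + energy s p.2 ^ 2))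

/-- The real Hilbert space of test functions on `S_β × ℝᵈ`, with the norm `(f | C f)^{1/2}`: the
completion of the domain of `C^{1/2}` in `L²(S_β × ℝᵈ; ℝ)`, after Fourier transformation in time
and space. -/
abbrev TestFun : Type := hermitian (covMeasure d s β)

open Classical in
/-- The test function with the Fourier transform `h` (and `0` if there is none). -/
noncomputable def TestFun.ofFourier (h : ℤ × Mom d → ℂ) : TestFun d s β :=
  if H : ∃ f : TestFun d s β, f.1 =ᵐ[covMeasure d s β] h then H.choose else 0

variable {d s β}

/-- `j_t g = δ_t ⊗ g`. Its Fourier coefficients are `β^{-1/2} exp (-i ωₙ t) g(k)`. -/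
noncomputable def sharpTime (t : ℝ) (g : TimeZero d s β) : TestFun d s β :=
  TestFun.ofFourier d s β fun p => (1 / √β : ℝ) * cexp (-I * (matsubara β p.1 * t : ℝ)) * g.1 p.2

/-- The time translation `(u_t f)(τ) = f(τ - t)` of test functions. -/
noncomputable def translate (t : ℝ) (f : TestFun d s β) : TestFun d s β :=
  TestFun.ofFourier d s β fun p => cexp (-I * (matsubara β p.1 * t : ℝ)) * f.1 p

variable (d s β)

/-- The path space: all functionals `φ` of the test functions, with the `σ`-algebra generated by
the evaluations `φ ↦ φ(f)`. -/
abbrev Path : Type := TestFun d s β → ℝ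

/-- The Gaussian measure on path space with `E[exp (i φ(f))] = exp (-(f | C f) / 4)`; the linear
combinations express that `φ(f)` is almost surely linear in `f`. -/
noncomputable def pathMeasure : Measure (Path d s β) :=
  (exists_gaussianField (fun f : TestFun d s β => f.1)).choose

theorem pathMeasure_spec : IsProbabilityMeasure (pathMeasure d s β) ∧
    ∀ c : TestFun d s β →₀ ℝ,
      ∫ φ, cexp (I * ((∑ f ∈ c.support, c f * φ f : ℝ) : ℂ)) ∂(pathMeasure d s β)
        = cexp (-(‖∑ f ∈ c.support, (c f : ℂ) • f.1‖ ^ 2 / 4 : ℝ)) :=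
  (exists_gaussianField (fun f : TestFun d s β => f.1)).choose_spec

instance : IsProbabilityMeasure (pathMeasure d s β) := (pathMeasure_spec d s β).1

variable {d s β}

/-- The time translation of paths, `(ũ_t φ)(f) = φ(u_t f)`. -/
noncomputable def translatePath (t : ℝ) (φ : Path d s β) : Path d s β := fun f => φ (translate t f)

/-- `U_t F = F ∘ ũ_t` on `L²`. -/
noncomputable def translateL2 (t : ℝ) (F : Lp ℂ 2 (pathMeasure d s β)) :
    Lp ℂ 2 (pathMeasure d s β) :=
  toL2 _ fun φ => F (translatePath t φ)

/-- The function `exp (i φ_0(g))`, with the sharp-time field `φ_0(g) = φ(j_0 g)`. -/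
noncomputable def expField (g : TimeZero d s β) (φ : Path d s β) : ℂ :=
  cexp (I * (φ (sharpTime 0 g) : ℂ))

variable (d s β)

/-- The time-zero `σ`-algebra, generated by the functions `exp (i φ_0(g))`. -/
noncomputable abbrev sigmaZero : MeasurableSpace (Path d s β) :=
  ⨆ g : TimeZero d s β, MeasurableSpace.comap (expField g) inferInstance

/-- The `σ`-algebra generated by the translates `U_t` of the time-zero `σ`-algebra, `t ∈ T`. -/
noncomputable abbrev sigmaTimes (T : Set ℝ) : MeasurableSpace (Path d s β) :=
  ⨆ t ∈ T, MeasurableSpace.comap (translatePath t) (sigmaZero d s β)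

theorem sigmaTimes_le (T : Set ℝ) : sigmaTimes d s β T ≤ MeasurableSpace.pi := by
  refine iSup₂_le fun t _ => ?_
  rw [sigmaZero, MeasurableSpace.comap_iSup]
  refine iSup_le fun g => ?_
  rw [MeasurableSpace.comap_comp]
  refine Measurable.comap_le ?_
  change Measurable fun φ : Path d s β => cexp (I * (φ (translate t (sharpTime 0 g)) : ℂ))
  fun_prop

/-- The physical Hilbert space: the `L²` functions measurable (up to null sets) with respect to the
`σ`-algebra of the times `0` and `β / 2`. -/
abbrev Phys : Type := lpMeas ℂ ℂ (sigmaTimes d s β {0, β / 2}) 2 (pathMeasure d s β)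

instance : CompleteSpace (Phys d s β) := by
  have : Fact (sigmaTimes d s β {0, β / 2} ≤ MeasurableSpace.pi) := ⟨sigmaTimes_le d s β _⟩
  infer_instance

/-- The thermal vacuum, the constant function `1`. -/
noncomputable def thermalVacuum : Phys d s β :=
  ⟨Lp.const 2 (pathMeasure d s β) (1 : ℂ), by
    rw [mem_lpMeas_iff_aestronglyMeasurable]
    exact aestronglyMeasurable_const.congr (Lp.coeFn_const 2 (pathMeasure d s β) (1 : ℂ)).symm⟩

/-- The conditional expectation onto the physical Hilbert space. -/
noncomputable def physExp : Lp ℂ 2 (pathMeasure d s β) →L[ℂ] Phys d s β :=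
  condExpL2 ℂ ℂ (sigmaTimes_le d s β {0, β / 2})

/-- The Liouvillian `L`: the closure of minus the derivative at `t = 0` of the local semigroup
`P(t) E F = E U_t F`, where `E` is the conditional expectation onto the physical Hilbert space and
`P(t)` is defined for `0 ≤ t ≤ r` on the `E F` with `F` measurable with respect to the times in
`[0, β / 2 - r]`. The operator `P(t)` is the restriction of `exp (-t L)`. -/
def liouvillian : Set (Phys d s β × Phys d s β) :=
  closure {p | ∃ r : ℝ, 0 < r ∧ r ≤ β / 2 ∧ ∃ F : Lp ℂ 2 (pathMeasure d s β),
    F ∈ lpMeas ℂ ℂ (sigmaTimes d s β (Set.Icc 0 (β / 2 - r))) 2 (pathMeasure d s β) ∧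
    p.1 = physExp d s β F ∧
    Filter.Tendsto (fun t : ℝ => (t⁻¹ : ℂ) • (p.1 - physExp d s β (translateL2 t F)))
      (nhdsWithin 0 (Set.Ioi 0)) (nhds p.2)}

/-- The von Neumann algebra `L^∞` of the time-zero `σ`-algebra, acting by multiplication on the
physical Hilbert space. -/
def timeZeroAlgebra : Set (Phys d s β →L[ℂ] Phys d s β) :=
  {A | ∃ b : Path d s β → ℂ, Measurable[sigmaZero d s β] b ∧ (∃ C : ℝ, ∀ φ, ‖b φ‖ ≤ C) ∧
    ∀ F : Phys d s β, (A F).1 =ᵐ[pathMeasure d s β] fun φ => b φ * F.1 φ}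

/-- The von Neumann algebra on the physical Hilbert space generated by the real-time translates
`exp (i t L) A exp (-i t L)` of the time-zero algebra. -/
def physAlgebra : Set (Phys d s β →L[ℂ] Phys d s β) :=
  doubleCommutant {B | ∃ t : ℝ, ∃ A ∈ timeZeroAlgebra d s β,
    B = expI (liouvillian d s β) t * A * expI (liouvillian d s β) (-t)}

end PathSpace

/-! ### The Araki-Woods representation -/

section ArakiWoods

variable (d : ℕ) (s β : ℝ)

/-- The one-particle measure of the Araki-Woods Fock space: the complex `L²` space of this measure
is `(2 ε)^{1/2} L² ⊕ conj ((2 ε)^{1/2} L²)`, with `false` for the first summand and `true` for the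
second one. The conjugate Hilbert space of an `L²` space is identified with the `L²` space by
mapping the conjugate vector of `f` to the function `k ↦ conj (f k)`. -/
noncomputable def awMeasure : Measure (Mom d × Bool) :=
  (energyMeasure d s).prod Measure.count

instance : SigmaFinite (awMeasure d s) := by unfold awMeasure; infer_instance

/-- The Araki-Woods Fock space. -/
abbrev AWFock : Type := Fock (awMeasure d s)

/-- `ε ⊕ -ε̄`. -/
noncomputable def awEnergy (p : Mom d × Bool) : ℝ :=
  if p.2 then -energy s p.1 else energy s p.1

variable {d s β}

/-- The vector `(1 + ρ)^{1/2} h ⊕ conj (ρ^{1/2} h)`, for complex `h` in the domain of `ρ^{1/2}`,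
that is, with `∫ |h|² coth (β ε / 2) / (2 ε) dk` finite; note `1 + 2 ρ = coth (β ε / 2)`. -/
noncomputable def awVector (h : Lp ℂ 2 (thermalMeasure d s β)) : Lp ℂ 2 (awMeasure d s) :=
  toL2 _ fun p => if p.2 then (√(density s β p.1) : ℝ) * starRingEnd ℂ (h p.1)
    else (√(1 + density s β p.1) : ℝ) * h p.1

/-- The left Araki-Woods Weyl operator. -/
noncomputable def awWeyl (h : Lp ℂ 2 (thermalMeasure d s β)) : AWFock d s →L[ℂ] AWFock d s :=
  weyl (awMeasure d s) (awVector h)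

variable (d s β)

/-- The left Araki-Woods von Neumann algebra. -/
def awAlgebra : Set (AWFock d s →L[ℂ] AWFock d s) :=
  doubleCommutant (Set.range (awWeyl (d := d) (s := s) (β := β)))

end ArakiWoods

/-! ### The properties of the Euclidean unitary -/

section Euclid

variable {d : ℕ} {s β : ℝ}

/-- `T` maps the thermal vacuum to the Araki-Woods vacuum. -/
def MapsVacuum (T : Phys d s β ≃ₗᵢ[ℂ] AWFock d s) : Prop :=
  T (thermalVacuum d s β) = vacuum (awMeasure d s)

/-- `T exp (i φ_0(g)) T⁻¹ = W(g)` for all `g`. -/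
def IntertwinesFields (T : Phys d s β ≃ₗᵢ[ℂ] AWFock d s) : Prop :=
  ∀ (g : TimeZero d s β) (F : Phys d s β), ∃ G : Phys d s β,
    G.1 =ᵐ[pathMeasure d s β] (fun φ => expField g φ * F.1 φ) ∧ T G = awWeyl g.1 (T F)

/-- `T L = dΓ(ε ⊕ -ε̄) T`, with equality of the domains. -/
def IntertwinesLiouvillian (T : Phys d s β ≃ₗᵢ[ℂ] AWFock d s) : Prop :=
  ∀ x y, (x, y) ∈ liouvillian d s β ↔ (T x, T y) ∈ dGamma (awMeasure d s) (awEnergy d s)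

end Euclid

end ThermalPath

set_option linter.unusedSectionVars false
attribute [-instance] CStarModule.toInner

namespace ThermalPath

/-! ### Total families in Hilbert spaces -/

section Hilbert

variable {H K : Type*} [NormedAddCommGroup H] [InnerProductSpace ℂ H] [CompleteSpace H]
  [NormedAddCommGroup K] [InnerProductSpace ℂ K] [CompleteSpace K]

/-! Everything is computed on the exponential vectors Exp(u) = Σ u^{⊗n}/√n! of the Fock space. Their
Gram matrix is e^{⟨u,v⟩} (`inner_expVec`). A Weyl operator W(f) shifts u by if/√2 up to an explicit
factor, and functions of dΓ(a) act on the exponent u alone. Write ε̃ = ε ⊕ -ε̄ and v_t(g) =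
e^{-tε̃}v_0(g) for 0 ≤ t ≤ β/2, where v_0(g) is the Araki-Woods vector of g (`timeVec`).

Unitary. For hermitian g and g', the inner product of v_t(g) and v_t'(g') is real; it is the
integral of the conjugate of g times g' against cosh((β/2-t-t')ε)/sinh(βε/2) and dk/(2ε)
(`inner_timeVec`). Summing over the Matsubara frequencies shows that the covariance of φ_t(g) and
φ_t'(g') is the same integral with |t-t'| in place of t+t' (`inner_sharpTime`). As cosh is even, the
two agree when t is 0 or β/2 and t' is any time between (`inner_sharpTime_eq`). Hence the assignment
of e^{-q(f)/4} Exp((i/√2)Σ c v_t(g)) to e^{iΣ c φ_t(g)}, with f = Σ c j_t g, preserves inner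
products for the times 0 and β/2 (`inner_fockVec`). The exponentials are total on the path side
because characters determine integrals (`total_fieldVec`). On the Fock side they are total because
hermitian functions at two distinct times span both summands over ℂ (`isTestFamily_hermFamily`).
This defines the unitary, and `euclid_physExp` extends its formula to all times in [0, β/2] after
the conditional expectation.

Liouvillian. Translating the times by t multiplies the exponents by e^{-tε̃}, so the local semigroup
becomes e^{-t dΓ(ε̃)}, and differentiation gives one inclusion. The other inclusion holds because
the exponential vectors of fields at the times 0 and t₀ < β/2, cut off in energy, lie in the domain
of the derivative and form a core of dΓ(ε̃). The core property is the orthogonality criterion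
`add_mul_eq_zero_of_orthogonal`, which also supplies the self-adjointness of the modular operator
below.

Modular conjugation. Exchanging the two summands with complex conjugation exchanges v_0(h) and
v_{β/2}(h), because 1+ρ = e^{βε}ρ; its second quantisation is J, and Δ^{1/2} is the second
quantisation of e^{-βε̃/2}. A linear space of operators that contains enough Weyl operators
W(v_0(h)) and commutes with the W(v_{β/2}(h)) has this J as its modular conjugation
(`isModularConjugation_of_weyl`). The criterion applies to the Araki-Woods algebra directly. It
applies to the transported path space algebra because complex functions are combinations of
real-time translates of hermitian ones (`exists_phase_decomposition`).

Uniqueness. If T' is another such unitary, then T'T⁻¹ fixes the vacuum and commutes with the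
W(v_0(g)) for hermitian g. Commuting with the evolution, it commutes with W(v_0(h)) for complex h in
the energy shells; commuting with J, it fixes the exponential vectors at the time β/2 as well.
Either way it fixes a total set. -/

/-- A family of vectors is total if only `0` is orthogonal to all of them. -/
def Total {ι : Type*} {H : Type*} [NormedAddCommGroup H] [InnerProductSpace ℂ H]
    (a : ι → H) : Prop := ∀ x, (∀ i, inner ℂ (a i) x = 0) → x = 0

theorem Total.span_eq_top {ι : Type*} {a : ι → H} (ha : Total a) :
    (Submodule.span ℂ (Set.range a)).topologicalClosure = ⊤ := by
  rw [Submodule.topologicalClosure_eq_top_iff, Submodule.eq_bot_iff]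
  intro x hx
  exact ha x fun i => hx _ (Submodule.subset_span ⟨i, rfl⟩)

theorem Total.dense_span {ι : Type*} {a : ι → H} (ha : Total a) :
    Dense (Submodule.span ℂ (Set.range a) : Set H) := by
  rw [Submodule.dense_iff_topologicalClosure_eq_top]
  exact ha.span_eq_top

theorem Total.denseRange {ι : Type*} {a : ι → H} (ha : Total a) :
    DenseRange (Finsupp.linearCombination ℂ a) := by
  have : Set.range (Finsupp.linearCombination ℂ a)
      = (Submodule.span ℂ (Set.range a) : Set H) := by
    rw [← Finsupp.range_linearCombination]; rfl
  rw [DenseRange, this]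
  exact ha.dense_span

theorem Total.eq_of_forall {ι : Type*} {a : ι → H} (ha : Total a) {x y : H}
    (h : ∀ i, inner ℂ (a i) x = inner ℂ (a i) y) : x = y := by
  rw [← sub_eq_zero]
  exact ha _ fun i => by rw [inner_sub_right, h, sub_self]

/-- Two continuous maps that are additive and homogeneous agree if they agree on a total family. -/
theorem Total.ext_map {ι : Type*} {a : ι → H} (ha : Total a) {σ : ℂ →+* ℂ} {f g : H →SL[σ] K}
    (h : ∀ i, f (a i) = g (a i)) : f = g := by
  refine ContinuousLinearMap.ext_on ha.dense_span ?_
  rintro _ ⟨i, rfl⟩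
  exact h i

theorem ofReal_norm_sq_eq_inner (x : H) : ((‖x‖ ^ 2 : ℝ) : ℂ) = inner ℂ x x := by
  rw [inner_self_eq_norm_sq_to_K]; norm_cast

theorem inner_linearCombination {ι : Type*} (a : ι → H) (c : ι →₀ ℂ) :
    inner ℂ (Finsupp.linearCombination ℂ a c) (Finsupp.linearCombination ℂ a c)
      = ∑ i ∈ c.support, ∑ j ∈ c.support, starRingEnd ℂ (c i) * c j * inner ℂ (a i) (a j) := by
  simp only [Finsupp.linearCombination_apply, Finsupp.sum, sum_inner, inner_sum, inner_smul_left,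
    inner_smul_right]
  rw [Finset.sum_comm]
  refine Finset.sum_congr rfl fun i _ => ?_
  try rw [Finset.mul_sum]
  exact Finset.sum_congr rfl fun j _ => by ring

/-- Total families with the same inner products are related by a unitary. -/
theorem exists_unitary_of_inner_eq {ι : Type*} {a : ι → H} {b : ι → K} (ha : Total a)
    (hb : Total b) (h : ∀ i j, inner ℂ (b i) (b j) = inner ℂ (a i) (a j)) :
    ∃ U : H ≃ₗᵢ[ℂ] K, ∀ i, U (a i) = b i := by
  -- Both squared norms are the quadratic form of the common Gram matrix, so sending each `a i` to
  -- `b i` is well defined and isometric on combinations.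
  have hn : ∀ c : ι →₀ ℂ, ‖Finsupp.linearCombination ℂ b (LinearEquiv.refl ℂ (ι →₀ ℂ) c)‖
      = ‖Finsupp.linearCombination ℂ a c‖ := by
    intro c
    rw [← sq_eq_sq₀ (norm_nonneg _) (norm_nonneg _)]
    have : ((‖Finsupp.linearCombination ℂ b c‖ ^ 2 : ℝ) : ℂ)
        = (‖Finsupp.linearCombination ℂ a c‖ ^ 2 : ℝ) := by
      rw [ofReal_norm_sq_eq_inner, ofReal_norm_sq_eq_inner,
        inner_linearCombination, inner_linearCombination]
      simp_rw [h]
    exact_mod_cast this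
  refine ⟨LinearEquiv.extendOfIsometry (LinearEquiv.refl ℂ (ι →₀ ℂ)) _ _ ha.denseRange
    hb.denseRange hn, fun i => ?_⟩
  have := LinearEquiv.extendOfIsometry_eq (LinearEquiv.refl ℂ (ι →₀ ℂ)) _ _ ha.denseRange
    hb.denseRange hn (Finsupp.single i 1)
  simpa using this

/-- The coefficientwise complex conjugation. -/
noncomputable def finsuppConj (ι : Type*) : (ι →₀ ℂ) ≃ₛₗ[starRingEnd ℂ] (ι →₀ ℂ) where
  toFun c := c.mapRange (starRingEnd ℂ) (map_zero _)
  invFun c := c.mapRange (starRingEnd ℂ) (map_zero _)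
  map_add' c c' := by ext; simp
  map_smul' r c := by ext; simp
  left_inv c := by ext; simp
  right_inv c := by ext; simp

/-- Total families with conjugate inner products are related by an antiunitary. -/
theorem exists_antiunitary_of_inner_eq {ι : Type*} {a : ι → H} {b : ι → K} (ha : Total a)
    (hb : Total b) (h : ∀ i j, inner ℂ (b i) (b j) = inner ℂ (a j) (a i)) :
    ∃ U : H ≃ₗᵢ⋆[ℂ] K, ∀ i, U (a i) = b i := by
  have hn : ∀ c : ι →₀ ℂ, ‖Finsupp.linearCombination ℂ b (finsuppConj ι c)‖
      = ‖Finsupp.linearCombination ℂ a c‖ := by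
    intro c
    rw [← sq_eq_sq₀ (norm_nonneg _) (norm_nonneg _)]
    have : ((‖Finsupp.linearCombination ℂ b (finsuppConj ι c)‖ ^ 2 : ℝ) : ℂ)
        = (‖Finsupp.linearCombination ℂ a c‖ ^ 2 : ℝ) := by
      rw [ofReal_norm_sq_eq_inner, ofReal_norm_sq_eq_inner,
        inner_linearCombination, inner_linearCombination]
      have hs : (finsuppConj ι c).support = c.support := by
        ext i; simp [finsuppConj]
      -- Conjugating the coefficients transposes the Gram form; exchanging the sums undoes this.
      rw [hs, Finset.sum_comm]
      refine Finset.sum_congr rfl fun i _ => Finset.sum_congr rfl fun j _ => ?_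
      rw [h]
      simp [finsuppConj, mul_comm]
    exact_mod_cast this
  refine ⟨LinearEquiv.extendOfIsometry (finsuppConj ι) _ _ ha.denseRange
    hb.denseRange hn, fun i => ?_⟩
  have := LinearEquiv.extendOfIsometry_eq (finsuppConj ι) _ _ ha.denseRange
    hb.denseRange hn (Finsupp.single i 1)
  have hc : finsuppConj ι (Finsupp.single i 1) = Finsupp.single i 1 := by
    simp [finsuppConj]
  rw [hc] at this
  simpa using this

/-- A vector of `H × H` lies in a closed subspace if every pair orthogonal to the subspace is
orthogonal to it. -/
theorem mem_of_orthogonal {S : Submodule ℂ (H × H)} (hS : IsClosed (S : Set (H × H))) {p : H × H}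
    (h : ∀ a b : H, (∀ q ∈ S, inner ℂ a q.1 + inner ℂ b q.2 = 0) →
      inner ℂ a p.1 + inner ℂ b p.2 = 0) : p ∈ S := by
  -- The product carries the supremum norm. The Hilbert norm on the same space has the same topology
  -- and makes a closed subspace its own double orthogonal complement.
  let Φ := WithLp.prodContinuousLinearEquiv 2 ℂ H H
  let S' : Submodule ℂ (WithLp 2 (H × H)) := S.comap (Φ : WithLp 2 (H × H) →ₗ[ℂ] H × H)
  have hS' : IsClosed (S' : Set (WithLp 2 (H × H))) := hS.preimage Φ.continuous
  have : CompleteSpace S' := hS'.completeSpace_coe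
  have h1 : Φ.symm p ∈ S'ᗮᗮ := by
    intro q hq
    have := h q.fst q.snd fun r hr => by
      have hm : Φ.symm r ∈ S' := by
        change Φ (Φ.symm r) ∈ S
        rwa [ContinuousLinearEquiv.apply_symm_apply]
      have := (Submodule.mem_orthogonal' _ _).1 hq _ hm
      rw [WithLp.prod_inner_apply] at this
      exact this
    rw [WithLp.prod_inner_apply]
    exact this
  rw [Submodule.orthogonal_orthogonal] at h1
  have h2 : Φ (Φ.symm p) ∈ S := h1
  rwa [ContinuousLinearEquiv.apply_symm_apply] at h2

/-! ### One-parameter unitary groups -/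

/-- Isometries that form a group are invertible, hence unitary with the inverse as adjoint. -/
theorem inner_map_eq_of_group {V : ℝ → H →L[ℂ] H} (h0 : V 0 = 1)
    (hadd : ∀ t u, V (t + u) = V t * V u) (hn : ∀ t x, ‖V t x‖ = ‖x‖) (t : ℝ) (x y : H) :
    inner ℂ (V t x) y = inner ℂ x (V (-t) y) := by
  have h1 : y = V t (V (-t) y) := by
    rw [← mul_apply_eq_comp, ← hadd, add_neg_cancel, h0]; rfl
  conv_lhs => rw [h1]
  exact (LinearMap.norm_map_iff_inner_map_map (V t)).1 (hn t) _ _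

/-- The derivative at `0` of an orbit of a group determines the derivative everywhere. -/
theorem hasDerivAt_of_group {V : ℝ → H →L[ℂ] H} (hadd : ∀ t u, V (t + u) = V t * V u)
    {x y : H} (h : HasDerivAt (fun t => V t x) y 0) (t : ℝ) :
    HasDerivAt (fun t => V t x) (V t y) t := by
  have h1 : HasDerivAt (fun u => V t (V (u - t) x)) (V t y) t := by
    have h2 : HasDerivAt (fun u : ℝ => V (u - t) x) y t :=
      HasDerivAt.comp_sub_const t t (by simpa using h)
    exact ((V t).restrictScalars ℝ).hasFDerivAt.comp_hasDerivAt t h2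
  refine h1.congr_of_eventuallyEq (Filter.Eventually.of_forall fun u => ?_)
  change V u x = V t (V (u - t) x)
  rw [← mul_apply_eq_comp, ← hadd, add_sub_cancel]

theorem hasDerivAt_inner {f g : ℝ → H} {f' g' : H} {t : ℝ} (hf : HasDerivAt f f' t)
    (hg : HasDerivAt g g' t) :
    HasDerivAt (fun t => inner ℂ (f t) (g t)) (inner ℂ (f t) g' + inner ℂ f' (g t)) t :=
  hf.inner ℂ hg

/-- The generator of a unitary group is symmetric. -/
theorem generator_symm {V : ℝ → H →L[ℂ] H} (h0 : V 0 = 1)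
    (hn : ∀ t x, ‖V t x‖ = ‖x‖) {x y x' y' : H}
    (h : HasDerivAt (fun t => V t x) (I • y) 0) (h' : HasDerivAt (fun t => V t x') (I • y') 0) :
    inner ℂ x y' = inner ℂ y x' := by
  have h1 := hasDerivAt_inner h h'
  have h2 : (fun t => inner ℂ (V t x) (V t x')) = fun _ => inner ℂ x x' := by
    funext t
    exact (LinearMap.norm_map_iff_inner_map_map (V t)).1 (hn t) _ _
  rw [h2] at h1
  have h3 := h1.unique (hasDerivAt_const (0 : ℝ) _)
  simp only [h0, inner_smul_left, inner_smul_right, conj_I] at h3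
  have h4 : I * (inner ℂ x y' - inner ℂ y x') = 0 := by
    rw [← h3]; simp; ring
  exact sub_eq_zero.1 ((mul_eq_zero.1 h4).resolve_left I_ne_zero)

/-- The operators are isometric, so continuity passes from the dense span to every vector by an ε/3
argument. -/
theorem continuous_of_total {ι : Type*} {V : ℝ → H →L[ℂ] H} (hn : ∀ t x, ‖V t x‖ = ‖x‖)
    {e : ι → H} (he : Total e) (hc : ∀ i, Continuous fun t => V t (e i)) (x : H) :
    Continuous fun t => V t x := by
  have hspan : ∀ x ∈ Submodule.span ℂ (Set.range e), Continuous fun t => V t x := by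
    intro x hx
    induction hx using Submodule.span_induction with
    | mem x h => obtain ⟨i, rfl⟩ := h; exact hc i
    | zero => simpa using continuous_const
    | add x y _ _ hx hy => simp only [map_add]; exact hx.add hy
    | smul c x _ hx => simp only [map_smul]; exact hx.const_smul c
  rw [Metric.continuous_iff]
  intro t ε hε
  obtain ⟨y, hy, hxy⟩ := Metric.dense_iff.1 he.dense_span x (ε / 3) (by positivity)
  obtain ⟨δ, hδ, h⟩ := Metric.continuous_iff.1 (hspan y hxy) t (ε / 3) (by positivity)
  refine ⟨δ, hδ, fun u hu => ?_⟩
  have h1 : ∀ u, dist (V u x) (V u y) < ε / 3 := fun u => by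
    rw [dist_eq_norm, ← map_sub, hn, ← dist_eq_norm, dist_comm]
    exact hy
  have h2 := h u hu
  have h3 := h1 u
  have h4 := h1 t
  rw [dist_comm] at h4
  linarith [dist_triangle4 (V u x) (V u y) (V t y) (V t x)]

/-- Pairing with the total set gives the integral equation V_t x = x + ∫ i V_τ y dτ in the weak
sense. It then holds as an equation between vectors, and its right-hand side is norm differentiable.
Thus the adjoint of the generator restricted to the orbits of a total set is no larger than the
generator. -/
theorem hasDerivAt_of_inner_eq {ι : Type*} {V : ℝ → H →L[ℂ] H} (h0 : V 0 = 1)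
    (hadd : ∀ t u, V (t + u) = V t * V u) (hn : ∀ t x, ‖V t x‖ = ‖x‖)
    (hc : ∀ x, Continuous fun t => V t x)
    {e z : ι → H} (he : Total e) (hd : ∀ i, HasDerivAt (fun t => V t (e i)) (I • z i) 0)
    {x y : H} (hxy : ∀ t i, inner ℂ (V t (z i)) x = inner ℂ (V t (e i)) y) :
    HasDerivAt (fun t => V t x) (I • y) 0 := by
  have hcy : Continuous fun t => I • V t y := (hc y).const_smul I
  have key : ∀ t, V t x = x + ∫ τ in (0 : ℝ)..t, I • V τ y := by
    intro t
    refine he.eq_of_forall fun i => ?_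
    rw [inner_add_right]
    have h1 : inner ℂ (e i) (∫ τ in (0 : ℝ)..t, I • V τ y)
        = ∫ τ in (0 : ℝ)..t, inner ℂ (e i) (I • V τ y) :=
      (ContinuousLinearMap.intervalIntegral_comp_comm (innerSL ℂ (e i))
        (hcy.intervalIntegrable _ _)).symm
    have h2 : ∀ τ, HasDerivAt (fun t => inner ℂ (e i) (V t x)) (inner ℂ (e i) (I • V τ y)) τ := by
      intro τ
      have h3 : ∀ t, inner ℂ (e i) (V t x) = inner ℂ (V (-t) (e i)) x := fun t => by
        rw [inner_map_eq_of_group h0 hadd hn, neg_neg]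
      simp_rw [h3]
      have h4 := hasDerivAt_of_group hadd (hd i) (-τ)
      have h5 : HasDerivAt (fun t : ℝ => V (-t) (e i)) (-V (-τ) (I • z i)) τ := by
        have := h4.scomp τ (hasDerivAt_neg τ)
        rw [neg_one_smul] at this
        exact this
      have h6 := hasDerivAt_inner h5 (hasDerivAt_const τ x)
      convert h6 using 1
      rw [inner_zero_right, zero_add, inner_neg_left, map_smul, inner_smul_left, hxy,
        inner_map_eq_of_group h0 hadd hn, neg_neg, inner_smul_right]
      simp
    rw [h1, intervalIntegral.integral_eq_sub_of_hasDerivAt (fun τ _ => h2 τ)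
      ((continuous_const.inner hcy).intervalIntegrable _ _), h0]
    change _ = inner ℂ (e i) x + (_ - inner ℂ (e i) x)
    ring
  have h7 : HasDerivAt (fun t => x + ∫ τ in (0 : ℝ)..t, I • V τ y) (I • V 0 y) 0 :=
    (intervalIntegral.integral_hasDerivAt_right (hcy.intervalIntegrable _ _)
      hcy.stronglyMeasurable.stronglyMeasurableAtFilter hcy.continuousAt).const_add x
  rw [h0] at h7
  exact h7.congr_of_eventuallyEq (Filter.Eventually.of_forall key)

/-- A closed operator `S` is the generator of a unitary group `V` if it contains the derivatives of
the orbits of a total set and is formally adjoint to these. -/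
theorem isUnitaryGroup_of_total {ι : Type*} {V : ℝ → H →L[ℂ] H} (h0 : V 0 = 1)
    (hadd : ∀ t u, V (t + u) = V t * V u) (hn : ∀ t x, ‖V t x‖ = ‖x‖)
    {e z : ι → H} (he : Total e) (hd : ∀ i, HasDerivAt (fun t => V t (e i)) (I • z i) 0)
    {S : Submodule ℂ (H × H)} (hS : IsClosed (S : Set (H × H)))
    (hmem : ∀ t i, (V t (e i), V t (z i)) ∈ S)
    (hadj : ∀ p ∈ S, ∀ t i, inner ℂ (V t (z i)) p.1 = inner ℂ (V t (e i)) p.2) :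
    IsUnitaryGroup (S : Set (H × H)) V := by
  have hc : ∀ x, Continuous fun t => V t x := continuous_of_total hn he fun i =>
    continuous_iff_continuousAt.2 fun t => (hasDerivAt_of_group hadd (hd i) t).continuousAt
  refine ⟨h0, hadd, hn, hc, fun x y => ⟨fun h => ?_, fun h => ?_⟩⟩
  · exact hasDerivAt_of_inner_eq h0 hadd hn hc he hd fun t i => hadj _ h t i
  · refine mem_of_orthogonal hS fun a b hab => ?_
    -- If (a, b) is orthogonal to `S`, then b is in the domain of the generator with image -a.
    -- Symmetry of the generator then makes (a, b) orthogonal to its whole graph.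
    have h1 : HasDerivAt (fun t => V t b) (I • (-a)) 0 := by
      refine hasDerivAt_of_inner_eq h0 hadd hn hc he hd fun t i => ?_
      have := hab _ (hmem t i)
      rw [inner_neg_right, ← inner_conj_symm, ← inner_conj_symm (V t (e i)) a, ← map_neg]
      congr 1
      exact eq_neg_of_add_eq_zero_right this
    have := generator_symm h0 hn h1 h
    rw [inner_neg_left] at this
    rw [this, add_neg_cancel]

/-- A unitary group is determined by its generator. -/
theorem IsUnitaryGroup.unique {A : Set (H × H)} {V W : ℝ → H →L[ℂ] H} (hV : IsUnitaryGroup A V)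
    (hW : IsUnitaryGroup A W) {ι : Type*} {e : ι → H} (he : Total e)
    (hA : ∀ i, ∃ y, (e i, y) ∈ A) : V = W := by
  have hinv : ∀ {U : ℝ → H →L[ℂ] H}, IsUnitaryGroup A U → ∀ {x y}, (x, y) ∈ A → ∀ t,
      (U t x, U t y) ∈ A := by
    intro U hU x y h t
    rw [hU.generator] at h ⊢
    have h1 : (fun u => U u (U t x)) = fun u => U t (U u x) := by
      funext u
      rw [← mul_apply_eq_comp, ← mul_apply_eq_comp, ← hU.map_add,
        ← hU.map_add, add_comm]
    rw [h1, ← map_smul]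
    exact ((U t).restrictScalars ℝ).hasFDerivAt.comp_hasDerivAt 0 h
  -- Both orbits stay in the domain of the common symmetric generator, so the inner product of the
  -- two orbits has derivative zero.
  have key : ∀ i j t, inner ℂ (V t (e i)) (W t (e j)) = inner ℂ (e i) (e j) := by
    intro i j t
    obtain ⟨y, hy⟩ := hA i
    obtain ⟨y', hy'⟩ := hA j
    have hd : ∀ t, HasDerivAt (fun t => inner ℂ (V t (e i)) (W t (e j))) 0 t := by
      intro t
      have h1 := hasDerivAt_of_group hV.map_add ((hV.generator _ _).1 hy) t
      have h2 := hasDerivAt_of_group hW.map_add ((hW.generator _ _).1 hy') t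
      convert hasDerivAt_inner h1 h2 using 1
      have h3 := hinv hV hy t
      have h4 := hinv hW hy' t
      have h5 := generator_symm hV.map_zero hV.norm_map ((hV.generator _ _).1 h3)
        ((hV.generator _ _).1 h4)
      rw [map_smul, map_smul, inner_smul_left, inner_smul_right, h5]
      simp
    have h6 := is_const_of_deriv_eq_zero (fun t => (hd t).differentiableAt)
      (fun t => (hd t).deriv) t 0
    rw [h6, hV.map_zero, hW.map_zero]
    rfl
  funext t
  refine he.ext_map fun j => ?_
  have hVinv : ∀ x, V t (V (-t) x) = x := fun x => by
    rw [← mul_apply_eq_comp, ← hV.map_add, add_neg_cancel, hV.map_zero]; rfl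
  have h1 : e j = V (-t) (W t (e j)) := he.eq_of_forall fun i => by
    rw [← inner_map_eq_of_group hV.map_zero hV.map_add hV.norm_map, key]
  conv_lhs => rw [h1, hVinv]

/-- A generator with total domain has only one group, so the choice made in `expI` does not matter.
-/
theorem expI_eq {A : Set (H × H)} {V : ℝ → H →L[ℂ] H} (hV : IsUnitaryGroup A V)
    {ι : Type*} {e : ι → H} (he : Total e) (hA : ∀ i, ∃ y, (e i, y) ∈ A) (t : ℝ) :
    expI A t = V t := by
  have h : ∃ V, IsUnitaryGroup A V := ⟨V, hV⟩
  rw [expI, dif_pos h, IsUnitaryGroup.unique h.choose_spec hV he hA]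

end Hilbert

/-! ### Tensor products and exponential vectors -/

section Tensor

variable {M : Type} [MeasurableSpace M] (m : Measure M) [SigmaFinite m]

theorem memLp_prod {n : ℕ} (v : Fin n → Lp ℂ 2 m) :
    MemLp (fun x : Fin n → M => ∏ j, v j (x j)) 2 (Measure.pi fun _ => m) := by
  have hm : AEStronglyMeasurable (fun x : Fin n → M => ∏ j, v j (x j)) (Measure.pi fun _ => m) :=
    Finset.aestronglyMeasurable_fun_prod _ fun j _ =>
      (Lp.aestronglyMeasurable (v j)).comp_quasiMeasurePreserving
        (Measure.quasiMeasurePreserving_eval (fun _ => m) j)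
  rw [memLp_two_iff_integrable_sq_norm hm]
  have := Integrable.fintype_prod (μ := fun _ : Fin n => m) (f := fun j x => ‖v j x‖ ^ 2)
    fun j => (memLp_two_iff_integrable_sq_norm (Lp.aestronglyMeasurable _)).1 (Lp.memLp (v j))
  simpa [norm_prod, Finset.prod_pow] using this

theorem toL2_coeFn {f : M → ℂ} (h : MemLp f 2 m) : toL2 m f =ᵐ[m] f := by
  rw [toL2, dif_pos h]; exact h.coeFn_toLp

theorem coeFn_comp_eval {n : ℕ} (j : Fin n) {f g : M → ℂ} (h : f =ᵐ[m] g) :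
    (fun x : Fin n → M => f (x j)) =ᵐ[Measure.pi fun _ => m] fun x => g (x j) :=
  (Measure.quasiMeasurePreserving_eval (fun _ => m) j).ae_eq h

theorem inner_toLp_prod {n : ℕ} (u v : Fin n → Lp ℂ 2 m) :
    inner ℂ ((memLp_prod m u).toLp _) ((memLp_prod m v).toLp _) = ∏ j, inner ℂ (u j) (v j) := by
  simp_rw [L2.inner_def]
  rw [← integral_fintype_prod_eq_prod (μ := fun _ : Fin n => m)
    (fun j x => inner ℂ (u j x) (v j x))]
  refine integral_congr_ae ?_
  filter_upwards [(memLp_prod m u).coeFn_toLp, (memLp_prod m v).coeFn_toLp] with x h1 h2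
  rw [h1, h2]
  simp [Finset.prod_mul_distrib, map_prod]

theorem norm_toLp_prod {n : ℕ} (v : Fin n → Lp ℂ 2 m) :
    ‖(memLp_prod m v).toLp _‖ = ∏ j, ‖v j‖ := by
  rw [← sq_eq_sq₀ (norm_nonneg _) (Finset.prod_nonneg fun _ _ => norm_nonneg _)]
  have := inner_toLp_prod m v v
  simp_rw [← ofReal_norm_sq_eq_inner, ← ofReal_prod] at this
  rw [← Finset.prod_pow]
  exact_mod_cast this

/-- The tensor product of `n` functions in `L²(M)`. -/
noncomputable def tens (n : ℕ) :
    ContinuousMultilinearMap ℂ (fun _ : Fin n => Lp ℂ 2 m) (Lp ℂ 2 (Measure.pi fun _ : Fin n => m)) :=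
  MultilinearMap.mkContinuous
    { toFun := fun v => (memLp_prod m v).toLp _
      map_update_add' := fun {_} v i x y => by
        rw [← MemLp.toLp_add]
        refine MemLp.toLp_congr _ _ ?_
        filter_upwards [coeFn_comp_eval m i (Lp.coeFn_add x y)] with q hq
        simp only [Pi.add_apply]
        rw [← Finset.mul_prod_erase _ _ (Finset.mem_univ i),
          ← Finset.mul_prod_erase _ _ (Finset.mem_univ i),
          ← Finset.mul_prod_erase _ _ (Finset.mem_univ i)]
        have h : ∀ w : Lp ℂ 2 m, ∏ j ∈ Finset.univ.erase i, (Function.update v i w j) (q j)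
            = ∏ j ∈ Finset.univ.erase i, v j (q j) := fun w =>
          Finset.prod_congr rfl fun j hj => by
            rw [Function.update_of_ne (Finset.ne_of_mem_erase hj)]
        convert_to (x + y : Lp ℂ 2 m) (q i) * _ = x (q i) * _ + y (q i) * _
        · congr 1
          · congr 2; convert Function.update_self i _ v
          · convert h _
        · congr 2
          · congr 2; convert Function.update_self i _ v
          · convert h _
          · congr 2; convert Function.update_self i _ v
          · convert h _
        rw [hq, Pi.add_apply, add_mul]
      map_update_smul' := fun {_} v i c x => by
        rw [← MemLp.toLp_const_smul]
        refine MemLp.toLp_congr _ _ ?_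
        filter_upwards [coeFn_comp_eval m i (Lp.coeFn_smul c x)] with q hq
        simp only [Pi.smul_apply]
        rw [← Finset.mul_prod_erase _ _ (Finset.mem_univ i),
          ← Finset.mul_prod_erase _ _ (Finset.mem_univ i)]
        have h : ∀ w : Lp ℂ 2 m, ∏ j ∈ Finset.univ.erase i, (Function.update v i w j) (q j)
            = ∏ j ∈ Finset.univ.erase i, v j (q j) := fun w =>
          Finset.prod_congr rfl fun j hj => by
            rw [Function.update_of_ne (Finset.ne_of_mem_erase hj)]
        convert_to (c • x : Lp ℂ 2 m) (q i) * _ = c • (x (q i) * _)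
        · congr 1
          · congr 2; convert Function.update_self i _ v
          · convert h _
        · congr 2
          · congr 2; convert Function.update_self i _ v
          · convert h _
        rw [hq, Pi.smul_apply, smul_mul_assoc] } 1
    fun v => by rw [one_mul]; exact (norm_toLp_prod m v).le

theorem tens_coeFn {n : ℕ} (v : Fin n → Lp ℂ 2 m) :
    tens m n v =ᵐ[Measure.pi fun _ => m] fun x => ∏ j, v j (x j) :=
  (memLp_prod m v).coeFn_toLp

theorem inner_tens {n : ℕ} (u v : Fin n → Lp ℂ 2 m) :
    inner ℂ (tens m n u) (tens m n v) = ∏ j, inner ℂ (u j) (v j) := inner_toLp_prod m u v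

theorem norm_tens_le (n : ℕ) : ‖tens m n‖ ≤ 1 :=
  MultilinearMap.mkContinuous_norm_le _ zero_le_one _

/-- The action of the permutations on the functions of `n` variables. -/
noncomputable def permute (n : ℕ) (σ : Equiv.Perm (Fin n)) :
    Lp ℂ 2 (Measure.pi fun _ : Fin n => m) →ₗᵢ[ℂ] Lp ℂ 2 (Measure.pi fun _ : Fin n => m) :=
  Lp.compMeasurePreservingₗᵢ ℂ _ (measurePreserving_permute m σ)

theorem permute_coeFn {n : ℕ} (σ : Equiv.Perm (Fin n))
    (f : Lp ℂ 2 (Measure.pi fun _ : Fin n => m)) :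
    permute m n σ f =ᵐ[Measure.pi fun _ => m] fun x => f (x ∘ σ) :=
  Lp.coeFn_compMeasurePreserving f (measurePreserving_permute m σ)

theorem permute_tens {n : ℕ} (σ : Equiv.Perm (Fin n)) (v : Fin n → Lp ℂ 2 m) :
    permute m n σ (tens m n v) = tens m n (v ∘ σ.symm) := by
  apply Lp.ext
  filter_upwards [permute_coeFn m σ (tens m n v),
    (measurePreserving_permute m σ).quasiMeasurePreserving.ae_eq (tens_coeFn m v),
    tens_coeFn m (v ∘ σ.symm)] with x h1 h2 h3
  rw [h1, h3]
  refine Eq.trans h2 ?_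
  simp only [Function.comp_apply]
  rw [← Equiv.prod_comp σ.symm]
  simp

theorem mem_Fock {ψ : FullFock m} : ψ ∈ Fock m ↔ ∀ n σ, permute m n σ (ψ n) = ψ n := Iff.rfl

/-- The inclusion of the symmetric functions of `n` variables. -/
theorem single_mem_Fock {n : ℕ} {f : Lp ℂ 2 (Measure.pi fun _ : Fin n => m)}
    (hf : ∀ σ, permute m n σ f = f) : lp.single 2 n f ∈ Fock m := by
  rw [mem_Fock]
  intro k σ
  rcases eq_or_ne k n with rfl | h
  · rw [lp.single_apply_self]; exact hf σ
  · rw [lp.single_apply_ne _ _ _ h, map_zero]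

/-- The power series of the exponential vectors. -/
noncomputable def expSeries : FormalMultilinearSeries ℂ (Lp ℂ 2 m) (Fock m) := fun n =>
  ((1 / √(n.factorial : ℝ) : ℝ) : ℂ) •
    (((Fock m).orthogonalProjectionOnto ∘L
      lp.singleContinuousLinearMap ℂ (fun n : ℕ => Lp ℂ 2 (Measure.pi fun _ : Fin n => m)) 2 n)
      |>.compContinuousMultilinearMap (tens m n))

theorem norm_expSeries_le (n : ℕ) : ‖expSeries m n‖ ≤ 1 / √(n.factorial : ℝ) := by
  refine (ContinuousMultilinearMap.opNorm_smul_le _ _).trans ?_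
  rw [Complex.norm_real, Real.norm_of_nonneg (by positivity)]
  refine mul_le_of_le_one_right (by positivity) ?_
  refine (ContinuousLinearMap.norm_compContinuousMultilinearMap_le _ _).trans ?_
  refine mul_le_one₀ ?_ (norm_nonneg _) (norm_tens_le m n)
  refine (ContinuousLinearMap.opNorm_comp_le _ _).trans ?_
  refine mul_le_one₀ (Submodule.orthogonalProjectionOnto_norm_le _) (norm_nonneg _) ?_
  refine ContinuousLinearMap.opNorm_le_bound _ zero_le_one fun x => ?_
  rw [lp.singleContinuousLinearMap_apply, lp.norm_single (by norm_num), one_mul]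

/-- The bound rⁿ/√n! is the square root of (r²)ⁿ/n!, which tends to 0 for every r. -/
theorem expSeries_radius : (expSeries m).radius = ⊤ := by
  refine ENNReal.eq_top_of_forall_nnreal_le fun r => ?_
  have hs : Filter.Tendsto (fun n : ℕ => √(((r : ℝ) ^ 2) ^ n / n.factorial)) Filter.atTop
      (nhds √0) := (FloorSemiring.tendsto_pow_div_factorial_atTop _).sqrt
  obtain ⟨C, hC⟩ := hs.bddAbove_range
  refine (expSeries m).le_radius_of_bound C fun n => ?_
  refine le_trans ?_ (hC ⟨n, rfl⟩)
  beta_reduce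
  rw [Real.sqrt_div' _ (by positivity), ← pow_mul, mul_comm 2 n, pow_mul,
    Real.sqrt_sq (by positivity)]
  calc _ ≤ 1 / √(n.factorial : ℝ) * (r : ℝ) ^ n := by gcongr; exact norm_expSeries_le m n
    _ = _ := by ring

/-- The exponential vector of `u`. -/
noncomputable def expVec (u : Lp ℂ 2 m) : Fock m := (expSeries m).sum u

theorem differentiable_expVec : Differentiable ℂ (expVec m) := fun u =>
  (FormalMultilinearSeries.hasFDerivAt_sum (p := expSeries m) (x := u)
    (by rw [expSeries_radius]; exact enorm_lt_top)).differentiableAt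

theorem hasSum_expVec (u : Lp ℂ 2 m) : HasSum (fun n => expSeries m n fun _ => u) (expVec m u) :=
  (expSeries m).hasSum (by rw [expSeries_radius]; simp)

/-- The `n`-particle component. -/
noncomputable def comp (n : ℕ) : Fock m →L[ℂ] Lp ℂ 2 (Measure.pi fun _ : Fin n => m) :=
  (lp.evalCLM ℂ (fun n : ℕ => Lp ℂ 2 (Measure.pi fun _ : Fin n => m)) 2 n) ∘L (Fock m).subtypeL

theorem comp_apply (n : ℕ) (ψ : Fock m) : comp m n ψ = ψ.1 n := rfl

/-- A tensor power is symmetric, so the projection onto the Fock space does not change it. The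
projection is there only to give the off-diagonal values a place in the Fock space. -/
theorem expSeries_diag (n : ℕ) (u : Lp ℂ 2 m) :
    ((expSeries m n fun _ => u : Fock m) : FullFock m)
      = lp.single 2 n (((1 / √(n.factorial : ℝ) : ℝ) : ℂ) • tens m n fun _ => u) := by
  have h : lp.single 2 n (tens m n fun _ => u) ∈ Fock m :=
    single_mem_Fock m fun σ => by rw [permute_tens]; rfl
  change ((((1 / √(n.factorial : ℝ) : ℝ) : ℂ) • (Fock m).orthogonalProjectionOnto
    (lp.single 2 n (tens m n fun _ => u)) : Fock m) : FullFock m) = _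
  rw [Submodule.orthogonalProjectionOnto_mem_subspace_eq_self (K := Fock m) ⟨_, h⟩, lp.single_smul]
  rfl

theorem expVec_apply (u : Lp ℂ 2 m) (n : ℕ) :
    (expVec m u).1 n = ((1 / √(n.factorial : ℝ) : ℝ) : ℂ) • tens m n fun _ => u := by
  have h1 := (hasSum_expVec m u).mapL (comp m n)
  refine h1.unique ?_
  convert hasSum_ite_eq n (((1 / √(n.factorial : ℝ) : ℝ) : ℂ) • tens m n fun _ => u) using 2 with k
  rw [comp_apply, expSeries_diag]
  split_ifs with h
  · subst h; rw [lp.single_apply_self]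
  · rw [lp.single_apply_ne _ _ _ (Ne.symm h)]

theorem hasSum_inner_Fock (ψ χ : Fock m) :
    HasSum (fun n => inner ℂ (ψ.1 n) (χ.1 n)) (inner ℂ ψ χ) := lp.hasSum_inner ψ.1 χ.1

theorem Fock.ext {ψ χ : Fock m} (h : ∀ n, ψ.1 n = χ.1 n) : ψ = χ :=
  Subtype.ext (lp.ext (funext h))

/-- The n-particle parts contribute ⟨u,v⟩ⁿ/n!, which is the exponential series. -/
theorem inner_expVec (u v : Lp ℂ 2 m) :
    inner ℂ (expVec m u) (expVec m v) = cexp (inner ℂ u v) := by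
  refine (hasSum_inner_Fock m _ _).unique ?_
  have h := NormedSpace.expSeries_div_hasSum_exp (inner ℂ u v : ℂ)
  rw [← Complex.exp_eq_exp_ℂ] at h
  refine h.congr_fun fun n => ?_
  rw [expVec_apply, expVec_apply, inner_smul_left, inner_smul_right, inner_tens, conj_ofReal,
    ← mul_assoc, ← ofReal_mul, Finset.prod_const, Finset.card_univ, Fintype.card_fin, one_div,
    ← mul_inv, Real.mul_self_sqrt (by positivity)]
  push_cast
  ring

theorem expVec_zero : expVec m 0 = vacuum m := by
  refine Fock.ext m fun n => ?_
  rw [expVec_apply]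
  rcases Nat.eq_zero_or_pos n with rfl | hn
  · change _ = (lp.single 2 0 (toL2 (Measure.pi fun _ : Fin 0 => m) fun _ => 1) : FullFock m) 0
    rw [lp.single_apply_self]
    have h1 : MemLp (fun _ : Fin 0 → M => (1 : ℂ)) 2 (Measure.pi fun _ => m) := by
      simpa using memLp_prod m (n := 0) (fun _ => 0)
    apply Lp.ext
    filter_upwards [toL2_coeFn _ h1, tens_coeFn m (n := 0) fun _ => 0,
      Lp.coeFn_smul (((1 / √((0 : ℕ).factorial : ℝ) : ℝ) : ℂ)) (tens m 0 fun _ => 0)] with x h1 h2 h3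
    rw [h1, h3, Pi.smul_apply, h2]
    simp
  · change _ = (lp.single 2 0 (toL2 (Measure.pi fun _ : Fin 0 => m) fun _ => 1) : FullFock m) n
    rw [lp.single_apply_ne _ _ _ hn.ne', (tens m n).map_coord_zero ⟨0, hn⟩ rfl, smul_zero]

/-- The derivative of the exponential vectors at `u` in the direction `f`. -/
noncomputable def dExpVec (u f : Lp ℂ 2 m) : Fock m := fderiv ℂ (expVec m) u f

theorem hasDerivAt_expVec {c : ℝ → Lp ℂ 2 m} {f : Lp ℂ 2 m} {t : ℝ} (h : HasDerivAt c f t) :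
    HasDerivAt (fun t => expVec m (c t)) (dExpVec m (c t) f) t :=
  ((differentiable_expVec m (c t)).hasFDerivAt.restrictScalars ℝ).comp_hasDerivAt t h

theorem dExpVec_smul (u f : Lp ℂ 2 m) (c : ℂ) : dExpVec m u (c • f) = c • dExpVec m u f :=
  map_smul _ _ _

/-- This is the product rule for the n-particle component, a multilinear map on the diagonal. -/
theorem dExpVec_apply (u f : Lp ℂ 2 m) (n : ℕ) :
    (dExpVec m u f).1 n = ((1 / √(n.factorial : ℝ) : ℝ) : ℂ) •
      ∑ j, tens m n (Function.update (fun _ => u) j f) := by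
  have h1 : HasFDerivAt (fun u => (expVec m u).1 n)
      ((comp m n) ∘L fderiv ℂ (expVec m) u) u :=
    (comp m n).hasFDerivAt.comp u (differentiable_expVec m u).hasFDerivAt
  simp_rw [expVec_apply] at h1
  have h2 : HasFDerivAt (fun u : Lp ℂ 2 m => (fun _ : Fin n => u))
      (ContinuousLinearMap.pi fun _ => ContinuousLinearMap.id ℂ _) u :=
    hasFDerivAt_pi.2 fun _ => hasFDerivAt_id u
  have h3 := (((tens m n).hasFDerivAt fun _ => u).comp u h2).const_smul
    ((1 / √(n.factorial : ℝ) : ℝ) : ℂ)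
  have h4 := DFunLike.congr_fun (h1.unique h3) f
  refine h4.trans ?_
  change ((1 / √(n.factorial : ℝ) : ℝ) : ℂ) • ((tens m n).linearDeriv (fun _ => u)) (fun _ => f) = _
  rw [ContinuousMultilinearMap.linearDeriv_apply]

end Tensor

/-! ### Totality of exponential vectors -/

/-- Convergence at t = 1 gives a positive radius of convergence, and a power series that represents
0 has vanishing coefficients. Applied to real multiples of a vector it separates the particle
numbers. -/
theorem eq_zero_of_hasSum_pow {c : ℕ → ℂ}
    (h : ∀ t : ℝ, HasSum (fun n => ((t ^ n : ℝ) : ℂ) * c n) 0) (n : ℕ) : c n = 0 := by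
  let p : FormalMultilinearSeries ℝ ℝ ℂ := fun n =>
    ContinuousMultilinearMap.mkPiRing ℝ (Fin n) (c n)
  have hr : (1 : NNReal) ≤ p.radius := by
    refine p.le_radius_of_summable ?_
    have := (h 1).summable.norm
    simpa [p] using this
  have h1 := p.hasFPowerSeriesOnBall (lt_of_lt_of_le (by norm_num) hr)
  have h2 : p.sum = 0 := by
    funext t
    have h3 := (h t).tsum_eq
    simpa [FormalMultilinearSeries.sum, p] using h3
  rw [h2] at h1
  have h3 := h1.hasFPowerSeriesAt.eq_zero
  have h4 := congrArg (fun q : ContinuousMultilinearMap ℝ (fun _ : Fin n => ℝ) ℂ => q fun _ => 1)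
    (congrFun h3 n)
  simpa [p] using h4

section Polarization

variable {E : Type*} [NormedAddCommGroup E] [NormedSpace ℂ E]

/-- Polarization: the n-th derivative of v ↦ L(v, …, v) is the sum of L over the permutations of its
arguments, hence n! L by symmetry. So L vanishes on the real space, and by linearity in one slot
after the other on its complex span. -/
theorem map_eq_zero_of_diag {n : ℕ} (L : ContinuousMultilinearMap ℂ (fun _ : Fin n => E) ℂ)
    (hL : ∀ (σ : Equiv.Perm (Fin n)) v, L (v ∘ σ) = L v) {V : Submodule ℝ E}
    (h : ∀ v ∈ V, L (fun _ => v) = 0) {w : Fin n → E}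
    (hw : ∀ i, w i ∈ Submodule.span ℂ (V : Set E)) : L w = 0 := by
  have hreal : ∀ v : Fin n → V, L (fun i => v i) = 0 := by
    intro v
    let g : ContinuousMultilinearMap ℝ (fun _ : Fin n => V) ℂ :=
      (L.restrictScalars ℝ).compContinuousLinearMap fun _ => V.subtypeL
    have h0 : (fun x : V => g fun _ => x) = fun _ => 0 := by
      funext x; exact h x x.2
    have h1 := g.iteratedFDeriv_comp_diagonal 0 v
    rw [h0] at h1
    have h2 : ∀ σ : Equiv.Perm (Fin n), g (fun i => v (σ i)) = L fun i => v i := fun σ =>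
      hL σ fun i => v i
    simp only [h2, Finset.sum_const] at h1
    have h3 : iteratedFDeriv ℝ n (fun _ : V => (0 : ℂ)) 0 = 0 := by
      rw [iteratedFDeriv_fun_zero]; rfl
    rw [h3] at h1
    have h4 := h1.symm
    simp only [zero_apply, smul_eq_zero] at h4
    exact h4.resolve_left (Finset.card_ne_zero_of_mem (Finset.mem_univ 1))
  -- Induction on the set `s` of slots whose entries may already lie in the complex span.
  have key : ∀ s : Finset (Fin n), ∀ w : Fin n → E,
      (∀ i ∈ s, w i ∈ Submodule.span ℂ (V : Set E)) → (∀ i ∉ s, w i ∈ V) → L w = 0 := by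
    intro s
    induction s using Finset.induction_on with
    | empty => exact fun w _ hw => hreal fun i => ⟨w i, hw i (Finset.notMem_empty i)⟩
    | insert i s hi ih =>
      intro w hs hns
      have h1 : ∀ x ∈ Submodule.span ℂ (V : Set E), L (Function.update w i x) = 0 := by
        intro x hx
        induction hx using Submodule.span_induction with
        | mem x hx =>
          refine ih _ (fun j hj => ?_) (fun j hj => ?_)
          · rw [Function.update_of_ne (ne_of_mem_of_not_mem hj hi)]
            exact hs j (Finset.mem_insert_of_mem hj)
          · rcases eq_or_ne j i with rfl | hji
            · rw [Function.update_self]; exact hx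
            · rw [Function.update_of_ne hji]
              exact hns j (by simp [hji, hj])
        | zero => exact L.map_update_zero _ _
        | add x y _ _ hx hy => rw [L.map_update_add, hx, hy, add_zero]
        | smul c x _ hx => rw [L.map_update_smul, hx, smul_zero]
      have h2 := h1 (w i) (hs i (Finset.mem_insert_self i s))
      rwa [Function.update_eq_self] at h2
  exact key Finset.univ w (fun i _ => hw i) fun i hi => absurd (Finset.mem_univ i) hi

end Polarization

/-! ### Symmetric functions on cubes and the core criterion -/

section Master

variable {M : Type} [MeasurableSpace M] (m : Measure M) [SigmaFinite m]

/-- Rectangles form a generating π-system, and the sets with vanishing integral form a λ-system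
because the whole space is itself a rectangle. -/
theorem ae_eq_zero_of_forall_rectangle {n : ℕ} {f : (Fin n → M) → ℂ}
    (hf : Integrable f (Measure.pi fun _ => m))
    (h : ∀ A : Fin n → Set M, (∀ i, MeasurableSet (A i)) →
      ∫ x in Set.univ.pi A, f x ∂(Measure.pi fun _ => m) = 0) :
    f =ᵐ[Measure.pi fun _ => m] 0 := by
  refine hf.ae_eq_zero_of_forall_setIntegral_eq_zero fun s hs hfin => ?_
  clear hfin
  induction s, hs using MeasurableSpace.induction_on_inter (generateFrom_pi (α := fun _ : Fin n => M)).symm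
    (isPiSystem_pi (α := fun _ : Fin n => M)) with
  | empty => simp
  | basic t ht =>
    obtain ⟨A, hA, rfl⟩ := ht
    exact h A fun i => hA i trivial
  | compl t ht h1 =>
    have h2 := h (fun _ => Set.univ) fun _ => MeasurableSet.univ
    rw [Set.pi_univ, setIntegral_univ] at h2
    rw [setIntegral_compl ht hf, h2, h1, sub_zero]
  | iUnion t hd ht h1 =>
    rw [integral_iUnion ht hd hf.integrableOn]
    simp [h1]

/-- The cube of a set. -/
def cube {M : Type} (B : Set M) (n : ℕ) : Set (Fin n → M) := Set.univ.pi fun _ => B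

theorem measurableSet_cube {B : Set M} (hB : MeasurableSet B) (n : ℕ) :
    MeasurableSet (cube B n) := MeasurableSet.univ_pi fun _ => hB

theorem measure_cube_lt_top {B : Set M} (hB : m B < ⊤) (n : ℕ) :
    (Measure.pi fun _ : Fin n => m) (cube B n) < ⊤ := by
  rw [cube, Measure.pi_pi]
  exact ENNReal.prod_lt_top fun _ _ => hB

theorem memLp_indicator_one {A : Set M} (hA : MeasurableSet A) (hfin : m A < ⊤) :
    MemLp (A.indicator fun _ => (1 : ℂ)) 2 m := memLp_indicator_const 2 hA 1 (Or.inr hfin.ne)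

/-- A symmetric function of `n` variables vanishes on a cube if it is orthogonal to the powers of
sufficiently many functions. -/
theorem ae_eq_zero_of_inner_tens {n : ℕ} {ψ : Lp ℂ 2 (Measure.pi fun _ : Fin n => m)}
    (hψ : ∀ σ, permute m n σ ψ = ψ) {B : Set M} (hB : MeasurableSet B) (hfin : m B < ⊤)
    {V : Submodule ℝ (Lp ℂ 2 m)}
    (hV : ∀ A ⊆ B, MeasurableSet A →
      toL2 m (A.indicator fun _ => 1) ∈ Submodule.span ℂ (V : Set (Lp ℂ 2 m)))
    (h : ∀ v ∈ V, inner ℂ ψ (tens m n fun _ => v) = 0) :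
    ∀ᵐ x ∂(Measure.pi fun _ : Fin n => m), x ∈ cube B n → ψ x = 0 := by
  -- The symmetry of ψ makes the pairing a symmetric multilinear form, so polarization applies.
  have h1 : ∀ w : Fin n → Lp ℂ 2 m, (∀ i, w i ∈ Submodule.span ℂ (V : Set (Lp ℂ 2 m))) →
      inner ℂ ψ (tens m n w) = 0 := by
    intro w hw
    refine map_eq_zero_of_diag ((innerSL ℂ ψ).compContinuousMultilinearMap (tens m n)) ?_ h hw
    intro σ v
    change inner ℂ ψ (tens m n (v ∘ σ)) = inner ℂ ψ (tens m n v)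
    have := permute_tens m σ.symm v
    rw [Equiv.symm_symm] at this
    rw [← this]
    conv_lhs => rw [← hψ σ.symm]
    exact (permute m n σ.symm).inner_map_map _ _
  have hint : Integrable ((cube B n).indicator fun x => starRingEnd ℂ (ψ x))
      (Measure.pi fun _ => m) := by
    rw [integrable_indicator_iff (measurableSet_cube hB n)]
    have := isFiniteMeasure_restrict.2 (measure_cube_lt_top m hfin n).ne
    have h2 : MemLp (fun x => starRingEnd ℂ (ψ x)) 2
        ((Measure.pi fun _ => m).restrict (cube B n)) := (Lp.memLp ψ).star.restrict _
    exact h2.integrable (by norm_num)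
  have h2 := ae_eq_zero_of_forall_rectangle m hint fun A hA => by
    rw [setIntegral_indicator (measurableSet_cube hB n), cube, Set.pi_inter_distrib.symm]
    -- Intersecting the sides with `B` puts their indicators into the complex span; the tensor
    -- product of these is the indicator of the rectangle cut down to the cube.
    have h3 := h1 (fun i => toL2 m ((A i ∩ B).indicator fun _ => 1)) fun i =>
      hV _ Set.inter_subset_right ((hA i).inter hB)
    rw [← h3, L2.inner_def, ← integral_indicator (MeasurableSet.univ_pi fun i => (hA i).inter hB)]
    refine integral_congr_ae ?_
    have h4 : ∀ i, (fun x : Fin n → M => toL2 m ((A i ∩ B).indicator fun _ => 1) (x i))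
        =ᵐ[Measure.pi fun _ => m] fun x => (A i ∩ B).indicator (fun _ => 1) (x i) := fun i =>
      coeFn_comp_eval m i (toL2_coeFn m (memLp_indicator_one m ((hA i).inter hB)
        ((measure_mono Set.inter_subset_right).trans_lt hfin)))
    filter_upwards [tens_coeFn m fun i => toL2 m ((A i ∩ B).indicator fun _ => 1),
      ae_all_iff.2 h4] with x h5 h6
    rw [h5]
    simp_rw [h6]
    by_cases hx : x ∈ Set.univ.pi fun i => A i ∩ B
    · rw [Set.indicator_of_mem hx, Finset.prod_eq_one]
      · simp
      · exact fun i _ => Set.indicator_of_mem (hx i trivial) _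
    · rw [Set.indicator_of_notMem hx]
      rw [Set.mem_univ_pi] at hx
      push Not at hx
      obtain ⟨i, hi⟩ := hx
      rw [Finset.prod_eq_zero (Finset.mem_univ i) (Set.indicator_of_notMem hi _), inner_zero_right]
  filter_upwards [h2] with x hx hxB
  rw [Set.indicator_of_mem hxB] at hx
  simpa using hx

/-- An increasing sequence of measurable sets of finite measure that covers almost everything. -/
structure IsExhaustion (B : ℕ → Set M) : Prop where
  meas : ∀ k, MeasurableSet (B k)
  finite : ∀ k, m (B k) < ⊤
  mono : Monotone B
  cover : ∀ᵐ x ∂m, ∃ k, x ∈ B k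

theorem IsExhaustion.cover_cube {B : ℕ → Set M} (hB : IsExhaustion m B) (n : ℕ) :
    ∀ᵐ x ∂(Measure.pi fun _ : Fin n => m), ∃ k, x ∈ cube (B k) n := by
  have h : ∀ i : Fin n, ∀ᵐ x ∂(Measure.pi fun _ : Fin n => m), ∃ k, x i ∈ B k := fun i =>
    (Measure.quasiMeasurePreserving_eval (fun _ => m) i).ae hB.cover
  filter_upwards [ae_all_iff.2 h] with x hx
  choose k hk using hx
  refine ⟨Finset.univ.sup k, fun i _ => hB.mono (Finset.le_sup (Finset.mem_univ i)) (hk i)⟩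

/-- A symmetric real multiplier on the Fock space, bounded on the cubes of an exhaustion. -/
structure IsMultiplier (B : ℕ → Set M) (lam : (n : ℕ) → (Fin n → M) → ℝ) : Prop where
  meas : ∀ n, Measurable (lam n)
  symm : ∀ n (σ : Equiv.Perm (Fin n)) x, lam n (x ∘ σ) = lam n x
  bound : ∀ n k, ∃ C, ∀ x ∈ cube (B k) n, |lam n x| ≤ C

/-- Real subspaces of functions supported in the sets of an exhaustion, whose complex spans contain
the indicator functions. -/
structure IsTestFamily (B : ℕ → Set M) (V : ℕ → Submodule ℝ (Lp ℂ 2 m)) : Prop where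
  supp : ∀ k, ∀ v ∈ V k, ∀ᵐ x ∂m, x ∉ B k → v x = 0
  span : ∀ k, ∀ A ⊆ B k, MeasurableSet A →
      toL2 m (A.indicator fun _ => 1) ∈ Submodule.span ℂ (V k : Set (Lp ℂ 2 m))

variable {m}

theorem IsMultiplier.memLp_indicator {B : ℕ → Set M} (hB : IsExhaustion m B)
    {lam : (n : ℕ) → (Fin n → M) → ℝ} (hl : IsMultiplier B lam) (n k : ℕ)
    (b : Lp ℂ 2 (Measure.pi fun _ : Fin n => m)) :
    MemLp ((cube (B k) n).indicator fun x => (lam n x : ℂ) * b x) 2 (Measure.pi fun _ => m) := by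
  obtain ⟨C, hC⟩ := hl.bound n k
  refine MemLp.of_le_mul (c := |C|) (Lp.memLp b) ?_ (Filter.Eventually.of_forall fun x => ?_)
  · exact (((hl.meas n).complex_ofReal.aestronglyMeasurable).mul
      (Lp.aestronglyMeasurable b)).indicator (measurableSet_cube (hB.meas k) n)
  · by_cases hx : x ∈ cube (B k) n
    · rw [Set.indicator_of_mem hx, norm_mul, Complex.norm_real]
      gcongr
      exact (hC x hx).trans (le_abs_self C)
    · rw [Set.indicator_of_notMem hx, norm_zero]
      positivity

/-- If `(a, b)` is orthogonal to the pairs `(Exp v, K Exp v)`, with the multiplication operator `K`,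
then `a + K b = 0`. -/
theorem add_mul_eq_zero_of_orthogonal {B : ℕ → Set M} (hB : IsExhaustion m B)
    {lam : (n : ℕ) → (Fin n → M) → ℝ} (hl : IsMultiplier B lam)
    {V : ℕ → Submodule ℝ (Lp ℂ 2 m)} (hV : IsTestFamily m B V) {a b : Fock m}
    (h : ∀ k, ∀ v ∈ V k, ∃ κ : Fock m,
      (∀ n, κ.1 n =ᵐ[Measure.pi fun _ => m] fun x => lam n x * (expVec m v).1 n x) ∧
      inner ℂ a (expVec m v) + inner ℂ b κ = 0) (n : ℕ) :
    ∀ᵐ x ∂(Measure.pi fun _ : Fin n => m), a.1 n x + lam n x * b.1 n x = 0 := by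
  have key : ∀ k, ∀ᵐ x ∂(Measure.pi fun _ : Fin n => m), x ∈ cube (B k) n →
      a.1 n x + lam n x * b.1 n x = 0 := by
    intro k
    -- The combination need not be square integrable because the multiplier may be unbounded; its
    -- restriction to a cube is.
    let f : (n : ℕ) → (Fin n → M) → ℂ := fun n =>
      (cube (B k) n).indicator fun x => a.1 n x + lam n x * b.1 n x
    have hf : ∀ n, MemLp (f n) 2 (Measure.pi fun _ => m) := by
      intro n
      have h1 := ((Lp.memLp (a.1 n)).indicator (measurableSet_cube (hB.meas k) n)).add
        (hl.memLp_indicator hB n k (b.1 n))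
      rw [← Set.indicator_add'] at h1
      exact h1
    let ψ : (n : ℕ) → Lp ℂ 2 (Measure.pi fun _ : Fin n => m) := fun n => (hf n).toLp
    have hψ : ∀ n, ψ n =ᵐ[Measure.pi fun _ => m] f n := fun n => (hf n).coeFn_toLp
    have hsymm : ∀ n σ, permute m n σ (ψ n) = ψ n := by
      intro n σ
      apply Lp.ext
      have ha := a.2 n σ
      have hb := b.2 n σ
      have ha' := permute_coeFn m σ (a.1 n)
      have hb' := permute_coeFn m σ (b.1 n)
      rw [permute, ha] at ha'
      rw [permute, hb] at hb'
      filter_upwards [permute_coeFn m σ (ψ n), hψ n,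
        (measurePreserving_permute m σ).quasiMeasurePreserving.ae_eq (hψ n), ha', hb']
        with x h1 h2 h3 h4 h5
      rw [h1, h2]
      refine Eq.trans h3 ?_
      have hx : x ∘ σ ∈ cube (B k) n ↔ x ∈ cube (B k) n := by
        simp only [cube, Set.mem_univ_pi, Function.comp_apply]
        exact ⟨fun h i => by simpa using h (σ.symm i), fun h i => h _⟩
      simp only [f, Function.comp_apply]
      by_cases hxB : x ∈ cube (B k) n
      · rw [Set.indicator_of_mem hxB, Set.indicator_of_mem (hx.2 hxB), h4, h5, hl.symm]
      · rw [Set.indicator_of_notMem hxB, Set.indicator_of_notMem (mt hx.1 hxB)]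
    -- The multiplier is real, so it can be moved to `b`, and Exp(v) vanishes off the cube, so the
    -- cutoff costs nothing.
    have hinner : ∀ v ∈ V k, ∀ κ : Fock m,
        (∀ n, κ.1 n =ᵐ[Measure.pi fun _ => m] fun x => lam n x * (expVec m v).1 n x) → ∀ n,
        inner ℂ (a.1 n) ((expVec m v).1 n) + inner ℂ (b.1 n) (κ.1 n)
          = inner ℂ (ψ n) ((expVec m v).1 n) := by
      intro v hv κ hκ n
      simp_rw [L2.inner_def]
      rw [← integral_add (L2.integrable_inner _ _) (L2.integrable_inner _ _)]
      refine integral_congr_ae ?_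
      have hsupp : ∀ i : Fin n, ∀ᵐ x ∂(Measure.pi fun _ : Fin n => m), x i ∉ B k → v (x i) = 0 :=
        fun i => (Measure.quasiMeasurePreserving_eval (fun _ => m) i).ae (hV.supp k v hv)
      have hE := expVec_apply m v n
      filter_upwards [hκ n, hψ n, ae_all_iff.2 hsupp, tens_coeFn m fun _ : Fin n => v,
        Lp.coeFn_smul ((1 / √(n.factorial : ℝ) : ℝ) : ℂ) (tens m n fun _ => v)]
        with x h1 h2 h3 h4 h5
      rw [h1, h2]
      by_cases hx : x ∈ cube (B k) n
      · simp only [f]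
        rw [Set.indicator_of_mem hx]
        simp only [RCLike.inner_apply, map_add, map_mul, conj_ofReal]
        ring
      · have h0 : (expVec m v).1 n x = 0 := by
          rw [hE, h5, Pi.smul_apply, h4]
          simp only [cube, Set.mem_univ_pi] at hx
          push Not at hx
          obtain ⟨i, hi⟩ := hx
          rw [Finset.prod_eq_zero (Finset.mem_univ i) (h3 i hi), smul_zero]
        simp [h0]
    -- Replacing v by tv with real t turns the hypothesis into a vanishing power series in t, whose
    -- n-th coefficient is the pairing with the n-th tensor power.
    have hz : ∀ v ∈ V k, inner ℂ (ψ n) (tens m n fun _ => v) = 0 := by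
      intro v hv
      have := eq_zero_of_hasSum_pow (c := fun n => ((1 / √(n.factorial : ℝ) : ℝ) : ℂ) *
        inner ℂ (ψ n) (tens m n fun _ => v)) (fun t => ?_) n
      · refine (mul_eq_zero.1 this).resolve_left ?_
        exact ofReal_ne_zero.2 (by positivity)
      · obtain ⟨κ, hκ, h0⟩ := h k (t • v) ((V k).smul_mem t hv)
        have h1 := (hasSum_inner_Fock m a (expVec m (t • v))).add (hasSum_inner_Fock m b κ)
        rw [h0] at h1
        refine h1.congr_fun fun n => ?_
        rw [hinner _ ((V k).smul_mem t hv) κ hκ, expVec_apply, inner_smul_right]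
        have h2 : (fun _ : Fin n => t • v) = fun i => (fun _ : Fin n => (t : ℂ)) i • (fun _ => v) i := by
          funext i; exact (Complex.coe_smul t v).symm
        rw [h2, (tens m n).map_smul_univ, inner_smul_right]
        simp only [Finset.prod_const, Finset.card_univ, Fintype.card_fin]
        push_cast
        ring
    have h1 := ae_eq_zero_of_inner_tens m (hsymm n) (hB.meas k) (hB.finite k) (hV.span k) hz
    filter_upwards [h1, hψ n] with x h2 h3 hx
    have h4 := h2 hx
    rw [h3] at h4
    simpa [f, Set.indicator_of_mem hx] using h4
  filter_upwards [ae_all_iff.2 key, hB.cover_cube m n] with x h1 ⟨k, hk⟩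
  exact h1 k hk

/-- The exponential vectors of a test family are total. -/
theorem IsTestFamily.total {B : ℕ → Set M} (hB : IsExhaustion m B)
    {V : ℕ → Submodule ℝ (Lp ℂ 2 m)} (hV : IsTestFamily m B V) :
    Total fun v : {v // ∃ k, v ∈ V k} => expVec m v.1 := by
  intro a ha
  refine Fock.ext m fun n => ?_
  -- With the multiplier 0, the criterion is plain orthogonality to the exponential vectors.
  have hl : IsMultiplier B fun n (_ : Fin n → M) => (0 : ℝ) :=
    ⟨fun _ => measurable_const, fun _ _ _ => rfl, fun _ _ => ⟨0, by simp⟩⟩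
  have h1 := add_mul_eq_zero_of_orthogonal hB hl hV (a := a) (b := 0) (fun k v hv =>
    ⟨0, fun n => ?_, ?_⟩) n
  · apply Lp.ext
    filter_upwards [h1, Lp.coeFn_zero ℂ 2 (Measure.pi fun _ : Fin n => m)] with x h2 h3
    rw [show (0 : Fock m).1 n = 0 from rfl, h3]
    simpa using h2
  · filter_upwards [Lp.coeFn_zero ℂ 2 (Measure.pi fun _ : Fin n => m)] with x h3
    rw [show (0 : Fock m).1 n = 0 from rfl, h3]
    simp
  · rw [inner_zero_left, add_zero]
    exact inner_eq_zero_symm.1 (ha ⟨v, k, hv⟩)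

variable (m) in
/-- The functions supported in a set. -/
def suppIn (B : Set M) : Submodule ℝ (Lp ℂ 2 m) where
  carrier := {v | ∀ᵐ x ∂m, x ∉ B → v x = 0}
  add_mem' := fun {v w} hv hw => by
    filter_upwards [hv, hw, Lp.coeFn_add v w] with x h1 h2 h3 hx
    rw [h3, Pi.add_apply, h1 hx, h2 hx, add_zero]
  zero_mem' := by
    filter_upwards [Lp.coeFn_zero ℂ 2 m] with x h3 _
    rw [h3, Pi.zero_apply]
  smul_mem' := fun c v hv => by
    filter_upwards [hv, Lp.coeFn_smul c v] with x h1 h3 hx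
    rw [h3, Pi.smul_apply, h1 hx, smul_zero]

theorem IsExhaustion.isTestFamily {B : ℕ → Set M} (hB : IsExhaustion m B) :
    IsTestFamily m B fun k => suppIn m (B k) := by
  refine ⟨fun k v hv => hv, fun k A hA hm => Submodule.subset_span ?_⟩
  filter_upwards [toL2_coeFn m (memLp_indicator_one m hm
    ((measure_mono hA).trans_lt (hB.finite k)))] with x h1 hx
  rw [h1, Set.indicator_of_notMem fun h => hx (hA h)]

variable (m) in
/-- All exponential vectors form a total family. -/
theorem total_expVec : Total (expVec m) := by
  have hB : IsExhaustion m (spanningSets m) :=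
    ⟨measurableSet_spanningSets m, measure_spanningSets_lt_top m, monotone_spanningSets m,
      Filter.Eventually.of_forall fun x => by
        exact Set.mem_iUnion.1 (by rw [iUnion_spanningSets]; trivial)⟩
  exact fun x hx => hB.isTestFamily.total hB x fun i => hx i.1

end Master

/-! ### Unitary groups that permute a total set up to factors -/

section Hilbert

variable {H : Type*} [NormedAddCommGroup H] [InnerProductSpace ℂ H] [CompleteSpace H]

/-- The orbit of `V t (e i)` is differentiated twice: by commuting `V t` with the group, and by the
formula for `V t (e i)`. -/
theorem map_generator_of_map_eq_smul {ι : Type*} {V : ℝ → H →L[ℂ] H}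
    (hadd : ∀ t u, V (t + u) = V t * V u) {e z : ι → H}
    (hd : ∀ i, HasDerivAt (fun t => V t (e i)) (I • z i) 0) {t : ℝ} {i j : ι} {c : ℂ}
    (h : V t (e i) = c • e j) : V t (z i) = c • z j := by
  have h1 : HasDerivAt (fun u => V u (V t (e i))) (V t (I • z i)) 0 := by
    have h2 : (fun u => V u (V t (e i))) = fun u => V t (V u (e i)) := by
      funext u
      rw [← mul_apply_eq_comp, ← mul_apply_eq_comp, ← hadd, ← hadd, add_comm]
    rw [h2]
    exact ((V t).restrictScalars ℝ).hasFDerivAt.comp_hasDerivAt 0 (hd i)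
  have h2 : HasDerivAt (fun u => V u (V t (e i))) (c • I • z j) 0 := by
    simp_rw [h, map_smul]
    exact (hd j).const_smul c
  have h3 := h1.unique h2
  rw [map_smul, smul_comm c] at h3
  exact smul_right_injective H I_ne_zero h3

/-- A version of `isUnitaryGroup_of_total` for total sets that the group permutes up to factors. -/
theorem isUnitaryGroup_of_total_smul {ι : Type*} {V : ℝ → H →L[ℂ] H} (h0 : V 0 = 1)
    (hadd : ∀ t u, V (t + u) = V t * V u) (hn : ∀ t x, ‖V t x‖ = ‖x‖)
    {e z : ι → H} (he : Total e) (hd : ∀ i, HasDerivAt (fun t => V t (e i)) (I • z i) 0)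
    (hperm : ∀ t i, ∃ (c : ℂ) (j : ι), V t (e i) = c • e j)
    {S : Submodule ℂ (H × H)} (hS : IsClosed (S : Set (H × H)))
    (hmem : ∀ i, (e i, z i) ∈ S)
    (hadj : ∀ p ∈ S, ∀ i, inner ℂ (z i) p.1 = inner ℂ (e i) p.2) :
    IsUnitaryGroup (S : Set (H × H)) V := by
  refine isUnitaryGroup_of_total h0 hadd hn he hd hS (fun t i => ?_) (fun p hp t i => ?_)
  · obtain ⟨c, j, h⟩ := hperm t i
    rw [map_generator_of_map_eq_smul hadd hd h, h]
    exact S.smul_mem c (hmem j)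
  · obtain ⟨c, j, h⟩ := hperm t i
    rw [map_generator_of_map_eq_smul hadd hd h, h, inner_smul_left, inner_smul_left, hadj p hp]

end Hilbert

/-! ### Creation and annihilation operators -/

section Weyl

variable {M : Type} [MeasurableSpace M] (m : Measure M) [SigmaFinite m]

theorem memLp_insert {n : ℕ} (j : Fin (n + 1)) (f : Lp ℂ 2 m)
    (ψ : Lp ℂ 2 (Measure.pi fun _ : Fin n => m)) :
    MemLp (fun x : Fin (n + 1) → M => f (x j) * ψ (j.removeNth x)) 2 (Measure.pi fun _ => m) := by
  have h1 : MemLp (fun p : M × (Fin n → M) => f p.1 * ψ p.2) 2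
      (m.prod (Measure.pi fun _ : Fin n => m)) := by
    have hm : AEStronglyMeasurable (fun p : M × (Fin n → M) => f p.1 * ψ p.2)
        (m.prod (Measure.pi fun _ : Fin n => m)) :=
      (Lp.aestronglyMeasurable f).comp_fst.mul (Lp.aestronglyMeasurable ψ).comp_snd
    rw [memLp_two_iff_integrable_sq_norm hm]
    have := ((memLp_two_iff_integrable_sq_norm (Lp.aestronglyMeasurable _)).1 (Lp.memLp f)).mul_prod
      ((memLp_two_iff_integrable_sq_norm (Lp.aestronglyMeasurable _)).1 (Lp.memLp ψ))
    simpa [mul_pow] using this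
  exact h1.comp_measurePreserving (measurePreserving_piFinSuccAbove (fun _ => m) j)

theorem coeFn_comp_removeNth {n : ℕ} (j : Fin (n + 1)) {f g : (Fin n → M) → ℂ}
    (h : f =ᵐ[Measure.pi fun _ => m] g) :
    (fun x : Fin (n + 1) → M => f (j.removeNth x)) =ᵐ[Measure.pi fun _ => m]
      fun x => g (j.removeNth x) :=
  (Measure.quasiMeasurePreserving_snd.comp
    (measurePreserving_piFinSuccAbove (fun _ => m) j).quasiMeasurePreserving).ae_eq h

theorem inner_insert {n : ℕ} (j : Fin (n + 1)) (f g : Lp ℂ 2 m)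
    (ψ χ : Lp ℂ 2 (Measure.pi fun _ : Fin n => m)) :
    inner ℂ ((memLp_insert m j f ψ).toLp _) ((memLp_insert m j g χ).toLp _)
      = inner ℂ f g * inner ℂ ψ χ := by
  simp_rw [L2.inner_def]
  have h1 := (measurePreserving_piFinSuccAbove (fun _ : Fin (n + 1) => m) j).integral_comp'
    (g := fun p : M × (Fin n → M) => inner ℂ (f p.1) (g p.1) * inner ℂ (ψ p.2) (χ p.2))
  rw [← integral_prod_mul, ← h1]
  refine integral_congr_ae ?_
  filter_upwards [(memLp_insert m j f ψ).coeFn_toLp, (memLp_insert m j g χ).coeFn_toLp]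
    with x h1 h2
  rw [h1, h2]
  change _ = inner ℂ (f (x j)) (g (x j)) * inner ℂ (ψ (j.removeNth x)) (χ (j.removeNth x))
  simp only [RCLike.inner_apply, map_mul]
  ring

/-- The tensor multiplication by `f` in the variable number `j`. -/
noncomputable def insertL {n : ℕ} (j : Fin (n + 1)) (f : Lp ℂ 2 m) :
    Lp ℂ 2 (Measure.pi fun _ : Fin n => m) →L[ℂ] Lp ℂ 2 (Measure.pi fun _ : Fin (n + 1) => m) :=
  LinearMap.mkContinuous
    { toFun := fun ψ => (memLp_insert m j f ψ).toLp _
      map_add' := fun ψ χ => by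
        rw [← MemLp.toLp_add]
        refine MemLp.toLp_congr _ _ ?_
        filter_upwards [coeFn_comp_removeNth m j (Lp.coeFn_add ψ χ)] with x hx
        rw [Pi.add_apply, hx, Pi.add_apply, mul_add]
      map_smul' := fun c ψ => by
        rw [RingHom.id_apply, ← MemLp.toLp_const_smul]
        refine MemLp.toLp_congr _ _ ?_
        filter_upwards [coeFn_comp_removeNth m j (Lp.coeFn_smul c ψ)] with x hx
        rw [Pi.smul_apply, hx, Pi.smul_apply, mul_smul_comm] }
    ‖f‖ fun ψ => by
      refine le_of_eq ?_
      rw [← sq_eq_sq₀ (norm_nonneg _) (by positivity), mul_pow]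
      have := inner_insert m j f f ψ ψ
      simp_rw [← ofReal_norm_sq_eq_inner] at this
      exact_mod_cast this

theorem insertL_coeFn {n : ℕ} (j : Fin (n + 1)) (f : Lp ℂ 2 m)
    (ψ : Lp ℂ 2 (Measure.pi fun _ : Fin n => m)) :
    insertL m j f ψ =ᵐ[Measure.pi fun _ => m] fun x => f (x j) * ψ (j.removeNth x) :=
  (memLp_insert m j f ψ).coeFn_toLp

theorem inner_insertL {n : ℕ} (j : Fin (n + 1)) (f g : Lp ℂ 2 m)
    (ψ χ : Lp ℂ 2 (Measure.pi fun _ : Fin n => m)) :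
    inner ℂ (insertL m j f ψ) (insertL m j g χ) = inner ℂ f g * inner ℂ ψ χ :=
  inner_insert m j f g ψ χ

theorem insertL_tens {n : ℕ} (j : Fin (n + 1)) (f u : Lp ℂ 2 m) :
    insertL m j f (tens m n fun _ => u) = tens m (n + 1) (Function.update (fun _ => u) j f) := by
  apply Lp.ext
  filter_upwards [insertL_coeFn m j f (tens m n fun _ => u),
    coeFn_comp_removeNth m j (tens_coeFn m fun _ : Fin n => u),
    tens_coeFn m (Function.update (fun _ => u) j f)] with x h1 h2 h3
  rw [h1, h2, h3, Fin.prod_univ_succAbove _ j, Function.update_self]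
  congr 1
  refine Finset.prod_congr rfl fun i _ => ?_
  rw [Function.update_of_ne (Fin.succAbove_ne j i)]
  rfl

/-- By Fubini, both sides have the same integrals over sets of finite measure. This identifies the
integral in `annihilation` with the adjoint of a bounded operator. -/
theorem insertL_adjoint_coeFn {n : ℕ} (f : Lp ℂ 2 m)
    (Ψ : Lp ℂ 2 (Measure.pi fun _ : Fin (n + 1) => m)) :
    (insertL m 0 f).adjoint Ψ =ᵐ[Measure.pi fun _ => m] fun x =>
      ∫ q, starRingEnd ℂ (f q) * Ψ (Fin.cons q x) ∂m := by
  have hmp := (measurePreserving_piFinSuccAbove (fun _ : Fin (n + 1) => m) 0).symm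
  have hcons : ∀ p : M × (Fin n → M),
      (MeasurableEquiv.piFinSuccAbove (fun _ : Fin (n + 1) => M) 0).symm p = Fin.cons p.1 p.2 :=
    fun p => Fin.insertNth_zero' p.1 p.2
  -- Testing against the indicator of `s` turns the pairing into a double integral over the first
  -- variable and the others.
  have hint : ∀ s : Set (Fin n → M), MeasurableSet s → (Measure.pi fun _ : Fin n => m) s < ⊤ →
      Integrable (fun p : M × (Fin n → M) => starRingEnd ℂ (f p.1 * s.indicator (fun _ => 1) p.2)
        * Ψ (Fin.cons p.1 p.2)) (m.prod (Measure.pi fun _ : Fin n => m)) ∧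
      ∫ p : M × (Fin n → M), starRingEnd ℂ (f p.1 * s.indicator (fun _ => 1) p.2)
        * Ψ (Fin.cons p.1 p.2) ∂(m.prod (Measure.pi fun _ : Fin n => m))
      = inner ℂ (insertL m 0 f (toL2 _ (s.indicator fun _ => 1))) Ψ := by
    intro s hs hfin
    have hA : (fun x : Fin (n + 1) → M => inner ℂ (insertL m 0 f (toL2 _ (s.indicator fun _ => 1)) x)
        (Ψ x)) =ᵐ[Measure.pi fun _ => m] fun x =>
        starRingEnd ℂ (f (x 0) * s.indicator (fun _ => 1) ((0 : Fin (n + 1)).removeNth x)) * Ψ x := by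
      filter_upwards [insertL_coeFn m 0 f (toL2 _ (s.indicator fun _ => 1)),
        coeFn_comp_removeNth m 0 (toL2_coeFn _ (memLp_indicator_one _ hs hfin))] with x h1 h2
      rw [h1, h2, RCLike.inner_apply, mul_comm]
    have h1 := (L2.integrable_inner (𝕜 := ℂ) (insertL m 0 f (toL2 _ (s.indicator fun _ => 1))) Ψ)
    have h2 := h1.congr hA
    have h3 : (fun p : M × (Fin n → M) => starRingEnd ℂ (f p.1 * s.indicator (fun _ => 1) p.2)
        * Ψ (Fin.cons p.1 p.2)) = (fun x : Fin (n + 1) → M => starRingEnd ℂ (f (x 0) *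
        s.indicator (fun _ => 1) ((0 : Fin (n + 1)).removeNth x)) * Ψ x) ∘
        (MeasurableEquiv.piFinSuccAbove (fun _ : Fin (n + 1) => M) 0).symm := by
      funext p
      rw [Function.comp_apply, hcons, Fin.cons_zero]
      rfl
    rw [h3]
    refine ⟨hmp.integrable_comp_of_integrable h2, ?_⟩
    rw [L2.inner_def, integral_congr_ae hA]
    exact hmp.integral_comp' (g := fun x : Fin (n + 1) → M => starRingEnd ℂ (f (x 0) *
        s.indicator (fun _ => 1) ((0 : Fin (n + 1)).removeNth x)) * Ψ x)
  refine ae_eq_of_forall_setIntegral_eq_of_sigmaFinite (fun s hs hfin => ?_)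
    (fun s hs hfin => ?_) (fun s hs hfin => ?_)
  · have := isFiniteMeasure_restrict.2 hfin.ne
    exact ((Lp.memLp _).restrict s).integrable (by norm_num)
  · have h1 := (hint s hs hfin).1.integral_prod_right
    rw [← integrable_indicator_iff hs]
    refine h1.congr (Filter.Eventually.of_forall fun x => ?_)
    by_cases hx : x ∈ s
    · simp [Set.indicator_of_mem hx]
    · simp [Set.indicator_of_notMem hx]
  · have h1 := hint s hs hfin
    have h2 : ∫ x in s, (insertL m 0 f).adjoint Ψ x ∂(Measure.pi fun _ => m)
        = inner ℂ (toL2 _ (s.indicator fun _ => 1)) ((insertL m 0 f).adjoint Ψ) := by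
      rw [L2.inner_def, ← integral_indicator hs]
      refine integral_congr_ae ?_
      filter_upwards [toL2_coeFn _ (memLp_indicator_one _ hs hfin)] with x h1
      rw [h1]
      by_cases hx : x ∈ s
      · simp [Set.indicator_of_mem hx]
      · simp [Set.indicator_of_notMem hx]
    rw [h2, ContinuousLinearMap.adjoint_inner_right, ← h1.2, integral_prod_symm _ h1.1,
      ← integral_indicator hs]
    refine integral_congr_ae (Filter.Eventually.of_forall fun x => ?_)
    by_cases hx : x ∈ s
    · simp [Set.indicator_of_mem hx]
    · simp [Set.indicator_of_notMem hx]

end Weyl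

/-! ### The Segal field operators and the Weyl operators -/

section Weyl

variable {M : Type} [MeasurableSpace M] (m : Measure M) [SigmaFinite m]

/-- The creation part, from `n` to `n + 1` particles. -/
noncomputable def creationL (f : Lp ℂ 2 m) (n : ℕ) :
    Lp ℂ 2 (Measure.pi fun _ : Fin n => m) →L[ℂ] Lp ℂ 2 (Measure.pi fun _ : Fin (n + 1) => m) :=
  ((1 / √((n : ℝ) + 1) : ℝ) : ℂ) • ∑ j : Fin (n + 1), insertL m j f

/-- The annihilation part, from `n + 1` to `n` particles. -/
noncomputable def annihilationL (f : Lp ℂ 2 m) (n : ℕ) :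
    Lp ℂ 2 (Measure.pi fun _ : Fin (n + 1) => m) →L[ℂ] Lp ℂ 2 (Measure.pi fun _ : Fin n => m) :=
  ((√((n : ℝ) + 1) : ℝ) : ℂ) • (insertL m 0 f).adjoint

theorem creationL_coeFn (f : Lp ℂ 2 m) (n : ℕ) (ψ : Fock m) :
    creationL m f n (ψ.1 n) =ᵐ[Measure.pi fun _ => m] creation m f ψ (n + 1) := by
  have h1 : creationL m f n (ψ.1 n) = ((1 / √((n : ℝ) + 1) : ℝ) : ℂ) •
      ∑ j : Fin (n + 1), insertL m j f (ψ.1 n) := by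
    rw [creationL, smul_apply, sum_apply]
  rw [h1]
  filter_upwards [Lp.coeFn_smul ((1 / √((n : ℝ) + 1) : ℝ) : ℂ)
    (∑ j : Fin (n + 1), insertL m j f (ψ.1 n)),
    Lp.coeFn_finsetSum Finset.univ (fun j : Fin (n + 1) => insertL m j f (ψ.1 n)),
    ae_all_iff.2 fun j => insertL_coeFn m j f (ψ.1 n)] with x h1 h2 h3
  rw [h1, Pi.smul_apply, h2, Finset.sum_apply, smul_eq_mul]
  simp_rw [h3]
  rfl

theorem annihilationL_coeFn (f : Lp ℂ 2 m) (n : ℕ) (ψ : Fock m) :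
    annihilationL m f n (ψ.1 (n + 1)) =ᵐ[Measure.pi fun _ => m] annihilation m f ψ n := by
  filter_upwards [Lp.coeFn_smul ((√((n : ℝ) + 1) : ℝ) : ℂ)
    ((insertL m 0 f).adjoint (ψ.1 (n + 1))), insertL_adjoint_coeFn m f (ψ.1 (n + 1))] with x h1 h2
  rw [annihilationL, smul_apply, h1, Pi.smul_apply, h2]
  rfl

/-- The `n`-particle component of the field operator. -/
noncomputable def fieldL (f : Lp ℂ 2 m) : (n : ℕ) →
    Fock m →L[ℂ] Lp ℂ 2 (Measure.pi fun _ : Fin n => m)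
  | 0 => ((1 / √2 : ℝ) : ℂ) • (annihilationL m f 0 ∘L comp m 1)
  | n + 1 => ((1 / √2 : ℝ) : ℂ) •
      (creationL m f n ∘L comp m n + annihilationL m f (n + 1) ∘L comp m (n + 2))

theorem fieldL_coeFn (f : Lp ℂ 2 m) (n : ℕ) (ψ : Fock m) :
    fieldL m f n ψ =ᵐ[Measure.pi fun _ => m] fun x =>
      (1 / √2 : ℝ) * (creation m f ψ n x + annihilation m f ψ n x) := by
  cases n with
  | zero =>
    filter_upwards [Lp.coeFn_smul ((1 / √2 : ℝ) : ℂ) (annihilationL m f 0 (ψ.1 1)),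
      annihilationL_coeFn m f 0 ψ] with x h1 h2
    refine Eq.trans h1 ?_
    rw [Pi.smul_apply, h2, smul_eq_mul]
    simp [creation]
  | succ n =>
    filter_upwards [Lp.coeFn_smul ((1 / √2 : ℝ) : ℂ)
        (creationL m f n (ψ.1 n) + annihilationL m f (n + 1) (ψ.1 (n + 2))),
      Lp.coeFn_add (creationL m f n (ψ.1 n)) (annihilationL m f (n + 1) (ψ.1 (n + 2))),
      creationL_coeFn m f n ψ, annihilationL_coeFn m f (n + 1) ψ] with x h1 h2 h3 h4
    refine Eq.trans h1 ?_
    rw [Pi.smul_apply, h2, Pi.add_apply, h3, h4, smul_eq_mul]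

/-- The field operator on the vectors with finitely many particles. -/
def preField (f : Lp ℂ 2 m) : Submodule ℂ (Fock m × Fock m) where
  carrier := {p | (∃ N : ℕ, ∀ n > N, p.1.1 n = 0) ∧ ∀ n, p.2.1 n = fieldL m f n p.1}
  add_mem' := by
    rintro p q ⟨⟨N, hN⟩, hp⟩ ⟨⟨N', hN'⟩, hq⟩
    refine ⟨⟨max N N', fun n hn => ?_⟩, fun n => ?_⟩
    · change p.1.1 n + q.1.1 n = 0
      rw [hN n (lt_of_le_of_lt (le_max_left _ _) hn), hN' n (lt_of_le_of_lt (le_max_right _ _) hn),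
        add_zero]
    · change p.2.1 n + q.2.1 n = fieldL m f n (p.1 + q.1)
      rw [hp, hq, map_add]
  zero_mem' := ⟨⟨0, fun n _ => rfl⟩, fun n => (map_zero (fieldL m f n)).symm⟩
  smul_mem' := by
    rintro c p ⟨⟨N, hN⟩, hp⟩
    refine ⟨⟨N, fun n hn => ?_⟩, fun n => ?_⟩
    · change c • p.1.1 n = 0
      rw [hN n hn, smul_zero]
    · change c • p.2.1 n = fieldL m f n (c • p.1)
      rw [hp, map_smul]

theorem coe_preField_closure (f : Lp ℂ 2 m) :
    ((preField m f).topologicalClosure : Set (Fock m × Fock m)) = segalField m f := by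
  rw [Submodule.topologicalClosure_coe, segalField]
  congr 1
  ext p
  refine and_congr_right fun _ => forall_congr' fun n => ?_
  rw [Lp.ext_iff]
  exact ⟨fun h => h.trans (fieldL_coeFn m f n p.1),
    fun h => h.trans (fieldL_coeFn m f n p.1).symm⟩

/-- The field operator applied to an exponential vector. -/
noncomputable def fieldExp (f u : Lp ℂ 2 m) : Fock m :=
  ((1 / √2 : ℝ) : ℂ) • (dExpVec m u f + inner ℂ f u • expVec m u)

theorem sqrt_factorial_succ (n : ℕ) :
    √((n + 1).factorial : ℝ) = √((n : ℝ) + 1) * √(n.factorial : ℝ) := by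
  rw [Nat.factorial_succ, Nat.cast_mul, Real.sqrt_mul (by positivity)]
  push_cast
  rfl

/-- Inserting f in every slot of a tensor power is what the product rule does; the factor √(n+1) is
the ratio of the normalisations. -/
theorem creationL_expVec (f u : Lp ℂ 2 m) (n : ℕ) :
    creationL m f n ((expVec m u).1 n) = (dExpVec m u f).1 (n + 1) := by
  rw [expVec_apply, map_smul, dExpVec_apply, creationL, smul_apply,
    sum_apply, smul_smul, ← ofReal_mul, sqrt_factorial_succ]
  simp_rw [insertL_tens]
  congr 2
  rw [one_div_mul_one_div, mul_comm]

theorem adjoint_insertL_tens (f u : Lp ℂ 2 m) (n : ℕ) :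
    (insertL m 0 f).adjoint (tens m (n + 1) fun _ => u) = inner ℂ f u • tens m n fun _ => u := by
  refine ext_inner_left ℂ fun χ => ?_
  have h : tens m (n + 1) (fun _ => u) = insertL m 0 u (tens m n fun _ => u) := by
    rw [insertL_tens]
    congr 1
    funext i
    rcases eq_or_ne i 0 with rfl | hi
    · rw [Function.update_self]
    · rw [Function.update_of_ne hi]
  rw [ContinuousLinearMap.adjoint_inner_right, h, inner_insertL, inner_smul_right]

/-- Contracting one slot of a tensor power with f leaves ⟨f,u⟩ times the next lower power:
exponential vectors are coherent. -/
theorem annihilationL_expVec (f u : Lp ℂ 2 m) (n : ℕ) :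
    annihilationL m f n ((expVec m u).1 (n + 1)) = inner ℂ f u • (expVec m u).1 n := by
  rw [expVec_apply, expVec_apply, map_smul, annihilationL, smul_apply,
    adjoint_insertL_tens, smul_smul, smul_comm, ← ofReal_mul, sqrt_factorial_succ]
  congr 3
  field_simp

theorem dExpVec_zero_apply (u f : Lp ℂ 2 m) : (dExpVec m u f).1 0 = 0 := by
  rw [dExpVec_apply, Finset.univ_eq_empty, Finset.sum_empty, smul_zero]

/-- The vector with the single component `ψₙ`. -/
noncomputable def proj (n : ℕ) (ψ : Fock m) : Fock m :=
  ⟨lp.single 2 n (ψ.1 n), single_mem_Fock m fun σ => ψ.2 n σ⟩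

theorem hasSum_proj (ψ : Fock m) : HasSum (fun n => proj m n ψ) ψ := by
  have h := lp.hasSum_single (p := 2) (by norm_num) ψ.1
  have hi : Topology.IsInducing (Subtype.val : Fock m → FullFock m) := ⟨rfl⟩
  exact (hi.hasSum_iff (g := (Fock m).subtype) _ _).1 h

theorem sum_proj_apply (N : ℕ) (ψ : Fock m) (n : ℕ) :
    (∑ k ∈ Finset.range N, proj m k ψ : Fock m).1 n = if n < N then ψ.1 n else 0 := by
  change comp m n _ = _
  rw [map_sum]
  have h : ∀ k, comp m n (proj m k ψ) = if n = k then ψ.1 n else 0 := by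
    intro k
    change (lp.single 2 k (ψ.1 k) : FullFock m) n = _
    split_ifs with h
    · subst h; rw [lp.single_apply_self]
    · rw [lp.single_apply_ne _ _ _ h]
  simp_rw [h]
  rw [Finset.sum_ite_eq]
  simp

/-- An exponential vector has infinitely many particles in general, so it is reached only in the
closure, by truncation in the particle number. -/
theorem fieldExp_mem (f u : Lp ℂ 2 m) :
    (expVec m u, fieldExp m f u) ∈ (preField m f).topologicalClosure := by
  -- Cutting Exp(u) after N particles leaves a creation part with at most N+1 particles and an
  -- annihilation part with at most N-1 particles. This is the reason for the three different
  -- ranges.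
  have h1 : Filter.Tendsto (fun N => (∑ k ∈ Finset.range (N + 1), proj m k (expVec m u),
      ((1 / √2 : ℝ) : ℂ) • (∑ k ∈ Finset.range (N + 2), proj m k (dExpVec m u f)
        + inner ℂ f u • ∑ k ∈ Finset.range N, proj m k (expVec m u)))) Filter.atTop
      (nhds (expVec m u, fieldExp m f u)) := by
    have hE := (hasSum_proj m (expVec m u)).tendsto_sum_nat
    have hD := (hasSum_proj m (dExpVec m u f)).tendsto_sum_nat
    exact (hE.comp (Filter.tendsto_add_atTop_nat 1)).prodMk_nhds
      (((hD.comp (Filter.tendsto_add_atTop_nat 2)).add (hE.const_smul _)).const_smul _)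
  refine mem_closure_of_tendsto h1 (Filter.Eventually.of_forall fun N =>
    ⟨⟨N, fun n hn => ?_⟩, fun n => ?_⟩)
  · rw [sum_proj_apply, if_neg (by omega)]
  · change ((1 / √2 : ℝ) : ℂ) • ((∑ k ∈ Finset.range (N + 2), proj m k (dExpVec m u f) : Fock m).1 n
      + inner ℂ f u • (∑ k ∈ Finset.range N, proj m k (expVec m u) : Fock m).1 n) = _
    rw [sum_proj_apply, sum_proj_apply]
    cases n with
    | zero =>
      change _ = ((1 / √2 : ℝ) : ℂ) • (annihilationL m f 0
        ((∑ k ∈ Finset.range (N + 1), proj m k (expVec m u) : Fock m).1 1))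
      rw [sum_proj_apply, if_pos (by omega), dExpVec_zero_apply, zero_add]
      congr 1
      split_ifs with h1 h2 h2
      · rw [annihilationL_expVec]
      · omega
      · omega
      · rw [map_zero, smul_zero]
    | succ n =>
      change _ = ((1 / √2 : ℝ) : ℂ) • (creationL m f n
        ((∑ k ∈ Finset.range (N + 1), proj m k (expVec m u) : Fock m).1 n) +
        annihilationL m f (n + 1)
        ((∑ k ∈ Finset.range (N + 1), proj m k (expVec m u) : Fock m).1 (n + 2)))
      rw [sum_proj_apply, sum_proj_apply]
      congr 2
      · split_ifs with h1 h2 h2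
        · rw [creationL_expVec]
        · omega
        · omega
        · rw [map_zero]
      · split_ifs with h1 h2 h2
        · rw [annihilationL_expVec]
        · omega
        · omega
        · rw [map_zero, smul_zero]

theorem inner_creationL (f u : Lp ℂ 2 m) (n : ℕ) (ψ : Fock m) :
    inner ℂ ((expVec m u).1 (n + 1)) (creationL m f n (ψ.1 n))
      = inner ℂ u f * inner ℂ ((expVec m u).1 n) (ψ.1 n) := by
  have h : ∀ j : Fin (n + 1), tens m (n + 1) (fun _ => u) = insertL m j u (tens m n fun _ => u) := by
    intro j
    rw [insertL_tens]
    congr 1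
    funext i
    rcases eq_or_ne i j with rfl | hi
    · rw [Function.update_self]
    · rw [Function.update_of_ne hi]
  rw [creationL, smul_apply, sum_apply, inner_smul_right,
    inner_sum, expVec_apply, expVec_apply]
  simp_rw [inner_smul_left]
  have h2 : ∀ j : Fin (n + 1), inner ℂ (tens m (n + 1) fun _ => u) (insertL m j f (ψ.1 n))
      = inner ℂ u f * inner ℂ (tens m n fun _ => u) (ψ.1 n) := fun j => by
    rw [h j, inner_insertL]
  simp_rw [h2]
  rw [Finset.sum_const, Finset.card_univ, Fintype.card_fin, conj_ofReal, conj_ofReal,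
    sqrt_factorial_succ, nsmul_eq_mul]
  have h3 : ((1 / √((n : ℝ) + 1) : ℝ) : ℂ) * (((n + 1 : ℕ) : ℂ) *
      ((1 / (√((n : ℝ) + 1) * √(n.factorial : ℝ)) : ℝ) : ℂ))
      = ((1 / √(n.factorial : ℝ) : ℝ) : ℂ) := by
    have : (1 / √((n : ℝ) + 1)) * (((n : ℝ) + 1) * (1 / (√((n : ℝ) + 1) * √(n.factorial : ℝ))))
        = 1 / √(n.factorial : ℝ) := by
      have h4 : √((n : ℝ) + 1) * √((n : ℝ) + 1) = (n : ℝ) + 1 := Real.mul_self_sqrt (by positivity)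
      have h5 : √((n : ℝ) + 1) ≠ 0 := by positivity
      field_simp
      nlinarith
    rw [← this]; push_cast; ring
  rw [← h3]
  ring

/-- The permutation symmetry of ψ makes all n+1 slots of the derivative contribute equally, and n+1
absorbs the square roots. -/
theorem inner_annihilationL (f u : Lp ℂ 2 m) (n : ℕ) (ψ : Fock m) :
    inner ℂ ((expVec m u).1 n) (annihilationL m f n (ψ.1 (n + 1)))
      = inner ℂ ((dExpVec m u f).1 (n + 1)) (ψ.1 (n + 1)) := by
  have h : ∀ j : Fin (n + 1), inner ℂ (tens m (n + 1) (Function.update (fun _ => u) j f))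
      (ψ.1 (n + 1)) = inner ℂ (insertL m 0 f (tens m n fun _ => u)) (ψ.1 (n + 1)) := by
    intro j
    have h1 := permute_tens m (Equiv.swap 0 j) (Function.update (fun _ => u) j f)
    have h2 := (permute m (n + 1) (Equiv.swap 0 j)).inner_map_map
      (tens m (n + 1) (Function.update (fun _ => u) j f)) (ψ.1 (n + 1))
    have h3 : permute m (n + 1) (Equiv.swap 0 j) (ψ.1 (n + 1)) = ψ.1 (n + 1) := ψ.2 _ _
    rw [h3, h1] at h2
    rw [← h2, insertL_tens]
    congr 2
    funext i
    rw [Function.comp_apply, Equiv.symm_swap]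
    rcases eq_or_ne i 0 with rfl | hi
    · rw [Equiv.swap_apply_left, Function.update_self, Function.update_self]
    · rw [Function.update_of_ne hi, Function.update_of_ne]
      intro h
      apply hi
      have := congrArg (Equiv.swap 0 j) h
      rwa [Equiv.swap_apply_self, Equiv.swap_apply_right] at this
  rw [expVec_apply, dExpVec_apply, annihilationL, smul_apply, inner_smul_right,
    inner_smul_left, inner_smul_left, ContinuousLinearMap.adjoint_inner_right, sum_inner]
  simp_rw [h]
  rw [Finset.sum_const, Finset.card_univ, Fintype.card_fin, conj_ofReal, conj_ofReal,
    sqrt_factorial_succ, nsmul_eq_mul]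
  have h3 : ((√((n : ℝ) + 1) : ℝ) : ℂ) * ((1 / √(n.factorial : ℝ) : ℝ) : ℂ) =
      ((1 / (√((n : ℝ) + 1) * √(n.factorial : ℝ)) : ℝ) : ℂ) * ((n + 1 : ℕ) : ℂ) := by
    have : √((n : ℝ) + 1) * (1 / √(n.factorial : ℝ))
        = (1 / (√((n : ℝ) + 1) * √(n.factorial : ℝ))) * ((n : ℝ) + 1) := by
      have h4 : √((n : ℝ) + 1) * √((n : ℝ) + 1) = (n : ℝ) + 1 := Real.mul_self_sqrt (by positivity)
      have h5 : √((n : ℝ) + 1) ≠ 0 := by positivity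
      field_simp
      nlinarith
    rw [← ofReal_mul, this]; push_cast; ring
  rw [← mul_assoc, h3]
  ring

theorem Fock.inner_smul_left (c : ℂ) (x y : Fock m) :
    inner ℂ (c • x) y = starRingEnd ℂ c * inner ℂ x y := _root_.inner_smul_left x y c

theorem Fock.inner_smul_right (c : ℂ) (x y : Fock m) :
    inner ℂ x (c • y) = c * inner ℂ x y := _root_.inner_smul_right x y c

/-- Creation and annihilation shift the particle number in opposite directions; after the
corresponding shifts of the summation index the two series agree term by term. -/
theorem preField_adjoint (f u : Lp ℂ 2 m) {p : Fock m × Fock m} (hp : p ∈ preField m f) :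
    inner ℂ (fieldExp m f u) p.1 = inner ℂ (expVec m u) p.2 := by
  have h1 := hasSum_inner_Fock m (expVec m u) p.2
  have hS := (hasSum_inner_Fock m (expVec m u) p.1).mul_left (inner ℂ u f)
  have hD := hasSum_inner_Fock m (dExpVec m u f) p.1
  rw [← hasSum_nat_add_iff' 1] at h1 hD
  simp only [Finset.range_one, Finset.sum_singleton, dExpVec_zero_apply, inner_zero_left,
    sub_zero] at h1 hD
  have hD' := hD
  rw [← hasSum_nat_add_iff' 1] at hD'
  simp only [Finset.range_one, Finset.sum_singleton] at hD'
  have h2 := (hS.add hD').mul_left ((1 / √2 : ℝ) : ℂ)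
  have h3 : ∀ n, inner ℂ ((expVec m u).1 (n + 1)) (p.2.1 (n + 1)) = ((1 / √2 : ℝ) : ℂ) *
      (inner ℂ u f * inner ℂ ((expVec m u).1 n) (p.1.1 n)
        + inner ℂ ((dExpVec m u f).1 (n + 1 + 1)) (p.1.1 (n + 1 + 1))) := by
    intro n
    rw [hp.2]
    change inner ℂ ((expVec m u).1 (n + 1)) (((1 / √2 : ℝ) : ℂ) • (creationL m f n (p.1.1 n)
      + annihilationL m f (n + 1) (p.1.1 (n + 2)))) = _
    rw [inner_smul_right, inner_add_right, inner_creationL, inner_annihilationL]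
  have h4 : inner ℂ ((expVec m u).1 0) (p.2.1 0) = ((1 / √2 : ℝ) : ℂ) *
      inner ℂ ((dExpVec m u f).1 1) (p.1.1 1) := by
    rw [hp.2]
    change inner ℂ ((expVec m u).1 0) (((1 / √2 : ℝ) : ℂ) • annihilationL m f 0 (p.1.1 1)) = _
    rw [inner_smul_right, inner_annihilationL]
  simp_rw [h3, h4] at h1
  have h5 := h1.unique h2
  have h6 : inner ℂ (fieldExp m f u) p.1 = ((1 / √2 : ℝ) : ℂ) *
      (inner ℂ (dExpVec m u f) p.1 + inner ℂ u f * inner ℂ (expVec m u) p.1) := by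
    rw [fieldExp, Fock.inner_smul_left, inner_add_left, Fock.inner_smul_left, conj_ofReal,
      inner_conj_symm]
  rw [h6]
  linear_combination -h5

theorem segalField_adjoint (f u : Lp ℂ 2 m) {p : Fock m × Fock m}
    (hp : p ∈ (preField m f).topologicalClosure) :
    inner ℂ (fieldExp m f u) p.1 = inner ℂ (expVec m u) p.2 := by
  have hc : IsClosed {p : Fock m × Fock m |
      inner ℂ (fieldExp m f u) p.1 = inner ℂ (expVec m u) p.2} :=
    isClosed_eq (by fun_prop) (by fun_prop)
  exact closure_minimal (fun p hp => preField_adjoint m f u hp) hc hp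

/-- The Weyl operator `exp (i φ(f))` applied to an exponential vector. -/
noncomputable def weylExp (f u : Lp ℂ 2 m) : Fock m :=
  cexp (-(inner ℂ f f / 4) + I / √2 * inner ℂ f u) • expVec m (u + (I / √2 : ℂ) • f)

theorem ofReal_sqrt_two_mul : ((√2 : ℝ) : ℂ) * (√2 : ℝ) = 2 := by
  rw [← ofReal_mul, Real.mul_self_sqrt (by norm_num)]; norm_num

theorem ofReal_sqrt_two_ne : ((√2 : ℝ) : ℂ) ≠ 0 := ofReal_ne_zero.2 (by positivity)

theorem I_div_sqrt_two_sq : (I / (√2 : ℝ) : ℂ) * (I / (√2 : ℝ)) = -(1 / 2) := by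
  rw [div_mul_div_comm, I_mul_I, ofReal_sqrt_two_mul]; norm_num

theorem conj_I_div_sqrt_two : starRingEnd ℂ (I / (√2 : ℝ)) = -(I / (√2 : ℝ)) := by
  rw [map_div₀, conj_I, conj_ofReal, neg_div]

/-- The shift contributes ⟨f,f⟩/2, which cancels the two factors -⟨f,f⟩/4, and its mixed terms
cancel those of the prefactors. -/
theorem inner_weylExp (f u v : Lp ℂ 2 m) :
    inner ℂ (weylExp m f u) (weylExp m f v) = inner ℂ (expVec m u) (expVec m v) := by
  rw [weylExp, weylExp, Fock.inner_smul_left, Fock.inner_smul_right, inner_expVec, inner_expVec, ← exp_conj, ← Complex.exp_add,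
    ← Complex.exp_add]
  congr 1
  simp only [map_add, map_neg, map_div₀, map_mul, inner_conj_symm, inner_add_left, inner_add_right,
    inner_smul_left, inner_smul_right, conj_I, conj_ofReal, map_ofNat]
  have h := I_div_sqrt_two_sq
  linear_combination (-(inner ℂ f f)) * h

/-- Up to nonzero factors this is the family of all exponential vectors with shifted labels. -/
theorem total_weylExp (f : Lp ℂ 2 m) : Total (weylExp m f) := by
  intro x hx
  refine total_expVec m x fun u => ?_
  have h := hx (u - (I / √2 : ℂ) • f)
  rw [weylExp, sub_add_cancel, Fock.inner_smul_left] at h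
  exact (mul_eq_zero.1 h).resolve_left (by simp [Complex.exp_ne_zero])

/-- The unitary Weyl operator. -/
noncomputable def weylU (f : Lp ℂ 2 m) : Fock m ≃ₗᵢ[ℂ] Fock m :=
  (exists_unitary_of_inner_eq (total_expVec m) (total_weylExp m f) (inner_weylExp m f)).choose

theorem weylU_expVec (f u : Lp ℂ 2 m) : weylU m f (expVec m u) = weylExp m f u :=
  (exists_unitary_of_inner_eq (total_expVec m) (total_weylExp m f) (inner_weylExp m f)).choose_spec u

/-- The unitary Weyl operator, as a bounded operator. -/
noncomputable def weylL (f : Lp ℂ 2 m) : Fock m →L[ℂ] Fock m :=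
  (weylU m f).toContinuousLinearEquiv

theorem weylL_expVec (f u : Lp ℂ 2 m) : weylL m f (expVec m u) = weylExp m f u :=
  weylU_expVec m f u

/-- The Weyl relations. The exponents differ only in the mixed term, which is half of ⟨f,g⟩ on the
left and a quarter of ⟨f,g⟩ + ⟨g,f⟩ on the right. -/
theorem weylL_mul (f g : Lp ℂ 2 m) : weylL m f * weylL m g =
    cexp ((inner ℂ g f - inner ℂ f g) / 4) • weylL m (f + g) := by
  refine (total_expVec m).ext_map fun u => ?_
  rw [mul_apply_eq_comp, smul_apply, weylL_expVec, weylL_expVec, weylExp, weylExp, map_smul,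
    weylL_expVec, weylExp, smul_smul, smul_smul, ← Complex.exp_add, ← Complex.exp_add, add_assoc u,
    ← smul_add, add_comm g f]
  congr 2
  simp only [inner_add_left, inner_add_right, inner_smul_right]
  have h := I_div_sqrt_two_sq
  linear_combination (inner ℂ f g) * h

theorem weylL_zero : weylL m 0 = 1 := by
  refine (total_expVec m).ext_map fun u => ?_
  rw [weylL_expVec, weylExp]
  simp

theorem norm_weylL (f : Lp ℂ 2 m) (x : Fock m) : ‖weylL m f x‖ = ‖x‖ := (weylU m f).norm_map x

/-- The explicit operators permute the exponential vectors up to factors and have the field operator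
as derivative on them, while the closed field operator is formally adjoint to these derivatives. The
criterion for generators then applies, so the Segal operator is self-adjoint and its abstract
exponential is the explicit one. -/
theorem isUnitaryGroup_weylL (f : Lp ℂ 2 m) :
    IsUnitaryGroup (segalField m f) fun t : ℝ => weylL m ((t : ℂ) • f) := by
  rw [← coe_preField_closure]
  refine isUnitaryGroup_of_total_smul (by simp [weylL_zero]) (fun t u => ?_)
    (fun t => norm_weylL m _) (total_expVec m) (z := fieldExp m f) (fun u => ?_) (fun t u => ?_)
    (preField m f).isClosed_topologicalClosure (fieldExp_mem m f)
    (fun p hp u => segalField_adjoint m f u hp)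
  · rw [weylL_mul, inner_smul_left, inner_smul_left, inner_smul_right, inner_smul_right,
      conj_ofReal, conj_ofReal]
    have : (u : ℂ) * (t * inner ℂ f f) - t * (u * inner ℂ f f) = 0 := by ring
    rw [this, zero_div, Complex.exp_zero, one_smul, ← add_smul]
    push_cast
    rfl
  · simp_rw [weylL_expVec, weylExp]
    have h1 : HasDerivAt (fun t : ℝ => u + (I / √2 : ℂ) • ((t : ℂ) • f)) ((I / √2 : ℂ) • f) 0 := by
      have : HasDerivAt (fun t : ℝ => (t : ℂ)) 1 0 := ofRealCLM.hasDerivAt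
      simpa using ((this.smul_const f).const_smul (I / √2 : ℂ)).const_add u
    have h2 := hasDerivAt_expVec m h1
    have h3 : HasDerivAt (fun t : ℝ => -(inner ℂ ((t : ℂ) • f) ((t : ℂ) • f) / 4)
        + I / √2 * inner ℂ ((t : ℂ) • f) u) (I / √2 * inner ℂ f u) 0 := by
      simp_rw [inner_smul_left, inner_smul_right, conj_ofReal]
      have h4 : HasDerivAt (fun t : ℝ => (t : ℂ)) 1 0 := ofRealCLM.hasDerivAt
      have h5 := ((h4.mul (h4.mul_const (inner ℂ f f))).div_const 4).neg.add
        ((h4.mul_const (inner ℂ f u)).const_mul (I / √2 : ℂ))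
      refine h5.congr_deriv ?_
      simp
    have h6 := h3.cexp.smul h2
    refine h6.congr_deriv ?_
    simp only [ofReal_zero, zero_smul, smul_zero, add_zero, inner_zero_left, mul_zero, zero_div,
      neg_zero, Complex.exp_zero, one_mul, one_smul, dExpVec_smul, fieldExp]
    rw [smul_add, smul_add, smul_smul, smul_smul, smul_smul]
    congr 2
    · push_cast; ring
    · push_cast; ring
  · exact ⟨_, _, weylL_expVec m _ u⟩

theorem weyl_eq (f : Lp ℂ 2 m) : weyl m f = weylL m f := by
  rw [weyl, expI_eq (isUnitaryGroup_weylL m f) (total_expVec m) fun u => ⟨fieldExp m f u, ?_⟩]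
  · simp
  · rw [← coe_preField_closure]
    exact fieldExp_mem m f u

end Weyl

/-! ### Multiplication operators on the Fock space -/

section Multiplier

variable {M : Type} [MeasurableSpace M] (m : Measure M) [SigmaFinite m]

/-- The graph of the maximal multiplication operator with `lam`. -/
def multGraph (lam : (n : ℕ) → (Fin n → M) → ℝ) : Set (Fock m × Fock m) :=
  {p | ∀ n, p.2.1 n =ᵐ[Measure.pi fun _ : Fin n => m] fun x => lam n x * p.1.1 n x}

variable {m}

theorem inner_eq_of_mem_multGraph {lam : (n : ℕ) → (Fin n → M) → ℝ} {p q : Fock m × Fock m}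
    (hp : p ∈ multGraph m lam) (hq : q ∈ multGraph m lam) : inner ℂ p.1 q.2 = inner ℂ p.2 q.1 := by
  refine (hasSum_inner_Fock m p.1 q.2).unique ?_
  refine (hasSum_inner_Fock m p.2 q.1).congr_fun fun n => ?_
  simp_rw [L2.inner_def]
  refine integral_congr_ae ?_
  filter_upwards [hp n, hq n] with x h1 h2
  rw [h1, h2]
  simp only [RCLike.inner_apply, map_mul, conj_ofReal]
  ring

/-- A multiplication operator with a core of exponential vectors. -/
structure HasExpCore (B : ℕ → Set M) (V : ℕ → Submodule ℝ (Lp ℂ 2 m))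
    (lam : (n : ℕ) → (Fin n → M) → ℝ) : Prop where
  exhaustion : IsExhaustion m B
  family : IsTestFamily m B V
  mult : IsMultiplier B lam
  mem : ∀ k, ∀ v ∈ V k, ∃ κ, (expVec m v, κ) ∈ multGraph m lam

variable {B : ℕ → Set M} {V : ℕ → Submodule ℝ (Lp ℂ 2 m)} {lam : (n : ℕ) → (Fin n → M) → ℝ}

/-- The maximal multiplication operator is the adjoint of its restriction to the exponential
vectors. This is the orthogonality criterion for the pair (y, -x). -/
theorem HasExpCore.mem_multGraph_iff (h : HasExpCore B V lam) (p : Fock m × Fock m) :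
    p ∈ multGraph m lam ↔ ∀ q ∈ multGraph m lam, (∃ k, ∃ v ∈ V k, q.1 = expVec m v) →
      inner ℂ q.2 p.1 = inner ℂ q.1 p.2 := by
  constructor
  · intro hp q hq _
    exact (inner_eq_of_mem_multGraph hq hp).symm
  · intro hp n
    have h1 := add_mul_eq_zero_of_orthogonal h.exhaustion h.mult h.family (a := p.2) (b := -p.1)
      (fun k v hv => ?_) n
    · filter_upwards [h1, Lp.coeFn_neg (p.1.1 n)] with x h2 h3
      have h4 : (-p.1 : Fock m).1 n = -p.1.1 n := rfl
      rw [h4, h3, Pi.neg_apply] at h2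
      linear_combination h2
    · obtain ⟨κ, hκ⟩ := h.mem k v hv
      refine ⟨κ, hκ, ?_⟩
      have h2 := hp _ hκ ⟨k, v, hv, rfl⟩
      rw [inner_neg_left, ← inner_conj_symm p.1, h2, inner_conj_symm, add_neg_cancel]

/-- A pair (a, b) orthogonal to `S` satisfies a + λb = 0, hence is orthogonal to the whole graph of
multiplication by λ. So the exponential vectors span a core. -/
theorem HasExpCore.subset_of_mem (h : HasExpCore B V lam) {S : Submodule ℂ (Fock m × Fock m)}
    (hS : IsClosed (S : Set (Fock m × Fock m)))
    (hmem : ∀ k, ∀ v ∈ V k, ∃ κ, (expVec m v, κ) ∈ multGraph m lam ∧ (expVec m v, κ) ∈ S) :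
    multGraph m lam ⊆ S := by
  intro p hp
  refine mem_of_orthogonal hS fun a b hab => ?_
  have h1 : ∀ n, ∀ᵐ x ∂(Measure.pi fun _ : Fin n => m), a.1 n x + lam n x * b.1 n x = 0 :=
    add_mul_eq_zero_of_orthogonal h.exhaustion h.mult h.family fun k v hv => by
      obtain ⟨κ, hκ, hκS⟩ := hmem k v hv
      exact ⟨κ, hκ, hab _ hκS⟩
  have h2 := (hasSum_inner_Fock m a p.1).add (hasSum_inner_Fock m b p.2)
  refine h2.unique (hasSum_zero.congr_fun fun n => ?_)
  simp_rw [L2.inner_def]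
  rw [← integral_add (L2.integrable_inner _ _) (L2.integrable_inner _ _)]
  refine (integral_congr_ae (g := fun _ => (0 : ℂ)) ?_).trans (integral_zero _ _)
  filter_upwards [h1 n, hp n] with x h3 h4
  rw [h4]
  have h5 := congrArg (starRingEnd ℂ) h3
  simp only [map_add, map_mul, conj_ofReal, map_zero] at h5
  simp only [RCLike.inner_apply]
  linear_combination p.1.1 n x * h5

variable (m lam) in
/-- The graph of a multiplication operator, as a subspace. -/
def multSub : Submodule ℂ (Fock m × Fock m) where
  carrier := multGraph m lam
  add_mem' := fun {p q} hp hq n => by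
    filter_upwards [hp n, hq n, Lp.coeFn_add (p.2.1 n) (q.2.1 n), Lp.coeFn_add (p.1.1 n) (q.1.1 n)]
      with x h1 h2 h3 h4
    change (p.2.1 n + q.2.1 n : Lp ℂ 2 (Measure.pi fun _ : Fin n => m)) x
      = lam n x * (p.1.1 n + q.1.1 n : Lp ℂ 2 (Measure.pi fun _ : Fin n => m)) x
    rw [h3, h4, Pi.add_apply, Pi.add_apply, h1, h2, mul_add]
  zero_mem' := fun n => by
    filter_upwards [Lp.coeFn_zero ℂ 2 (Measure.pi fun _ : Fin n => m)] with x h1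
    change (0 : Lp ℂ 2 (Measure.pi fun _ : Fin n => m)) x
      = lam n x * (0 : Lp ℂ 2 (Measure.pi fun _ : Fin n => m)) x
    rw [h1, Pi.zero_apply, mul_zero]
  smul_mem' := fun c p hp n => by
    filter_upwards [hp n, Lp.coeFn_smul c (p.2.1 n), Lp.coeFn_smul c (p.1.1 n)]
      with x h1 h3 h4
    change (c • p.2.1 n : Lp ℂ 2 (Measure.pi fun _ : Fin n => m)) x
      = lam n x * (c • p.1.1 n : Lp ℂ 2 (Measure.pi fun _ : Fin n => m)) x
    rw [h3, h4, Pi.smul_apply, Pi.smul_apply, h1, mul_smul_comm]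

/-- The adjoint description exhibits the graph as an intersection of closed sets. -/
theorem HasExpCore.isClosed (h : HasExpCore B V lam) : IsClosed (multGraph m lam) := by
  have : multGraph m lam = ⋂ q : {q // q ∈ multGraph m lam ∧ ∃ k, ∃ v ∈ V k, q.1 = expVec m v},
      {p | inner ℂ q.1.2 p.1 = inner ℂ q.1.1 p.2} := by
    ext p
    rw [h.mem_multGraph_iff, Set.mem_iInter]
    exact ⟨fun h q => h q.1 q.2.1 q.2.2, fun h q h1 h2 => h ⟨q, h1, h2⟩⟩
  rw [this]
  exact isClosed_iInter fun q => isClosed_eq (by fun_prop) (by fun_prop)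

theorem multGraph_unique {x y y' : Fock m} (h : (x, y) ∈ multGraph m lam)
    (h' : (x, y') ∈ multGraph m lam) : y = y' :=
  Fock.ext m fun n => Lp.ext ((h n).trans (h' n).symm)

/-- A nonnegative multiplication operator is positive and self-adjoint. -/
theorem HasExpCore.isPositiveSelfAdjoint (h : HasExpCore B V lam) (hpos : ∀ n x, 0 ≤ lam n x) :
    IsPositiveSelfAdjoint (multGraph m lam) := by
  refine ⟨fun y hy => ?_, fun x y => ⟨fun hp q hq => ?_, fun hp => ?_⟩, fun p hp => ?_⟩
  · exact multGraph_unique hy (multSub m lam).zero_mem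
  · exact inner_eq_of_mem_multGraph hq hp
  · rw [h.mem_multGraph_iff]
    exact fun q hq _ => (hp q hq).symm
  · have h1 := (hasSum_inner_Fock m p.1 p.2).mapL reCLM
    refine h1.nonneg fun n => ?_
    rw [L2.inner_def, reCLM_apply, ← RCLike.re_eq_complex_re, ← integral_re (L2.integrable_inner _ _)]
    refine integral_nonneg_of_ae ?_
    filter_upwards [hp n] with x h2
    rw [h2]
    simp only [RCLike.inner_apply, Pi.zero_apply]
    have : (lam n x : ℂ) * p.1.1 n x * starRingEnd ℂ (p.1.1 n x)
        = ((lam n x * normSq (p.1.1 n x) : ℝ) : ℂ) := by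
      rw [mul_assoc, mul_conj]; push_cast; ring
    rw [this]
    exact mul_nonneg (hpos n x) (normSq_nonneg _)

end Multiplier

/-! ### Second quantisation of multiplication operators -/

section SecondQuantisation

variable {M : Type} [MeasurableSpace M] (m : Measure M) [SigmaFinite m]

/-- The product of a function with an `L²` function (and `0` if it is not square integrable). -/
noncomputable def mulFun (g : M → ℂ) (u : Lp ℂ 2 m) : Lp ℂ 2 m := toL2 m fun x => g x * u x

variable {m}

theorem mulFun_coeFn_of_memLp {g : M → ℂ} {u : Lp ℂ 2 m} (h : MemLp (fun x => g x * u x) 2 m) :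
    mulFun m g u =ᵐ[m] fun x => g x * u x := toL2_coeFn m h

theorem memLp_mul_of_bound {g : M → ℂ} (hg : Measurable g) {u : Lp ℂ 2 m} {C : ℝ}
    (h : ∀ᵐ x ∂m, ‖g x * u x‖ ≤ C * ‖u x‖) : MemLp (fun x => g x * u x) 2 m :=
  MemLp.of_le_mul (Lp.memLp u) (hg.aestronglyMeasurable.mul (Lp.aestronglyMeasurable u)) h

theorem memLp_mul_of_supp {g : M → ℂ} (hg : Measurable g) {B : Set M} {u : Lp ℂ 2 m}
    (hu : u ∈ suppIn m B) {C : ℝ} (hC : ∀ x ∈ B, ‖g x‖ ≤ C) : MemLp (fun x => g x * u x) 2 m := by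
  refine memLp_mul_of_bound hg (C := C) ?_
  filter_upwards [hu] with x h
  by_cases hx : x ∈ B
  · rw [norm_mul]; gcongr; exact hC x hx
  · rw [h hx]; simp

theorem mulFun_mem_suppIn {g : M → ℂ} {B : Set M} {u : Lp ℂ 2 m} (hu : u ∈ suppIn m B) :
    mulFun m g u ∈ suppIn m B := by
  by_cases h : MemLp (fun x => g x * u x) 2 m
  · filter_upwards [hu, mulFun_coeFn_of_memLp h] with x h1 h2 hx
    rw [h2, h1 hx, mul_zero]
  · rw [mulFun, toL2, dif_neg h]
    exact (suppIn m B).zero_mem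

/-- The function a is bounded on the support of u, so |e^z - 1 - z| ≤ |z|² holds uniformly there for
small t and gives a quadratic remainder in L². -/
theorem hasDerivAt_mulFun_exp {a : M → ℝ} (ha : Measurable a) {B : Set M} {u : Lp ℂ 2 m}
    (hu : u ∈ suppIn m B) {C : ℝ} (hC : ∀ x ∈ B, |a x| ≤ C) (ζ : ℂ) :
    HasDerivAt (fun t : ℝ => mulFun m (fun x => cexp (t * ζ * a x)) u)
      (ζ • mulFun m (fun x => (a x : ℂ)) u) 0 := by
  have hC0 : 0 ≤ |C| := abs_nonneg C
  have hC' : ∀ x ∈ B, |a x| ≤ |C| := fun x hx => (hC x hx).trans (le_abs_self C)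
  have hmem : ∀ t : ℝ, MemLp (fun x => cexp (t * ζ * a x) * u x) 2 m := fun t => by
    refine memLp_mul_of_supp (by fun_prop) hu (C := Real.exp (|t| * ‖ζ‖ * |C|)) fun x hx => ?_
    refine (Complex.norm_exp_le_exp_norm _).trans ?_
    rw [norm_mul, norm_mul, Complex.norm_real, Complex.norm_real]
    have := hC' x hx
    gcongr
    · exact le_rfl
    · exact this
  have hmema : MemLp (fun x => (a x : ℂ) * u x) 2 m :=
    memLp_mul_of_supp (by fun_prop) hu (C := |C|) fun x hx => by
      rw [Complex.norm_real]; exact hC' x hx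
  rw [hasDerivAt_iff_isLittleO]
  refine Asymptotics.IsBigO.trans_isLittleO (g := fun t : ℝ => t ^ 2) ?_ ?_
  · refine Asymptotics.IsBigO.of_bound ((‖ζ‖ * |C|) ^ 2 * ‖u‖) ?_
    have hev : ∀ᶠ t : ℝ in nhds 0, |t| * (‖ζ‖ * |C|) ≤ 1 := by
      have : Filter.Tendsto (fun t : ℝ => |t| * (‖ζ‖ * |C|)) (nhds 0) (nhds (|0| * (‖ζ‖ * |C|))) :=
        (continuous_abs.mul continuous_const).tendsto 0
      rw [abs_zero, zero_mul] at this
      exact (this.eventually (gt_mem_nhds one_pos)).mono fun t h => h.le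
    filter_upwards [hev] with t ht
    rw [mul_right_comm]
    refine Lp.norm_le_mul_norm_of_ae_le_mul ?_
    filter_upwards [hu, mulFun_coeFn_of_memLp (hmem t), mulFun_coeFn_of_memLp (hmem 0),
      mulFun_coeFn_of_memLp hmema,
      Lp.coeFn_sub (mulFun m (fun x => cexp (t * ζ * a x)) u
        - mulFun m (fun x => cexp ((0 : ℝ) * ζ * a x)) u)
        ((t - 0) • ζ • mulFun m (fun x => (a x : ℂ)) u),
      Lp.coeFn_sub (mulFun m (fun x => cexp (t * ζ * a x)) u)
        (mulFun m (fun x => cexp ((0 : ℝ) * ζ * a x)) u),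
      Lp.coeFn_smul (t - 0) (ζ • mulFun m (fun x => (a x : ℂ)) u),
      Lp.coeFn_smul ζ (mulFun m (fun x => (a x : ℂ)) u)] with x h0 h1 h2 h3 h4 h5 h6 h7
    rw [h4, Pi.sub_apply, h5, Pi.sub_apply, h6, Pi.smul_apply, h7, Pi.smul_apply, h1, h2, h3]
    have e : cexp (t * ζ * a x) * u x - cexp ((0 : ℝ) * ζ * a x) * u x
        - (t - 0) • ζ • ((a x : ℂ) * u x)
        = (cexp (t * ζ * a x) - 1 - t * ζ * a x) * u x := by
      simp only [ofReal_zero, zero_mul, Complex.exp_zero, sub_zero, Complex.real_smul, smul_eq_mul]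
      ring
    rw [e, norm_mul]
    by_cases hx : x ∈ B
    · gcongr
      have hz : ‖(t : ℂ) * ζ * a x‖ ≤ |t| * (‖ζ‖ * |C|) := by
        rw [norm_mul, norm_mul, Complex.norm_real, Complex.norm_real, mul_assoc]
        have := hC' x hx
        gcongr
        · exact le_rfl
        · exact this
      refine (Complex.norm_exp_sub_one_sub_id_le (hz.trans ht)).trans ?_
      rw [Real.norm_of_nonneg (sq_nonneg t), ← sq_abs t, ← mul_pow, mul_comm _ |t|]
      gcongr
    · rw [h0 hx]; simp
  · simpa using Asymptotics.isLittleO_pow_sub_sub (0 : ℝ) (m := 2) (by norm_num)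

theorem isMultiplier_sum {B : ℕ → Set M} {a : M → ℝ} (ha : Measurable a)
    (hbd : ∀ k, ∃ C, ∀ x ∈ B k, |a x| ≤ C) :
    IsMultiplier B fun n (x : Fin n → M) => ∑ j, a (x j) := by
  refine ⟨fun n => by fun_prop, fun n σ x => Equiv.sum_comp σ fun j => a (x j), fun n k => ?_⟩
  obtain ⟨C, hC⟩ := hbd k
  refine ⟨∑ _ : Fin n, C, fun x hx => (Finset.abs_sum_le_sum_abs _ _).trans
    (Finset.sum_le_sum fun j _ => hC _ (hx j trivial))⟩

theorem isMultiplier_exp_sum {B : ℕ → Set M} {a : M → ℝ} (ha : Measurable a)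
    (hbd : ∀ k, ∃ C, ∀ x ∈ B k, |a x| ≤ C) (c : ℝ) :
    IsMultiplier B fun n (x : Fin n → M) => Real.exp (c * ∑ j, a (x j)) := by
  have h := isMultiplier_sum ha hbd
  refine ⟨fun n => ((h.meas n).const_mul c).exp, fun n σ x => ?_, fun n k => ?_⟩
  · have := h.symm n σ x
    beta_reduce at this
    rw [this]
  · obtain ⟨C, hC⟩ := h.bound n k
    refine ⟨Real.exp (|c| * C), fun x hx => ?_⟩
    rw [Real.abs_exp]
    refine Real.exp_le_exp.2 ((le_abs_self _).trans ?_)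
    rw [abs_mul]
    gcongr
    exact hC x hx

theorem expVec_coeFn (u : Lp ℂ 2 m) (n : ℕ) :
    (expVec m u).1 n =ᵐ[Measure.pi fun _ => m]
      fun x => ((1 / √(n.factorial : ℝ) : ℝ) : ℂ) * ∏ j, u (x j) := by
  rw [expVec_apply]
  filter_upwards [Lp.coeFn_smul ((1 / √(n.factorial : ℝ) : ℝ) : ℂ) (tens m n fun _ => u),
    tens_coeFn m fun _ : Fin n => u] with x h1 h2
  rw [h1, Pi.smul_apply, h2, smul_eq_mul]

/-- The factors e^{ca(x_j)} of the slots multiply to the exponential of the sum. -/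
theorem expVec_mul_mem {a : M → ℝ} {c : ℝ} {u : Lp ℂ 2 m}
    (h : MemLp (fun x => (Real.exp (c * a x) : ℂ) * u x) 2 m) :
    (expVec m u, expVec m (mulFun m (fun x => (Real.exp (c * a x) : ℂ)) u)) ∈
      multGraph m fun _ x => Real.exp (c * ∑ j, a (x j)) := by
  intro n
  filter_upwards [expVec_coeFn u n, expVec_coeFn (mulFun m (fun x => (Real.exp (c * a x) : ℂ)) u) n,
    ae_all_iff.2 fun j : Fin n => coeFn_comp_eval m j (mulFun_coeFn_of_memLp h)] with x h1 h2 h3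
  rw [h1, h2]
  simp_rw [h3]
  rw [Finset.prod_mul_distrib, ← ofReal_prod, ← Real.exp_sum, Finset.mul_sum]
  ring

/-- The derivative puts au into one slot at a time, which multiplies the tensor power by a(x_j). -/
theorem dExpVec_mem_dGamma {a : M → ℝ} {u : Lp ℂ 2 m}
    (h : MemLp (fun x => (a x : ℂ) * u x) 2 m) :
    (expVec m u, dExpVec m u (mulFun m (fun x => (a x : ℂ)) u)) ∈
      multGraph m fun _ x => ∑ j, a (x j) := by
  intro n
  have h1 := dExpVec_apply m u (mulFun m (fun x => (a x : ℂ)) u) n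
  have h5 : ∀ j : Fin n, tens m n (Function.update (fun _ => u) j (mulFun m (fun x => (a x : ℂ)) u))
      =ᵐ[Measure.pi fun _ => m] fun x => a (x j) * ∏ i, u (x i) := by
    intro j
    filter_upwards [tens_coeFn m (Function.update (fun _ => u) j (mulFun m (fun x => (a x : ℂ)) u)),
      coeFn_comp_eval m j (mulFun_coeFn_of_memLp h)] with x h1 h2
    rw [h1, ← Finset.mul_prod_erase _ _ (Finset.mem_univ j), Function.update_self, h2,
      ← Finset.mul_prod_erase _ _ (Finset.mem_univ j), mul_assoc]
    congr 2
    refine Finset.prod_congr rfl fun i hi => ?_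
    rw [Function.update_of_ne (Finset.ne_of_mem_erase hi)]
  filter_upwards [expVec_coeFn u n, ae_all_iff.2 h5,
    Lp.coeFn_smul ((1 / √(n.factorial : ℝ) : ℝ) : ℂ)
      (∑ j : Fin n, tens m n (Function.update (fun _ => u) j (mulFun m (fun x => (a x : ℂ)) u))),
    Lp.coeFn_finsetSum Finset.univ
      (fun j : Fin n => tens m n (Function.update (fun _ => u) j (mulFun m (fun x => (a x : ℂ)) u)))]
    with x h2 h3 h4 h6
  rw [h1, h4, Pi.smul_apply, h6, Finset.sum_apply, h2]
  simp_rw [h3]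
  rw [← Finset.sum_mul, smul_eq_mul]
  push_cast
  ring

theorem hasExpCore_sum {B : ℕ → Set M} (hB : IsExhaustion m B) {V : ℕ → Submodule ℝ (Lp ℂ 2 m)}
    (hV : IsTestFamily m B V) {a : M → ℝ} (ha : Measurable a)
    (hbd : ∀ k, ∃ C, ∀ x ∈ B k, |a x| ≤ C) : HasExpCore B V fun _ x => ∑ j, a (x j) := by
  refine ⟨hB, hV, isMultiplier_sum ha hbd, fun k v hv => ?_⟩
  obtain ⟨C, hC⟩ := hbd k
  exact ⟨_, dExpVec_mem_dGamma (memLp_mul_of_supp (by fun_prop) (hV.supp k v hv) (C := C)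
    fun x hx => by rw [Complex.norm_real]; exact hC x hx)⟩

theorem memLp_exp_mul {B : Set M} {a : M → ℝ} (ha : Measurable a) {u : Lp ℂ 2 m}
    (hu : u ∈ suppIn m B) (hbd : ∃ C, ∀ x ∈ B, |a x| ≤ C) (c : ℝ) :
    MemLp (fun x => (Real.exp (c * a x) : ℂ) * u x) 2 m := by
  obtain ⟨C, hC⟩ := hbd
  refine memLp_mul_of_supp (by fun_prop) hu (C := Real.exp (|c| * C)) fun x hx => ?_
  rw [Complex.norm_real, Real.norm_of_nonneg (Real.exp_nonneg _)]
  refine Real.exp_le_exp.2 ((le_abs_self _).trans ?_)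
  rw [abs_mul]
  gcongr
  exact hC x hx

theorem hasExpCore_exp_sum {B : ℕ → Set M} (hB : IsExhaustion m B)
    {V : ℕ → Submodule ℝ (Lp ℂ 2 m)} (hV : IsTestFamily m B V) {a : M → ℝ} (ha : Measurable a)
    (hbd : ∀ k, ∃ C, ∀ x ∈ B k, |a x| ≤ C) (c : ℝ) :
    HasExpCore B V fun _ x => Real.exp (c * ∑ j, a (x j)) :=
  ⟨hB, hV, isMultiplier_exp_sum ha hbd c, fun k v hv =>
    ⟨_, expVec_mul_mem (memLp_exp_mul ha (hV.supp k v hv) (hbd k) c)⟩⟩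

/-- Second quantisation. Linearity of `U` need not be assumed, since the Gram matrix of the
exponential vectors involves only inner products, and surjectivity keeps the family total. -/
theorem exists_gamma {U : Lp ℂ 2 m → Lp ℂ 2 m} (hU : Function.Surjective U)
    (h : ∀ u v, inner ℂ (U u) (U v) = inner ℂ u v) :
    ∃ G : Fock m ≃ₗᵢ[ℂ] Fock m, ∀ u, G (expVec m u) = expVec m (U u) :=
  exists_unitary_of_inner_eq (total_expVec m) (b := fun u => expVec m (U u))
    (fun x hx => total_expVec m x fun u => by obtain ⟨v, rfl⟩ := hU u; exact hx v)
    fun u v => by rw [inner_expVec, inner_expVec, h]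

theorem exists_antigamma {U : Lp ℂ 2 m → Lp ℂ 2 m} (hU : Function.Surjective U)
    (h : ∀ u v, inner ℂ (U u) (U v) = inner ℂ v u) :
    ∃ G : Fock m ≃ₗᵢ⋆[ℂ] Fock m, ∀ u, G (expVec m u) = expVec m (U u) :=
  exists_antiunitary_of_inner_eq (total_expVec m) (b := fun u => expVec m (U u))
    (fun x hx => total_expVec m x fun u => by obtain ⟨v, rfl⟩ := hU u; exact hx v)
    fun u v => by rw [inner_expVec, inner_expVec, h]

variable (m) in
/-- Multiplication by `exp (i t a)`. -/
noncomputable def phase (a : M → ℝ) (t : ℝ) (u : Lp ℂ 2 m) : Lp ℂ 2 m :=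
  mulFun m (fun x => cexp (t * I * a x)) u

variable {a : M → ℝ}

theorem norm_phase (t y : ℝ) : ‖cexp (t * I * y)‖ = 1 := by
  rw [show (t : ℂ) * I * y = ((t * y : ℝ) : ℂ) * I by push_cast; ring,
    Complex.norm_exp_ofReal_mul_I]

theorem phase_coeFn (ha : Measurable a) (t : ℝ) (u : Lp ℂ 2 m) :
    phase m a t u =ᵐ[m] fun x => cexp (t * I * a x) * u x :=
  mulFun_coeFn_of_memLp (memLp_mul_of_bound (by fun_prop) (C := 1)
    (Filter.Eventually.of_forall fun x => by rw [norm_mul, norm_phase]))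

theorem phase_phase (ha : Measurable a) (t s : ℝ) (u : Lp ℂ 2 m) :
    phase m a t (phase m a s u) = phase m a (t + s) u := by
  apply Lp.ext
  filter_upwards [phase_coeFn ha t (phase m a s u), phase_coeFn ha s u, phase_coeFn ha (t + s) u]
    with x h1 h2 h3
  rw [h1, h2, h3, ← mul_assoc, ← Complex.exp_add]
  congr 2
  push_cast
  ring

theorem phase_zero (ha : Measurable a) (u : Lp ℂ 2 m) : phase m a 0 u = u := by
  apply Lp.ext
  filter_upwards [phase_coeFn ha 0 u] with x h1
  rw [h1]
  simp

theorem inner_phase (ha : Measurable a) (t : ℝ) (u v : Lp ℂ 2 m) :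
    inner ℂ (phase m a t u) (phase m a t v) = inner ℂ u v := by
  simp_rw [L2.inner_def]
  refine integral_congr_ae ?_
  filter_upwards [phase_coeFn ha t u, phase_coeFn ha t v] with x h1 h2
  rw [h1, h2]
  simp only [RCLike.inner_apply, map_mul]
  have h := mul_conj (cexp (t * I * a x))
  rw [normSq_eq_norm_sq, norm_phase] at h
  linear_combination (v x * starRingEnd ℂ (u x)) * (h.trans (by norm_num : _ = (1 : ℂ)))

end SecondQuantisation

section SecondQuantisation

variable {M : Type} [MeasurableSpace M] {m : Measure M} [SigmaFinite m] {a : M → ℝ}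

theorem dGamma_eq_multSub (a : M → ℝ) :
    dGamma m a = (multSub m fun _ x => ∑ j, a (x j) : Set (Fock m × Fock m)) := rfl

theorem mem_dGamma_of_suppIn {B : Set M} (ha : Measurable a) {C : ℝ} (hC : ∀ x ∈ B, |a x| ≤ C)
    {v : Lp ℂ 2 m} (hv : v ∈ suppIn m B) :
    (expVec m v, dExpVec m v (mulFun m (fun x => (a x : ℂ)) v)) ∈
      multSub m fun _ x => ∑ j, a (x j) :=
  dExpVec_mem_dGamma (memLp_mul_of_supp (by fun_prop) hv (C := C)
    fun x hx => by rw [Complex.norm_real]; exact hC x hx)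

theorem hasDerivAt_expVec_phase (ha : Measurable a) {B : Set M} {v : Lp ℂ 2 m}
    (hv : v ∈ suppIn m B) {C : ℝ} (hC : ∀ x ∈ B, |a x| ≤ C) :
    HasDerivAt (fun t => expVec m (phase m a t v))
      (I • dExpVec m v (mulFun m (fun x => (a x : ℂ)) v)) 0 := by
  have h1 := hasDerivAt_expVec m (hasDerivAt_mulFun_exp ha hv hC I)
  have h2 : mulFun m (fun x => cexp ((0 : ℝ) * I * a x)) v = v := phase_zero ha v
  rw [h2, dExpVec_smul] at h1
  exact h1

theorem exists_phase_unitary (ha : Measurable a) (t : ℝ) :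
    ∃ G : Fock m →L[ℂ] Fock m, (∀ x, ‖G x‖ = ‖x‖) ∧
      ∀ u, G (expVec m u) = expVec m (phase m a t u) := by
  obtain ⟨G, hG⟩ := exists_gamma (fun u => ⟨phase m a (-t) u, by
      rw [phase_phase ha, add_neg_cancel, phase_zero ha]⟩) (inner_phase (m := m) ha t)
  exact ⟨G.toContinuousLinearEquiv, fun x => G.norm_map x, hG⟩

/-- A phase does not enlarge the support of a function, so the group permutes the exponential
vectors with cut-off exponents, on which it is differentiable. -/
theorem exists_dGamma_group {B : ℕ → Set M} (hB : IsExhaustion m B) (ha : Measurable a)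
    (hbd : ∀ k, ∃ C, ∀ x ∈ B k, |a x| ≤ C) :
    ∃ V : ℝ → Fock m →L[ℂ] Fock m, IsUnitaryGroup (dGamma m a) V ∧
      ∀ t u, V t (expVec m u) = expVec m (phase m a t u) := by
  choose V hn hV using fun t => exists_phase_unitary (m := m) ha t
  refine ⟨V, ?_, hV⟩
  have h0 : V 0 = 1 := (total_expVec m).ext_map fun u => by
    rw [hV, phase_zero ha]; rfl
  have hadd : ∀ t u, V (t + u) = V t * V u := fun t u => (total_expVec m).ext_map fun v => by
    rw [mul_apply_eq_comp, hV, hV, hV, phase_phase ha]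
  have hclosed : IsClosed (multSub m fun _ x => ∑ j, a (x j) : Set (Fock m × Fock m)) :=
    (hasExpCore_sum hB hB.isTestFamily ha hbd).isClosed
  rw [dGamma_eq_multSub]
  let e : {v : Lp ℂ 2 m // ∃ k, v ∈ suppIn m (B k)} → Fock m := fun v => expVec m v.1
  let z : {v : Lp ℂ 2 m // ∃ k, v ∈ suppIn m (B k)} → Fock m :=
    fun v => dExpVec m v.1 (mulFun m (fun x => (a x : ℂ)) v.1)
  have hmem : ∀ v, (e v, z v) ∈ multSub m fun _ x => ∑ j, a (x j) := by
    rintro ⟨v, k, hv⟩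
    obtain ⟨C, hC⟩ := hbd k
    exact mem_dGamma_of_suppIn ha hC hv
  have hd : ∀ v, HasDerivAt (fun t => V t (e v)) (I • z v) 0 := by
    rintro ⟨v, k, hv⟩
    obtain ⟨C, hC⟩ := hbd k
    have h1 : (fun t => V t (expVec m v)) = fun t => expVec m (phase m a t v) :=
      funext fun t => hV t v
    change HasDerivAt (fun t => V t (expVec m v)) _ 0
    rw [h1]
    exact hasDerivAt_expVec_phase ha hv hC
  have hperm : ∀ t v, ∃ (c : ℂ) (w : _), V t (e v) = c • e w := by
    rintro t ⟨v, k, hv⟩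
    refine ⟨1, ⟨phase m a t v, k, mulFun_mem_suppIn hv⟩, ?_⟩
    rw [one_smul]
    exact hV t v
  have hadj : ∀ p ∈ multSub m fun _ x => ∑ j, a (x j), ∀ v,
      inner ℂ (z v) p.1 = inner ℂ (e v) p.2 := fun p hp v =>
    (inner_eq_of_mem_multGraph (hmem v) hp).symm
  exact isUnitaryGroup_of_total_smul h0 hadd hn (hB.isTestFamily.total hB) hd hperm hclosed hmem hadj

theorem isUnitaryGroup_expI_dGamma {B : ℕ → Set M} (hB : IsExhaustion m B) (ha : Measurable a)
    (hbd : ∀ k, ∃ C, ∀ x ∈ B k, |a x| ≤ C) :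
    IsUnitaryGroup (dGamma m a) (expI (dGamma m a)) ∧
      ∀ t u, expI (dGamma m a) t (expVec m u) = expVec m (phase m a t u) := by
  obtain ⟨V, hV, hVe⟩ := exists_dGamma_group hB ha hbd
  have h : expI (dGamma m a) = V := by
    funext t
    refine expI_eq hV (hB.isTestFamily.total hB) ?_ t
    rintro ⟨v, k, hv⟩
    exact (hasExpCore_sum hB hB.isTestFamily ha hbd).mem k v hv
  rw [h]
  exact ⟨hV, hVe⟩

end SecondQuantisation

/-! ### The one-particle measures and identities for the thermal density -/

section OneParticleMeasure

theorem measurePreserving_neg_withDensity {d : ℕ} {f : Mom d → ENNReal} (hn : ∀ k, f (-k) = f k) :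
    MeasurePreserving Neg.neg (volume.withDensity f) (volume.withDensity f) := by
  refine ⟨measurable_neg, Measure.ext fun A hA => ?_⟩
  rw [Measure.map_apply measurable_neg hA, withDensity_apply _ (measurable_neg hA),
    withDensity_apply _ hA, ← lintegral_indicator (measurable_neg hA), ← lintegral_indicator hA,
    ← lintegral_neg_eq_self]
  refine lintegral_congr fun k => ?_
  by_cases h : k ∈ A
  · rw [Set.indicator_of_mem h, Set.indicator_of_mem (by simpa using h), hn]
  · rw [Set.indicator_of_notMem h, Set.indicator_of_notMem (by simpa using h)]

variable {d : ℕ} {s β : ℝ}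

theorem measurable_energy : Measurable (energy s : Mom d → ℝ) := by
  unfold energy; fun_prop

theorem measurable_density : Measurable (density s β : Mom d → ℝ) := by
  have := measurable_energy (d := d) (s := s)
  unfold density; fun_prop

theorem measurable_cothHalf : Measurable (cothHalf s β : Mom d → ℝ) := by
  have := measurable_energy (d := d) (s := s)
  unfold cothHalf
  exact (Real.measurable_cosh.comp (by fun_prop)).div (Real.measurable_sinh.comp (by fun_prop))

theorem measurable_awEnergy : Measurable (awEnergy d s) := by
  have := measurable_energy (d := d) (s := s)
  refine Measurable.ite (measurable_snd (measurableSet_singleton true)) ?_ ?_ <;> fun_prop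

theorem energy_neg (k : Mom d) : energy s (-k) = energy s k := by rw [energy, norm_neg, energy]

theorem density_neg (k : Mom d) : density s β (-k) = density s β k := by
  rw [density, energy_neg, density]

theorem cothHalf_neg (k : Mom d) : cothHalf s β (-k) = cothHalf s β k := by
  rw [cothHalf, energy_neg, cothHalf]

variable [hd : Fact (0 < d)] [hs : Fact (0 < s)] [hβ : Fact (0 < β)]

theorem energy_pos {k : Mom d} (hk : k ≠ 0) : 0 < energy s k :=
  Real.rpow_pos_of_pos (norm_pos_iff.2 hk) s

theorem ae_ne_zero : ∀ᵐ k : Mom d, k ≠ 0 := by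
  have : Nonempty (Fin d) := ⟨⟨0, hd.out⟩⟩
  have : Nontrivial (Mom d) := inferInstance
  exact Measure.ae_ne volume 0

/-- The density 1/(2ε) is positive except at the origin, which is a null set in positive dimension.
-/
theorem ae_energyMeasure : ae (energyMeasure d s) = ae (volume : Measure (Mom d)) := by
  have := measurable_energy (d := d) (s := s)
  have h1 : energyMeasure d s ≪ volume := withDensity_absolutelyContinuous _ _
  have h2 : volume ≪ energyMeasure d s := by
    refine withDensity_absolutelyContinuous' (by fun_prop) ?_
    filter_upwards [ae_ne_zero (d := d)] with k hk
    have := energy_pos (s := s) hk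
    rw [ne_eq, ENNReal.ofReal_eq_zero, not_le]
    positivity
  exact le_antisymm h1.ae_le h2.ae_le

theorem ae_energy_pos : ∀ᵐ k ∂(energyMeasure d s), 0 < energy s k := by
  rw [ae_energyMeasure]
  filter_upwards [ae_ne_zero (d := d)] with k hk using energy_pos hk

theorem thermalMeasure_eq :
    thermalMeasure d s β = (energyMeasure d s).withDensity fun k => ENNReal.ofReal (cothHalf s β k) := by
  have := measurable_energy (d := d) (s := s)
  have := measurable_cothHalf (d := d) (s := s) (β := β)
  rw [energyMeasure, ← withDensity_mul _ (by fun_prop) (by fun_prop), thermalMeasure]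
  congr 1
  funext k
  have : 0 ≤ energy s k := Real.rpow_nonneg (norm_nonneg _) _
  rw [Pi.mul_apply, ← ENNReal.ofReal_mul (by positivity)]
  congr 1
  ring

theorem density_pos {k : Mom d} (hk : 0 < energy s k) : 0 < density s β k := by
  have := hβ.out
  rw [density]
  have : 1 < Real.exp (β * energy s k) := Real.one_lt_exp_iff.2 (by positivity)
  exact one_div_pos.2 (by linarith)

theorem one_add_density {k : Mom d} (hk : 0 < energy s k) :
    1 + density s β k = Real.exp (β * energy s k) * density s β k := by
  have := hβ.out
  rw [density]
  have : 1 < Real.exp (β * energy s k) := Real.one_lt_exp_iff.2 (by positivity)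
  have : Real.exp (β * energy s k) - 1 ≠ 0 := by linarith
  field_simp
  ring

theorem sinh_mul_density {k : Mom d} (hk : 0 < energy s k) :
    2 * Real.sinh (β * energy s k / 2) * density s β k = Real.exp (-(β * energy s k / 2)) := by
  have := hβ.out
  have h1 : 1 < Real.exp (β * energy s k) := Real.one_lt_exp_iff.2 (by positivity)
  have h2 : Real.exp (β * energy s k) - 1 ≠ 0 := by linarith
  rw [density, Real.sinh_eq, ← mul_div_assoc, mul_one, div_eq_iff h2]
  have h3 : Real.exp (-(β * energy s k / 2)) * Real.exp (β * energy s k)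
    = Real.exp (β * energy s k / 2) := by rw [← Real.exp_add]; ring_nf
  linarith

theorem sinh_pos {k : Mom d} (hk : 0 < energy s k) : 0 < Real.sinh (β * energy s k / 2) := by
  have := hβ.out
  exact Real.sinh_pos_iff.2 (by positivity)

/-- The weight `e^{-τε}(1 + ρ) + e^{τε}ρ` is `cosh((β/2 - τ)ε) / sinh(βε/2)`. -/
theorem weight_eq {k : Mom d} (hk : 0 < energy s k) (τ : ℝ) :
    Real.exp (-(τ * energy s k)) * (1 + density s β k) + Real.exp (τ * energy s k) * density s β k
      = Real.cosh ((β / 2 - τ) * energy s k) / Real.sinh (β * energy s k / 2) := by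
  have h1 := sinh_pos (β := β) hk
  have h2 := sinh_mul_density (β := β) hk
  rw [eq_div_iff h1.ne', one_add_density hk, Real.cosh_eq]
  have h3 : Real.exp ((β / 2 - τ) * energy s k) = Real.exp (-(τ * energy s k)) *
    Real.exp (β * energy s k) * Real.exp (-(β * energy s k / 2)) := by
      rw [← Real.exp_add, ← Real.exp_add]; ring_nf
  have h4 : Real.exp (-((β / 2 - τ) * energy s k)) = Real.exp (τ * energy s k) *
     Real.exp (-(β * energy s k / 2)) := by
      rw [← Real.exp_add]; ring_nf
  rw [h3, h4, ← h2]
  ring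

theorem cothHalf_eq {k : Mom d} (hk : 0 < energy s k) :
    cothHalf s β k = 1 + density s β k + density s β k := by
  have := weight_eq (β := β) hk 0
  simp only [zero_mul, neg_zero, Real.exp_zero, one_mul, sub_zero] at this
  rw [this, cothHalf]
  ring_nf

theorem ae_thermalMeasure : ae (thermalMeasure d s β) = ae (energyMeasure d s) := by
  have hm := measurable_cothHalf (d := d) (s := s) (β := β)
  rw [thermalMeasure_eq]
  refine le_antisymm (withDensity_absolutelyContinuous _ _).ae_le
    (withDensity_absolutelyContinuous' (by fun_prop) ?_).ae_le
  filter_upwards [ae_energy_pos (d := d) (s := s)] with k hk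
  have := density_pos (β := β) hk
  rw [ne_eq, ENNReal.ofReal_eq_zero, not_le, cothHalf_eq hk]
  positivity

/-- The thermal measure is coth(βε/2) times the energy measure, so a weight with square at most coth
is harmless. -/
theorem memLp_energyMeasure_of_thermalMeasure {h : Mom d → ℂ} (hh : MemLp h 2 (thermalMeasure d s β))
    {w : Mom d → ℝ} (hw : Measurable w)
    (hb : ∀ k, 0 < energy s k → w k ^ 2 ≤ cothHalf s β k) :
    MemLp (fun k => (w k : ℂ) * h k) 2 (energyMeasure d s) := by
  have hm := measurable_cothHalf (d := d) (s := s) (β := β)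
  have hmeas : AEStronglyMeasurable h (energyMeasure d s) := by
    obtain ⟨h', h1, h2⟩ := hh.1
    refine ⟨h', h1, ?_⟩
    rw [Filter.EventuallyEq, ae_thermalMeasure] at h2
    exact h2
  have h1 := (memLp_two_iff_integrable_sq_norm hh.1).1 hh
  rw [thermalMeasure_eq, integrable_withDensity_iff_integrable_smul' (by fun_prop) (by simp)] at h1
  have hwh : AEStronglyMeasurable (fun k => (w k : ℂ) * h k) (energyMeasure d s) :=
    hw.complex_ofReal.aestronglyMeasurable.mul hmeas
  rw [memLp_two_iff_integrable_sq_norm hwh]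
  refine h1.mono' (hwh.norm.pow 2) ?_
  filter_upwards [ae_energy_pos (d := d) (s := s)] with k hk
  have hρ := density_pos (β := β) hk
  have hc : 0 ≤ cothHalf s β k := by rw [cothHalf_eq hk]; positivity
  rw [norm_mul, Complex.norm_real, ENNReal.toReal_ofReal hc, smul_eq_mul, Real.norm_eq_abs,
    abs_of_nonneg (by positivity), mul_pow, Real.norm_eq_abs, sq_abs]
  exact mul_le_mul_of_nonneg_right (hb k hk) (by positivity)

end OneParticleMeasure

/-! ### Two copies of momentum space -/

section ArakiWoodsMeasure

variable {d : ℕ} {s : ℝ}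

theorem awMeasure_eq : awMeasure d s = (energyMeasure d s).map (fun k => (k, true))
    + (energyMeasure d s).map fun k => (k, false) := by
  have h : (Measure.count : Measure Bool) = Measure.dirac true + Measure.dirac false :=
    Measure.sum_bool _
  rw [awMeasure, h, Measure.prod_add, Measure.prod_dirac, Measure.prod_dirac]

theorem measurableEmbedding_summand (b : Bool) :
    MeasurableEmbedding fun k : Mom d => (k, b) :=
  measurableEmbedding_prod_mk_right b

theorem ae_awMeasure_iff {p : Mom d × Bool → Prop} : (∀ᵐ x ∂(awMeasure d s), p x) ↔
    ∀ b, ∀ᵐ k ∂(energyMeasure d s), p (k, b) := by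
  rw [awMeasure_eq, ae_add_measure_iff, (measurableEmbedding_summand true).ae_map_iff,
    (measurableEmbedding_summand false).ae_map_iff, Bool.forall_bool, and_comm]

theorem integrable_awMeasure_iff {F : Mom d × Bool → ℂ} : Integrable F (awMeasure d s) ↔
    ∀ b, Integrable (fun k => F (k, b)) (energyMeasure d s) := by
  rw [awMeasure_eq, integrable_add_measure, (measurableEmbedding_summand true).integrable_map_iff,
    (measurableEmbedding_summand false).integrable_map_iff, Bool.forall_bool, and_comm]
  rfl

theorem integral_awMeasure {F : Mom d × Bool → ℂ} (hF : Integrable F (awMeasure d s)) :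
    ∫ x, F x ∂(awMeasure d s) = ∫ k, F (k, false) ∂(energyMeasure d s)
      + ∫ k, F (k, true) ∂(energyMeasure d s) := by
  have h := hF
  rw [awMeasure_eq] at h ⊢
  rw [integral_add_measure (integrable_add_measure.1 h).1 (integrable_add_measure.1 h).2,
    (measurableEmbedding_summand true).integral_map, (measurableEmbedding_summand false).integral_map,
    add_comm]

theorem memLp_awMeasure_iff {F : Mom d × Bool → ℂ} :
    MemLp F 2 (awMeasure d s) ↔ ∀ b, MemLp (fun k => F (k, b)) 2 (energyMeasure d s) := by
  have hm : AEStronglyMeasurable F (awMeasure d s) ↔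
      ∀ b, AEStronglyMeasurable (fun k => F (k, b)) (energyMeasure d s) := by
    rw [awMeasure_eq, aestronglyMeasurable_add_measure_iff,
      (measurableEmbedding_summand true).aestronglyMeasurable_map_iff,
      (measurableEmbedding_summand false).aestronglyMeasurable_map_iff, Bool.forall_bool, and_comm]
    rfl
  constructor
  · intro h b
    have h1 := h.1
    rw [memLp_two_iff_integrable_sq_norm (hm.1 h.1 b)]
    have h2 := ((memLp_two_iff_integrable_sq_norm h.1).1 h).ofReal (𝕜 := ℂ)
    have h3 := integrable_awMeasure_iff.1 h2 b
    exact h3.re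
  · intro h
    have h1 := hm.2 fun b => (h b).1
    rw [memLp_two_iff_integrable_sq_norm h1]
    have h2 := fun b => ((memLp_two_iff_integrable_sq_norm (h b).1).1 (h b)).ofReal (𝕜 := ℂ)
    exact (integrable_awMeasure_iff.2 h2 : Integrable (fun x => ((‖F x‖ ^ 2 : ℝ) : ℂ)) _).re

end ArakiWoodsMeasure

/-! ### The vectors e^{-tε̃}v_g, their inner products and the conjugation -/

section OneParticleVectors

theorem inner_eq_integral {M : Type} [MeasurableSpace M] {m : Measure M} (u v : Lp ℂ 2 m) :
    inner ℂ u v = ∫ x, starRingEnd ℂ (u x) * v x ∂m := by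
  rw [L2.inner_def]
  exact integral_congr_ae (Filter.Eventually.of_forall fun x =>
    (RCLike.inner_apply _ _).trans (mul_comm _ _))

theorem integrable_conj_mul {M : Type} [MeasurableSpace M] {m : Measure M} (u v : Lp ℂ 2 m) :
    Integrable (fun x => starRingEnd ℂ (u x) * v x) m := by
  refine (L2.integrable_inner (𝕜 := ℂ) u v).congr (Filter.Eventually.of_forall fun x => ?_)
  exact (RCLike.inner_apply _ _).trans (mul_comm _ _)

variable {d : ℕ} {s β : ℝ}

instance : SigmaFinite (thermalMeasure d s β) := by
  unfold thermalMeasure; infer_instance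

/-- The weights `e^{-tε}(1 + ρ)^{1/2}` and `e^{tε}ρ^{1/2}` of the two summands. -/
noncomputable def timeWeight (s β t : ℝ) (b : Bool) (k : Mom d) : ℝ :=
  if b then Real.exp (t * energy s k) * √(density s β k)
  else Real.exp (-(t * energy s k)) * √(1 + density s β k)

theorem measurable_timeWeight (t : ℝ) (b : Bool) :
    Measurable (timeWeight s β t b : Mom d → ℝ) := by
  have := measurable_energy (d := d) (s := s)
  have := measurable_density (d := d) (s := s) (β := β)
  unfold timeWeight
  cases b <;> simp only [Bool.false_eq_true, if_true, if_false] <;> fun_prop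

theorem timeWeight_neg (t : ℝ) (b : Bool) (k : Mom d) :
    timeWeight s β t b (-k) = timeWeight s β t b k := by
  simp only [timeWeight, energy_neg, density_neg]

/-- Complex conjugation in the second summand. -/
def conjIf (b : Bool) (z : ℂ) : ℂ := if b then starRingEnd ℂ z else z

variable [hd : Fact (0 < d)] [hs : Fact (0 < s)] [hβ : Fact (0 < β)]

/-- The restriction to 0 ≤ t ≤ β/2 enters here: e^{-2tε} ≤ 1 bounds the first weight, and e^{2tε}ρ ≤
e^{βε}ρ = 1+ρ bounds the second; coth is 1+2ρ. -/
theorem timeWeight_sq_le {t : ℝ} (ht : t ∈ Set.Icc 0 (β / 2)) (b : Bool) {k : Mom d}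
    (hk : 0 < energy s k) : timeWeight s β t b k ^ 2 ≤ cothHalf s β k := by
  have hρ := density_pos (β := β) hk
  have h1 := one_add_density (β := β) hk
  have h0 := ht.1
  rw [cothHalf_eq hk]
  cases b <;> simp only [timeWeight, Bool.false_eq_true, if_true, if_false, mul_pow]
  · rw [Real.sq_sqrt (by positivity), ← Real.exp_nat_mul]
    have : Real.exp ((2 : ℕ) * -(t * energy s k)) ≤ 1 := by
      rw [Real.exp_le_one_iff]
      have := mul_nonneg h0 hk.le
      push_cast
      linarith
    nlinarith
  · rw [Real.sq_sqrt hρ.le, ← Real.exp_nat_mul]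
    have : Real.exp ((2 : ℕ) * (t * energy s k)) ≤ Real.exp (β * energy s k) := by
      rw [Real.exp_le_exp]
      have := mul_le_mul_of_nonneg_right ht.2 hk.le
      push_cast
      linarith
    nlinarith

/-- The function `e^{-tε}(1 + ρ)^{1/2} h ⊕ conj (e^{tε}ρ^{1/2} h)`. -/
noncomputable def timeFun (s β t : ℝ) (h : Mom d → ℂ) (p : Mom d × Bool) : ℂ :=
  timeWeight s β t p.2 p.1 * conjIf p.2 (h p.1)

theorem memLp_timeFun {t : ℝ} (ht : t ∈ Set.Icc 0 (β / 2)) {h : Mom d → ℂ}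
    (hh : MemLp h 2 (thermalMeasure d s β)) : MemLp (timeFun s β t h) 2 (awMeasure d s) := by
  rw [memLp_awMeasure_iff]
  intro b
  have := memLp_energyMeasure_of_thermalMeasure hh (measurable_timeWeight t b)
    (fun k hk => timeWeight_sq_le ht b hk)
  cases b
  · exact this
  · have h2 := this.star
    refine h2.ae_eq (Filter.Eventually.of_forall fun k => ?_)
    change starRingEnd ℂ _ = _
    rw [map_mul, conj_ofReal]
    rfl

theorem ae_awMeasure_of_thermalMeasure {p : Mom d → Prop} (h : ∀ᵐ k ∂(thermalMeasure d s β), p k) :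
    ∀ᵐ x ∂(awMeasure d s), p x.1 := by
  rw [ae_thermalMeasure] at h
  exact ae_awMeasure_iff.2 fun _ => h

theorem ae_awEnergy_pos : ∀ᵐ x ∂(awMeasure d s), 0 < energy s x.1 :=
  ae_awMeasure_iff.2 fun _ => ae_energy_pos

theorem conjIf_add (b : Bool) (z w : ℂ) : conjIf b (z + w) = conjIf b z + conjIf b w := by
  cases b <;> simp [conjIf]

theorem conjIf_real_mul (b : Bool) (r : ℝ) (w : ℂ) : conjIf b (r * w) = r * conjIf b w := by
  cases b <;> simp [conjIf]

/-- `e^{-tε}(1 + ρ)^{1/2} h ⊕ conj (e^{tε}ρ^{1/2} h)` -/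
noncomputable def timeVec (t : Set.Icc (0 : ℝ) (β / 2)) :
    Lp ℂ 2 (thermalMeasure d s β) →ₗ[ℝ] Lp ℂ 2 (awMeasure d s) where
  toFun h := toL2 _ (timeFun s β t h)
  map_add' g h := by
    apply Lp.ext
    filter_upwards [toL2_coeFn _ (memLp_timeFun t.2 (Lp.memLp (g + h))),
      toL2_coeFn _ (memLp_timeFun t.2 (Lp.memLp g)), toL2_coeFn _ (memLp_timeFun t.2 (Lp.memLp h)),
      ae_awMeasure_of_thermalMeasure (Lp.coeFn_add g h),
      Lp.coeFn_add (toL2 (awMeasure d s) (timeFun s β t g)) (toL2 (awMeasure d s) (timeFun s β t h))]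
      with x h1 h2 h3 h4 h5
    rw [h5, Pi.add_apply, h1, h2, h3, timeFun, h4, Pi.add_apply, conjIf_add, mul_add]
    rfl
  map_smul' r h := by
    apply Lp.ext
    filter_upwards [toL2_coeFn _ (memLp_timeFun t.2 (Lp.memLp (r • h))),
      toL2_coeFn _ (memLp_timeFun t.2 (Lp.memLp h)),
      ae_awMeasure_of_thermalMeasure (Lp.coeFn_smul r h),
      Lp.coeFn_smul r (toL2 (awMeasure d s) (timeFun s β t h))]
      with x h1 h3 h4 h5
    rw [RingHom.id_apply, h5, Pi.smul_apply, h1, h3, timeFun, h4, Pi.smul_apply, real_smul,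
      conjIf_real_mul, real_smul, timeFun]
    ring

theorem timeVec_coeFn (t : Set.Icc (0 : ℝ) (β / 2)) (h : Lp ℂ 2 (thermalMeasure d s β)) :
    timeVec t h =ᵐ[awMeasure d s] timeFun s β t h :=
  toL2_coeFn _ (memLp_timeFun t.2 (Lp.memLp h))

/-- The time `0`. -/
noncomputable def timeZero : Set.Icc (0 : ℝ) (β / 2) := ⟨0, le_rfl, by have := hβ.out; positivity⟩

/-- The time `β / 2`. -/
noncomputable def timeHalf : Set.Icc (0 : ℝ) (β / 2) := ⟨β / 2, by have := hβ.out; positivity, le_rfl⟩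

theorem awVector_eq (h : Lp ℂ 2 (thermalMeasure d s β)) : awVector h = timeVec timeZero h := by
  rw [awVector]
  change _ = toL2 _ _
  congr 1
  funext p
  rcases p with ⟨k, b⟩
  cases b <;> simp [timeFun, timeWeight, timeZero, conjIf]

theorem timeWeight_exp (t t' : ℝ) (b : Bool) (k : Mom d) :
    Real.exp ((t - t') * awEnergy d s (k, b)) * timeWeight s β t b k = timeWeight s β t' b k := by
  cases b <;> simp only [timeWeight, awEnergy, Bool.false_eq_true, if_true, if_false] <;>
    rw [← mul_assoc, ← Real.exp_add] <;> ring_nf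

/-- The opposite signs of the exponents in the two summands are those of ε ⊕ -ε, so a single
exponential of ε̃ moves one time to another. -/
theorem exp_mul_timeVec (t t' : Set.Icc (0 : ℝ) (β / 2)) (h : Lp ℂ 2 (thermalMeasure d s β)) :
    (fun x => (Real.exp ((t - t') * awEnergy d s x) : ℂ) * timeVec t h x) =ᵐ[awMeasure d s]
      timeVec t' h := by
  filter_upwards [timeVec_coeFn t h, timeVec_coeFn t' h] with x h1 h2
  rw [h1, h2, timeFun, timeFun, ← timeWeight_exp (t : ℝ) t']
  push_cast
  ring

/-- In the second summand complex conjugation turns e^{iτε} into e^{-iτε}, which is the phase of -ε.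
-/
theorem phase_timeVec (t : Set.Icc (0 : ℝ) (β / 2)) (τ : ℝ) (h : Lp ℂ 2 (thermalMeasure d s β)) :
    phase (awMeasure d s) (awEnergy d s) τ (timeVec t h)
      = timeVec t (phase (thermalMeasure d s β) (energy s) τ h) := by
  apply Lp.ext
  filter_upwards [phase_coeFn measurable_awEnergy τ (timeVec t h), timeVec_coeFn t h,
    timeVec_coeFn t (phase (thermalMeasure d s β) (energy s) τ h),
    ae_awMeasure_of_thermalMeasure (phase_coeFn measurable_energy τ h)] with x h1 h2 h3 h4
  rw [h1, h2, h3, timeFun, timeFun, h4]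
  rcases x with ⟨k, b⟩
  cases b
  · simp only [conjIf, awEnergy, Bool.false_eq_true, if_false]
    ring
  · simp only [conjIf, awEnergy, if_true, map_mul, ← exp_conj, conj_ofReal, conj_I]
    push_cast
    ring_nf

/-- `g(-k) = conj g(k)` almost everywhere. -/
theorem ae_neg_of_hermitian {g : Lp ℂ 2 (thermalMeasure d s β)}
    (hg : g ∈ hermitian (thermalMeasure d s β)) :
    ∀ᵐ k ∂(energyMeasure d s), g (-k) = starRingEnd ℂ (g k) := by
  obtain ⟨w, hw, h1⟩ := hg
  rw [Filter.EventuallyEq, ae_thermalMeasure] at h1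
  have h2 := (measurePreserving_neg_withDensity (d := d)
    (f := fun k => ENNReal.ofReal (1 / (2 * energy s k)))
    (fun k => by rw [energy_neg])).quasiMeasurePreserving.ae h1
  change ∀ᵐ k ∂(energyMeasure d s), g (-k) = w (-k) at h2
  filter_upwards [h1, h2] with k h3 h4
  rw [h3, h4, hw]

theorem integral_energyMeasure_neg (F : Mom d → ℂ) :
    ∫ k, F (-k) ∂(energyMeasure d s) = ∫ k, F k ∂(energyMeasure d s) :=
  (measurePreserving_neg_withDensity (d := d)
    (f := fun k => ENNReal.ofReal (1 / (2 * energy s k)))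
    (fun k => by rw [energy_neg])).integral_comp (MeasurableEquiv.neg (Mom d)).measurableEmbedding F

/-- The kernel `cosh ((β / 2 - τ) ε) / sinh (β ε / 2)`. -/
noncomputable def thermalKernel (s β τ : ℝ) (k : Mom d) : ℝ :=
  Real.cosh ((β / 2 - τ) * energy s k) / Real.sinh (β * energy s k / 2)

theorem thermalKernel_neg (τ : ℝ) (k : Mom d) :
    thermalKernel s β τ (-k) = thermalKernel s β τ k := by
  rw [thermalKernel, energy_neg, thermalKernel]

/-- The second summand is taken at -k, where the conjugate of g is g(k) again. Both summands then
carry the same product of g and g', and their weights add up to the thermal kernel by `weight_eq`.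
-/
theorem timeFun_mul_add (t t' : ℝ) {g g' : Mom d → ℂ} {k : Mom d} (hk : 0 < energy s k)
    (h2 : g (-k) = starRingEnd ℂ (g k)) (h3 : g' (-k) = starRingEnd ℂ (g' k)) :
    starRingEnd ℂ (timeFun s β t g (k, false)) * timeFun s β t' g' (k, false)
      + starRingEnd ℂ (timeFun s β t g (-k, true)) * timeFun s β t' g' (-k, true)
      = (thermalKernel s β (t + t') k : ℂ) * (starRingEnd ℂ (g k) * g' k) := by
  have hρ := density_pos (β := β) hk
  have e1 : timeWeight s β t false k * timeWeight s β t' false k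
      = Real.exp (-((t + t') * energy s k)) * (1 + density s β k) := by
    simp only [timeWeight, Bool.false_eq_true, if_false]
    rw [mul_mul_mul_comm, ← Real.exp_add, Real.mul_self_sqrt (by positivity)]
    ring_nf
  have e2 : timeWeight s β t true k * timeWeight s β t' true k
      = Real.exp ((t + t') * energy s k) * density s β k := by
    simp only [timeWeight, if_true]
    rw [mul_mul_mul_comm, ← Real.exp_add, Real.mul_self_sqrt (by positivity)]
    ring_nf
  have e3 := weight_eq (β := β) hk (t + t')
  rw [← e1, ← e2] at e3
  simp only [timeFun, timeWeight_neg, conjIf, Bool.false_eq_true, if_true, if_false, map_mul,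
    conj_ofReal, h2, h3, conj_conj]
  rw [thermalKernel, ← e3]
  push_cast
  ring

theorem measurePreserving_neg_energyMeasure :
    MeasurePreserving Neg.neg (energyMeasure d s) (energyMeasure d s) :=
  measurePreserving_neg_withDensity fun k => by rw [energy_neg]

theorem integrable_energyMeasure_neg {F : Mom d → ℂ} (hF : Integrable F (energyMeasure d s)) :
    Integrable (fun k => F (-k)) (energyMeasure d s) :=
  measurePreserving_neg_energyMeasure.integrable_comp_of_integrable hF

theorem integral_awMeasure_neg {F : Mom d × Bool → ℂ} (hF : Integrable F (awMeasure d s)) :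
    ∫ x, F x ∂(awMeasure d s)
      = ∫ k, (F (k, false) + F (-k, true)) ∂(energyMeasure d s) := by
  have h1 := integrable_awMeasure_iff.1 hF false
  have h2 := integrable_energyMeasure_neg (integrable_awMeasure_iff.1 hF true)
  rw [integral_awMeasure hF, ← integral_energyMeasure_neg fun k => F (k, true),
    ← integral_add h1 h2]

theorem inner_timeVec (t t' : Set.Icc (0 : ℝ) (β / 2)) {g g' : Lp ℂ 2 (thermalMeasure d s β)}
    (hg : g ∈ hermitian (thermalMeasure d s β)) (hg' : g' ∈ hermitian (thermalMeasure d s β)) :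
    inner ℂ (timeVec t g) (timeVec t' g')
      = ∫ k, (thermalKernel s β (t + t') k : ℂ) * (starRingEnd ℂ (g k) * g' k)
          ∂(energyMeasure d s) := by
  have hF : (fun x => starRingEnd ℂ (timeVec t g x) * timeVec t' g' x) =ᵐ[awMeasure d s]
      fun x => starRingEnd ℂ (timeFun s β t g x) * timeFun s β t' g' x := by
    filter_upwards [timeVec_coeFn t g, timeVec_coeFn t' g'] with x h1 h2
    rw [h1, h2]
  rw [inner_eq_integral, integral_congr_ae hF,
    integral_awMeasure_neg ((integrable_conj_mul _ _).congr hF)]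
  refine integral_congr_ae ?_
  filter_upwards [ae_energy_pos (d := d) (s := s), ae_neg_of_hermitian hg, ae_neg_of_hermitian hg']
    with k hk h2 h3
  exact timeFun_mul_add _ _ hk h2 h3

/-- The reflection of k conjugates the integrand. This reality matches the symmetry of a covariance.
-/
theorem conj_inner_timeVec (t t' : Set.Icc (0 : ℝ) (β / 2)) {g g' : Lp ℂ 2 (thermalMeasure d s β)}
    (hg : g ∈ hermitian (thermalMeasure d s β)) (hg' : g' ∈ hermitian (thermalMeasure d s β)) :
    starRingEnd ℂ (inner ℂ (timeVec t g) (timeVec t' g'))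
      = inner ℂ (timeVec t g) (timeVec t' g') := by
  rw [inner_timeVec t t' hg hg', ← integral_conj, ← integral_energyMeasure_neg]
  refine integral_congr_ae ?_
  filter_upwards [ae_neg_of_hermitian hg, ae_neg_of_hermitian hg'] with k h2 h3
  simp only [map_mul, conj_ofReal, h2, h3, conj_conj, thermalKernel_neg]

/-- The antiunitary `a ⊕ b̄ ↦ b ⊕ ā`. -/
noncomputable def swapConj (u : Lp ℂ 2 (awMeasure d s)) : Lp ℂ 2 (awMeasure d s) :=
  toL2 _ fun p => starRingEnd ℂ (u (p.1, !p.2))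

theorem swapConj_coeFn (u : Lp ℂ 2 (awMeasure d s)) :
    swapConj u =ᵐ[awMeasure d s] fun p => starRingEnd ℂ (u (p.1, !p.2)) := by
  refine toL2_coeFn _ (memLp_awMeasure_iff.2 fun b => ?_)
  exact (memLp_awMeasure_iff.1 (Lp.memLp u) (!b)).star

theorem ae_awMeasure_not {p : Mom d × Bool → Prop} (h : ∀ᵐ x ∂(awMeasure d s), p x) :
    ∀ᵐ x ∂(awMeasure d s), p (x.1, !x.2) :=
  ae_awMeasure_iff.2 fun b => ae_awMeasure_iff.1 h (!b)

theorem swapConj_swapConj (u : Lp ℂ 2 (awMeasure d s)) : swapConj (swapConj u) = u := by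
  apply Lp.ext
  filter_upwards [swapConj_coeFn (swapConj u), ae_awMeasure_not (swapConj_coeFn u)] with x h1 h2
  rw [h1, h2, conj_conj, Bool.not_not]

theorem swapConj_smul (c : ℂ) (u : Lp ℂ 2 (awMeasure d s)) :
    swapConj (c • u) = starRingEnd ℂ c • swapConj u := by
  apply Lp.ext
  filter_upwards [swapConj_coeFn u, swapConj_coeFn (c • u),
    Lp.coeFn_smul (starRingEnd ℂ c) (swapConj u), ae_awMeasure_not (Lp.coeFn_smul c u)]
    with x h1 h3 h4 h5
  rw [h3, h4, Pi.smul_apply, h1, h5, Pi.smul_apply, smul_eq_mul, smul_eq_mul, map_mul]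

theorem inner_swapConj (u v : Lp ℂ 2 (awMeasure d s)) :
    inner ℂ (swapConj u) (swapConj v) = inner ℂ v u := by
  have hI := integrable_conj_mul v u
  have hI' := integrable_awMeasure_iff.1 hI
  have hF : (fun x => starRingEnd ℂ (swapConj u x) * swapConj v x) =ᵐ[awMeasure d s]
      fun x => starRingEnd ℂ (v (x.1, !x.2)) * u (x.1, !x.2) := by
    filter_upwards [swapConj_coeFn u, swapConj_coeFn v] with x h1 h2
    rw [h1, h2, conj_conj, mul_comm]
  have hI2 : Integrable (fun x => starRingEnd ℂ (v (x.1, !x.2)) * u (x.1, !x.2))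
      (awMeasure d s) := integrable_awMeasure_iff.2 fun b => hI' (!b)
  rw [inner_eq_integral, inner_eq_integral, integral_congr_ae hF, integral_awMeasure hI,
    integral_awMeasure hI2, add_comm]
  simp only [Bool.not_true, Bool.not_false]

theorem sqrt_one_add_density {k : Mom d} (hk : 0 < energy s k) :
    √(1 + density s β k) = Real.exp (β / 2 * energy s k) * √(density s β k) := by
  have hρ := density_pos (β := β) hk
  rw [one_add_density hk, Real.sqrt_mul (Real.exp_nonneg _)]
  congr 1
  rw [Real.sqrt_eq_iff_mul_self_eq (Real.exp_nonneg _) (Real.exp_nonneg _), ← Real.exp_add]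
  ring_nf

/-- This is the one-particle KMS relation: (1+ρ)^{1/2} = e^{βε/2}ρ^{1/2}. It holds for complex h. -/
theorem swapConj_timeVec (h : Lp ℂ 2 (thermalMeasure d s β)) :
    swapConj (timeVec timeZero h) = timeVec timeHalf h := by
  apply Lp.ext
  filter_upwards [swapConj_coeFn (timeVec timeZero h), ae_awMeasure_not (timeVec_coeFn timeZero h),
    timeVec_coeFn timeHalf h, ae_awEnergy_pos (d := d) (s := s)] with x h1 h2 h3 hk
  rw [h1, h2, h3]
  rcases x with ⟨k, b⟩
  have h4 := sqrt_one_add_density (β := β) hk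
  cases b
  · simp only [timeFun, timeWeight, timeZero, timeHalf, conjIf, Bool.not_false, if_true, zero_mul,
      Real.exp_zero, one_mul, map_mul, conj_ofReal, conj_conj, Bool.false_eq_true, if_false]
    rw [h4, ← mul_assoc (Real.exp _), ← Real.exp_add, neg_add_cancel, Real.exp_zero, one_mul]
  · simp only [timeFun, timeWeight, timeZero, timeHalf, conjIf, Bool.not_true, if_true, zero_mul,
      neg_zero,
      Real.exp_zero, one_mul, map_mul, conj_ofReal, Bool.false_eq_true, if_false]
    rw [h4]

end OneParticleVectors

/-! ### Energy shells and families of test vectors -/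

section TestFamilies

variable {d : ℕ} {s β : ℝ}

/-- The momenta with energy in `[1 / (n + 1), n + 1]`. -/
def shell (d : ℕ) (s : ℝ) (n : ℕ) : Set (Mom d) :=
  {k | energy s k ∈ Set.Icc (1 / ((n : ℝ) + 1)) (n + 1)}

theorem measurableSet_shell (n : ℕ) : MeasurableSet (shell d s n) :=
  measurable_energy measurableSet_Icc

theorem neg_mem_shell {n : ℕ} {k : Mom d} : -k ∈ shell d s n ↔ k ∈ shell d s n := by
  simp only [shell, Set.mem_ofPred_eq, energy_neg]

theorem energy_pos_of_mem_shell {n : ℕ} {k : Mom d} (hk : k ∈ shell d s n) : 0 < energy s k :=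
  lt_of_lt_of_le (by positivity) hk.1

theorem exists_bound_shell {φ : ℝ → ℝ} (hφ : ContinuousOn φ (Set.Ioi 0)) (n : ℕ) :
    ∃ C, ∀ k ∈ shell d s n, |φ (energy s k)| ≤ C := by
  obtain ⟨C, hC⟩ := (isCompact_Icc (a := 1 / ((n : ℝ) + 1)) (b := n + 1)).exists_bound_of_continuousOn
    (hφ.mono fun x hx => lt_of_lt_of_le (by positivity) hx.1)
  exact ⟨C, fun k hk => hC _ hk⟩

/-- The shells in the two summands. -/
def awShell (d : ℕ) (s : ℝ) (n : ℕ) : Set (Mom d × Bool) := Prod.fst ⁻¹' shell d s n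

theorem exists_bound_awEnergy (n : ℕ) : ∃ C, ∀ x ∈ awShell d s n, |awEnergy d s x| ≤ C := by
  refine ⟨n + 1, fun x hx => ?_⟩
  have h : |awEnergy d s x| = |energy s x.1| := by
    rw [awEnergy]; split_ifs <;> simp
  rw [h, abs_of_pos (energy_pos_of_mem_shell hx)]
  exact hx.2

variable [hd : Fact (0 < d)] [hs : Fact (0 < s)] [hβ : Fact (0 < β)]

/-- A shell is bounded since s > 0, and 1/(2ε) is at most (n+1)/2 on it. -/
theorem energyMeasure_shell_lt_top (n : ℕ) : energyMeasure d s (shell d s n) < ⊤ := by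
  rw [energyMeasure, withDensity_apply _ (measurableSet_shell n)]
  have hvol : (volume : Measure (Mom d)) (shell d s n) < ⊤ := by
    refine lt_of_le_of_lt (measure_mono (t := Metric.closedBall 0 (((n : ℝ) + 1) ^ (1 / s)))
      fun k hk => ?_) measure_closedBall_lt_top
    rw [mem_closedBall_zero_iff]
    have h1 : ‖k‖ ^ s ≤ n + 1 := hk.2
    have h2 := Real.rpow_le_rpow (by positivity) h1 (z := 1 / s) (by have := hs.out; positivity)
    rwa [← Real.rpow_mul (norm_nonneg k), mul_one_div_cancel hs.out.ne', Real.rpow_one] at h2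
  refine lt_of_le_of_lt (setLIntegral_mono (g := fun _ => ENNReal.ofReal (((n : ℝ) + 1) / 2))
    measurable_const fun k hk => ?_) ?_
  · refine ENNReal.ofReal_le_ofReal ?_
    have h1 := energy_pos_of_mem_shell hk
    have h2 := hk.1
    rw [div_le_iff₀ (by positivity)] at h2 ⊢
    linarith
  · rw [setLIntegral_const]
    exact ENNReal.mul_lt_top (by simp) hvol

theorem ae_exists_shell : ∀ᵐ k ∂(energyMeasure d s), ∃ n, k ∈ shell d s n := by
  filter_upwards [ae_energy_pos (d := d) (s := s)] with k hk
  obtain ⟨n, hn⟩ := exists_nat_ge (max (energy s k) (1 / energy s k))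
  refine ⟨n, ?_, ?_⟩
  · rw [div_le_iff₀ (by positivity)]
    have h1 := (le_max_right _ _).trans hn
    rw [div_le_iff₀ hk] at h1
    nlinarith
  · exact ((le_max_left _ _).trans hn).trans (by linarith)

theorem isExhaustion_awShell : IsExhaustion (awMeasure d s) (awShell d s) := by
  refine ⟨fun n => measurable_fst (measurableSet_shell n), fun n => ?_, fun n n' h x hx => ?_, ?_⟩
  · rw [awMeasure_eq, Measure.add_apply, (measurableEmbedding_summand true).map_apply,
      (measurableEmbedding_summand false).map_apply]
    exact ENNReal.add_lt_top.2 ⟨energyMeasure_shell_lt_top n, energyMeasure_shell_lt_top n⟩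
  · have h' : (n : ℝ) ≤ n' := by exact_mod_cast h
    exact ⟨(one_div_le_one_div_of_le (by positivity) (by linarith)).trans hx.1,
      hx.2.trans (by linarith)⟩
  · exact ae_awMeasure_iff.2 fun _ => ae_exists_shell

theorem thermalMeasure_shell_lt_top (n : ℕ) : thermalMeasure d s β (shell d s n) < ⊤ := by
  obtain ⟨C, hC⟩ := exists_bound_shell (d := d) (s := s)
    (φ := fun e => Real.cosh (β * e / 2) / Real.sinh (β * e / 2)) (by
      refine ContinuousOn.div (by fun_prop) (by fun_prop) fun e he => ?_
      have := hβ.out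
      have he' : 0 < e := he
      exact (Real.sinh_pos_iff.2 (by positivity)).ne') n
  rw [thermalMeasure_eq, withDensity_apply _ (measurableSet_shell n)]
  refine lt_of_le_of_lt (setLIntegral_mono (g := fun _ => ENNReal.ofReal C)
    measurable_const fun k hk => ENNReal.ofReal_le_ofReal ((le_abs_self _).trans (hC k hk))) ?_
  rw [setLIntegral_const]
  exact ENNReal.mul_lt_top (by simp) (energyMeasure_shell_lt_top n)

/-- The functions supported in a shell. -/
noncomputable abbrev shellFun (d : ℕ) (s β : ℝ) (n : ℕ) :
    Submodule ℝ (Lp ℂ 2 (thermalMeasure d s β)) := suppIn (thermalMeasure d s β) (shell d s n)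

theorem exists_shellFun {n : ℕ} {φ : Mom d → ℝ} (hφ : Measurable φ)
    (hb : ∃ C, ∀ k ∈ shell d s n, |φ k| ≤ C) {A : Set (Mom d)} (hA : MeasurableSet A)
    (hAn : A ⊆ shell d s n) : ∃ h ∈ shellFun d s β n,
      h =ᵐ[thermalMeasure d s β] fun k => (φ k : ℂ) * A.indicator (fun _ => 1) k := by
  obtain ⟨C, hC⟩ := hb
  have h1 := toL2_coeFn _ (memLp_indicator_one (thermalMeasure d s β) hA
    ((measure_mono hAn).trans_lt (thermalMeasure_shell_lt_top n)))
  have hu : toL2 (thermalMeasure d s β) (A.indicator fun _ => 1) ∈ shellFun d s β n := by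
    filter_upwards [h1] with k h2 hk
    rw [h2, Set.indicator_of_notMem fun h => hk (hAn h)]
  refine ⟨mulFun _ (fun k => (φ k : ℂ)) _, mulFun_mem_suppIn hu, ?_⟩
  filter_upwards [mulFun_coeFn_of_memLp (memLp_mul_of_supp hφ.complex_ofReal hu (C := C)
    fun k hk => by rw [Complex.norm_real]; exact hC k hk), h1] with k h2 h3
  rw [h2, h3]

theorem timeVec_mem_suppIn {n : ℕ} {h : Lp ℂ 2 (thermalMeasure d s β)} (hh : h ∈ shellFun d s β n)
    (t : Set.Icc (0 : ℝ) (β / 2)) : timeVec t h ∈ suppIn (awMeasure d s) (awShell d s n) := by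
  filter_upwards [timeVec_coeFn t h, ae_awMeasure_of_thermalMeasure hh] with x h1 h2 hx
  rw [h1, timeFun, h2 hx]
  rcases x with ⟨k, b⟩
  cases b <;> simp [conjIf]

theorem measurePreserving_neg_thermalMeasure :
    MeasurePreserving Neg.neg (thermalMeasure d s β) (thermalMeasure d s β) :=
  measurePreserving_neg_withDensity fun k => by rw [energy_neg, cothHalf_neg]

/-- The hermitian part `(h(k) + conj h(-k)) / 2`. -/
noncomputable def hermPart (h : Lp ℂ 2 (thermalMeasure d s β)) : Lp ℂ 2 (thermalMeasure d s β) :=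
  toL2 _ fun k => (1 / 2 : ℝ) * (h k + starRingEnd ℂ (h (-k)))

theorem hermPart_coeFn (h : Lp ℂ 2 (thermalMeasure d s β)) :
    hermPart h =ᵐ[thermalMeasure d s β] fun k => (1 / 2 : ℝ) * (h k + starRingEnd ℂ (h (-k))) := by
  refine toL2_coeFn _ (MemLp.const_mul ((Lp.memLp h).add ?_) _)
  exact ((Lp.memLp h).comp_measurePreserving measurePreserving_neg_thermalMeasure).star

theorem hermPart_mem (h : Lp ℂ 2 (thermalMeasure d s β)) :
    hermPart h ∈ hermitian (thermalMeasure d s β) := by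
  refine ⟨_, fun k => ?_, hermPart_coeFn h⟩
  rw [neg_neg, map_mul, conj_ofReal, map_add, conj_conj, add_comm]

theorem hermPart_mem_shellFun {n : ℕ} {h : Lp ℂ 2 (thermalMeasure d s β)}
    (hh : h ∈ shellFun d s β n) : hermPart h ∈ shellFun d s β n := by
  have h2 := measurePreserving_neg_thermalMeasure.quasiMeasurePreserving.ae hh
  filter_upwards [hh, h2, hermPart_coeFn h] with k h3 h4 h5 hk
  rw [h5, h3 hk, h4 (mt neg_mem_shell.1 hk)]
  simp

/-- The second term is the antihermitian part of h, because multiplication by i exchanges hermitian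
and antihermitian functions. -/
theorem eq_hermPart_add (h : Lp ℂ 2 (thermalMeasure d s β)) :
    h = hermPart h + I • hermPart (-I • h) := by
  apply Lp.ext
  have h1 := measurePreserving_neg_thermalMeasure.quasiMeasurePreserving.ae
    (Lp.coeFn_smul (-I) h)
  filter_upwards [hermPart_coeFn h, hermPart_coeFn (-I • h),
    Lp.coeFn_add (hermPart h) (I • hermPart (-I • h)), Lp.coeFn_smul I (hermPart (-I • h)),
    Lp.coeFn_smul (-I) h, h1] with k h1 h2 h3 h4 h5 h6
  rw [h3, Pi.add_apply, h4, Pi.smul_apply, h1, h2, h5, Pi.smul_apply, h6, Pi.smul_apply, smul_eq_mul,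
    smul_eq_mul, smul_eq_mul, map_mul, map_neg, conj_I]
  push_cast
  linear_combination (h k / 2 - starRingEnd ℂ (h (-k)) / 2) * I_mul_I

theorem smul_mem_shellFun {n : ℕ} {h : Lp ℂ 2 (thermalMeasure d s β)} (c : ℂ)
    (hh : h ∈ shellFun d s β n) : c • h ∈ shellFun d s β n := by
  filter_upwards [hh, Lp.coeFn_smul c h] with k h1 h2 hk
  rw [h2, Pi.smul_apply, h1 hk, smul_zero]

theorem coeFn_mem_hermitian_of_real_mul {g g' : Lp ℂ 2 (thermalMeasure d s β)} {φ : Mom d → ℝ}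
    (hφ : ∀ k, φ (-k) = φ k) (hg : g ∈ hermitian (thermalMeasure d s β))
    (h : g' =ᵐ[thermalMeasure d s β] fun k => (φ k : ℂ) * g k) :
    g' ∈ hermitian (thermalMeasure d s β) := by
  obtain ⟨w, hw, h1⟩ := hg
  refine ⟨fun k => φ k * w k, fun k => ?_, ?_⟩
  · change φ (-k) * w (-k) = _
    rw [hw, hφ, map_mul, conj_ofReal]
  · filter_upwards [h, h1] with k h2 h3
    rw [h2, h3]

/-- Every function supported in a shell is a combination of hermitian functions and their real-time
translates. -/
theorem exists_phase_decomposition {n : ℕ} {h : Lp ℂ 2 (thermalMeasure d s β)}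
    (hh : h ∈ shellFun d s β n) : ∃ (τ : ℝ) (g g' : Lp ℂ 2 (thermalMeasure d s β)),
      g ∈ hermitian (thermalMeasure d s β) ∧ g' ∈ hermitian (thermalMeasure d s β) ∧
      h = g + phase _ (energy s) τ g' + phase _ (energy s) (-τ) (-g') := by
  -- On the shell τε lies in (0, 1], hence sin(τε) is positive and bounded away from zero.
  let τ : ℝ := 1 / (n + 1)
  have hτ : 0 < τ := by positivity
  have hm : Measurable fun k : Mom d => 1 / (2 * Real.sin (τ * energy s k)) := by
    have := measurable_energy (d := d) (s := s); fun_prop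
  have hsin : ∀ e ∈ Set.Icc (1 / ((n : ℝ) + 1)) (n + 1), 0 < Real.sin (τ * e) := by
    intro e he
    have h0 : 0 < e := lt_of_lt_of_le (by positivity) he.1
    refine Real.sin_pos_of_pos_of_lt_pi (by positivity) (lt_of_le_of_lt ?_ (lt_trans one_lt_two
      (by linarith [Real.pi_gt_three])))
    simp only [τ]
    rw [one_div, inv_mul_le_iff₀ (by positivity), mul_one]
    exact he.2
  obtain ⟨C, hC⟩ := (isCompact_Icc (a := 1 / ((n : ℝ) + 1)) (b := n + 1)).exists_bound_of_continuousOn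
    (f := fun e => 1 / (2 * Real.sin (τ * e))) (by
      refine ContinuousOn.div (by fun_prop) (by fun_prop) fun e he => ?_
      have := hsin e he
      positivity)
  -- The antihermitian part ig₂ equals (e^{iτε} - e^{-iτε}) g₂/(2 sin τε), a difference of two
  -- real-time translates of the hermitian function g'.
  let g₂ := hermPart (-I • h)
  have hg₂ : g₂ ∈ shellFun d s β n := hermPart_mem_shellFun (smul_mem_shellFun _ hh)
  let g' := mulFun (thermalMeasure d s β) (fun k => ((1 / (2 * Real.sin (τ * energy s k)) : ℝ) : ℂ)) g₂
  have hg' : g' =ᵐ[thermalMeasure d s β]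
      fun k => ((1 / (2 * Real.sin (τ * energy s k)) : ℝ) : ℂ) * g₂ k :=
    mulFun_coeFn_of_memLp (memLp_mul_of_supp (by fun_prop) hg₂ (C := C)
      fun k hk => by rw [Complex.norm_real]; exact hC _ hk)
  refine ⟨τ, hermPart h, g', hermPart_mem h, coeFn_mem_hermitian_of_real_mul (fun k => by
    rw [energy_neg]) (hermPart_mem _) hg', ?_⟩
  conv_lhs => rw [eq_hermPart_add h]
  rw [add_assoc]
  congr 1
  apply Lp.ext
  filter_upwards [hg', hg₂, phase_coeFn measurable_energy τ g', phase_coeFn measurable_energy (-τ) (-g'),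
    Lp.coeFn_neg g', Lp.coeFn_smul I g₂,
    Lp.coeFn_add (phase _ (energy s) τ g') (phase _ (energy s) (-τ) (-g'))]
    with k h1 h2 h3 h4 h5 h6 h7
  rw [h6, h7, Pi.smul_apply, Pi.add_apply, h3, h4, h5, Pi.neg_apply, h1]
  by_cases hk : k ∈ shell d s n
  · have h8 : ((Real.sin (τ * energy s k) : ℝ) : ℂ) ≠ 0 := ofReal_ne_zero.2 (hsin _ hk).ne'
    have h9 : cexp (τ * I * energy s k) - cexp ((-τ : ℝ) * I * energy s k)
        = 2 * I * ((Real.sin (τ * energy s k) : ℝ) : ℂ) := by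
      rw [show (τ : ℂ) * I * energy s k = ((τ * energy s k : ℝ) : ℂ) * I by push_cast; ring,
        show ((-τ : ℝ) : ℂ) * I * energy s k = ((-(τ * energy s k) : ℝ) : ℂ) * I by
          push_cast; ring, exp_mul_I, exp_mul_I, ← ofReal_cos, ← ofReal_sin, ← ofReal_cos,
        ← ofReal_sin, Real.cos_neg, Real.sin_neg]
      push_cast
      ring
    have h10 : cexp (τ * I * energy s k) * (((1 / (2 * Real.sin (τ * energy s k)) : ℝ) : ℂ) * g₂ k)
        + cexp ((-τ : ℝ) * I * energy s k) *
          -(((1 / (2 * Real.sin (τ * energy s k)) : ℝ) : ℂ) * g₂ k)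
        = (cexp (τ * I * energy s k) - cexp ((-τ : ℝ) * I * energy s k)) *
          (((1 / (2 * Real.sin (τ * energy s k)) : ℝ) : ℂ) * g₂ k) := by ring
    rw [h10, h9, smul_eq_mul]
    push_cast at h8 ⊢
    field_simp
  · rw [h2 hk]
    simp

theorem IsTestFamily.map_smul {M : Type} [MeasurableSpace M] {m : Measure M} {B : ℕ → Set M}
    {V : ℕ → Submodule ℝ (Lp ℂ 2 m)} (hV : IsTestFamily m B V) {c : ℂ} (hc : c ≠ 0) :
    IsTestFamily m B fun n => (V n).map (c • (LinearMap.id : Lp ℂ 2 m →ₗ[ℝ] Lp ℂ 2 m)) := by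
  refine ⟨?_, fun n A hA hm => Submodule.span_le.2 (fun v hv => ?_) (hV.span n A hA hm)⟩
  · rintro n _ ⟨v, hv, rfl⟩
    filter_upwards [hV.supp n v hv, Lp.coeFn_smul c v] with x h1 h2 hx
    change (c • v : Lp ℂ 2 m) x = 0
    rw [h2, Pi.smul_apply, h1 hx, smul_zero]
  · have h1 : v = c⁻¹ • c • v := by rw [smul_smul, inv_mul_cancel₀ hc, one_smul]
    rw [SetLike.mem_coe, h1]
    exact Submodule.smul_mem _ _ (Submodule.subset_span ⟨v, hv, rfl⟩)

/-- The vectors of complex functions at time zero. -/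
noncomputable def complexFamily (d : ℕ) (s β : ℝ) [Fact (0 < d)] [Fact (0 < s)] [Fact (0 < β)]
    (n : ℕ) : Submodule ℝ (Lp ℂ 2 (awMeasure d s)) := (shellFun d s β n).map (timeVec timeZero)

theorem toL2_indicator_coeFn {n : ℕ} {A : Set (Mom d × Bool)} (hA : A ⊆ awShell d s n)
    (hm : MeasurableSet A) : toL2 (awMeasure d s) (A.indicator fun _ => 1) =ᵐ[awMeasure d s]
      A.indicator fun _ => (1 : ℂ) :=
  toL2_coeFn _ (memLp_indicator_one _ hm
    ((measure_mono hA).trans_lt (isExhaustion_awShell.finite n)))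

theorem continuousOn_sqrt_density : ContinuousOn (fun e => 1 / √(1 / (Real.exp (β * e) - 1)))
    (Set.Ioi 0) := by
  have h : ∀ e ∈ Set.Ioi (0 : ℝ), 0 < Real.exp (β * e) - 1 := by
    intro e he
    have := hβ.out
    have he' : 0 < e := he
    have : 1 < Real.exp (β * e) := Real.one_lt_exp_iff.2 (by positivity)
    linarith
  refine ContinuousOn.div continuousOn_const (ContinuousOn.sqrt (ContinuousOn.div continuousOn_const
    (by fun_prop) fun e he => (h e he).ne')) fun e he => ?_
  have := h e he
  positivity

theorem exists_shellFun_density {n : ℕ} {A : Set (Mom d)} (hA : MeasurableSet A)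
    (hAn : A ⊆ shell d s n) : ∃ h ∈ shellFun d s β n, h =ᵐ[thermalMeasure d s β]
      fun k => ((1 / √(density s β k) : ℝ) : ℂ) * A.indicator (fun _ => 1) k := by
  refine exists_shellFun ?_ ?_ hA hAn
  · have := measurable_density (d := d) (s := s) (β := β); fun_prop
  · exact exists_bound_shell continuousOn_sqrt_density n

theorem exists_shellFun_one_add_density {n : ℕ} {A : Set (Mom d)} (hA : MeasurableSet A)
    (hAn : A ⊆ shell d s n) : ∃ h ∈ shellFun d s β n, h =ᵐ[thermalMeasure d s β]
      fun k => ((1 / √(1 + density s β k) : ℝ) : ℂ) * A.indicator (fun _ => 1) k := by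
  refine exists_shellFun ?_ ⟨1, fun k hk => ?_⟩ hA hAn
  · have := measurable_density (d := d) (s := s) (β := β); fun_prop
  · have := density_pos (β := β) (energy_pos_of_mem_shell hk)
    rw [abs_of_nonneg (by positivity)]
    refine div_le_one_of_le₀ ?_ (by positivity)
    rw [Real.one_le_sqrt]
    linarith

/-- The vector depends on h linearly in the first summand and antilinearly in the second, so this
combination isolates the first summand; the opposite sign isolates the second. -/
theorem timeVec_sub (t : Set.Icc (0 : ℝ) (β / 2)) (h : Lp ℂ 2 (thermalMeasure d s β)) :
    (timeVec t h - I • timeVec t (I • h) : Lp ℂ 2 (awMeasure d s)) =ᵐ[awMeasure d s]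
      fun x => if x.2 then 0 else 2 * (timeWeight s β t false x.1 * h x.1) := by
  filter_upwards [timeVec_coeFn t h, timeVec_coeFn t (I • h),
    ae_awMeasure_of_thermalMeasure (Lp.coeFn_smul I h),
    Lp.coeFn_sub (timeVec t h) (I • timeVec t (I • h)),
    Lp.coeFn_smul I (timeVec t (I • h))] with x h1 h2 h3 h4 h5
  rw [h4, Pi.sub_apply, h5, Pi.smul_apply, h1, h2, timeFun, timeFun, h3, Pi.smul_apply, smul_eq_mul,
    smul_eq_mul]
  rcases x with ⟨k, b⟩
  cases b
  · simp only [conjIf, Bool.false_eq_true, if_false]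
    linear_combination (-timeWeight s β t false k * h k) * I_mul_I
  · simp only [conjIf, if_true, map_mul, conj_I]
    linear_combination (timeWeight s β t true k * starRingEnd ℂ (h k)) * I_mul_I

theorem timeVec_add (t : Set.Icc (0 : ℝ) (β / 2)) (h : Lp ℂ 2 (thermalMeasure d s β)) :
    (timeVec t h + I • timeVec t (I • h) : Lp ℂ 2 (awMeasure d s)) =ᵐ[awMeasure d s]
      fun x => if x.2 then 2 * (timeWeight s β t true x.1 * starRingEnd ℂ (h x.1)) else 0 := by
  filter_upwards [timeVec_coeFn t h, timeVec_coeFn t (I • h),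
    ae_awMeasure_of_thermalMeasure (Lp.coeFn_smul I h),
    Lp.coeFn_add (timeVec t h) (I • timeVec t (I • h)),
    Lp.coeFn_smul I (timeVec t (I • h))] with x h1 h2 h3 h4 h5
  rw [h4, Pi.add_apply, h5, Pi.smul_apply, h1, h2, timeFun, timeFun, h3, Pi.smul_apply, smul_eq_mul,
    smul_eq_mul]
  rcases x with ⟨k, b⟩
  cases b
  · simp only [conjIf, Bool.false_eq_true, if_false]
    linear_combination (timeWeight s β t false k * h k) * I_mul_I
  · simp only [conjIf, if_true, map_mul, conj_I]
    linear_combination (-timeWeight s β t true k * starRingEnd ℂ (h k)) * I_mul_I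

theorem conj_indicator_one {X : Type} (A : Set X) (x : X) :
    starRingEnd ℂ (A.indicator (fun _ => (1 : ℂ)) x) = A.indicator (fun _ => (1 : ℂ)) x := by
  by_cases h : x ∈ A
  · rw [Set.indicator_of_mem h, map_one]
  · rw [Set.indicator_of_notMem h, map_zero]

theorem measurableSet_section {A : Set (Mom d × Bool)} (hm : MeasurableSet A) (b : Bool) :
    MeasurableSet ((fun k => (k, b)) ⁻¹' A) := (measurableEmbedding_summand b).measurable hm

theorem section_subset {n : ℕ} {A : Set (Mom d × Bool)} (hA : A ⊆ awShell d s n) (b : Bool) :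
    (fun k => (k, b)) ⁻¹' A ⊆ shell d s n := fun k hk => by
  have h1 : (k, b) ∈ A := hk
  have h2 := hA h1
  exact h2

/-- With complex h at one time the two summands can be separated, and the weights can be divided out
because their inverses are bounded on a shell. -/
theorem isTestFamily_complexFamily :
    IsTestFamily (awMeasure d s) (awShell d s) (complexFamily d s β) := by
  refine ⟨?_, fun n A hA hm => ?_⟩
  · rintro n _ ⟨h, hh, rfl⟩
    exact timeVec_mem_suppIn hh _
  · have hsec := measurableSet_section hm
    have hsub := section_subset hA
    obtain ⟨h₁, hh₁, e₁⟩ := exists_shellFun_one_add_density (β := β) (hsec false) (hsub false)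
    obtain ⟨h₂, hh₂, e₂⟩ := exists_shellFun_density (β := β) (hsec true) (hsub true)
    have hmem : ∀ h ∈ shellFun d s β n, timeVec timeZero h ∈
        Submodule.span ℂ (complexFamily d s β n : Set (Lp ℂ 2 (awMeasure d s))) :=
      fun h hh => Submodule.subset_span ⟨h, hh, rfl⟩
    obtain ⟨v, hv⟩ : ∃ v, v = timeVec timeZero h₁ - I • timeVec timeZero (I • h₁) := ⟨_, rfl⟩
    obtain ⟨w, hw⟩ : ∃ w, w = timeVec timeZero h₂ + I • timeVec timeZero (I • h₂) := ⟨_, rfl⟩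
    have hv' : v ∈ Submodule.span ℂ (complexFamily d s β n : Set (Lp ℂ 2 (awMeasure d s))) := by
      rw [hv]
      exact sub_mem (hmem _ hh₁) (Submodule.smul_mem _ _ (hmem _ (smul_mem_shellFun I hh₁)))
    have hw' : w ∈ Submodule.span ℂ (complexFamily d s β n : Set (Lp ℂ 2 (awMeasure d s))) := by
      rw [hw]
      exact add_mem (hmem _ hh₂) (Submodule.smul_mem _ _ (hmem _ (smul_mem_shellFun I hh₂)))
    have av := timeVec_sub timeZero h₁
    have aw := timeVec_add timeZero h₂
    rw [← hv] at av
    rw [← hw] at aw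
    have key : toL2 (awMeasure d s) (A.indicator fun _ => 1) = (1 / 2 : ℂ) • v + (1 / 2 : ℂ) • w := by
      apply Lp.ext
      filter_upwards [toL2_indicator_coeFn hA hm, av, aw,
        ae_awMeasure_of_thermalMeasure e₁, ae_awMeasure_of_thermalMeasure e₂,
        Lp.coeFn_add ((1 / 2 : ℂ) • v) ((1 / 2 : ℂ) • w),
        Lp.coeFn_smul (1 / 2 : ℂ) v, Lp.coeFn_smul (1 / 2 : ℂ) w, ae_awEnergy_pos (d := d) (s := s)]
        with x a0 a1 a2 a3 a4 a5 a6 a7 a8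
      rw [a0, a5, Pi.add_apply, a6, a7, Pi.smul_apply, Pi.smul_apply, a1, a2, a3, a4]
      rcases x with ⟨k, b⟩
      have hρ := density_pos (β := β) a8
      have h1 : ((√(density s β k) : ℝ) : ℂ) ≠ 0 := ofReal_ne_zero.2 (by positivity)
      have h2 : ((√(1 + density s β k) : ℝ) : ℂ) ≠ 0 := ofReal_ne_zero.2 (by positivity)
      have h3 : A.indicator (fun _ => (1 : ℂ)) (k, b)
            = ((fun k => (k, b)) ⁻¹' A).indicator (fun _ => 1) k := rfl
      rw [h3]
      cases b
      · simp only [timeWeight, timeZero, zero_mul, neg_zero, Real.exp_zero, one_mul,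
          Bool.false_eq_true, if_false, smul_eq_mul, mul_zero, add_zero]
        push_cast
        field_simp
      · simp only [timeWeight, timeZero, zero_mul, Real.exp_zero, one_mul,
          if_true, smul_eq_mul, map_mul, conj_ofReal, conj_indicator_one, mul_zero, zero_add]
        push_cast
        field_simp
    rw [key]
    exact add_mem (Submodule.smul_mem _ _ hv') (Submodule.smul_mem _ _ hw')

/-- The vectors of hermitian functions at the times `0` and `t`. -/
noncomputable def hermFamily (d : ℕ) (s β : ℝ) [Fact (0 < d)] [Fact (0 < s)] [Fact (0 < β)]
    (t : Set.Icc (0 : ℝ) (β / 2)) (n : ℕ) : Submodule ℝ (Lp ℂ 2 (awMeasure d s)) :=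
  (hermitian (thermalMeasure d s β) ⊓ shellFun d s β n).map (timeVec timeZero)
    ⊔ (hermitian (thermalMeasure d s β) ⊓ shellFun d s β n).map (timeVec t)

/-- The complex-linear extension of `timeVec t` from the hermitian functions. -/
noncomputable def timeVecC (t : Set.Icc (0 : ℝ) (β / 2)) (h : Lp ℂ 2 (thermalMeasure d s β)) :
    Lp ℂ 2 (awMeasure d s) := timeVec t (hermPart h) + I • timeVec t (hermPart (-I • h))

/-- For hermitian functions the conjugate of h(k) is h(-k), and the latter expression is complex
linear in h. -/
theorem timeVecC_coeFn (t : Set.Icc (0 : ℝ) (β / 2)) (h : Lp ℂ 2 (thermalMeasure d s β)) :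
    timeVecC t h =ᵐ[awMeasure d s]
      fun x => timeWeight s β t x.2 x.1 * h (if x.2 then -x.1 else x.1) := by
  have e1 := Lp.coeFn_add (hermPart h) (I • hermPart (-I • h))
  rw [← eq_hermPart_add h] at e1
  have e3 : ∀ᵐ k ∂(thermalMeasure d s β), h k = hermPart h k + I * hermPart (-I • h) k := by
    filter_upwards [e1, Lp.coeFn_smul I (hermPart (-I • h))] with k h1 h2
    rw [h1, Pi.add_apply, h2, Pi.smul_apply, smul_eq_mul]
  have e4 := measurePreserving_neg_thermalMeasure.quasiMeasurePreserving.ae e3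
  have e5 := ae_neg_of_hermitian (hermPart_mem h)
  have e6 := ae_neg_of_hermitian (hermPart_mem (-I • h))
  rw [← ae_thermalMeasure (β := β)] at e5 e6
  filter_upwards [timeVec_coeFn t (hermPart h), timeVec_coeFn t (hermPart (-I • h)),
    Lp.coeFn_add (timeVec t (hermPart h)) (I • timeVec t (hermPart (-I • h))),
    Lp.coeFn_smul I (timeVec t (hermPart (-I • h))), ae_awMeasure_of_thermalMeasure e3,
    ae_awMeasure_of_thermalMeasure e4, ae_awMeasure_of_thermalMeasure e5,
    ae_awMeasure_of_thermalMeasure e6] with x h1 h2 h3 h4 h5 h6 h7 h8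
  rw [timeVecC, h3, Pi.add_apply, h4, Pi.smul_apply, h1, h2, timeFun, timeFun, smul_eq_mul]
  rcases x with ⟨k, b⟩
  cases b
  · simp only [conjIf, Bool.false_eq_true, if_false]
    rw [h5]
    ring
  · simp only [conjIf, if_true]
    rw [h6, h7, h8]
    ring

theorem timeVecC_mem {t : Set.Icc (0 : ℝ) (β / 2)} {n : ℕ} {W : Submodule ℝ (Lp ℂ 2 (awMeasure d s))}
    (hW : (hermitian (thermalMeasure d s β) ⊓ shellFun d s β n).map (timeVec t) ≤ W)
    {h : Lp ℂ 2 (thermalMeasure d s β)} (hh : h ∈ shellFun d s β n) :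
    timeVecC t h ∈ Submodule.span ℂ (W : Set (Lp ℂ 2 (awMeasure d s))) := by
  have hmem : ∀ h ∈ shellFun d s β n, timeVec t (hermPart h) ∈
      Submodule.span ℂ (W : Set (Lp ℂ 2 (awMeasure d s))) := fun h hh =>
    Submodule.subset_span (hW ⟨_, ⟨hermPart_mem h, hermPart_mem_shellFun hh⟩, rfl⟩)
  exact add_mem (hmem h hh) (Submodule.smul_mem _ _ (hmem _ (smul_mem_shellFun _ hh)))

theorem exists_shellFun_mul {n : ℕ} {φ : ℝ → ℝ} (hφ : ContinuousOn φ (Set.Ioi 0))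
    (hm : Measurable φ) {u : Lp ℂ 2 (thermalMeasure d s β)} (hu : u ∈ shellFun d s β n) :
    ∃ h ∈ shellFun d s β n, h =ᵐ[thermalMeasure d s β] fun k => (φ (energy s k) : ℂ) * u k := by
  obtain ⟨C, hC⟩ := exists_bound_shell (d := d) (s := s) hφ n
  exact ⟨_, mulFun_mem_suppIn hu, mulFun_coeFn_of_memLp (memLp_mul_of_supp
    (hm.comp measurable_energy).complex_ofReal hu (C := C)
    fun k hk => by rw [Complex.norm_real]; exact hC k hk)⟩

/-- Hermitian functions at one time do not separate the summands, but two times do: the weights in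
the two summands differ by e^{-tε} and e^{tε}, which are distinct for t > 0. -/
theorem isTestFamily_hermFamily {t : Set.Icc (0 : ℝ) (β / 2)} (ht : 0 < (t : ℝ)) :
    IsTestFamily (awMeasure d s) (awShell d s) (hermFamily d s β t) := by
  refine ⟨fun n v hv => ?_, fun n A hA hm => ?_⟩
  · have h1 : hermFamily d s β t n ≤ suppIn (awMeasure d s) (awShell d s n) := by
      refine sup_le ?_ ?_
      · rintro _ ⟨h, hh, rfl⟩
        exact timeVec_mem_suppIn hh.2 _
      · rintro _ ⟨h, hh, rfl⟩
        exact timeVec_mem_suppIn hh.2 _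
    exact h1 hv
  · have hsec := measurableSet_section hm
    have hsub := section_subset hA
    -- With g at the time 0 and h' at the time t, the equations are g + e^{-tε}h' = u₁ in the first
    -- summand and g + e^{tε}h' = u₂ in the second. The solution is h' = (u₂ - u₁)/(2 sinh tε) and g
    -- = u₁ - e^{-tε}h'. The function u₂ uses the reflected section of A because the second summand
    -- evaluates at -k.
    obtain ⟨u₁, hu₁, e₁⟩ := exists_shellFun_one_add_density (β := β) (hsec false) (hsub false)
    obtain ⟨u₂, hu₂, e₂⟩ := exists_shellFun_density (β := β) (A := Neg.neg ⁻¹' ((fun k => (k, true)) ⁻¹' A))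
      (measurable_neg (hsec true)) (fun k hk => neg_mem_shell.1 (hsub true hk))
    obtain ⟨h', hh', e'⟩ := exists_shellFun_mul (φ := fun e => 1 / (2 * Real.sinh (t * e)))
      (by
        refine ContinuousOn.div (by fun_prop) (by fun_prop) fun e he => ?_
        have he' : 0 < e := he
        have : 0 < Real.sinh (t * e) := Real.sinh_pos_iff.2 (by positivity)
        positivity)
      (((measurable_const.mul (Real.measurable_sinh.comp (by fun_prop)))).const_div 1)
      ((shellFun d s β n).sub_mem hu₂ hu₁)
    obtain ⟨h'', hh'', e''⟩ := exists_shellFun_mul (φ := fun e => Real.exp (-(t * e)))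
      (by fun_prop) (by fun_prop) hh'
    have hh : u₁ - h'' ∈ shellFun d s β n := (shellFun d s β n).sub_mem hu₁ hh''
    have eh' : ∀ᵐ k ∂(thermalMeasure d s β),
        h' k = ((1 / (2 * Real.sinh (t * energy s k)) : ℝ) : ℂ) * (u₂ k - u₁ k) := by
      filter_upwards [e', Lp.coeFn_sub u₂ u₁] with k a1 a2
      rw [a1, a2, Pi.sub_apply]
    have eh : ∀ᵐ k ∂(thermalMeasure d s β), (u₁ - h'' : Lp ℂ 2 (thermalMeasure d s β)) k
        = u₁ k - ((Real.exp (-(t * energy s k)) : ℝ) : ℂ) * h' k := by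
      filter_upwards [e'', Lp.coeFn_sub u₁ h''] with k a1 a2
      rw [a2, Pi.sub_apply, a1]
    have hv := timeVecC_mem (W := hermFamily d s β t n) le_sup_left hh
    have hw := timeVecC_mem (W := hermFamily d s β t n) le_sup_right hh'
    have av := timeVecC_coeFn timeZero (u₁ - h'')
    have aw := timeVecC_coeFn t h'
    obtain ⟨g, hg⟩ : ∃ g, g = u₁ - h'' := ⟨_, rfl⟩
    rw [← hg] at hv av eh
    obtain ⟨v, hv'⟩ : ∃ v, v = timeVecC timeZero g := ⟨_, rfl⟩
    obtain ⟨w, hw'⟩ : ∃ w, w = timeVecC t h' := ⟨_, rfl⟩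
    rw [← hv'] at hv av
    rw [← hw'] at hw aw
    have hneg := measurePreserving_neg_thermalMeasure (d := d) (s := s) (β := β)
      |>.quasiMeasurePreserving
    have key : toL2 (awMeasure d s) (A.indicator fun _ => 1) = v + w := by
      apply Lp.ext
      filter_upwards [toL2_indicator_coeFn hA hm, av, aw, Lp.coeFn_add v w,
        ae_awMeasure_of_thermalMeasure e₁, ae_awMeasure_of_thermalMeasure (hneg.ae e₂),
        ae_awMeasure_of_thermalMeasure eh, ae_awMeasure_of_thermalMeasure (hneg.ae eh),
        ae_awMeasure_of_thermalMeasure (hneg.ae eh'), ae_awEnergy_pos (d := d) (s := s)]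
        with x a0 a1 a2 a3 a4 a5 a6 a7 a8 a9
      rw [a0, a3, Pi.add_apply, a1, a2]
      rcases x with ⟨k, b⟩
      have hρ := density_pos (β := β) a9
      have h1 : ((√(density s β k) : ℝ) : ℂ) ≠ 0 := ofReal_ne_zero.2 (by positivity)
      have h2 : ((√(1 + density s β k) : ℝ) : ℂ) ≠ 0 := ofReal_ne_zero.2 (by positivity)
      have h3 : A.indicator (fun _ => (1 : ℂ)) (k, b)
            = ((fun k => (k, b)) ⁻¹' A).indicator (fun _ => 1) k := rfl
      have h4 : (Neg.neg ⁻¹' ((fun k => (k, true)) ⁻¹' A)).indicator (fun _ => (1 : ℂ)) (-k)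
          = ((fun k => (k, true)) ⁻¹' A).indicator (fun _ => 1) k := by
        rw [← Set.indicator_comp_right]
        simp [Function.comp_def]
      rw [h3]
      cases b
      · simp only [timeWeight, timeZero, zero_mul, neg_zero, Real.exp_zero, one_mul,
          Bool.false_eq_true, if_false]
        rw [a6, a4]
        push_cast
        field_simp
        ring
      · simp only [timeWeight, timeZero, zero_mul, Real.exp_zero, one_mul, if_true]
        have hs : ((Real.sinh (t * energy s k) : ℝ) : ℂ) ≠ 0 :=
          ofReal_ne_zero.2 (Real.sinh_pos_iff.2 (mul_pos ht a9)).ne'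
        have hs2 : ((Real.exp (t * energy s k) : ℝ) : ℂ) - ((Real.exp (-(t * energy s k)) : ℝ) : ℂ)
            = 2 * ((Real.sinh (t * energy s k) : ℝ) : ℂ) := by
          rw [Real.sinh_eq]; push_cast; ring
        have a8' : 2 * ((Real.sinh (t * energy s k) : ℝ) : ℂ) * h' (-k) = u₂ (-k) - u₁ (-k) := by
          rw [a8, energy_neg, ofReal_div, ofReal_mul, ofReal_one, ofReal_ofNat]
          field_simp
        have a5' : ((√(density s β k) : ℝ) : ℂ) * u₂ (-k)
            = ((fun k => (k, true)) ⁻¹' A).indicator (fun _ => 1) k := by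
          rw [a5, density_neg, h4, ofReal_div, ofReal_one]
          field_simp
        rw [a7, energy_neg, ← a5', ofReal_mul]
        linear_combination (-((√(density s β k) : ℝ) : ℂ)) * a8'
          - ((√(density s β k) : ℝ) : ℂ) * h' (-k) * hs2
    rw [key]
    exact add_mem hv hw

end TestFamilies

/-! ### Relations between Weyl operators -/

section WeylOperators

variable {M : Type} [MeasurableSpace M] {m : Measure M} [SigmaFinite m]

theorem weylL_mul_neg (f : Lp ℂ 2 m) : weylL m f * weylL m (-f) = 1 := by
  rw [weylL_mul, add_neg_cancel, weylL_zero, inner_neg_left, inner_neg_right, sub_self, zero_div,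
    Complex.exp_zero, one_smul]

theorem adjoint_weylL (f : Lp ℂ 2 m) : (weylL m f).adjoint = weylL m (-f) := by
  refine ((ContinuousLinearMap.eq_adjoint_iff _ _).2 fun x y => ?_).symm
  have h1 : inner ℂ (weylL m f (weylL m (-f) x)) (weylL m f y) = inner ℂ (weylL m (-f) x) y :=
    (weylU m f).inner_map_map _ _
  rw [← h1, ← mul_apply_eq_comp, weylL_mul_neg]
  rfl

theorem weylL_mul_of_real {f g : Lp ℂ 2 m} (h : starRingEnd ℂ (inner ℂ f g) = inner ℂ f g) :
    weylL m f * weylL m g = weylL m (f + g) := by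
  rw [inner_conj_symm] at h
  rw [weylL_mul, h, sub_self, zero_div, Complex.exp_zero, one_smul]

/-- The phase in the Weyl relations involves only the imaginary part of the inner product. -/
theorem weylL_commute {f g : Lp ℂ 2 m} (h : starRingEnd ℂ (inner ℂ f g) = inner ℂ f g) :
    weylL m f * weylL m g = weylL m g * weylL m f := by
  rw [weylL_mul_of_real h, weylL_mul_of_real (by rw [← inner_conj_symm, h, h]), add_comm]

theorem weylL_vacuum (f : Lp ℂ 2 m) :
    weylL m f (vacuum m) = cexp (-(inner ℂ f f / 4)) • expVec m ((I / √2 : ℂ) • f) := by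
  rw [← expVec_zero, weylL_expVec, weylExp, inner_zero_right, mul_zero, add_zero, zero_add]

theorem inner_eq_of_mul_real {u u' v v' : Lp ℂ 2 m} {φ : M → ℝ}
    (hu : u' =ᵐ[m] fun x => (φ x : ℂ) * u x) (hv : v' =ᵐ[m] fun x => (φ x : ℂ) * v x) :
    inner ℂ u' v = inner ℂ u v' := by
  rw [inner_eq_integral, inner_eq_integral]
  refine integral_congr_ae ?_
  filter_upwards [hu, hv] with x h1 h2
  rw [h1, h2, map_mul, conj_ofReal]
  ring

theorem phase_add {a : M → ℝ} (ha : Measurable a) (t : ℝ) (u v : Lp ℂ 2 m) :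
    phase m a t (u + v) = phase m a t u + phase m a t v := by
  apply Lp.ext
  filter_upwards [phase_coeFn ha t u, phase_coeFn ha t v, phase_coeFn ha t (u + v),
    Lp.coeFn_add u v, Lp.coeFn_add (phase m a t u) (phase m a t v)] with x h1 h2 h3 h4 h5
  rw [h3, h5, h4, Pi.add_apply, Pi.add_apply, h1, h2, mul_add]

theorem phase_smul {a : M → ℝ} (ha : Measurable a) (t : ℝ) (c : ℂ) (u : Lp ℂ 2 m) :
    phase m a t (c • u) = c • phase m a t u := by
  apply Lp.ext
  filter_upwards [phase_coeFn ha t u, phase_coeFn ha t (c • u),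
    Lp.coeFn_smul c u, Lp.coeFn_smul c (phase m a t u)] with x h1 h3 h4 h5
  rw [h3, h5, h4, Pi.smul_apply, Pi.smul_apply, h1, smul_eq_mul, smul_eq_mul]
  ring

/-- The group of the second quantisation acts on the Weyl operators by the one-particle group. -/
theorem conj_weylL {V : ℝ → Fock m →L[ℂ] Fock m} {a : M → ℝ} (ha : Measurable a)
    (hV : ∀ t u, V t (expVec m u) = expVec m (phase m a t u)) (t : ℝ) (f : Lp ℂ 2 m) :
    V t * weylL m f * V (-t) = weylL m (phase m a t f) := by
  refine (total_expVec m).ext_map fun u => ?_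
  rw [mul_apply_eq_comp, mul_apply_eq_comp, hV, weylL_expVec, weylL_expVec, weylExp, weylExp,
    map_smul, hV, phase_add ha, phase_smul ha, phase_phase ha, add_neg_cancel, phase_zero ha,
    inner_phase ha, ← inner_phase ha t f (phase m a (-t) u), phase_phase ha, add_neg_cancel,
    phase_zero ha]

end WeylOperators

/-! ### Second quantisation of the exchange of the summands -/

section ModularConjugation

variable {d : ℕ} {s β : ℝ} [hd : Fact (0 < d)] [hs : Fact (0 < s)] [hβ : Fact (0 < β)]

theorem swapConj_surjective :
    Function.Surjective (swapConj : Lp ℂ 2 (awMeasure d s) → Lp ℂ 2 (awMeasure d s)) :=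
  fun u => ⟨swapConj u, swapConj_swapConj u⟩

/-- The modular conjugation of the Araki-Woods algebra. -/
theorem exists_modularJ (d : ℕ) (s : ℝ) [Fact (0 < d)] [Fact (0 < s)] :
    ∃ J : AWFock d s ≃ₗᵢ⋆[ℂ] AWFock d s,
    ∀ u, J (expVec _ u) = expVec _ (swapConj u) :=
  exists_antigamma swapConj_surjective inner_swapConj

/-- The modular conjugation of the Araki-Woods algebra. -/
noncomputable def modularJ (d : ℕ) (s : ℝ) [Fact (0 < d)] [Fact (0 < s)] :
    AWFock d s ≃ₗᵢ⋆[ℂ] AWFock d s := (exists_modularJ d s).choose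

theorem modularJ_expVec (u : Lp ℂ 2 (awMeasure d s)) :
    modularJ d s (expVec _ u) = expVec _ (swapConj u) := (exists_modularJ d s).choose_spec u

theorem modularJ_modularJ (x : AWFock d s) : modularJ d s (modularJ d s x) = x := by
  have h : (((modularJ d s).trans (modularJ d s) : AWFock d s ≃ₗᵢ[ℂ] AWFock d s).toContinuousLinearEquiv :
      AWFock d s →L[ℂ] AWFock d s) = ContinuousLinearMap.id ℂ (AWFock d s) := by
    refine (total_expVec _).ext_map fun u => ?_
    change modularJ d s (modularJ d s _) = _
    rw [modularJ_expVec, modularJ_expVec, swapConj_swapConj]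
    rfl
  exact congrArg (fun f : AWFock d s →L[ℂ] AWFock d s => f x) h

theorem inner_modularJ (x y : AWFock d s) :
    inner ℂ (modularJ d s x) (modularJ d s y) = inner ℂ y x := by
  have h : ∀ u, inner ℂ (modularJ d s (expVec _ u)) (modularJ d s y) = inner ℂ y (expVec _ u) := by
    intro u
    have h2 : ∀ v, inner ℂ (modularJ d s (expVec _ u)) (modularJ d s (expVec _ v))
        = inner ℂ (expVec _ v) (expVec _ u) := fun v => by
      rw [modularJ_expVec, modularJ_expVec, inner_expVec, inner_expVec, inner_swapConj]
    have h3 : (innerSL ℂ (modularJ d s (expVec _ u))).comp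
        ((modularJ d s).toContinuousLinearEquiv : AWFock d s →SL[starRingEnd ℂ] AWFock d s)
        = innerSLFlip ℂ (expVec _ u) := (total_expVec _).ext_map fun v => h2 v
    exact congrArg (fun f : AWFock d s →SL[starRingEnd ℂ] ℂ => f y) h3
  have h3 : (innerSLFlip ℂ (modularJ d s y)).comp
      ((modularJ d s).toContinuousLinearEquiv : AWFock d s →SL[starRingEnd ℂ] AWFock d s)
      = innerSL ℂ y := (total_expVec _).ext_map fun v => h v
  exact congrArg (fun f : AWFock d s →L[ℂ] ℂ => f x) h3

end ModularConjugation

/-! ### Transport of commutants and Tomita operators by unitaries -/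

section Transport

variable {H K : Type*} [NormedAddCommGroup H] [InnerProductSpace ℂ H] [CompleteSpace H]
  [NormedAddCommGroup K] [InnerProductSpace ℂ K] [CompleteSpace K]

/-- `T A T⁻¹` -/
noncomputable def conjOp (T : H ≃ₗᵢ[ℂ] K) (A : H →L[ℂ] H) : K →L[ℂ] K :=
  (T.toContinuousLinearEquiv : H →L[ℂ] K).comp
    (A.comp (T.symm.toContinuousLinearEquiv : K →L[ℂ] H))

theorem conjOp_apply (T : H ≃ₗᵢ[ℂ] K) (A : H →L[ℂ] H) (x : K) : conjOp T A x = T (A (T.symm x)) :=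
  rfl

theorem conjOp_mul (T : H ≃ₗᵢ[ℂ] K) (A B : H →L[ℂ] H) :
    conjOp T (A * B) = conjOp T A * conjOp T B := by
  ext x
  simp [conjOp_apply]

theorem conjOp_injective (T : H ≃ₗᵢ[ℂ] K) : Function.Injective (conjOp T) := by
  intro A B h
  ext x
  have := congrArg (fun f : K →L[ℂ] K => T.symm (f (T x))) h
  simpa [conjOp_apply] using this

theorem conjOp_surjective (T : H ≃ₗᵢ[ℂ] K) : Function.Surjective (conjOp T) := by
  intro B
  refine ⟨conjOp T.symm B, ?_⟩
  ext x
  simp [conjOp_apply]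

theorem adjoint_conjOp (T : H ≃ₗᵢ[ℂ] K) (A : H →L[ℂ] H) :
    (conjOp T A).adjoint = conjOp T A.adjoint := by
  refine ((ContinuousLinearMap.eq_adjoint_iff _ _).2 fun x y => ?_).symm
  have h1 : inner ℂ (T (A.adjoint (T.symm x))) y = inner ℂ (A.adjoint (T.symm x)) (T.symm y) := by
    rw [← T.inner_map_map (A.adjoint (T.symm x)), T.apply_symm_apply]
  have h2 : inner ℂ x (T (A (T.symm y))) = inner ℂ (T.symm x) (A (T.symm y)) := by
    rw [← T.inner_map_map (T.symm x), T.apply_symm_apply]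
  rw [conjOp_apply, conjOp_apply, h1, h2, ContinuousLinearMap.adjoint_inner_left]

/-- The double commutant is transported by a unitary. -/
theorem image_doubleCommutant (T : H ≃ₗᵢ[ℂ] K) (N : Set (H →L[ℂ] H)) :
    conjOp T '' doubleCommutant N = doubleCommutant (conjOp T '' N) := by
  have key : ∀ S : Set (H →L[ℂ] H), conjOp T '' Set.centralizer S
      = Set.centralizer (conjOp T '' S) := by
    intro S
    ext B
    constructor
    · rintro ⟨A, hA, rfl⟩ _ ⟨C, hC, rfl⟩
      rw [← conjOp_mul, ← conjOp_mul, hA C hC]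
    · intro hB
      obtain ⟨A, rfl⟩ := conjOp_surjective T B
      refine ⟨A, fun C hC => conjOp_injective T ?_, rfl⟩
      rw [conjOp_mul, conjOp_mul]
      exact hB _ ⟨C, hC, rfl⟩
  rw [doubleCommutant, key, key, doubleCommutant]

/-- A unitary maps the Tomita graph homeomorphically onto that of the transported algebra, and the
conditions on a positive self-adjoint graph involve only inner products. -/
theorem isModularConjugation_transport (T : H ≃ₗᵢ[ℂ] K) {N : Set (H →L[ℂ] H)} {Ω : H}
    {J' : K ≃ₗᵢ⋆[ℂ] K} (h : IsModularConjugation (conjOp T '' N) (T Ω) J') {J : H ≃ₗᵢ⋆[ℂ] H}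
    (hJ : ∀ x, T (J x) = J' (T x)) : IsModularConjugation N Ω J := by
  have hgraph : ∀ x y, (x, J y) ∈ tomitaOperator N Ω ↔
      (T x, J' (T y)) ∈ tomitaOperator (conjOp T '' N) (T Ω) := by
    intro x y
    have himg : {p : K × K | ∃ A ∈ conjOp T '' N, p = (A (T Ω), A.adjoint (T Ω))}
        = (T.toHomeomorph.prodCongr T.toHomeomorph) ''
          {p : H × H | ∃ A ∈ N, p = (A Ω, A.adjoint Ω)} := by
      ext p
      constructor
      · rintro ⟨_, ⟨A, hA, rfl⟩, rfl⟩
        refine ⟨_, ⟨A, hA, rfl⟩, ?_⟩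
        rw [adjoint_conjOp, conjOp_apply, conjOp_apply, T.symm_apply_apply]
        rfl
      · rintro ⟨_, ⟨A, hA, rfl⟩, rfl⟩
        refine ⟨_, ⟨A, hA, rfl⟩, ?_⟩
        rw [adjoint_conjOp, conjOp_apply, conjOp_apply, T.symm_apply_apply]
        rfl
    rw [tomitaOperator, tomitaOperator, himg, ← Homeomorph.image_closure, ← hJ]
    exact ((T.toHomeomorph.prodCongr T.toHomeomorph).injective.mem_set_image (a := (x, J y))).symm
  refine ⟨fun x => T.injective (by rw [hJ, hJ, h.1]), ?_⟩
  have hset : ∀ x y, (x, y) ∈ {p : H × H | (p.1, J p.2) ∈ tomitaOperator N Ω} ↔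
      (T x, T y) ∈ {p : K × K | (p.1, J' p.2) ∈ tomitaOperator (conjOp T '' N) (T Ω)} := hgraph
  obtain ⟨h1, h2, h3⟩ := h.2
  generalize {p : H × H | (p.1, J p.2) ∈ tomitaOperator N Ω} = G at hset
  generalize {p : K × K | (p.1, J' p.2) ∈ tomitaOperator (conjOp T '' N) (T Ω)} = G' at hset h1 h2 h3
  have hin : ∀ x y : H, inner ℂ (T x) (T y) = inner ℂ x y := T.inner_map_map
  refine ⟨fun y hy => ?_, fun x y => ?_, fun p hp => ?_⟩
  · have := h1 (T y) (by rw [← map_zero T]; exact (hset 0 y).1 hy)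
    simpa using this
  · rw [hset, h2]
    constructor
    · intro hp q hq
      have := hp (T q.1, T q.2) ((hset _ _).1 hq)
      rw [← T.inner_map_map, ← T.inner_map_map q.2]
      exact this
    · intro hp q hq
      have hq' := (hset (T.symm q.1) (T.symm q.2)).2 (by
        rw [T.apply_symm_apply, T.apply_symm_apply]; exact hq)
      have h := hp _ hq'
      have e1 : inner ℂ q.1 (T y) = inner ℂ (T.symm q.1) y := by
        rw [← hin (T.symm q.1), T.apply_symm_apply]
      have e2 : inner ℂ q.2 (T x) = inner ℂ (T.symm q.2) x := by
        rw [← hin (T.symm q.2), T.apply_symm_apply]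
      exact e1.trans (h.trans e2.symm)
  · have := h3 _ ((hset _ _).1 hp)
    rw [← hin]
    exact this

/-- The antilinear closed Tomita operator, multiplied by an antiunitary involution. -/
theorem exists_tomita_submodule {N : Set (H →L[ℂ] H)} (hadd : ∀ A ∈ N, ∀ B ∈ N, A + B ∈ N)
    (hsmul : ∀ (c : ℂ), ∀ A ∈ N, c • A ∈ N) (hne : N.Nonempty) (J : H ≃ₗᵢ⋆[ℂ] H)
    (hJ : ∀ x, J (J x) = x) (Ω : H) : ∃ S : Submodule ℂ (H × H),
      (∀ p, p ∈ S ↔ ∃ A ∈ N, p = (A Ω, J (A.adjoint Ω))) ∧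
      {p : H × H | (p.1, J p.2) ∈ tomitaOperator N Ω} = S.topologicalClosure := by
  let S : Submodule ℂ (H × H) :=
    { carrier := {p | ∃ A ∈ N, p = (A Ω, J (A.adjoint Ω))}
      add_mem' := by
        rintro _ _ ⟨A, hA, rfl⟩ ⟨B, hB, rfl⟩
        exact ⟨A + B, hadd A hA B hB, by rw [map_add, add_apply, add_apply, map_add]; rfl⟩
      zero_mem' := by
        obtain ⟨A, hA⟩ := hne
        refine ⟨(0 : ℂ) • A, hsmul _ _ hA, ?_⟩
        simp
        rfl
      smul_mem' := by
        rintro c _ ⟨A, hA, rfl⟩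
        exact ⟨c • A, hsmul c A hA, by
          rw [map_smulₛₗ, smul_apply, smul_apply, map_smulₛₗ, conj_conj]; rfl⟩ }
  refine ⟨S, fun p => Iff.rfl, ?_⟩
  let Φ : (H × H) ≃ₜ (H × H) := (Homeomorph.refl _).prodCongr J.toHomeomorph
  have himg : {p : H × H | ∃ A ∈ N, p = (A Ω, A.adjoint Ω)} = Φ '' (S : Set (H × H)) := by
    ext p
    constructor
    · rintro ⟨A, hA, rfl⟩
      exact ⟨_, ⟨A, hA, rfl⟩, Prod.ext rfl (hJ _)⟩
    · rintro ⟨_, ⟨A, hA, rfl⟩, rfl⟩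
      exact ⟨A, hA, Prod.ext rfl (hJ _)⟩
  ext p
  change Φ p ∈ closure _ ↔ _
  rw [himg, ← Homeomorph.image_closure, Φ.injective.mem_set_image]
  rfl

end Transport

/-! ### The modular conjugation of the left Weyl operators -/

section ModularTheory

variable {d : ℕ} {s β : ℝ} [hd : Fact (0 < d)] [hs : Fact (0 < s)] [hβ : Fact (0 < β)]

/-- The multiplier `exp (-(β / 2) ∑ ε̃)` of the square root of the modular operator. -/
noncomputable def modularMult (d : ℕ) (s β : ℝ) (n : ℕ) (x : Fin n → Mom d × Bool) : ℝ :=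
  Real.exp (-(β / 2) * ∑ j, awEnergy d s (x j))

theorem hasExpCore_modular {V : ℕ → Submodule ℝ (Lp ℂ 2 (awMeasure d s))}
    (hV : IsTestFamily (awMeasure d s) (awShell d s) V) :
    HasExpCore (awShell d s) V (modularMult d s β) :=
  hasExpCore_exp_sum isExhaustion_awShell hV measurable_awEnergy exists_bound_awEnergy _

theorem swapConj_neg (u : Lp ℂ 2 (awMeasure d s)) : swapConj (-u) = -swapConj u := by
  rw [← neg_one_smul ℂ, swapConj_smul, map_neg, map_one, neg_one_smul]

theorem I_div_sqrt_two_ne_zero : (I / (√2 : ℝ) : ℂ) ≠ 0 :=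
  div_ne_zero I_ne_zero ofReal_sqrt_two_ne

/-- `(i / √2) v_h`, for complex functions `h`. -/
noncomputable def weylFamily (d : ℕ) (s β : ℝ) [Fact (0 < d)] [Fact (0 < s)] [Fact (0 < β)]
    (n : ℕ) : Submodule ℝ (Lp ℂ 2 (awMeasure d s)) :=
  (complexFamily d s β n).map ((I / √2 : ℂ) • LinearMap.id)

theorem isTestFamily_weylFamily :
    IsTestFamily (awMeasure d s) (awShell d s) (weylFamily d s β) :=
  isTestFamily_complexFamily.map_smul I_div_sqrt_two_ne_zero

theorem mulFun_smul_timeVec (t t' : Set.Icc (0 : ℝ) (β / 2)) (c : ℂ)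
    (h : Lp ℂ 2 (thermalMeasure d s β)) :
    (expVec _ (c • timeVec t h), expVec _ (c • timeVec t' h)) ∈ multGraph (awMeasure d s)
      fun _ x => Real.exp ((t - t') * ∑ j, awEnergy d s (x j)) := by
  have h0 : (fun x => (Real.exp ((t - t') * awEnergy d s x) : ℂ) * (c • timeVec t h :
      Lp ℂ 2 (awMeasure d s)) x) =ᵐ[awMeasure d s] (c • timeVec t' h : Lp ℂ 2 (awMeasure d s)) := by
    filter_upwards [exp_mul_timeVec t t' h, Lp.coeFn_smul c (timeVec t h),
      Lp.coeFn_smul c (timeVec t' h)] with x h1 h2 h3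
    rw [h2, h3, Pi.smul_apply, Pi.smul_apply, ← h1, smul_eq_mul, smul_eq_mul]
    ring
  have h1 : MemLp (fun x => (Real.exp ((t - t') * awEnergy d s x) : ℂ) * (c • timeVec t h :
      Lp ℂ 2 (awMeasure d s)) x) 2 (awMeasure d s) := (Lp.memLp _).ae_eq h0.symm
  have h2 : mulFun (awMeasure d s) (fun x => (Real.exp ((t - t') * awEnergy d s x) : ℂ))
      (c • timeVec t h) = c • timeVec t' h := Lp.ext ((mulFun_coeFn_of_memLp h1).trans h0)
  have h3 := expVec_mul_mem h1
  rw [h2] at h3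
  exact h3

theorem mem_modular (c : ℂ) (h : Lp ℂ 2 (thermalMeasure d s β)) :
    (expVec _ (c • timeVec timeZero h), expVec _ (c • timeVec timeHalf h)) ∈
      multGraph (awMeasure d s) (modularMult d s β) := by
  have := mulFun_smul_timeVec timeZero timeHalf c h
  simp only [timeZero, timeHalf, zero_sub] at this
  exact this

/-- The antiunitary exchange swaps the two times, and moving the real multiplier e^{-βε̃/2} across
the inner product swaps them back. No hermiticity is needed, so left and right Weyl operators
commute for all complex functions. -/
theorem conj_inner_timeZero_timeHalf (h g : Lp ℂ 2 (thermalMeasure d s β)) :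
    starRingEnd ℂ (inner ℂ (timeVec timeZero h) (timeVec timeHalf g))
      = inner ℂ (timeVec timeZero h) (timeVec timeHalf g) := by
  have h1 : inner ℂ (timeVec timeHalf h) (timeVec timeZero g)
      = inner ℂ (timeVec timeZero h) (timeVec timeHalf g) :=
    inner_eq_of_mul_real (exp_mul_timeVec timeZero timeHalf h).symm
      (exp_mul_timeVec timeZero timeHalf g).symm
  rw [inner_conj_symm, ← swapConj_timeVec g, ← swapConj_swapConj (timeVec timeZero h),
    inner_swapConj, swapConj_timeVec, h1, swapConj_timeVec, ← swapConj_timeVec h,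
    swapConj_swapConj]

/-- The modular theorem: a space of operators that contains enough left Weyl operators and
commutes with the right Weyl operators has the modular conjugation `modularJ`. -/
theorem isModularConjugation_of_weyl {N : Set (AWFock d s →L[ℂ] AWFock d s)}
    (hadd : ∀ A ∈ N, ∀ B ∈ N, A + B ∈ N) (hsmul : ∀ (c : ℂ), ∀ A ∈ N, c • A ∈ N)
    (hmem : ∀ n, ∀ h ∈ shellFun d s β n, weylL _ (timeVec timeZero h) ∈ N)
    (hcomm : ∀ A ∈ N, ∀ n, ∀ h ∈ shellFun d s β n,
      A * weylL _ (timeVec timeHalf h) = weylL _ (timeVec timeHalf h) * A) :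
    IsModularConjugation N (vacuum (awMeasure d s)) (modularJ d s) := by
  let Ω := vacuum (awMeasure d s)
  obtain ⟨S, hS, hset⟩ := exists_tomita_submodule hadd hsmul ⟨_, hmem 0 0 (Submodule.zero_mem _)⟩
    (modularJ d s) modularJ_modularJ Ω
  have hcore := hasExpCore_modular (β := β) (isTestFamily_weylFamily (d := d) (s := s) (β := β))
  -- For a right Weyl operator R that commutes with A, ⟨RΩ, AΩ⟩ = ⟨A*Ω, R*Ω⟩. The vector RΩ is a
  -- multiple of an exponential vector, so (AΩ, JA*Ω) satisfies the adjoint relation with the core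
  -- of Δ^{1/2}.
  have hSD : (S : Set (AWFock d s × AWFock d s)) ⊆ multGraph _ (modularMult d s β) := by
    intro p hp
    obtain ⟨A, hA, rfl⟩ := (hS p).1 hp
    rw [hcore.mem_multGraph_iff]
    rintro ⟨q₁, q₂⟩ hq ⟨k, _, ⟨_, ⟨h, hh, rfl⟩, rfl⟩, rfl⟩
    have hq2 : q₂ = expVec _ ((I / √2 : ℂ) • timeVec timeHalf h) :=
      multGraph_unique hq (mem_modular (I / √2 : ℂ) h)
    subst hq2
    change inner ℂ (expVec _ ((I / √2 : ℂ) • timeVec timeHalf h)) (A Ω)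
      = inner ℂ (expVec _ ((I / √2 : ℂ) • timeVec timeZero h)) (modularJ d s (A.adjoint Ω))
    have hJ : expVec _ ((I / √2 : ℂ) • timeVec timeZero h)
        = modularJ d s (expVec _ ((I / √2 : ℂ) • -timeVec timeHalf h)) := by
      rw [modularJ_expVec, swapConj_smul, conj_I_div_sqrt_two, ← swapConj_timeVec,
        swapConj_neg, swapConj_swapConj, neg_smul, smul_neg, neg_neg]
    rw [hJ, inner_modularJ]
    let w : Lp ℂ 2 (awMeasure d s) := timeVec timeHalf h
    let c : ℂ := cexp (-(inner ℂ w w / 4))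
    have hc : c ≠ 0 := Complex.exp_ne_zero _
    have e1 : weylL _ w Ω = c • expVec _ ((I / √2 : ℂ) • w) := weylL_vacuum w
    have e2 : weylL _ (-w) Ω = c • expVec _ ((I / √2 : ℂ) • -w) := by
      rw [weylL_vacuum, inner_neg_left, inner_neg_right, neg_neg]
    have hcc : starRingEnd ℂ c = c := by
      rw [← exp_conj, map_neg, map_div₀, inner_conj_symm, map_ofNat]
    have e3 : inner ℂ (weylL _ w Ω) (A Ω) = inner ℂ (A.adjoint Ω) (weylL _ (-w) Ω) := by
      have e4 := hcomm A hA k (-h) ((shellFun d s β k).neg_mem hh)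
      rw [map_neg] at e4
      rw [ContinuousLinearMap.adjoint_inner_left, ← mul_apply_eq_comp, e4, mul_apply_eq_comp,
        ← adjoint_weylL, ContinuousLinearMap.adjoint_inner_right]
    rw [e1, e2, Fock.inner_smul_left, Fock.inner_smul_right, hcc] at e3
    exact mul_left_cancel₀ hc e3
  -- Conversely, a multiple of a left Weyl operator applied to the vacuum is a core vector of
  -- Δ^{1/2}, and J times its adjoint on the vacuum is the image under Δ^{1/2}.
  have hDS : multGraph (awMeasure d s) (modularMult d s β) = S.topologicalClosure := by
    refine Set.Subset.antisymm (hcore.subset_of_mem S.isClosed_topologicalClosure ?_)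
      (closure_minimal hSD hcore.isClosed)
    rintro k _ ⟨_, ⟨h, hh, rfl⟩, rfl⟩
    refine ⟨_, mem_modular (I / √2 : ℂ) h, S.le_topologicalClosure ((hS _).2 ?_)⟩
    let w : Lp ℂ 2 (awMeasure d s) := timeVec timeZero h
    let c : ℂ := cexp (-(inner ℂ w w / 4))
    have hc : c ≠ 0 := Complex.exp_ne_zero _
    have e1 : weylL _ w Ω = c • expVec _ ((I / √2 : ℂ) • w) := weylL_vacuum w
    have e2 : weylL _ (-w) Ω = c • expVec _ ((I / √2 : ℂ) • -w) := by
      rw [weylL_vacuum, inner_neg_left, inner_neg_right, neg_neg]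
    have hcc : starRingEnd ℂ c = c := by
      rw [← exp_conj, map_neg, map_div₀, inner_conj_symm, map_ofNat]
    refine ⟨c⁻¹ • weylL _ w, hsmul _ _ (hmem k h hh), Prod.ext ?_ ?_⟩
    · change expVec _ ((I / √2 : ℂ) • w) = c⁻¹ • weylL _ w Ω
      rw [e1, smul_smul, inv_mul_cancel₀ hc, one_smul]
    · change expVec _ ((I / √2 : ℂ) • timeVec timeHalf h)
        = modularJ d s ((c⁻¹ • weylL _ w).adjoint Ω)
      rw [map_smulₛₗ, smul_apply, adjoint_weylL, e2, map_inv₀, hcc, smul_smul, inv_mul_cancel₀ hc,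
        one_smul, modularJ_expVec, swapConj_smul, conj_I_div_sqrt_two, ← swapConj_timeVec,
        swapConj_neg, neg_smul, smul_neg, neg_neg]
  refine ⟨modularJ_modularJ, ?_⟩
  rw [hset, ← hDS]
  exact hcore.isPositiveSelfAdjoint fun n x => Real.exp_nonneg _

theorem weylL_commute_timeHalf (h g : Lp ℂ 2 (thermalMeasure d s β)) :
    weylL (awMeasure d s) (timeVec timeZero h) * weylL _ (timeVec timeHalf g)
      = weylL _ (timeVec timeHalf g) * weylL _ (timeVec timeZero h) :=
  weylL_commute (conj_inner_timeZero_timeHalf h g)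

/-- The right Weyl operators lie in the commutant of the generators, hence commute with the double
commutant. -/
theorem isModularConjugation_awAlgebra :
    IsModularConjugation (awAlgebra d s β) (vacuum (awMeasure d s)) (modularJ d s) := by
  refine isModularConjugation_of_weyl (β := β) (fun A hA B hB => Set.add_mem_centralizer hA hB)
    (fun c A hA C hC => ?_) (fun n h _ => ?_) (fun A hA n h _ => ?_)
  · rw [mul_smul_comm, smul_mul_assoc, hA C hC]
  · have h1 : weylL (awMeasure d s) (timeVec timeZero h) = awWeyl h := by
      rw [awWeyl, weyl_eq, awVector_eq]
    rw [h1]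
    exact Set.subset_centralizer_centralizer ⟨h, rfl⟩
  · refine (hA _ ?_).symm
    rintro _ ⟨g, rfl⟩
    rw [awWeyl, weyl_eq, awVector_eq]
    exact weylL_commute_timeHalf g h

end ModularTheory

/-! ### The Matsubara sum -/

section FourierSum

theorem summable_matsubara {β : ℝ} (hβ : 0 < β) (ε : ℝ) :
    Summable fun n : ℤ => 1 / β * (1 / (matsubara β n ^ 2 + ε ^ 2)) := by
  refine Summable.mul_left _ ?_
  have h := (Real.summable_one_div_int_pow (p := 2)).2 (by norm_num)
  refine Summable.of_norm_bounded_eventually (h.mul_left ((β / (2 * Real.pi)) ^ 2)) ?_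
  filter_upwards [(Set.finite_singleton (0 : ℤ)).compl_mem_cofinite] with n hn
  have hn' : (n : ℝ) ≠ 0 := by exact_mod_cast hn
  have hpi := Real.pi_pos
  have h1 : 0 < matsubara β n ^ 2 := by rw [matsubara]; positivity
  rw [Real.norm_of_nonneg (by positivity)]
  calc 1 / (matsubara β n ^ 2 + ε ^ 2) ≤ 1 / matsubara β n ^ 2 :=
        one_div_le_one_div_of_le h1 (by nlinarith [sq_nonneg ε])
    _ = (β / (2 * Real.pi)) ^ 2 * (1 / (n : ℝ) ^ 2) := by
        rw [matsubara]; field_simp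

/-- The hyperbolic cosine is a sum of two exponentials, and e^{-iω_nβ} = 1 simplifies the boundary
terms. -/
theorem integral_exp_mul_cosh {β ε : ℝ} (hβ : 0 < β) (hε : 0 < ε) (n : ℤ) :
    ∫ x in (0 : ℝ)..β, cexp (-(I * matsubara β n) * x) * (Real.cosh ((β / 2 - x) * ε) : ℂ)
      = 2 * ε * Real.sinh (β * ε / 2) * (1 / (matsubara β n ^ 2 + ε ^ 2)) := by
  set ω : ℂ := (matsubara β n : ℂ) with hω
  have hω' : cexp (-(I * ω) * β) = 1 := by
    rw [hω, matsubara, Complex.exp_eq_one_iff]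
    refine ⟨-n, ?_⟩
    have : (β : ℂ) ≠ 0 := ofReal_ne_zero.2 hβ.ne'
    push_cast
    field_simp
  have hre : ∀ σ : ℝ, σ ≠ 0 → -(I * ω) + σ ≠ 0 := by
    intro σ hσ h
    have := congrArg Complex.re h
    simp [hω] at this
    exact hσ this
  have h1 : ∀ x : ℝ, cexp (-(I * ω) * x) * (Real.cosh ((β / 2 - x) * ε) : ℂ)
      = cexp (β * ε / 2) / 2 * cexp ((-(I * ω) + (-ε : ℝ)) * x)
        + cexp (-(β * ε / 2)) / 2 * cexp ((-(I * ω) + ε) * x) := by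
    intro x
    rw [Real.cosh_eq]
    push_cast
    rw [div_mul_eq_mul_div, div_mul_eq_mul_div, ← Complex.exp_add, ← Complex.exp_add, mul_div_assoc',
      mul_add, ← Complex.exp_add, ← Complex.exp_add, add_div]
    ring_nf
  have h2 : ∀ σ : ℝ, σ ≠ 0 → ∫ x in (0 : ℝ)..β, cexp ((-(I * ω) + σ) * x)
      = (cexp (σ * β) - 1) / (-(I * ω) + σ) := by
    intro σ hσ
    rw [integral_exp_mul_complex (hre σ hσ), add_mul, Complex.exp_add, hω', one_mul, ofReal_zero,
      mul_zero, Complex.exp_zero]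
  simp_rw [h1]
  rw [intervalIntegral.integral_add (Continuous.intervalIntegrable (by fun_prop) _ _)
    (Continuous.intervalIntegrable (by fun_prop) _ _), intervalIntegral.integral_const_mul,
    intervalIntegral.integral_const_mul, h2 _ (neg_ne_zero.2 hε.ne'), h2 _ hε.ne', Real.sinh_eq]
  have a1 := hre _ (neg_ne_zero.2 hε.ne')
  have a2 := hre _ hε.ne'
  have a4 : (ω ^ 2 + (ε : ℂ) ^ 2) = -((-(I * ω) + (-ε : ℝ)) * (-(I * ω) + ε)) := by
    push_cast
    linear_combination ω ^ 2 * I_sq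
  have e1 : cexp (((-ε : ℝ) : ℂ) * β) = cexp (-(β * ε / 2)) * cexp (-(β * ε / 2)) := by
    rw [← Complex.exp_add]; push_cast; ring_nf
  have e2 : cexp ((ε : ℂ) * β) = cexp (β * ε / 2) * cexp (β * ε / 2) := by
    rw [← Complex.exp_add]; ring_nf
  have e3 : cexp (β * ε / 2) * cexp (-(β * ε / 2)) = 1 := by
    rw [← Complex.exp_add, add_neg_cancel, Complex.exp_zero]
  rw [e1, e2, a4]
  have e6 : ((-ε : ℝ) : ℂ) = -ε := by push_cast; rfl
  rw [e6] at a1 ⊢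
  push_cast
  generalize cexp (β * ε / 2) = p at *
  generalize cexp (-(β * ε / 2)) = q at *
  have e4 : p / 2 * ((q * q - 1) / (-(I * ω) + -ε)) = (q - p) / 2 / (-(I * ω) + -ε) := by
    field_simp
    linear_combination q * e3
  have e5 : q / 2 * ((p * p - 1) / (-(I * ω) + ε)) = (p - q) / 2 / (-(I * ω) + ε) := by
    field_simp
    linear_combination p * e3
  rw [e4, e5]
  field_simp
  ring

/-- This is the Fourier series of cosh((β/2-x)ε) on the circle of length β. The function has equal
values at 0 and β, so it is continuous there, and summability of the coefficients gives pointwise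
convergence. -/
theorem hasSum_matsubara {β ε x : ℝ} (hβ : 0 < β) (hε : 0 < ε) (hx : x ∈ Set.Icc 0 β) :
    HasSum (fun n : ℤ => ((1 / β * (1 / (matsubara β n ^ 2 + ε ^ 2)) : ℝ) : ℂ) *
      cexp (I * (matsubara β n * x : ℝ)))
      ((Real.cosh ((β / 2 - x) * ε) / (2 * ε * Real.sinh (β * ε / 2)) : ℝ) : ℂ) := by
  have : Fact (0 < β) := ⟨hβ⟩
  have hs : 0 < Real.sinh (β * ε / 2) := Real.sinh_pos_iff.2 (by positivity)
  let f : ℝ → ℂ := fun x => (Real.cosh ((β / 2 - x) * ε) : ℂ)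
  have hper : f 0 = f (0 + β) := by
    simp only [f]
    rw [← Real.cosh_neg ((β / 2 - (0 + β)) * ε)]
    ring_nf
  have hf : ContinuousOn f (Set.Icc 0 (0 + β)) := by
    refine Continuous.continuousOn ?_
    exact continuous_ofReal.comp (Real.continuous_cosh.comp (by fun_prop))
  let F : C(AddCircle β, ℂ) := ⟨AddCircle.liftIco β 0 f, AddCircle.liftIco_continuous hper hf⟩
  have hcoef : ∀ n : ℤ, fourierCoeff F n = 2 * ε * Real.sinh (β * ε / 2) *
      ((1 / β * (1 / (matsubara β n ^ 2 + ε ^ 2)) : ℝ) : ℂ) := by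
    intro n
    change fourierCoeff (AddCircle.liftIco β 0 f) n = _
    rw [fourierCoeff_liftIco_eq, fourierCoeffOn_eq_integral]
    have h1 : ∀ x : ℝ, fourier (-n) (x : AddCircle (0 + β - 0)) • f x
        = cexp (-(I * matsubara β n) * x) * (Real.cosh ((β / 2 - x) * ε) : ℂ) := by
      intro x
      rw [fourier_coe_apply, smul_eq_mul]
      congr 2
      rw [matsubara]
      push_cast
      have : (β : ℂ) ≠ 0 := ofReal_ne_zero.2 hβ.ne'
      rw [zero_add, sub_zero]
      field_simp
    simp_rw [h1]
    rw [zero_add, sub_zero, integral_exp_mul_cosh hβ hε, Complex.real_smul]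
    push_cast
    ring
  have hsum : Summable (fourierCoeff F) := by
    have := (Complex.hasSum_ofReal.2 (summable_matsubara hβ ε).hasSum).summable.mul_left (2 * ε * Real.sinh (β * ε / 2) : ℂ)
    exact this.congr fun n => (hcoef n).symm
  have h2 := has_pointwise_sum_fourier_series_of_summable hsum (x : AddCircle β)
  have h3 : F (x : AddCircle β) = f x := by
    change AddCircle.liftIco β 0 f x = f x
    rcases hx.2.lt_or_eq with h | h
    · exact AddCircle.liftIco_zero_coe_apply ⟨hx.1, h⟩
    · have : ((x : ℝ) : AddCircle β) = ((0 : ℝ) : AddCircle β) := by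
        rw [h, AddCircle.coe_period]; rfl
      rw [this, AddCircle.liftIco_zero_coe_apply ⟨le_rfl, hβ⟩, h, hper, zero_add]
  rw [h3] at h2
  have h4 := h2.mul_left ((1 / (2 * ε * Real.sinh (β * ε / 2)) : ℝ) : ℂ)
  have hs' : ((Real.sinh (β * ε / 2) : ℝ) : ℂ) ≠ 0 := ofReal_ne_zero.2 hs.ne'
  have hε' : (ε : ℂ) ≠ 0 := ofReal_ne_zero.2 hε.ne'
  have hβ' : (β : ℂ) ≠ 0 := ofReal_ne_zero.2 hβ.ne'
  rw [show ((Real.cosh ((β / 2 - x) * ε) / (2 * ε * Real.sinh (β * ε / 2)) : ℝ) : ℂ)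
    = ((1 / (2 * ε * Real.sinh (β * ε / 2)) : ℝ) : ℂ) * f x by simp only [f]; push_cast; ring]
  refine h4.congr_fun fun n => ?_
  rw [hcoef, fourier_coe_apply, smul_eq_mul]
  have h5 : cexp (2 * Real.pi * I * n * x / β) = cexp (I * (matsubara β n * x : ℝ)) := by
    congr 1
    rw [matsubara]
    push_cast
    field_simp
  rw [h5]
  generalize cexp (I * (matsubara β n * x : ℝ)) = e
  have h6 : ((1 / (2 * ε * Real.sinh (β * ε / 2)) : ℝ) : ℂ) * (2 * ε * Real.sinh (β * ε / 2)) = 1 := by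
    rw [ofReal_div, ofReal_one, ofReal_mul, ofReal_mul, ofReal_ofNat]
    exact one_div_mul_cancel (mul_ne_zero (mul_ne_zero two_ne_zero hε') hs')
  linear_combination (-((1 / β * (1 / (matsubara β n ^ 2 + ε ^ 2)) : ℝ) : ℂ) * e) * h6

/-- The thermal two-point function as a Matsubara sum. -/
theorem hasSum_matsubara_abs {β ε u : ℝ} (hβ : 0 < β) (hε : 0 < ε) (hu : |u| ≤ β) :
    HasSum (fun n : ℤ => ((1 / β * (1 / (matsubara β n ^ 2 + ε ^ 2)) : ℝ) : ℂ) *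
      cexp (I * (matsubara β n * u : ℝ)))
      ((Real.cosh ((β / 2 - |u|) * ε) / (2 * ε * Real.sinh (β * ε / 2)) : ℝ) : ℂ) := by
  have h := hasSum_matsubara hβ hε ⟨abs_nonneg u, hu⟩
  rcases abs_choice u with h1 | h1
  · rw [h1] at h ⊢
    exact h
  · refine ((Equiv.neg ℤ).hasSum_iff).1 (h.congr_fun fun n => ?_)
    have h2 : matsubara β (-n) = -matsubara β n := by
      rw [matsubara, matsubara]; push_cast; ring
    rw [Function.comp_apply, Equiv.neg_apply, h2, h1]
    ring_nf

end FourierSum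

/-! ### Sharp-time test functions and their covariance -/

section Covariance

variable {d : ℕ} {s β : ℝ}

instance : SigmaFinite (covMeasure d s β) := by
  unfold covMeasure; infer_instance

theorem matsubara_neg (n : ℤ) : matsubara β (-n) = -matsubara β n := by
  rw [matsubara, matsubara]; push_cast; ring

/-- The symbol `1 / (ωₙ² + ε²)`. -/
noncomputable def covSymbol (s β : ℝ) (p : ℤ × Mom d) : ℝ :=
  1 / (matsubara β p.1 ^ 2 + energy s p.2 ^ 2)

theorem covSymbol_nonneg (p : ℤ × Mom d) : 0 ≤ covSymbol s β p := by
  unfold covSymbol; positivity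

theorem measurable_matsubara : Measurable fun p : ℤ × Mom d => matsubara β p.1 := by
  have h : Measurable (matsubara β) := measurable_of_countable _
  exact h.comp measurable_fst

theorem measurable_covSymbol : Measurable (covSymbol s β : ℤ × Mom d → ℝ) := by
  have h1 := measurable_matsubara (d := d) (β := β)
  have h2 : Measurable fun p : ℤ × Mom d => energy s p.2 := measurable_energy.comp measurable_snd
  unfold covSymbol
  fun_prop

theorem covMeasure_eq : covMeasure d s β = (Measure.count.prod volume).withDensity fun p =>
    ENNReal.ofReal (covSymbol s β p) := rfl

theorem integrable_covMeasure_iff {F : ℤ × Mom d → ℂ} : Integrable F (covMeasure d s β) ↔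
    Integrable (fun p => (covSymbol s β p : ℂ) * F p) (Measure.count.prod volume) := by
  have := measurable_covSymbol (d := d) (s := s) (β := β)
  rw [covMeasure_eq, integrable_withDensity_iff_integrable_smul' (by fun_prop) (by simp)]
  refine integrable_congr (Filter.Eventually.of_forall fun p => ?_)
  simp only [ENNReal.toReal_ofReal (covSymbol_nonneg p), real_smul]

theorem integral_covMeasure (F : ℤ × Mom d → ℂ) : ∫ p, F p ∂(covMeasure d s β)
    = ∫ p, (covSymbol s β p : ℂ) * F p ∂(Measure.count.prod volume) := by
  have := measurable_covSymbol (d := d) (s := s) (β := β)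
  rw [covMeasure_eq, integral_withDensity_eq_integral_toReal_smul (by fun_prop) (by simp)]
  refine integral_congr_ae (Filter.Eventually.of_forall fun p => ?_)
  simp only [ENNReal.toReal_ofReal (covSymbol_nonneg p), real_smul]

theorem integral_energyMeasure (F : Mom d → ℂ) : ∫ k, F k ∂(energyMeasure d s)
    = ∫ k, ((1 / (2 * energy s k) : ℝ) : ℂ) * F k := by
  have := measurable_energy (d := d) (s := s)
  rw [energyMeasure, integral_withDensity_eq_integral_toReal_smul (by fun_prop) (by simp)]
  refine integral_congr_ae (Filter.Eventually.of_forall fun k => ?_)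
  have h : 0 ≤ energy s k := Real.rpow_nonneg (norm_nonneg _) _
  simp only [ENNReal.toReal_ofReal (show 0 ≤ 1 / (2 * energy s k) by positivity), real_smul]

/-- The Fourier coefficients of `δ_t ⊗ g`. -/
noncomputable def sharpFun (β t : ℝ) (g : Mom d → ℂ) (p : ℤ × Mom d) : ℂ :=
  (1 / √β : ℝ) * cexp (-I * (matsubara β p.1 * t : ℝ)) * g p.2

theorem norm_cexp_neg (y : ℝ) : ‖cexp (-I * y)‖ = 1 := by
  rw [show -I * (y : ℂ) = ((-y : ℝ) : ℂ) * I by push_cast; ring, Complex.norm_exp_ofReal_mul_I]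

theorem conj_cexp_neg (y : ℝ) : starRingEnd ℂ (cexp (-I * y)) = cexp (I * y) := by
  rw [← exp_conj, map_mul, map_neg, conj_I, conj_ofReal, neg_neg]

variable [hd : Fact (0 < d)] [hs : Fact (0 < s)] [hβ : Fact (0 < β)]

theorem ae_covMeasure_of_thermalMeasure {p : Mom d → Prop} (h : ∀ᵐ k ∂(thermalMeasure d s β), p k) :
    ∀ᵐ x ∂(covMeasure d s β), p x.2 := by
  rw [ae_thermalMeasure, ae_energyMeasure] at h
  refine (withDensity_absolutelyContinuous _ _).ae_le ?_
  exact Measure.quasiMeasurePreserving_snd.ae h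

theorem conj_sharpFun_mul (t t' : ℝ) (g g' : Mom d → ℂ) (n : ℤ) (k : Mom d) :
    starRingEnd ℂ (sharpFun β t g (n, k)) * sharpFun β t' g' (n, k)
      = (1 / β : ℝ) * cexp (I * (matsubara β n * (t - t') : ℝ)) * (starRingEnd ℂ (g k) * g' k) := by
  have h1 : ((1 / √β : ℝ) : ℂ) * ((1 / √β : ℝ) : ℂ) = ((1 / β : ℝ) : ℂ) := by
    rw [← ofReal_mul, div_mul_div_comm, one_mul, Real.mul_self_sqrt hβ.out.le]
  have h2 : cexp (I * (matsubara β n * t : ℝ)) * cexp (-I * (matsubara β n * t' : ℝ))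
      = cexp (I * (matsubara β n * (t - t') : ℝ)) := by
    rw [← Complex.exp_add]; push_cast; ring_nf
  rw [sharpFun, sharpFun, map_mul, map_mul, conj_ofReal, conj_cexp_neg, ← h1, ← h2]
  ring

/-- The sum over the Matsubara frequencies. -/
theorem hasSum_covSymbol {t t' : ℝ} (ht : |t - t'| ≤ β) (g g' : Mom d → ℂ) {k : Mom d}
    (hk : 0 < energy s k) :
    HasSum (fun n : ℤ => (covSymbol s β (n, k) : ℂ) *
        (starRingEnd ℂ (sharpFun β t g (n, k)) * sharpFun β t' g' (n, k)))
      (((1 / (2 * energy s k) : ℝ) : ℂ) *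
        ((thermalKernel s β |t - t'| k : ℂ) * (starRingEnd ℂ (g k) * g' k))) := by
  have h := (hasSum_matsubara_abs hβ.out hk ht).mul_right (starRingEnd ℂ (g k) * g' k)
  have e : ((Real.cosh ((β / 2 - |t - t'|) * energy s k) /
      (2 * energy s k * Real.sinh (β * energy s k / 2)) : ℝ) : ℂ) * (starRingEnd ℂ (g k) * g' k)
      = (((1 / (2 * energy s k) : ℝ) : ℂ) *
        ((thermalKernel s β |t - t'| k : ℂ) * (starRingEnd ℂ (g k) * g' k))) := by
    rw [thermalKernel, ← mul_assoc (((1 / (2 * energy s k) : ℝ) : ℂ)), ← ofReal_mul]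
    congr 2
    rw [div_mul_div_comm, one_mul]
  rw [← e]
  refine h.congr_fun fun n => ?_
  rw [conj_sharpFun_mul, covSymbol, ofReal_mul (1 / β)]
  ring

/-- The sum over the frequencies of the squared coefficients is coth(βε/2)|g|²/(2ε), which is
integrable exactly because g lies in the thermal space. -/
theorem memLp_sharpFun (t : ℝ) (g : Lp ℂ 2 (thermalMeasure d s β)) :
    MemLp (sharpFun β t g) 2 (covMeasure d s β) := by
  have hm : Measurable (sharpFun β t g : ℤ × Mom d → ℂ) := by
    have h1 := measurable_matsubara (d := d) (β := β)
    have h2 : Measurable fun p : ℤ × Mom d => g p.2 :=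
      (Lp.stronglyMeasurable g).measurable.comp measurable_snd
    unfold sharpFun
    fun_prop
  rw [memLp_two_iff_integrable_sq_norm hm.aestronglyMeasurable]
  have hF : ∀ p, starRingEnd ℂ (sharpFun β t g p) * sharpFun β t g p
      = ((‖sharpFun β t g p‖ ^ 2 : ℝ) : ℂ) := fun p => by
    rw [mul_comm, mul_conj, normSq_eq_norm_sq]
  suffices h : Integrable (fun p => starRingEnd ℂ (sharpFun β t g p) * sharpFun β t g p)
      (covMeasure d s β) by
    simp_rw [hF] at h
    exact h.re
  have hc := measurable_covSymbol (d := d) (s := s) (β := β)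
  rw [integrable_covMeasure_iff, integrable_prod_iff' (by
    refine Measurable.aestronglyMeasurable ?_
    have : Measurable fun p => starRingEnd ℂ (sharpFun β t g p) := Complex.continuous_conj.measurable.comp hm
    fun_prop)]
  have hnorm : ∀ p, ‖(covSymbol s β p : ℂ) *
      (starRingEnd ℂ (sharpFun β t g p) * sharpFun β t g p)‖
      = ((covSymbol s β p : ℂ) * (starRingEnd ℂ (sharpFun β t g p) * sharpFun β t g p)).re := by
    intro p
    rw [hF, ← ofReal_mul, ofReal_re, Complex.norm_real, Real.norm_of_nonneg]
    exact mul_nonneg (covSymbol_nonneg p) (by positivity)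
  have ht : |t - t| ≤ β := by rw [sub_self, abs_zero]; exact hβ.out.le
  have hpos : ∀ᵐ k : Mom d, 0 < energy s k := by
    rw [← ae_energyMeasure (s := s)]
    exact ae_energy_pos
  have hsum : ∀ᵐ k : Mom d, Summable fun n : ℤ => ‖(covSymbol s β (n, k) : ℂ) *
      (starRingEnd ℂ (sharpFun β t g (n, k)) * sharpFun β t g (n, k))‖ := by
    filter_upwards [hpos] with k hk
    simp_rw [hnorm]
    exact ((hasSum_covSymbol ht g g hk).mapL reCLM).summable
  refine ⟨?_, ?_⟩
  · filter_upwards [hsum] with k hk using integrable_count_iff.2 hk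
  · have h1 := (memLp_two_iff_integrable_sq_norm (Lp.memLp g).1).1 (Lp.memLp g)
    have hcoth := measurable_cothHalf (d := d) (s := s) (β := β)
    have hen := measurable_energy (d := d) (s := s)
    have h2 : Integrable (fun k => ‖g k‖ ^ 2) (volume.withDensity fun k : Mom d =>
      ENNReal.ofReal (cothHalf s β k / (2 * energy s k))) := h1
    rw [integrable_withDensity_iff_integrable_smul' (by fun_prop) (by simp)] at h2
    refine h2.congr ?_
    filter_upwards [hpos, hsum] with k hk hk2
    have h2 : Integrable (fun n : ℤ => ‖(covSymbol s β (n, k) : ℂ) *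
      (starRingEnd ℂ (sharpFun β t g (n, k)) * sharpFun β t g (n, k))‖) Measure.count :=
      (integrable_count_iff.2 hk2).norm
    rw [integral_countable h2]
    have h3 := (hasSum_covSymbol ht g g hk).mapL reCLM
    have h4 : HasSum (fun n : ℤ => Measure.count.real {n} • ‖(covSymbol s β (n, k) : ℂ) *
      (starRingEnd ℂ (sharpFun β t g (n, k)) * sharpFun β t g (n, k))‖) _ :=
      h3.congr_fun fun n => by
        rw [hnorm, measureReal_def, Measure.count_singleton, ENNReal.toReal_one, one_smul]
        rfl
    have hρ := density_pos (β := β) hk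
    have hco : 0 ≤ cothHalf s β k := by rw [cothHalf_eq hk]; positivity
    rw [h4.tsum_eq, ENNReal.toReal_ofReal (by positivity), reCLM_apply, mul_comm (starRingEnd ℂ (g k)),
      mul_conj, normSq_eq_norm_sq, ← ofReal_mul, ← ofReal_mul, ofReal_re, thermalKernel, sub_self,
      abs_zero, sub_zero, cothHalf, smul_eq_mul]
    ring_nf

theorem sharpFun_mem_hermitian (t : ℝ) {g : Lp ℂ 2 (thermalMeasure d s β)}
    (hg : g ∈ hermitian (thermalMeasure d s β)) :
    toL2 (covMeasure d s β) (sharpFun β t g) ∈ hermitian (covMeasure d s β) := by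
  obtain ⟨w, hw, h1⟩ := hg
  refine ⟨sharpFun β t w, fun p => ?_, ?_⟩
  · rw [sharpFun, sharpFun, map_mul, map_mul, conj_ofReal, conj_cexp_neg, Prod.snd_neg, hw, Prod.fst_neg,
      matsubara_neg]
    push_cast
    ring_nf
  · filter_upwards [toL2_coeFn _ (memLp_sharpFun t g), ae_covMeasure_of_thermalMeasure h1]
      with p h2 h3
    rw [h2, sharpFun, sharpFun, h3]

theorem ofFourier_coeFn {h : ℤ × Mom d → ℂ} (H : ∃ f : TestFun d s β, f.1 =ᵐ[covMeasure d s β] h) :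
    (TestFun.ofFourier d s β h).1 =ᵐ[covMeasure d s β] h := by
  rw [TestFun.ofFourier, dif_pos H]
  exact H.choose_spec

theorem sharpTime_coeFn (t : ℝ) (g : TimeZero d s β) :
    (sharpTime t g).1 =ᵐ[covMeasure d s β] sharpFun β t g.1 :=
  ofFourier_coeFn ⟨⟨_, sharpFun_mem_hermitian t g.2⟩, toL2_coeFn _ (memLp_sharpFun t g.1)⟩

theorem translate_coeFn (t : ℝ) (f : TestFun d s β) :
    (translate t f).1 =ᵐ[covMeasure d s β]
      fun p => cexp (-I * (matsubara β p.1 * t : ℝ)) * f.1 p := by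
  have hm : Measurable fun p : ℤ × Mom d => cexp (-I * (matsubara β p.1 * t : ℝ)) := by
    have h1 := measurable_matsubara (d := d) (β := β)
    fun_prop
  have hmem : MemLp (fun p => cexp (-I * (matsubara β p.1 * t : ℝ)) * f.1 p) 2
      (covMeasure d s β) :=
    MemLp.of_le (Lp.memLp f.1) (hm.aestronglyMeasurable.mul (Lp.aestronglyMeasurable f.1))
      (Filter.Eventually.of_forall fun p => by rw [norm_mul, norm_cexp_neg, one_mul])
  refine ofFourier_coeFn ⟨⟨toL2 _ _, ?_⟩, toL2_coeFn _ hmem⟩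
  obtain ⟨w, hw, h1⟩ := f.2
  refine ⟨fun p => cexp (-I * (matsubara β p.1 * t : ℝ)) * w p, fun p => ?_, ?_⟩
  · change cexp (-I * (matsubara β (-p).1 * t : ℝ)) * w (-p) = _
    rw [map_mul, conj_cexp_neg, hw, Prod.fst_neg, matsubara_neg]
    push_cast
    ring_nf
  · filter_upwards [toL2_coeFn _ hmem, h1] with p h2 h3
    rw [h2, h3]

theorem cexp_neg_add (y t t' : ℝ) : cexp (-I * (y * t : ℝ)) * cexp (-I * (y * t' : ℝ))
    = cexp (-I * (y * (t + t') : ℝ)) := by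
  rw [← Complex.exp_add]; push_cast; ring_nf

theorem translate_sharpTime (t t' : ℝ) (g : TimeZero d s β) :
    translate t (sharpTime t' g) = sharpTime (t + t') g := by
  apply Subtype.ext
  apply Lp.ext
  filter_upwards [translate_coeFn t (sharpTime t' g), sharpTime_coeFn t' g,
    sharpTime_coeFn (t + t') g] with p h1 h2 h3
  rw [h1, h2, h3, sharpFun, sharpFun, ← cexp_neg_add]
  ring

/-- The covariance of the sharp-time fields. -/
theorem inner_sharpTime {t t' : ℝ} (ht : |t - t'| ≤ β) (g g' : TimeZero d s β) :
    inner ℂ (sharpTime t g).1 (sharpTime t' g').1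
      = ∫ k, (thermalKernel s β |t - t'| k : ℂ) * (starRingEnd ℂ (g.1 k) * g'.1 k)
          ∂(energyMeasure d s) := by
  have hF : (fun p => starRingEnd ℂ ((sharpTime t g).1 p) * (sharpTime t' g').1 p)
      =ᵐ[covMeasure d s β] fun p => starRingEnd ℂ (sharpFun β t g.1 p) * sharpFun β t' g'.1 p := by
    filter_upwards [sharpTime_coeFn t g, sharpTime_coeFn t' g'] with p h1 h2
    rw [h1, h2]
  have hI := integrable_covMeasure_iff.1 ((integrable_conj_mul _ _).congr hF)
  rw [inner_eq_integral, integral_congr_ae hF, integral_covMeasure, integral_prod_symm _ hI,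
    integral_energyMeasure]
  have hpos : ∀ᵐ k : Mom d, 0 < energy s k := by
    rw [← ae_energyMeasure (s := s)]
    exact ae_energy_pos
  have hI' := ((integrable_prod_iff' hI.1).1 hI).1
  refine integral_congr_ae ?_
  filter_upwards [hpos, hI'] with k hk hk2
  rw [integral_countable hk2]
  have h4 : HasSum (fun n : ℤ => (Measure.count : Measure ℤ).real {n} • ((covSymbol s β (n, k) : ℂ) *
      (starRingEnd ℂ (sharpFun β t g.1 (n, k)) * sharpFun β t' g'.1 (n, k)))) _ :=
    (hasSum_covSymbol ht g.1 g'.1 hk).congr_fun fun n => by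
      rw [measureReal_def, Measure.count_singleton, ENNReal.toReal_one, one_smul]
  exact h4.tsum_eq

/-- The covariances of the sharp-time fields, one of them at the time `0` or `β / 2`, are the inner
products of the vectors in the Araki-Woods space. -/
theorem inner_sharpTime_eq {t t' : Set.Icc (0 : ℝ) (β / 2)} (ht : t = timeZero ∨ t = timeHalf)
    (g g' : TimeZero d s β) : inner ℂ (sharpTime (t : ℝ) g).1 (sharpTime (t' : ℝ) g').1
      = inner ℂ (timeVec t g.1) (timeVec t' g'.1) := by
  have hβ' := hβ.out
  have h0 := t'.2.1
  have h1 := t'.2.2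
  have habs : |(t : ℝ) - t'| ≤ β := by
    rw [abs_le]
    have h2 := t.2.1
    have h3 := t.2.2
    constructor <;> linarith
  rw [inner_sharpTime habs, inner_timeVec t t' g.2 g'.2]
  congr 1
  funext k
  congr 2
  -- At the time 0 the sum of the times is their distance. At the time β/2 the distance is β/2 - t',
  -- and the two arguments of cosh differ only by a sign.
  rcases ht with rfl | rfl
  · simp only [timeZero, zero_sub, abs_neg, abs_of_nonneg h0, zero_add]
  · simp only [timeHalf]
    rw [abs_of_nonneg (by linarith), thermalKernel, thermalKernel,
      ← Real.cosh_neg ((β / 2 - (β / 2 + (t' : ℝ))) * energy s k)]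
    ring_nf

end Covariance

/-! ### Characters determine measures and functions -/

section Characters

variable {Y : Type}

/-- The characters `exp (i ∑ c_y x_y)` of a product of real lines. -/
noncomputable def character (c : Y →₀ ℝ) (x : Y → ℝ) : ℂ :=
  cexp (I * ((Finsupp.linearCombination ℝ x c : ℝ) : ℂ))

theorem norm_character (c : Y →₀ ℝ) (x : Y → ℝ) : ‖character c x‖ = 1 := by
  rw [character, mul_comm, Complex.norm_exp_ofReal_mul_I]

theorem measurable_character (c : Y →₀ ℝ) : Measurable (character c) := by
  unfold character
  simp only [Finsupp.linearCombination_apply, Finsupp.sum]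
  fun_prop

theorem character_add (c c' : Y →₀ ℝ) (x : Y → ℝ) :
    character (c + c') x = character c x * character c' x := by
  rw [character, character, character, ← Complex.exp_add, map_add, ofReal_add, mul_add]

theorem conj_character (c : Y →₀ ℝ) (x : Y → ℝ) :
    starRingEnd ℂ (character c x) = character (-c) x := by
  rw [character, character, ← exp_conj, map_mul, conj_I, conj_ofReal, map_neg, ofReal_neg]
  ring_nf

/-- A finite measure on a product of real lines is determined by the integrals of characters. -/
theorem ext_of_characters {ν₁ ν₂ : Measure (Y → ℝ)} [IsFiniteMeasure ν₁] [IsFiniteMeasure ν₂]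
    (h : ∀ c, ∫ x, character c x ∂ν₁ = ∫ x, character c x ∂ν₂) : ν₁ = ν₂ := by
  classical
  -- The characters are the characteristic functions of the finite-dimensional marginals, and a
  -- finite measure on the product is the projective limit of these.
  have key : ∀ J : Finset Y, ν₁.map J.restrict = ν₂.map J.restrict := by
    intro J
    have hm : Measurable (J.restrict : (Y → ℝ) → J → ℝ) := Finset.measurable_restrict J
    refine Measure.ext_of_charFunDual (funext fun L => ?_)
    rw [charFunDual_apply, charFunDual_apply, integral_map hm.aemeasurable (by fun_prop),
      integral_map hm.aemeasurable (by fun_prop)]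
    let c : Y →₀ ℝ := Finsupp.mapDomain Subtype.val
      (Finsupp.equivFunOnFinite.symm fun j : J => L (Pi.single j (1 : ℝ)))
    have hL : ∀ x : Y → ℝ, cexp (L (J.restrict x) * I) = character c x := by
      intro x
      rw [character, Finsupp.linearCombination_mapDomain, mul_comm]
      congr 3
      have h1 : J.restrict x = ∑ j : J, x j • (Pi.single j (1 : ℝ) : J → ℝ) := by
        funext j
        rw [Finset.sum_apply, Finset.sum_eq_single j]
        · simp
        · intro i _ hi
          simp [hi.symm]
        · simp
      rw [h1, map_sum, Finsupp.linearCombination_apply, Finsupp.sum_fintype _ _ (by simp)]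
      refine Finset.sum_congr rfl fun j _ => ?_
      rw [map_smul, smul_eq_mul, smul_eq_mul, mul_comm]
      rfl
    simp_rw [hL]
    exact h c
  have h2 : IsProjectiveLimit ν₂ fun J => ν₁.map J.restrict := fun J => (key J).symm
  have h1 : IsProjectiveLimit ν₁ fun J => ν₁.map J.restrict := fun J => rfl
  exact h1.unique h2

variable {Ω : Type} {m : MeasurableSpace Ω} [m0 : MeasurableSpace Ω] {μ : Measure Ω} [IsFiniteMeasure μ]

/-- The positive and the negative part of f, as densities, push forward under X to finite measures
with the same characters, hence to the same measure. -/
theorem setIntegral_eq_zero_of_characters_real {X : Ω → Y → ℝ} (hX : Measurable X) {f : Ω → ℝ}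
    (hf : Integrable f μ) (h : ∀ c, ∫ ω, (f ω : ℂ) * character c (X ω) ∂μ = 0)
    {B : Set (Y → ℝ)} (hB : MeasurableSet B) : ∫ ω in X ⁻¹' B, f ω ∂μ = 0 := by
  have hpos : ∀ g : Ω → ℝ, Integrable g μ → ∀ c,
      IsFiniteMeasure ((μ.withDensity fun ω => ENNReal.ofReal (g ω)).map X) ∧
      ∫ x, character c x ∂((μ.withDensity fun ω => ENNReal.ofReal (g ω)).map X)
        = ∫ ω, ((max (g ω) 0 : ℝ) : ℂ) * character c (X ω) ∂μ := by
    intro g hg c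
    have hfin : IsFiniteMeasure (μ.withDensity fun ω => ENNReal.ofReal (g ω)) :=
      isFiniteMeasure_withDensity_ofReal hg.2
    refine ⟨inferInstance, ?_⟩
    rw [integral_map hX.aemeasurable (measurable_character c).aestronglyMeasurable,
      integral_withDensity_eq_integral_toReal_smul₀ hg.1.aemeasurable.ennreal_ofReal (by simp)]
    refine integral_congr_ae (Filter.Eventually.of_forall fun ω => ?_)
    simp only [ENNReal.toReal_ofReal', real_smul]
  have hint : ∀ g : Ω → ℝ, Integrable g μ → ∀ c,
      Integrable (fun ω => ((max (g ω) 0 : ℝ) : ℂ) * character c (X ω)) μ := fun g hg c =>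
    hg.pos_part.ofReal.mul_bdd (c := 1) ((measurable_character c).comp hX).aestronglyMeasurable
      (Filter.Eventually.of_forall fun ω => (norm_character c _).le)
  have hfin1 := (hpos f hf 0).1
  have hfin2 := (hpos (fun ω => -f ω) hf.neg 0).1
  have heq : (μ.withDensity fun ω => ENNReal.ofReal (f ω)).map X
      = (μ.withDensity fun ω => ENNReal.ofReal (-f ω)).map X := by
    refine ext_of_characters fun c => ?_
    rw [(hpos f hf c).2, (hpos (fun ω => -f ω) hf.neg c).2, ← sub_eq_zero,
      ← integral_sub (hint f hf c) (hint (fun ω => -f ω) hf.neg c), ← h c]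
    refine integral_congr_ae (Filter.Eventually.of_forall fun ω => ?_)
    beta_reduce
    rw [← sub_mul, ← ofReal_sub]
    congr 2
    rcases le_total 0 (f ω) with h | h
    · rw [max_eq_left h, max_eq_right (by linarith), sub_zero]
    · rw [max_eq_right h, max_eq_left (by linarith), zero_sub, neg_neg]
  have h3 := congrArg (fun ν => ν B) heq
  beta_reduce at h3
  rw [Measure.map_apply hX hB, Measure.map_apply hX hB, withDensity_apply _ (hX hB),
    withDensity_apply _ (hX hB)] at h3
  rw [integral_eq_lintegral_pos_part_sub_lintegral_neg_part hf.integrableOn, h3, sub_self]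

/-- Conjugation sends a character to the one with index -c, so the hypothesis passes to the real and
imaginary parts. -/
theorem setIntegral_eq_zero_of_characters {X : Ω → Y → ℝ} (hX : Measurable X) {F : Ω → ℂ}
    (hF : Integrable F μ) (h : ∀ c, ∫ ω, F ω * character c (X ω) ∂μ = 0)
    {B : Set (Y → ℝ)} (hB : MeasurableSet B) : ∫ ω in X ⁻¹' B, F ω ∂μ = 0 := by
  have hint : ∀ {G : Ω → ℂ}, Integrable G μ → ∀ c, Integrable (fun ω => G ω * character c (X ω)) μ :=
    fun hG c => hG.mul_bdd (c := 1) ((measurable_character c).comp hX).aestronglyMeasurable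
      (Filter.Eventually.of_forall fun ω => (norm_character c _).le)
  have hFc : Integrable (fun ω => starRingEnd ℂ (F ω)) μ :=
    Complex.conjCLE.toContinuousLinearMap.integrable_comp hF
  have hconj : ∀ c, ∫ ω, starRingEnd ℂ (F ω) * character c (X ω) ∂μ = 0 := by
    intro c
    have h1 := congrArg (starRingEnd ℂ) (h (-c))
    rw [← integral_conj, map_zero] at h1
    rw [← h1]
    refine integral_congr_ae (Filter.Eventually.of_forall fun ω => ?_)
    beta_reduce
    rw [map_mul, conj_character, neg_neg]
  have hre : ∀ c, ∫ ω, ((F ω).re : ℂ) * character c (X ω) ∂μ = 0 := by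
    intro c
    have h1 : ∀ ω, ((F ω).re : ℂ) * character c (X ω) = (1 / 2 : ℂ) * (F ω * character c (X ω)
        + starRingEnd ℂ (F ω) * character c (X ω)) := fun ω => by
      rw [re_eq_add_conj]; ring
    simp_rw [h1]
    rw [integral_const_mul, integral_add (hint hF c) (hint hFc c), h, hconj, add_zero, mul_zero]
  have him : ∀ c, ∫ ω, ((F ω).im : ℂ) * character c (X ω) ∂μ = 0 := by
    intro c
    have h1 : ∀ ω, ((F ω).im : ℂ) * character c (X ω) = (1 / (2 * I) : ℂ) * (F ω * character c (X ω)
        - starRingEnd ℂ (F ω) * character c (X ω)) := fun ω => by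
      rw [im_eq_sub_conj]; ring
    simp_rw [h1]
    rw [integral_const_mul, integral_sub (hint hF c) (hint hFc c), h, hconj, sub_zero, mul_zero]
  rw [← integral_re_add_im hF.integrableOn]
  have e1 := setIntegral_eq_zero_of_characters_real hX hF.re hre hB
  have e2 := setIntegral_eq_zero_of_characters_real hX hF.im him hB
  rw [e1, e2]
  simp

/-- An `L²` function measurable with respect to real variables vanishes if it is orthogonal to their
characters. -/
theorem ae_eq_zero_of_characters {X : Ω → Y → ℝ} (hX : Measurable X) {F : Lp ℂ 2 μ}
    (hm : m ≤ MeasurableSpace.comap X MeasurableSpace.pi)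
    (hF : AEStronglyMeasurable[m] F μ)
    (h : ∀ c, ∫ ω, F ω * character c (X ω) ∂μ = 0) : F = 0 := by
  have hm0 : m ≤ m0 := hm.trans hX.comap_le
  have hint : Integrable F μ := (Lp.memLp F).integrable (by norm_num)
  refine (Lp.eq_zero_iff_ae_eq_zero).2 (Lp.ae_eq_zero_of_forall_setIntegral_eq_zero' ℂ hm0 F
    (by norm_num) (by norm_num) (fun s _ _ => hint.integrableOn) (fun s hs _ => ?_) hF)
  obtain ⟨B, hB, rfl⟩ := hm s hs
  exact setIntegral_eq_zero_of_characters hX hint h hB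

/-- An integrable function orthogonal to the characters of real variables is orthogonal to all
bounded functions of them. -/
theorem integral_mul_eq_zero_of_characters {X : Ω → Y → ℝ} (hX : Measurable X) {F : Ω → ℂ}
    (hF : Integrable F μ)
    (hm : m ≤ MeasurableSpace.comap X MeasurableSpace.pi)
    (h : ∀ c, ∫ ω, F ω * character c (X ω) ∂μ = 0) {b : Ω → ℂ} (hb : Measurable[m] b) {C : ℝ}
    (hC : ∀ ω, ‖b ω‖ ≤ C) : ∫ ω, b ω * F ω ∂μ = 0 := by
  have hm0 : m ≤ m0 := hm.trans hX.comap_le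
  have hbF : Integrable (fun ω => b ω * F ω) μ :=
    hF.bdd_mul (hb.mono hm0 le_rfl).aestronglyMeasurable (Filter.Eventually.of_forall hC)
  -- The conditional expectation of F vanishes, and the bounded measurable factor can be taken out
  -- of it.
  have h0 : μ[F|m] =ᵐ[μ] 0 := by
    refine (ae_eq_condExp_of_forall_setIntegral_eq hm0 hF (fun s _ _ => integrableOn_zero)
      (fun s hs _ => ?_) aestronglyMeasurable_zero).symm
    obtain ⟨B, hB, rfl⟩ := hm s hs
    rw [setIntegral_eq_zero_of_characters hX hF h hB]
    simp
  have h1 : μ[fun ω => b ω * F ω|m] =ᵐ[μ] fun ω => b ω * (μ[F|m]) ω :=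
    condExp_bilin_of_stronglyMeasurable_left (ContinuousLinearMap.mul ℝ ℂ)
      hb.stronglyMeasurable hbF hF
  rw [← integral_condExp hm0, integral_congr_ae h1]
  have h2 : (fun ω => b ω * (μ[F|m]) ω) =ᵐ[μ] 0 := by
    filter_upwards [h0] with ω hω
    rw [hω]
    simp
  rw [integral_congr_ae h2]
  simp

end Characters

theorem inner_linearCombination_congr {ι κ : Type*} {H K : Type*} [NormedAddCommGroup H]
    [InnerProductSpace ℂ H] [Module ℝ H] [IsScalarTower ℝ ℂ H] [NormedAddCommGroup K]
    [InnerProductSpace ℂ K] [Module ℝ K] [IsScalarTower ℝ ℂ K] {a : ι → H} {a' : κ → H}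
    {b : ι → K} {b' : κ → K} {c : ι →₀ ℝ} {c' : κ →₀ ℝ}
    (h : ∀ i ∈ c.support, ∀ j ∈ c'.support, inner ℂ (a i) (a' j) = inner ℂ (b i) (b' j)) :
    inner ℂ (Finsupp.linearCombination ℝ a c) (Finsupp.linearCombination ℝ a' c')
      = inner ℂ (Finsupp.linearCombination ℝ b c) (Finsupp.linearCombination ℝ b' c') := by
  simp only [Finsupp.linearCombination_apply, Finsupp.sum, sum_inner, inner_sum]
  refine Finset.sum_congr rfl fun i hi => Finset.sum_congr rfl fun j hj => ?_
  simp only [← algebraMap_smul ℂ (_ : ℝ), inner_smul_left, inner_smul_right, h j hj i hi]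

theorem conj_inner_linearCombination {ι κ : Type*} {H : Type*} [NormedAddCommGroup H]
    [InnerProductSpace ℂ H] [Module ℝ H] [IsScalarTower ℝ ℂ H] {a : ι → H} {a' : κ → H} {c : ι →₀ ℝ} {c' : κ →₀ ℝ}
    (h : ∀ i j, starRingEnd ℂ (inner ℂ (a i) (a' j)) = inner ℂ (a i) (a' j)) :
    starRingEnd ℂ (inner ℂ (Finsupp.linearCombination ℝ a c) (Finsupp.linearCombination ℝ a' c'))
      = inner ℂ (Finsupp.linearCombination ℝ a c) (Finsupp.linearCombination ℝ a' c') := by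
  simp only [Finsupp.linearCombination_apply, Finsupp.sum, sum_inner, inner_sum, map_sum]
  refine Finset.sum_congr rfl fun i _ => Finset.sum_congr rfl fun j _ => ?_
  simp only [← algebraMap_smul ℂ (_ : ℝ), inner_smul_left, inner_smul_right, map_mul, coe_algebraMap,
    conj_ofReal, h j i]

theorem Total.of_smul {ι κ : Type*} {H : Type*} [NormedAddCommGroup H] [InnerProductSpace ℂ H]
    {a : ι → H} {b : κ → H} (hb : Total b) (h : ∀ k, ∃ i, ∃ r : ℂ, b k = r • a i) : Total a := by
  intro x hx
  refine hb x fun k => ?_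
  obtain ⟨i, r, hr⟩ := h k
  rw [hr, inner_smul_left, hx, mul_zero]

/-! ### Exponentials of the Gaussian field -/

section Fields

variable {d : ℕ} {s β : ℝ}

theorem character_mapDomain {Y Z : Type} (e : Y → Z) (c : Y →₀ ℝ) (x : Z → ℝ) :
    character (Finsupp.mapDomain e c) x = character c fun y => x (e y) := by
  rw [character, character, Finsupp.linearCombination_mapDomain]
  rfl

theorem integral_character_path (c : TestFun d s β →₀ ℝ) :
    ∫ φ, character c φ ∂(pathMeasure d s β)
      = cexp (-((‖Finsupp.linearCombination ℝ (fun f : TestFun d s β => f.1) c‖ ^ 2 / 4 : ℝ) : ℂ)) := by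
  have h := (pathMeasure_spec d s β).2 c
  simp only [character, Finsupp.linearCombination_apply, Finsupp.sum, smul_eq_mul]
  rw [h]
  push_cast
  rfl

/-- The index `(t, g)` of the field `φ_t(g)`. -/
abbrev FieldIndex (d : ℕ) (s β : ℝ) : Type := ℝ × TimeZero d s β

/-- The values `φ_t(g)` of all the fields. -/
noncomputable def fields (φ : Path d s β) (y : FieldIndex d s β) : ℝ := φ (sharpTime y.1 y.2)

theorem measurable_fields : Measurable (fields (d := d) (s := s) (β := β)) := by
  unfold fields
  fun_prop

/-- The function `exp (i ∑ c φ_t(g))`. -/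
noncomputable def pathExp (c : FieldIndex d s β →₀ ℝ) (φ : Path d s β) : ℂ :=
  character c (fields φ)

theorem measurable_pathExp (c : FieldIndex d s β →₀ ℝ) : Measurable (pathExp c) :=
  (measurable_character c).comp measurable_fields

theorem norm_pathExp (c : FieldIndex d s β →₀ ℝ) (φ : Path d s β) : ‖pathExp c φ‖ = 1 :=
  norm_character _ _

theorem memLp_pathExp (c : FieldIndex d s β →₀ ℝ) :
    MemLp (pathExp c) 2 (pathMeasure d s β) :=
  MemLp.of_bound (measurable_pathExp c).aestronglyMeasurable 1
    (Filter.Eventually.of_forall fun φ => (norm_pathExp c φ).le)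

/-- The function `exp (i ∑ c φ_t(g))` in `L²`. -/
noncomputable def fieldVec (c : FieldIndex d s β →₀ ℝ) : Lp ℂ 2 (pathMeasure d s β) :=
  (memLp_pathExp c).toLp

theorem fieldVec_coeFn (c : FieldIndex d s β →₀ ℝ) :
    fieldVec c =ᵐ[pathMeasure d s β] pathExp c := (memLp_pathExp c).coeFn_toLp

/-- The test function `∑ c δ_t ⊗ g`. -/
noncomputable def testVec (c : FieldIndex d s β →₀ ℝ) : Lp ℂ 2 (covMeasure d s β) :=
  Finsupp.linearCombination ℝ (fun y : FieldIndex d s β => (sharpTime y.1 y.2).1) c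

theorem pathExp_add (c c' : FieldIndex d s β →₀ ℝ) (φ : Path d s β) :
    pathExp (c + c') φ = pathExp c φ * pathExp c' φ := character_add _ _ _

theorem conj_pathExp (c : FieldIndex d s β →₀ ℝ) (φ : Path d s β) :
    starRingEnd ℂ (pathExp c φ) = pathExp (-c) φ := conj_character _ _

theorem testVec_add (c c' : FieldIndex d s β →₀ ℝ) :
    testVec (c + c') = testVec c + testVec c' := map_add _ _ _

theorem testVec_neg (c : FieldIndex d s β →₀ ℝ) : testVec (-c) = -testVec c := map_neg _ _

theorem integral_pathExp (c : FieldIndex d s β →₀ ℝ) :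
    ∫ φ, pathExp c φ ∂(pathMeasure d s β) = cexp (-((‖testVec c‖ ^ 2 / 4 : ℝ) : ℂ)) := by
  have h := integral_character_path (c.mapDomain fun y : FieldIndex d s β => sharpTime y.1 y.2)
  simp only [character_mapDomain, Finsupp.linearCombination_mapDomain] at h
  exact h

theorem inner_fieldVec (c c' : FieldIndex d s β →₀ ℝ) :
    inner ℂ (fieldVec c) (fieldVec c') = cexp (-((‖testVec c' - testVec c‖ ^ 2 / 4 : ℝ) : ℂ)) := by
  rw [sub_eq_add_neg, ← testVec_neg, ← testVec_add, ← integral_pathExp, inner_eq_integral]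
  refine integral_congr_ae ?_
  filter_upwards [fieldVec_coeFn c, fieldVec_coeFn c'] with φ h1 h2
  rw [h1, h2, conj_pathExp, pathExp_add, mul_comm]

/-- The field is almost surely linear in the test function. -/
theorem pathExp_ae_eq {c c' : FieldIndex d s β →₀ ℝ} (h : testVec c = testVec c') :
    pathExp c =ᵐ[pathMeasure d s β] pathExp c' := by
  -- Equal test functions give distance zero in L², by the formula for the inner products.
  have h1 : fieldVec c = fieldVec c' := by
    rw [← sub_eq_zero, ← inner_self_eq_zero (𝕜 := ℂ), inner_sub_left, inner_sub_right,
      inner_sub_right]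
    simp only [inner_fieldVec, h, sub_self]
  have h2 := fieldVec_coeFn c
  rw [h1] at h2
  exact h2.symm.trans (fieldVec_coeFn c')

variable [hd : Fact (0 < d)] [hs : Fact (0 < s)] [hβ : Fact (0 < β)]

theorem inner_translate (t : ℝ) (f g : TestFun d s β) :
    inner ℂ (translate t f).1 (translate t g).1 = inner ℂ f.1 g.1 := by
  rw [inner_eq_integral, inner_eq_integral]
  refine integral_congr_ae ?_
  filter_upwards [translate_coeFn t f, translate_coeFn t g] with p h1 h2
  rw [h1, h2, map_mul, mul_mul_mul_comm, conj_cexp_neg, ← Complex.exp_add]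
  simp

theorem measurable_translatePath (t : ℝ) :
    Measurable (translatePath t : Path d s β → Path d s β) := by
  unfold translatePath
  fun_prop

/-- A translation is a phase in the frequency variable, so it preserves the covariance, and the
characters determine the law. -/
theorem measurePreserving_translatePath (t : ℝ) :
    MeasurePreserving (translatePath t) (pathMeasure d s β) (pathMeasure d s β) := by
  refine ⟨measurable_translatePath t, ?_⟩
  have : IsFiniteMeasure ((pathMeasure d s β).map (translatePath t)) :=
    Measure.isFiniteMeasure_map _ _
  refine ext_of_characters fun c => ?_
  rw [integral_map (measurable_translatePath t).aemeasurable
    (measurable_character c).aestronglyMeasurable]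
  have h := integral_character_path (c.mapDomain fun f : TestFun d s β => translate t f)
  simp only [character_mapDomain, Finsupp.linearCombination_mapDomain] at h
  refine h.trans ?_
  have h2 := inner_linearCombination_congr (c := c) (c' := c)
    (a := fun f : TestFun d s β => (translate t f).1) (a' := fun f : TestFun d s β => (translate t f).1)
    (b := fun f : TestFun d s β => f.1) (b' := fun f : TestFun d s β => f.1)
    fun i _ j _ => inner_translate t i j
  rw [integral_character_path, ofReal_div, ofReal_div, ofReal_norm_sq_eq_inner,
    ofReal_norm_sq_eq_inner]
  exact congrArg (fun z => cexp (-(z / _))) h2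

/-- The translation of field indices in time. -/
noncomputable def shift (t : ℝ) (c : FieldIndex d s β →₀ ℝ) : FieldIndex d s β →₀ ℝ :=
  c.mapDomain fun y => (t + y.1, y.2)

theorem pathExp_translatePath (t : ℝ) (c : FieldIndex d s β →₀ ℝ) (φ : Path d s β) :
    pathExp c (translatePath t φ) = pathExp (shift t c) φ := by
  rw [pathExp, pathExp, shift, character_mapDomain]
  congr 1
  funext y
  rw [fields, fields, translatePath, translate_sharpTime]

theorem translateL2_coeFn (t : ℝ) (F : Lp ℂ 2 (pathMeasure d s β)) :
    translateL2 t F =ᵐ[pathMeasure d s β] fun φ => F (translatePath t φ) :=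
  toL2_coeFn _ ((Lp.memLp F).comp_measurePreserving (measurePreserving_translatePath t))

theorem translateL2_eq (t : ℝ) (F : Lp ℂ 2 (pathMeasure d s β)) :
    translateL2 t F = Lp.compMeasurePreservingₗᵢ ℂ _ (measurePreserving_translatePath t) F :=
  Lp.ext ((translateL2_coeFn t F).trans
    (Lp.coeFn_compMeasurePreserving F (measurePreserving_translatePath t)).symm)

theorem translateL2_fieldVec (t : ℝ) (c : FieldIndex d s β →₀ ℝ) :
    translateL2 t (fieldVec c) = fieldVec (shift t c) := by
  apply Lp.ext
  filter_upwards [translateL2_coeFn t (fieldVec c), fieldVec_coeFn (shift t c),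
    (measurePreserving_translatePath t).quasiMeasurePreserving.ae (fieldVec_coeFn c)] with φ h1 h2 h3
  rw [h1, h2, h3, pathExp_translatePath]

/-- The combinations of field indices with times in `T`. -/
noncomputable def timesIn (d : ℕ) (s β : ℝ) (T : Set ℝ) : Submodule ℝ (FieldIndex d s β →₀ ℝ) :=
  Finsupp.supported ℝ ℝ {y | y.1 ∈ T}

theorem single_mem_timesIn {T : Set ℝ} {t : ℝ} (ht : t ∈ T) (g : TimeZero d s β) (r : ℝ) :
    Finsupp.single (t, g) r ∈ timesIn d s β T := Finsupp.single_mem_supported ℝ r ht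

theorem fst_mem_of_mem_timesIn {T : Set ℝ} {c : FieldIndex d s β →₀ ℝ} (hc : c ∈ timesIn d s β T)
    {y : FieldIndex d s β} (hy : y ∈ c.support) : y.1 ∈ T :=
  (Finsupp.mem_supported ℝ c).1 hc hy

theorem shift_mem_timesIn {T T' : Set ℝ} {t : ℝ} (h : ∀ t' ∈ T, t + t' ∈ T')
    {c : FieldIndex d s β →₀ ℝ} (hc : c ∈ timesIn d s β T) : shift t c ∈ timesIn d s β T' := by
  classical
  refine (Finsupp.mem_supported ℝ _).2 fun y hy => ?_
  obtain ⟨y', hy', rfl⟩ := Finset.mem_image.1 (Finsupp.mapDomain_support hy)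
  exact h _ (fst_mem_of_mem_timesIn hc hy')

theorem expField_translatePath (t : ℝ) (g : TimeZero d s β) (φ : Path d s β) :
    expField g (translatePath t φ) = cexp (I * (φ (sharpTime t g) : ℂ)) := by
  rw [expField, translatePath, translate_sharpTime, add_zero]

theorem pathExp_single_one (t : ℝ) (g : TimeZero d s β) (φ : Path d s β) :
    pathExp (Finsupp.single (t, g) 1) φ = cexp (I * (φ (sharpTime t g) : ℂ)) := by
  rw [pathExp, character, Finsupp.linearCombination_single, one_smul, fields]

theorem sharpTime_smul (t r : ℝ) (g : TimeZero d s β) :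
    (sharpTime t (r • g)).1 = r • (sharpTime t g).1 := by
  apply Lp.ext
  filter_upwards [sharpTime_coeFn t (r • g), sharpTime_coeFn t g,
    Lp.coeFn_smul r (sharpTime t g).1, ae_covMeasure_of_thermalMeasure (Lp.coeFn_smul r g.1)]
    with p h1 h2 h3 h4
  rw [h1, h3, Pi.smul_apply, h2, sharpFun, sharpFun, Submodule.coe_smul, h4, Pi.smul_apply,
    real_smul, real_smul]
  ring

/-- The σ-algebra is generated by exponentials of the fields with coefficient one. A real
coefficient r is absorbed since rφ_t(g) = φ_t(rg) almost surely; measurability therefore holds only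
up to null sets. -/
theorem aestronglyMeasurable_pathExp {T : Set ℝ} {c : FieldIndex d s β →₀ ℝ}
    (hc : c ∈ timesIn d s β T) :
    AEStronglyMeasurable[sigmaTimes d s β T] (pathExp c) (pathMeasure d s β) := by
  classical
  induction c using Finsupp.induction with
  | zero =>
    have h : pathExp (0 : FieldIndex d s β →₀ ℝ) = fun _ => 1 := by
      funext φ
      simp [pathExp, character]
    rw [h]
    exact aestronglyMeasurable_const
  | single_add y r c hy hr ih =>
    have hs : y.1 ∈ T := by
      refine fst_mem_of_mem_timesIn hc (Finsupp.mem_support_iff.2 ?_)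
      rw [Finsupp.add_apply, Finsupp.single_eq_same, Finsupp.notMem_support_iff.1 hy, add_zero]
      exact hr
    have hc' : c ∈ timesIn d s β T := by
      have h1 := (timesIn d s β T).sub_mem hc (single_mem_timesIn hs y.2 r)
      rwa [Prod.mk.eta, add_sub_cancel_left] at h1
    have h1 : pathExp (Finsupp.single y r) =ᵐ[pathMeasure d s β]
        pathExp (Finsupp.single (y.1, r • y.2) 1) := by
      refine pathExp_ae_eq ?_
      rw [testVec, testVec, Finsupp.linearCombination_single, Finsupp.linearCombination_single,
        one_smul, sharpTime_smul]
    have h2 : Measurable[sigmaTimes d s β T] (pathExp (Finsupp.single (y.1, r • y.2) (1 : ℝ))) := by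
      have h3 : pathExp (Finsupp.single (y.1, r • y.2) (1 : ℝ))
          = expField (r • y.2) ∘ translatePath y.1 := by
        funext φ
        rw [pathExp_single_one, Function.comp_apply, expField_translatePath]
      rw [h3]
      have h4 : Measurable[sigmaZero d s β] (expField (r • y.2)) :=
        Measurable.of_comap_le (le_iSup (fun g : TimeZero d s β =>
          MeasurableSpace.comap (expField g) inferInstance) (r • y.2))
      refine h4.comp (Measurable.of_comap_le ?_)
      exact le_iSup₂ (f := fun t (_ : t ∈ T) =>
        MeasurableSpace.comap (translatePath t) (sigmaZero d s β)) y.1 hs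
    have h5 : pathExp (Finsupp.single y r + c)
        = fun φ => pathExp (Finsupp.single y r) φ * pathExp c φ :=
      funext fun φ => pathExp_add _ _ _
    rw [h5]
    exact (h2.stronglyMeasurable.aestronglyMeasurable.congr h1.symm).mul (ih hc')

theorem fieldVec_mem {T : Set ℝ} {c : FieldIndex d s β →₀ ℝ} (hc : c ∈ timesIn d s β T) :
    fieldVec c ∈ lpMeas ℂ ℂ (sigmaTimes d s β T) 2 (pathMeasure d s β) := by
  rw [mem_lpMeas_iff_aestronglyMeasurable]
  exact (aestronglyMeasurable_pathExp hc).congr (fieldVec_coeFn c).symm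

/-- The fields at times in `T`. -/
noncomputable def fieldsIn (T : Set ℝ) (φ : Path d s β) (y : T × TimeZero d s β) : ℝ :=
  φ (sharpTime y.1 y.2)

theorem measurable_fieldsIn (T : Set ℝ) :
    Measurable (fieldsIn T : Path d s β → T × TimeZero d s β → ℝ) := by
  unfold fieldsIn
  fun_prop

theorem sigmaTimes_le_comap (T : Set ℝ) :
    sigmaTimes d s β T ≤ MeasurableSpace.comap (fieldsIn T) MeasurableSpace.pi := by
  refine iSup₂_le fun t ht => ?_
  rw [sigmaZero, MeasurableSpace.comap_iSup]
  refine iSup_le fun g => ?_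
  rw [MeasurableSpace.comap_comp]
  have h : expField g ∘ translatePath t
      = (fun x : T × TimeZero d s β → ℝ => cexp (I * (x (⟨t, ht⟩, g) : ℂ))) ∘ fieldsIn T := by
    funext φ
    rw [Function.comp_apply, Function.comp_apply, expField_translatePath, fieldsIn]
  rw [h, ← MeasurableSpace.comap_comp]
  refine MeasurableSpace.comap_mono (Measurable.comap_le ?_)
  fun_prop

theorem sigmaZero_le_comap :
    sigmaZero d s β ≤ MeasurableSpace.comap (fieldsIn {0}) MeasurableSpace.pi := by
  refine iSup_le fun g => ?_
  have h : expField g = (fun x : ({0} : Set ℝ) × TimeZero d s β → ℝ =>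
      cexp (I * (x (⟨0, rfl⟩, g) : ℂ))) ∘ fieldsIn {0} := rfl
  rw [h, ← MeasurableSpace.comap_comp]
  refine MeasurableSpace.comap_mono (Measurable.comap_le ?_)
  fun_prop

/-- The index of the fields at times in `T`. -/
noncomputable def restrictIndex {T : Set ℝ} (c : T × TimeZero d s β →₀ ℝ) :
    FieldIndex d s β →₀ ℝ := c.mapDomain fun y => ((y.1 : ℝ), y.2)

theorem restrictIndex_mem {T : Set ℝ} (c : T × TimeZero d s β →₀ ℝ) :
    restrictIndex c ∈ timesIn d s β T := by
  classical
  refine (Finsupp.mem_supported ℝ _).2 fun y hy => ?_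
  obtain ⟨y', _, rfl⟩ := Finset.mem_image.1 (Finsupp.mapDomain_support hy)
  exact y'.1.2

theorem pathExp_restrictIndex {T : Set ℝ} (c : T × TimeZero d s β →₀ ℝ) (φ : Path d s β) :
    pathExp (restrictIndex c) φ = character c (fieldsIn T φ) := by
  rw [pathExp, restrictIndex, character_mapDomain]
  rfl

/-- Orthogonality to the exponentials is orthogonality to all characters of the fields at these
times, with the sign of the index changed by the conjugation in the inner product. -/
theorem total_fieldVec (T : Set ℝ) : Total fun c : timesIn d s β T =>
    (⟨fieldVec c.1, fieldVec_mem c.2⟩ :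
      lpMeas ℂ ℂ (sigmaTimes d s β T) 2 (pathMeasure d s β)) := by
  intro F hF
  apply Subtype.ext
  refine ae_eq_zero_of_characters (measurable_fieldsIn T) (sigmaTimes_le_comap T)
    ((mem_lpMeas_iff_aestronglyMeasurable).1 F.2) fun c => ?_
  have h1 : inner ℂ (fieldVec (-restrictIndex c)) F.1 = 0 :=
    hF ⟨-restrictIndex c, (timesIn d s β T).neg_mem (restrictIndex_mem c)⟩
  rw [inner_eq_integral] at h1
  rw [← h1]
  refine integral_congr_ae ?_
  filter_upwards [fieldVec_coeFn (-restrictIndex c)] with φ h2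
  rw [h2, conj_pathExp, neg_neg, pathExp_restrictIndex, mul_comm]

end Fields

/-! ### The Euclidean unitary -/

section Euclidean

variable {d : ℕ} {s β : ℝ} [hd : Fact (0 < d)] [hs : Fact (0 < s)] [hβ : Fact (0 < β)]

/-- The nearest time in `[0, β / 2]`. -/
noncomputable def timeOf (t : ℝ) : Set.Icc (0 : ℝ) (β / 2) :=
  Set.projIcc 0 (β / 2) (half_pos hβ.out).le t

theorem timeOf_coe (t : Set.Icc (0 : ℝ) (β / 2)) : timeOf (t : ℝ) = t := Set.projIcc_val _ t

theorem timeOf_of_mem {t : ℝ} (ht : t ∈ Set.Icc 0 (β / 2)) : timeOf t = ⟨t, ht⟩ :=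
  Set.projIcc_of_mem _ ht

/-- The vector `∑ c e^{-tε̃} v_g`. -/
noncomputable def waveVec (c : FieldIndex d s β →₀ ℝ) : Lp ℂ 2 (awMeasure d s) :=
  Finsupp.linearCombination ℝ (fun y : FieldIndex d s β => timeVec (timeOf y.1) y.2.1) c

theorem waveVec_add (c c' : FieldIndex d s β →₀ ℝ) :
    waveVec (c + c') = waveVec c + waveVec c' := map_add _ _ _

theorem waveVec_neg (c : FieldIndex d s β →₀ ℝ) : waveVec (-c) = -waveVec c := map_neg _ _

theorem waveVec_single (t : Set.Icc (0 : ℝ) (β / 2)) (g : TimeZero d s β) :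
    waveVec (Finsupp.single ((t : ℝ), g) 1) = timeVec t g.1 := by
  rw [waveVec, Finsupp.linearCombination_single, one_smul, timeOf_coe]

theorem pair_subset_Icc : ({0, β / 2} : Set ℝ) ⊆ Set.Icc 0 (β / 2) := by
  have h := (half_pos hβ.out).le
  rintro t (rfl | rfl)
  · exact ⟨le_rfl, h⟩
  · exact ⟨h, le_rfl⟩

theorem timesIn_mono {T T' : Set ℝ} (h : T ⊆ T') : timesIn d s β T ≤ timesIn d s β T' :=
  Finsupp.supported_mono fun _ hy => h hy

/-- One argument must be restricted to the times 0 and β/2, because the covariance depends on the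
difference of the times and the inner product in the Fock exponent on their sum. -/
theorem inner_testVec {c c' : FieldIndex d s β →₀ ℝ} (hc : c ∈ timesIn d s β {0, β / 2})
    (hc' : c' ∈ timesIn d s β (Set.Icc 0 (β / 2))) :
    inner ℂ (testVec c) (testVec c') = inner ℂ (waveVec c) (waveVec c') := by
  refine inner_linearCombination_congr fun y hy y' hy' => ?_
  have h1 := fst_mem_of_mem_timesIn hc hy
  have h2 := fst_mem_of_mem_timesIn hc' hy'
  rw [timeOf_of_mem (pair_subset_Icc h1), timeOf_of_mem h2]
  refine inner_sharpTime_eq (t := ⟨y.1, pair_subset_Icc h1⟩) (t' := ⟨y'.1, h2⟩) ?_ y.2 y'.2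
  rcases h1 with h | h
  · exact Or.inl (Subtype.ext h)
  · exact Or.inr (Subtype.ext h)

theorem conj_inner_waveVec (c c' : FieldIndex d s β →₀ ℝ) :
    starRingEnd ℂ (inner ℂ (waveVec c) (waveVec c')) = inner ℂ (waveVec c) (waveVec c') :=
  conj_inner_linearCombination fun y y' => conj_inner_timeVec _ _ y.2.2 y'.2.2

theorem inner_testVec' {c c' : FieldIndex d s β →₀ ℝ} (hc : c ∈ timesIn d s β {0, β / 2})
    (hc' : c' ∈ timesIn d s β (Set.Icc 0 (β / 2))) :
    inner ℂ (testVec c') (testVec c) = inner ℂ (waveVec c) (waveVec c') := by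
  rw [← inner_conj_symm, inner_testVec hc hc', conj_inner_waveVec]

/-- The image of `E exp (i ∑ c φ_t(g))` in the Araki-Woods Fock space. -/
noncomputable def fockVec (c : FieldIndex d s β →₀ ℝ) : AWFock d s :=
  cexp (-((‖testVec c‖ ^ 2 / 4 : ℝ) : ℂ)) • expVec (awMeasure d s) ((I / √2 : ℂ) • waveVec c)

/-- Both sides are Gaussian. The prefactors give the two squared norms, and |i/√2|² = 1/2 produces
the mixed term of -‖f' - f‖²/4, where the reality of the covariance is used. -/
theorem inner_fockVec {c c' : FieldIndex d s β →₀ ℝ} (hc : c ∈ timesIn d s β {0, β / 2})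
    (hc' : c' ∈ timesIn d s β (Set.Icc 0 (β / 2))) :
    inner ℂ (fockVec c) (fockVec c') = inner ℂ (fieldVec c) (fieldVec c') := by
  rw [inner_fieldVec, fockVec, fockVec, Fock.inner_smul_left, Fock.inner_smul_right, inner_expVec,
    ← exp_conj, map_neg, conj_ofReal, ← Complex.exp_add, ← Complex.exp_add, inner_smul_left,
    inner_smul_right, conj_I_div_sqrt_two, ofReal_div, ofReal_div, ofReal_div,
    ofReal_norm_sq_eq_inner, ofReal_norm_sq_eq_inner, ofReal_norm_sq_eq_inner, inner_sub_left,
    inner_sub_right, inner_sub_right, inner_testVec hc hc', inner_testVec' hc hc']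
  congr 1
  have h := I_div_sqrt_two_sq
  push_cast at h ⊢
  linear_combination (-(inner ℂ (waveVec c) (waveVec c'))) * h

theorem exists_waveVec_of_mem {t : Set.Icc (0 : ℝ) (β / 2)} {n : ℕ} {v : Lp ℂ 2 (awMeasure d s)}
    (hv : v ∈ hermFamily d s β t n) : ∃ c ∈ timesIn d s β {0, (t : ℝ)}, v = waveVec c := by
  obtain ⟨_, ⟨g, hg, rfl⟩, _, ⟨g', hg', rfl⟩, rfl⟩ := Submodule.mem_sup.1 hv
  refine ⟨Finsupp.single ((timeZero : Set.Icc (0 : ℝ) (β / 2)).1, ⟨g, hg.1⟩) 1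
    + Finsupp.single ((t : ℝ), ⟨g', hg'.1⟩) 1, Submodule.add_mem _
      (single_mem_timesIn (Or.inl rfl) _ _) (single_mem_timesIn (Or.inr rfl) _ _), ?_⟩
  rw [waveVec_add, waveVec_single, waveVec_single]

/-- The exponents of the coherent vectors of hermitian functions at the times `0` and `t`. -/
noncomputable def coherentFamily (d : ℕ) (s β : ℝ) [Fact (0 < d)] [Fact (0 < s)] [Fact (0 < β)]
    (t : Set.Icc (0 : ℝ) (β / 2)) (n : ℕ) : Submodule ℝ (Lp ℂ 2 (awMeasure d s)) :=
  (hermFamily d s β t n).map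
    ((I / (√2 : ℝ) : ℂ) • (LinearMap.id : Lp ℂ 2 (awMeasure d s) →ₗ[ℝ] Lp ℂ 2 (awMeasure d s)))

theorem isTestFamily_coherentFamily {t : Set.Icc (0 : ℝ) (β / 2)} (ht : 0 < (t : ℝ)) :
    IsTestFamily (awMeasure d s) (awShell d s) (coherentFamily d s β t) :=
  (isTestFamily_hermFamily ht).map_smul I_div_sqrt_two_ne_zero

theorem exists_waveVec_of_mem_coherent {t : Set.Icc (0 : ℝ) (β / 2)} {n : ℕ}
    {v : Lp ℂ 2 (awMeasure d s)} (hv : v ∈ coherentFamily d s β t n) :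
    ∃ c ∈ timesIn d s β {0, (t : ℝ)}, v = (I / (√2 : ℝ) : ℂ) • waveVec c := by
  obtain ⟨w, hw, rfl⟩ := hv
  obtain ⟨c, hc, rfl⟩ := exists_waveVec_of_mem hw
  exact ⟨c, hc, rfl⟩

theorem expVec_eq_smul_fockVec (c : FieldIndex d s β →₀ ℝ) :
    expVec (awMeasure d s) ((I / √2 : ℂ) • waveVec c)
      = cexp ((‖testVec c‖ ^ 2 / 4 : ℝ) : ℂ) • fockVec c := by
  rw [fockVec, smul_smul, ← Complex.exp_add, add_neg_cancel, Complex.exp_zero, one_smul]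

/-- The unitary itself uses the times 0 and β/2. The proof works for 0 and any second positive time,
as does the test family behind it. -/
theorem total_fockVec_of_pos {t : Set.Icc (0 : ℝ) (β / 2)} (ht : 0 < (t : ℝ)) :
    Total fun c : timesIn d s β {0, (t : ℝ)} => fockVec c.1 := by
  refine ((isTestFamily_coherentFamily ht).total isExhaustion_awShell).of_smul ?_
  rintro ⟨v, n, hv⟩
  obtain ⟨c, hc, rfl⟩ := exists_waveVec_of_mem_coherent hv
  exact ⟨⟨c, hc⟩, _, expVec_eq_smul_fockVec c⟩

theorem total_fockVec : Total fun c : timesIn d s β {0, β / 2} => fockVec c.1 :=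
  total_fockVec_of_pos (t := timeHalf) (half_pos hβ.out)

/-- The coherent vectors of the physical Hilbert space. -/
noncomputable def physVec (c : timesIn d s β {0, β / 2}) : Phys d s β :=
  ⟨fieldVec c.1, fieldVec_mem c.2⟩

theorem total_physVec : Total (physVec : timesIn d s β {0, β / 2} → Phys d s β) :=
  total_fieldVec {0, β / 2}

theorem exists_euclid : ∃ T : Phys d s β ≃ₗᵢ[ℂ] AWFock d s, ∀ c, T (physVec c) = fockVec c.1 :=
  exists_unitary_of_inner_eq total_physVec total_fockVec fun c c' =>
    inner_fockVec c.2 (timesIn_mono pair_subset_Icc c'.2)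

variable (d s β) in
/-- The Euclidean unitary. -/
noncomputable def euclid : Phys d s β ≃ₗᵢ[ℂ] AWFock d s := exists_euclid.choose

theorem euclid_physVec (c : timesIn d s β {0, β / 2}) :
    euclid d s β (physVec c) = fockVec c.1 := exists_euclid.choose_spec c

theorem inner_physExp (x : Phys d s β) (F : Lp ℂ 2 (pathMeasure d s β)) :
    inner ℂ x (physExp d s β F) = inner ℂ x.1 F := by
  have : Fact (sigmaTimes d s β {0, β / 2} ≤ MeasurableSpace.pi) := ⟨sigmaTimes_le d s β _⟩
  exact Submodule.inner_orthogonalProjectionOnto_eq_of_mem_left x F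

/-- Against coherent vectors at the times 0 and β/2 the conditional expectation drops out, and
`inner_fockVec` allows all intermediate times in the other argument. -/
theorem euclid_physExp {c : FieldIndex d s β →₀ ℝ} (hc : c ∈ timesIn d s β (Set.Icc 0 (β / 2))) :
    euclid d s β (physExp d s β (fieldVec c)) = fockVec c := by
  refine (total_fockVec (d := d) (s := s) (β := β)).eq_of_forall fun c' => ?_
  rw [← euclid_physVec, LinearIsometryEquiv.inner_map_map, inner_physExp, euclid_physVec,
    inner_fockVec c'.2 hc]
  rfl

theorem fockVec_zero : fockVec (0 : FieldIndex d s β →₀ ℝ) = vacuum (awMeasure d s) := by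
  have h1 : testVec (0 : FieldIndex d s β →₀ ℝ) = 0 := map_zero _
  have h2 : waveVec (0 : FieldIndex d s β →₀ ℝ) = 0 := map_zero _
  rw [fockVec, h1, h2, smul_zero, expVec_zero]
  simp

theorem fieldVec_zero :
    fieldVec (0 : FieldIndex d s β →₀ ℝ) = Lp.const 2 (pathMeasure d s β) (1 : ℂ) := by
  apply Lp.ext
  filter_upwards [fieldVec_coeFn (0 : FieldIndex d s β →₀ ℝ),
    Lp.coeFn_const 2 (pathMeasure d s β) (1 : ℂ)] with φ h1 h2
  rw [h1, h2]
  simp [pathExp, character]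

theorem mapsVacuum_euclid : MapsVacuum (euclid d s β) := by
  rw [MapsVacuum, ← fockVec_zero (β := β), ← euclid_physVec ⟨0, Submodule.zero_mem _⟩]
  congr 1
  exact Subtype.ext fieldVec_zero.symm

/-- The prefactor of the Weyl operator supplies the squared norm of c and, through (i/√2)² = -1/2,
the mixed term of the normalisation of c + c'. -/
theorem weylL_fockVec {c c' : FieldIndex d s β →₀ ℝ} (hc : c ∈ timesIn d s β {0, β / 2})
    (hc' : c' ∈ timesIn d s β (Set.Icc 0 (β / 2))) :
    weylL (awMeasure d s) (waveVec c) (fockVec c') = fockVec (c + c') := by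
  rw [fockVec, fockVec, map_smul, weylL_expVec, weylExp, smul_smul, ← Complex.exp_add, waveVec_add,
    smul_add, add_comm ((I / √2 : ℂ) • waveVec c), testVec_add, ofReal_div, ofReal_div,
    ofReal_norm_sq_eq_inner, ofReal_norm_sq_eq_inner, inner_add_left, inner_add_right,
    inner_add_right, inner_testVec hc hc', inner_testVec' hc hc',
    inner_testVec hc (timesIn_mono pair_subset_Icc hc), inner_smul_right]
  congr 2
  have h := I_div_sqrt_two_sq
  push_cast at h ⊢
  linear_combination (inner ℂ (waveVec c) (waveVec c')) * h

theorem awWeyl_eq (h : Lp ℂ 2 (thermalMeasure d s β)) :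
    awWeyl h = weylL (awMeasure d s) (timeVec timeZero h) := by
  rw [awWeyl, weyl_eq, awVector_eq]

theorem inner_weylL_left (f : Lp ℂ 2 (awMeasure d s)) (x y : AWFock d s) :
    inner ℂ x (weylL (awMeasure d s) f y) = inner ℂ (weylL (awMeasure d s) (-f) x) y := by
  rw [← adjoint_weylL, ContinuousLinearMap.adjoint_inner_left]

theorem expField_eq (g : TimeZero d s β) (φ : Path d s β) :
    expField g φ = pathExp (Finsupp.single (0, g) 1) φ := by
  rw [pathExp_single_one, expField]

/-- The unitary maps multiplication by `exp (i ∑ c φ_t(g))` to a Weyl operator. -/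
theorem exists_mul_pathExp (e : timesIn d s β {0, β / 2}) (F : Phys d s β) : ∃ G : Phys d s β,
    G.1 =ᵐ[pathMeasure d s β] (fun φ => pathExp e.1 φ * F.1 φ) ∧
      euclid d s β G = weylL (awMeasure d s) (waveVec e.1) (euclid d s β F) := by
  have hmem : MemLp (fun φ => pathExp e.1 φ * F.1 φ) 2 (pathMeasure d s β) := by
    refine MemLp.of_le (Lp.memLp F.1) (AEStronglyMeasurable.mul
      (measurable_pathExp _).aestronglyMeasurable (Lp.aestronglyMeasurable F.1))
      (Filter.Eventually.of_forall fun φ => ?_)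
    rw [norm_mul, norm_pathExp, one_mul]
  have hsm : hmem.toLp ∈ lpMeas ℂ ℂ (sigmaTimes d s β {0, β / 2}) 2 (pathMeasure d s β) := by
    rw [mem_lpMeas_iff_aestronglyMeasurable]
    refine AEStronglyMeasurable.congr ?_ hmem.coeFn_toLp.symm
    exact AEStronglyMeasurable.mul (aestronglyMeasurable_pathExp e.2)
      (mem_lpMeas_iff_aestronglyMeasurable.1 F.2)
  refine ⟨⟨hmem.toLp, hsm⟩, hmem.coeFn_toLp,
    (total_fockVec (d := d) (s := s) (β := β)).eq_of_forall fun c => ?_⟩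
  rw [inner_weylL_left, ← waveVec_neg, weylL_fockVec ((timesIn d s β _).neg_mem e.2)
    (timesIn_mono pair_subset_Icc c.2), ← euclid_physVec, LinearIsometryEquiv.inner_map_map]
  have h2 : fockVec (-e.1 + c.1) = euclid d s β (physVec (-e + c)) := (euclid_physVec (-e + c)).symm
  rw [h2, LinearIsometryEquiv.inner_map_map]
  change inner ℂ (fieldVec c.1) hmem.toLp = inner ℂ (fieldVec (-e.1 + c.1)) F.1
  rw [inner_eq_integral, inner_eq_integral]
  refine integral_congr_ae ?_
  filter_upwards [fieldVec_coeFn c.1, fieldVec_coeFn (-e.1 + c.1), hmem.coeFn_toLp] with φ h3 h4 h5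
  rw [h3, h4, h5, pathExp_add, map_mul, conj_pathExp (-e.1), neg_neg]
  ring

theorem intertwinesFields_euclid : IntertwinesFields (euclid d s β) := by
  intro g F
  obtain ⟨G, h1, h2⟩ := exists_mul_pathExp
    ⟨Finsupp.single (0, g) 1, single_mem_timesIn (Or.inl rfl) g 1⟩ F
  refine ⟨G, ?_, ?_⟩
  · filter_upwards [h1] with φ h3
    rw [h3, expField_eq]
  · rw [h2, awWeyl_eq]
    congr 2
    exact waveVec_single timeZero g

end Euclidean

/-! ### Differentiating the semigroup of a second quantisation -/

section Decay

variable {M : Type} [MeasurableSpace M] {m : Measure M} [SigmaFinite m] {a : M → ℝ}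

theorem mulFun_exp_zero (v : Lp ℂ 2 m) :
    mulFun m (fun x => (Real.exp (-(0 : ℝ) * a x) : ℂ)) v = v := by
  have h : (fun x => (Real.exp (-(0 : ℝ) * a x) : ℂ) * v x) = v := by
    funext x
    simp
  refine Lp.ext ((mulFun_coeFn_of_memLp ?_).trans ?_)
  · rw [h]; exact Lp.memLp v
  · rw [h]

theorem hasDerivAt_expVec_decay (ha : Measurable a) {B : Set M} {v : Lp ℂ 2 m}
    (hv : v ∈ suppIn m B) {C : ℝ} (hC : ∀ x ∈ B, |a x| ≤ C) :
    HasDerivAt (fun t : ℝ => expVec m (mulFun m (fun x => (Real.exp (-t * a x) : ℂ)) v))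
      (-dExpVec m v (mulFun m (fun x => (a x : ℂ)) v)) 0 := by
  have h1 := hasDerivAt_expVec m (hasDerivAt_mulFun_exp ha hv hC (-1))
  have h3 : ∀ t : ℝ, (fun x => cexp (t * (-1) * a x)) = fun x => (Real.exp (-t * a x) : ℂ) := by
    intro t
    funext x
    push_cast
    ring_nf
  simp_rw [h3] at h1
  rw [mulFun_exp_zero, dExpVec_smul, neg_one_smul] at h1
  exact h1

theorem tendsto_expVec_decay (ha : Measurable a) {B : Set M} {v : Lp ℂ 2 m}
    (hv : v ∈ suppIn m B) {C : ℝ} (hC : ∀ x ∈ B, |a x| ≤ C) :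
    Filter.Tendsto (fun t : ℝ => (t⁻¹ : ℂ) • (expVec m v
        - expVec m (mulFun m (fun x => (Real.exp (-t * a x) : ℂ)) v)))
      (nhdsWithin 0 (Set.Ioi 0)) (nhds (dExpVec m v (mulFun m (fun x => (a x : ℂ)) v))) := by
  have h1 := (hasDerivAt_iff_tendsto_slope_zero.1 (hasDerivAt_expVec_decay ha hv hC)).neg
  rw [neg_neg] at h1
  refine (h1.mono_left (nhdsWithin_mono _ fun t (ht : 0 < t) => ht.ne')).congr fun t => ?_
  rw [zero_add, mulFun_exp_zero, ← smul_neg, neg_sub, ← ofReal_inv]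
  exact (algebraMap_smul ℂ t⁻¹ _).symm

/-- The derivative of the semigroup `exp (-t dΓ(a))` on one vector. -/
theorem mem_multGraph_of_tendsto {B : ℕ → Set M} (hB : IsExhaustion m B) (ha : Measurable a)
    (hbd : ∀ k, ∃ C, ∀ x ∈ B k, |a x| ≤ C) {x y : Fock m} {Y : ℝ → Fock m} {r : ℝ} (hr : 0 < r)
    (hY : ∀ t, 0 < t → t ≤ r → (x, Y t) ∈ multGraph m fun _ x => Real.exp (-t * ∑ j, a (x j)))
    (hlim : Filter.Tendsto (fun t : ℝ => (t⁻¹ : ℂ) • (x - Y t))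
      (nhdsWithin 0 (Set.Ioi 0)) (nhds y)) :
    (x, y) ∈ multGraph m fun _ x => ∑ j, a (x j) := by
  rw [(hasExpCore_sum hB hB.isTestFamily ha hbd).mem_multGraph_iff]
  rintro ⟨_, κ⟩ hq ⟨k, v, hv, rfl⟩
  obtain ⟨C, hC⟩ := hbd k
  have h1 := dExpVec_mem_dGamma (memLp_mul_of_supp (g := fun x => (a x : ℂ)) (by fun_prop) hv (C := C)
    fun x hx => by rw [Complex.norm_real]; exact hC x hx)
  obtain rfl := multGraph_unique h1 hq
  -- The semigroup is symmetric, so the difference quotients can be moved to an exponential vector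
  -- of the core, where the limit is known. Comparing the limits gives the adjoint relation that
  -- characterises the graph.
  have h2 := (tendsto_expVec_decay ha hv hC).inner (tendsto_const_nhds (x := x)) (𝕜 := ℂ)
  have h3 := (tendsto_const_nhds (x := expVec m v)).inner hlim (𝕜 := ℂ)
  refine tendsto_nhds_unique h2 (h3.congr' ?_)
  filter_upwards [Ioc_mem_nhdsGT hr] with t ht
  have h4 := inner_eq_of_mem_multGraph
    (expVec_mul_mem (memLp_exp_mul ha hv ⟨C, hC⟩ (-t))) (hY t ht.1 ht.2)
  dsimp only at h4
  rw [Fock.inner_smul_left, Fock.inner_smul_right, inner_sub_left, inner_sub_right, h4, map_inv₀, conj_ofReal]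

end Decay

/-! ### The local semigroup on the Fock space -/

section Liouvillian

variable {d : ℕ} {s β : ℝ} [hd : Fact (0 < d)] [hs : Fact (0 < s)] [hβ : Fact (0 < β)]

theorem inner_testVec_shift (t : ℝ) (c : FieldIndex d s β →₀ ℝ) :
    inner ℂ (testVec (shift t c)) (testVec (shift t c)) = inner ℂ (testVec c) (testVec c) := by
  rw [testVec, shift, Finsupp.linearCombination_mapDomain]
  refine inner_linearCombination_congr fun y _ y' _ => ?_
  simp only [Function.comp_apply]
  rw [← translate_sharpTime t y.1, ← translate_sharpTime t y'.1]
  exact inner_translate t _ _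

/-- All shifted times must stay in [0, β/2]; outside this interval `timeOf` truncates the time and
the relation fails. -/
theorem exp_mul_waveVec {t : ℝ} {T : Set ℝ} (hT : T ⊆ Set.Icc 0 (β / 2))
    (hT' : ∀ t' ∈ T, t + t' ∈ Set.Icc 0 (β / 2)) {c : FieldIndex d s β →₀ ℝ}
    (hc : c ∈ timesIn d s β T) :
    (fun x => (Real.exp (-t * awEnergy d s x) : ℂ) * waveVec c x) =ᵐ[awMeasure d s]
      waveVec (shift t c) := by
  rw [timesIn, Finsupp.supported_eq_span_single] at hc
  induction hc using Submodule.span_induction with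
  | mem c hc =>
    obtain ⟨⟨t', g⟩, ht', rfl⟩ := hc
    have h1 : waveVec (Finsupp.single (t', g) (1 : ℝ)) = timeVec ⟨t', hT ht'⟩ g.1 :=
      waveVec_single ⟨t', hT ht'⟩ g
    have h2 : waveVec (shift t (Finsupp.single (t', g) (1 : ℝ)))
        = timeVec ⟨t + t', hT' t' ht'⟩ g.1 := by
      rw [shift, Finsupp.mapDomain_single]
      exact waveVec_single ⟨t + t', hT' t' ht'⟩ g
    have h3 := exp_mul_timeVec ⟨t', hT ht'⟩ ⟨t + t', hT' t' ht'⟩ g.1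
    rw [h1, h2]
    simp only [sub_add_cancel_right] at h3
    exact h3
  | zero =>
    have h1 : waveVec (0 : FieldIndex d s β →₀ ℝ) = 0 := map_zero _
    rw [shift, Finsupp.mapDomain_zero, h1]
    filter_upwards [Lp.coeFn_zero ℂ 2 (awMeasure d s)] with x h2
    rw [h2, Pi.zero_apply, mul_zero]
  | add c c' _ _ h h' =>
    have h1 : shift t (c + c') = shift t c + shift t c' := Finsupp.mapDomain_add
    rw [h1, waveVec_add, waveVec_add]
    filter_upwards [h, h', Lp.coeFn_add (waveVec c) (waveVec c'),
      Lp.coeFn_add (waveVec (shift t c)) (waveVec (shift t c'))] with x h1 h2 h3 h4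
    rw [h3, h4, Pi.add_apply, Pi.add_apply, ← h1, ← h2, mul_add]
  | smul r c _ h =>
    have h1 : shift t (r • c) = r • shift t c := Finsupp.mapDomain_smul r c
    have h2 : ∀ c : FieldIndex d s β →₀ ℝ, waveVec (r • c) = r • waveVec c := fun c => map_smul _ _ _
    rw [h1, h2, h2]
    filter_upwards [h, Lp.coeFn_smul r (waveVec c), Lp.coeFn_smul r (waveVec (shift t c))]
      with x h1 h2 h3
    rw [h2, h3, Pi.smul_apply, Pi.smul_apply, ← h1, real_smul, real_smul]
    ring

theorem exp_mul_smul_waveVec (ζ : ℂ) {t : ℝ} {T : Set ℝ} (hT : T ⊆ Set.Icc 0 (β / 2))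
    (hT' : ∀ t' ∈ T, t + t' ∈ Set.Icc 0 (β / 2)) {c : FieldIndex d s β →₀ ℝ}
    (hc : c ∈ timesIn d s β T) :
    (fun x => (Real.exp (-t * awEnergy d s x) : ℂ) * (ζ • waveVec c : Lp ℂ 2 (awMeasure d s)) x)
      =ᵐ[awMeasure d s] (ζ • waveVec (shift t c) : Lp ℂ 2 (awMeasure d s)) := by
  filter_upwards [exp_mul_waveVec hT hT' hc, Lp.coeFn_smul ζ (waveVec c),
    Lp.coeFn_smul ζ (waveVec (shift t c))] with x h1 h2 h3
  rw [h2, h3, Pi.smul_apply, Pi.smul_apply, ← h1, smul_eq_mul, smul_eq_mul]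
  ring

theorem mulFun_smul_waveVec (ζ : ℂ) {t : ℝ} {T : Set ℝ} (hT : T ⊆ Set.Icc 0 (β / 2))
    (hT' : ∀ t' ∈ T, t + t' ∈ Set.Icc 0 (β / 2)) {c : FieldIndex d s β →₀ ℝ}
    (hc : c ∈ timesIn d s β T) :
    mulFun (awMeasure d s) (fun x => (Real.exp (-t * awEnergy d s x) : ℂ)) (ζ • waveVec c)
      = ζ • waveVec (shift t c) :=
  Lp.ext ((mulFun_coeFn_of_memLp ((Lp.memLp _).ae_eq (exp_mul_smul_waveVec ζ hT hT' hc).symm)).trans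
    (exp_mul_smul_waveVec ζ hT hT' hc))

/-- The multiplication operator `exp (-t dΓ(ε ⊕ -ε̄))`. -/
noncomputable def decaySub (d : ℕ) (s t : ℝ) : Submodule ℂ (AWFock d s × AWFock d s) :=
  multSub (awMeasure d s) fun _ x => Real.exp (-t * ∑ j, awEnergy d s (x j))

theorem isClosed_decaySub (t : ℝ) :
    IsClosed (decaySub d s t : Set (AWFock d s × AWFock d s)) :=
  (hasExpCore_exp_sum isExhaustion_awShell isExhaustion_awShell.isTestFamily measurable_awEnergy
    exists_bound_awEnergy (-t)).isClosed

/-- Translation leaves the Gaussian prefactor unchanged and multiplies the exponent by e^{-tε̃}. -/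
theorem fockVec_shift {t : ℝ} {T : Set ℝ} (hT : T ⊆ Set.Icc 0 (β / 2))
    (hT' : ∀ t' ∈ T, t + t' ∈ Set.Icc 0 (β / 2)) {c : FieldIndex d s β →₀ ℝ}
    (hc : c ∈ timesIn d s β T) : (fockVec c, fockVec (shift t c)) ∈ decaySub d s t := by
  have h1 := expVec_mul_mem
    ((Lp.memLp _).ae_eq (exp_mul_smul_waveVec (I / √2 : ℂ) hT hT' hc).symm)
  rw [mulFun_smul_waveVec _ hT hT' hc] at h1
  have h2 := (decaySub d s t).smul_mem (cexp (-((‖testVec c‖ ^ 2 / 4 : ℝ) : ℂ))) h1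
  have h3 : ‖testVec (shift t c)‖ ^ 2 = ‖testVec c‖ ^ 2 := by
    apply ofReal_injective
    rw [ofReal_norm_sq_eq_inner, ofReal_norm_sq_eq_inner, inner_testVec_shift]
  rw [fockVec, fockVec, h3]
  exact h2

variable (d s β) in
/-- The map `F ↦ T E F`. -/
noncomputable def euclidExp : Lp ℂ 2 (pathMeasure d s β) →L[ℂ] AWFock d s :=
  ((euclid d s β).toContinuousLinearEquiv : Phys d s β →L[ℂ] AWFock d s).comp (physExp d s β)

/-- The translation `U_t` as a bounded operator. -/
noncomputable def translateL (t : ℝ) :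
    Lp ℂ 2 (pathMeasure d s β) →L[ℂ] Lp ℂ 2 (pathMeasure d s β) :=
  (Lp.compMeasurePreservingₗᵢ ℂ _ (measurePreserving_translatePath t)).toContinuousLinearMap

theorem translateL_apply (t : ℝ) (F : Lp ℂ 2 (pathMeasure d s β)) :
    translateL t F = translateL2 t F := (translateL2_eq t F).symm

/-- On exponentials of fields the relation is explicit, since t ≤ r keeps the shifted times below
β/2. These exponentials are total and the graph of e^{-t dΓ(ε̃)} is closed, so it extends to all F;
in particular EU_tF depends only on EF. -/
theorem euclidExp_translate_mem {t r : ℝ} (ht : 0 ≤ t) (htr : t ≤ r)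
    {F : Lp ℂ 2 (pathMeasure d s β)}
    (hF : F ∈ lpMeas ℂ ℂ (sigmaTimes d s β (Set.Icc 0 (β / 2 - r))) 2 (pathMeasure d s β)) :
    (euclidExp d s β F, euclidExp d s β (translateL2 t F)) ∈ decaySub d s t := by
  have hT : Set.Icc 0 (β / 2 - r) ⊆ Set.Icc 0 (β / 2) :=
    Set.Icc_subset_Icc_right (by linarith)
  have hT' : ∀ t' ∈ Set.Icc 0 (β / 2 - r), t + t' ∈ Set.Icc 0 (β / 2) := fun t' h =>
    ⟨by linarith [h.1], by linarith [h.2]⟩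
  let A : lpMeas ℂ ℂ (sigmaTimes d s β (Set.Icc 0 (β / 2 - r))) 2 (pathMeasure d s β) →L[ℂ]
      AWFock d s × AWFock d s :=
    ((euclidExp d s β).prod ((euclidExp d s β).comp (translateL t))).comp (Submodule.subtypeL _)
  have hA : ∀ F, A F = (euclidExp d s β F.1, euclidExp d s β (translateL2 t F.1)) := fun F => by
    rw [← translateL_apply]
    rfl
  have hcl : IsClosed {F | A F ∈ decaySub d s t} := (isClosed_decaySub t).preimage A.continuous
  have hsub : Submodule.span ℂ (Set.range fun c : timesIn d s β (Set.Icc 0 (β / 2 - r)) =>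
      (⟨fieldVec c.1, fieldVec_mem c.2⟩ : lpMeas ℂ ℂ (sigmaTimes d s β (Set.Icc 0 (β / 2 - r))) 2
        (pathMeasure d s β))) ≤ (decaySub d s t).comap (A : _ →ₗ[ℂ] AWFock d s × AWFock d s) := by
    refine Submodule.span_le.2 ?_
    rintro _ ⟨c, rfl⟩
    change A _ ∈ decaySub d s t
    rw [hA, translateL2_fieldVec]
    have h1 : euclidExp d s β (fieldVec c.1) = fockVec c.1 :=
      euclid_physExp (timesIn_mono hT c.2)
    have h2 : euclidExp d s β (fieldVec (shift t c.1)) = fockVec (shift t c.1) :=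
      euclid_physExp (shift_mem_timesIn hT' c.2)
    dsimp only
    rw [h1, h2]
    exact fockVec_shift hT hT' c.2
  have : Fact (sigmaTimes d s β (Set.Icc 0 (β / 2 - r)) ≤ MeasurableSpace.pi) := ⟨sigmaTimes_le d s β _⟩
  have h3 : (⟨F, hF⟩ : lpMeas ℂ ℂ (sigmaTimes d s β (Set.Icc 0 (β / 2 - r))) 2 (pathMeasure d s β))
      ∈ {F | A F ∈ decaySub d s t} :=
    hcl.closure_subset_iff.2 hsub ((total_fieldVec _).dense_span _)
  have h4 : A ⟨F, hF⟩ ∈ decaySub d s t := h3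
  rwa [hA] at h4

end Liouvillian

theorem Total.map_symm {ι H K : Type*} [NormedAddCommGroup H] [InnerProductSpace ℂ H]
    [NormedAddCommGroup K] [InnerProductSpace ℂ K] {e : ι → K} (he : Total e) (T : H ≃ₗᵢ[ℂ] K) :
    Total fun i => T.symm (e i) := by
  intro x hx
  rw [← T.map_eq_zero_iff]
  refine he _ fun i => ?_
  rw [← hx i, ← T.inner_map_map, T.apply_symm_apply]

theorem IsUnitaryGroup.transport {H K : Type*} [NormedAddCommGroup H] [InnerProductSpace ℂ H]
    [CompleteSpace H] [NormedAddCommGroup K] [InnerProductSpace ℂ K] [CompleteSpace K]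
    {A : Set (H × H)} {B : Set (K × K)} {V : ℝ → K →L[ℂ] K} (hV : IsUnitaryGroup B V)
    (T : H ≃ₗᵢ[ℂ] K) (h : ∀ x y, (x, y) ∈ A ↔ (T x, T y) ∈ B) :
    IsUnitaryGroup A fun t => conjOp T.symm (V t) := by
  refine ⟨?_, fun t u => ?_, fun t x => ?_, fun x => ?_, fun x y => ?_⟩
  · rw [hV.map_zero]
    ext x
    simp [conjOp_apply]
  · rw [hV.map_add, conjOp_mul]
  · rw [conjOp_apply, LinearIsometryEquiv.norm_map, hV.norm_map, LinearIsometryEquiv.norm_map]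
  · exact T.symm.continuous.comp (hV.continuous (T x))
  · rw [h, hV.generator]
    have h1 : ∀ t, conjOp T.symm (V t) x = T.symm (V t (T x)) := fun t => rfl
    simp_rw [h1]
    constructor
    · intro hd
      have h2 := (T.symm.toContinuousLinearEquiv : K →L[ℂ] H).hasFDerivAt.restrictScalars ℝ
        |>.comp_hasDerivAt (0 : ℝ) hd
      simpa [Function.comp_def] using h2
    · intro hd
      have h2 := (T.toContinuousLinearEquiv : H →L[ℂ] K).hasFDerivAt.restrictScalars ℝ
        |>.comp_hasDerivAt (0 : ℝ) hd
      simpa [Function.comp_def] using h2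

theorem exists_transport_submodule {H K : Type*} [NormedAddCommGroup H] [InnerProductSpace ℂ H]
    [NormedAddCommGroup K] [InnerProductSpace ℂ K] (T : H ≃ₗᵢ[ℂ] K) {D : Submodule ℂ (H × H)}
    (hD : IsClosed (D : Set (H × H))) : ∃ S : Submodule ℂ (K × K), IsClosed (S : Set (K × K)) ∧
      (∀ x y, (T.symm x, T.symm y) ∈ D → (x, y) ∈ S) ∧ ∀ x y, (T x, T y) ∈ S → (x, y) ∈ D := by
  let e : K →L[ℂ] H := (T.symm.toContinuousLinearEquiv : K →L[ℂ] H)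
  refine ⟨D.comap (e.prodMap e : K × K →ₗ[ℂ] H × H), hD.preimage (e.prodMap e).continuous,
    fun x y h => h, fun x y h => ?_⟩
  have h1 : (T.symm (T x), T.symm (T y)) ∈ D := h
  rwa [T.symm_apply_apply, T.symm_apply_apply] at h1

/-! ### The Liouvillian and its unitary group -/

section Liouvillian

variable {d : ℕ} {s β : ℝ} [hd : Fact (0 < d)] [hs : Fact (0 < s)] [hβ : Fact (0 < β)]

theorem sigmaTimes_mono {T T' : Set ℝ} (h : T ⊆ T') : sigmaTimes d s β T ≤ sigmaTimes d s β T' :=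
  biSup_mono fun _ ht => h ht

theorem lpMeas_sigmaTimes_mono {T T' : Set ℝ} (h : T ⊆ T') {F : Lp ℂ 2 (pathMeasure d s β)}
    (hF : F ∈ lpMeas ℂ ℂ (sigmaTimes d s β T) 2 (pathMeasure d s β)) :
    F ∈ lpMeas ℂ ℂ (sigmaTimes d s β T') 2 (pathMeasure d s β) := by
  rw [mem_lpMeas_iff_aestronglyMeasurable] at hF ⊢
  exact hF.mono (sigmaTimes_mono h)

variable (d s β) in
/-- The graph of minus the derivative of the local semigroup. -/
noncomputable def derivSub : Submodule ℂ (Phys d s β × Phys d s β) where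
  carrier := {p | ∃ r : ℝ, 0 < r ∧ r ≤ β / 2 ∧ ∃ F : Lp ℂ 2 (pathMeasure d s β),
    F ∈ lpMeas ℂ ℂ (sigmaTimes d s β (Set.Icc 0 (β / 2 - r))) 2 (pathMeasure d s β) ∧
    p.1 = physExp d s β F ∧
    Filter.Tendsto (fun t : ℝ => (t⁻¹ : ℂ) • (p.1 - physExp d s β (translateL2 t F)))
      (nhdsWithin 0 (Set.Ioi 0)) (nhds p.2)}
  add_mem' := by
    rintro p p' ⟨r, hr, hrβ, F, hF, h1, h2⟩ ⟨r', hr', hrβ', F', hF', h1', h2'⟩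
    refine ⟨min r r', lt_min hr hr', (min_le_left _ _).trans hrβ, F + F', Submodule.add_mem _
      (lpMeas_sigmaTimes_mono (Set.Icc_subset_Icc_right ?_) hF)
      (lpMeas_sigmaTimes_mono (Set.Icc_subset_Icc_right ?_) hF'), ?_, ?_⟩
    · linarith [min_le_left r r']
    · linarith [min_le_right r r']
    · rw [Prod.fst_add, h1, h1', map_add]
    · refine (h2.add h2').congr fun t => ?_
      rw [← smul_add, Prod.fst_add, ← translateL_apply, ← translateL_apply, ← translateL_apply,
        map_add, map_add, add_sub_add_comm]
  zero_mem' := by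
    refine ⟨β / 2, half_pos hβ.out, le_rfl, 0, Submodule.zero_mem _, (map_zero _).symm, ?_⟩
    refine tendsto_const_nhds.congr fun t => ?_
    rw [← translateL_apply, map_zero, map_zero, Prod.fst_zero, sub_zero, smul_zero, Prod.snd_zero]
  smul_mem' := by
    rintro c p ⟨r, hr, hrβ, F, hF, h1, h2⟩
    refine ⟨r, hr, hrβ, c • F, Submodule.smul_mem _ c hF, ?_, ?_⟩
    · rw [Prod.smul_fst, h1, map_smul]
    · refine (h2.const_smul c).congr fun t => ?_
      rw [Prod.smul_fst, ← translateL_apply, ← translateL_apply, map_smul, map_smul, ← smul_sub,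
        smul_comm]

theorem liouvillian_eq : liouvillian d s β = (derivSub d s β).topologicalClosure := rfl

theorem isClosed_dGamma : IsClosed (dGamma (awMeasure d s) (awEnergy d s)) :=
  (hasExpCore_sum isExhaustion_awShell isExhaustion_awShell.isTestFamily measurable_awEnergy
    exists_bound_awEnergy).isClosed

/-- The difference quotients of the local semigroup are those of e^{-t dΓ(ε̃)}, so their limit is
dΓ(ε̃) on the vector. -/
theorem mem_dGamma_of_mem_derivSub {p : Phys d s β × Phys d s β} (hp : p ∈ derivSub d s β) :
    (euclid d s β p.1, euclid d s β p.2) ∈ dGamma (awMeasure d s) (awEnergy d s) := by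
  obtain ⟨r, hr, hrβ, F, hF, h1, h2⟩ := hp
  refine mem_multGraph_of_tendsto isExhaustion_awShell measurable_awEnergy exists_bound_awEnergy
    (Y := fun t => euclidExp d s β (translateL2 t F)) hr (fun t ht htr => ?_) ?_
  · rw [h1]
    exact euclidExp_translate_mem ht.le htr hF
  · refine (((euclid d s β).continuous.tendsto _).comp h2).congr fun t => ?_
    rw [Function.comp_apply, map_smul, map_sub]
    rfl

/-- Energy cutoff makes the semigroup differentiable on the exponential vector. The times 0 and t₀ <
β/2 leave the margin r = β/2 - t₀ for translation. -/
theorem exists_mem_derivSub {t₀ : ℝ} (h0 : 0 < t₀) (h1 : t₀ < β / 2) {c : FieldIndex d s β →₀ ℝ}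
    (hc : c ∈ timesIn d s β {0, t₀}) {n : ℕ}
    (hsupp : (I / √2 : ℂ) • waveVec c ∈ suppIn (awMeasure d s) (awShell d s n)) :
    ((euclid d s β).symm (fockVec c), (euclid d s β).symm (cexp (-((‖testVec c‖ ^ 2 / 4 : ℝ) : ℂ)) •
      dExpVec (awMeasure d s) ((I / √2 : ℂ) • waveVec c)
        (mulFun (awMeasure d s) (fun x => (awEnergy d s x : ℂ)) ((I / √2 : ℂ) • waveVec c))))
      ∈ derivSub d s β := by
  have hsub : ({0, t₀} : Set ℝ) ⊆ Set.Icc 0 t₀ := by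
    rintro t (rfl | rfl)
    · exact ⟨le_rfl, h0.le⟩
    · exact ⟨h0.le, le_rfl⟩
  have hT : ({0, t₀} : Set ℝ) ⊆ Set.Icc 0 (β / 2) :=
    hsub.trans (Set.Icc_subset_Icc_right h1.le)
  refine ⟨β / 2 - t₀, by linarith, by linarith, fieldVec c, ?_, ?_, ?_⟩
  · rw [sub_sub_cancel]
    exact fieldVec_mem (timesIn_mono hsub hc)
  · rw [← euclid_physExp (timesIn_mono hT hc), LinearIsometryEquiv.symm_apply_apply]
  · obtain ⟨C, hC⟩ := exists_bound_awEnergy (d := d) (s := s) n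
    have h2 := (tendsto_expVec_decay measurable_awEnergy hsupp hC).const_smul
      (cexp (-((‖testVec c‖ ^ 2 / 4 : ℝ) : ℂ)))
    refine ((((euclid d s β).symm.continuous.tendsto _).comp h2)).congr' ?_
    filter_upwards [Ioc_mem_nhdsGT (show (0 : ℝ) < β / 2 - t₀ by linarith)] with t ht
    have hT' : ∀ t' ∈ ({0, t₀} : Set ℝ), t + t' ∈ Set.Icc 0 (β / 2) := fun t' h =>
      ⟨by linarith [(hsub h).1, ht.1], by linarith [(hsub h).2, ht.2]⟩
    have h3 : ‖testVec (shift t c)‖ ^ 2 = ‖testVec c‖ ^ 2 := by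
      apply ofReal_injective
      rw [ofReal_norm_sq_eq_inner, ofReal_norm_sq_eq_inner, inner_testVec_shift]
    have h4 : physExp d s β (translateL2 t (fieldVec c))
        = (euclid d s β).symm (fockVec (shift t c)) := by
      rw [translateL2_fieldVec, ← euclid_physExp (shift_mem_timesIn hT' hc),
        LinearIsometryEquiv.symm_apply_apply]
    rw [Function.comp_apply, h4, mulFun_smul_waveVec _ hT hT' hc, ← map_sub, ← map_smul]
    congr 1
    rw [smul_comm, smul_sub, fockVec, fockVec, h3]

/-- Multiplication by the inverse of the Gaussian prefactor passes from the images of field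
exponentials to bare exponential vectors. -/
theorem exists_core_derivSub {t₀ : Set.Icc (0 : ℝ) (β / 2)} (h0 : 0 < (t₀ : ℝ))
    (h1 : (t₀ : ℝ) < β / 2) {n : ℕ} {v : Lp ℂ 2 (awMeasure d s)}
    (hv : v ∈ coherentFamily d s β t₀ n) :
    ∃ κ, (expVec (awMeasure d s) v, κ) ∈ multGraph (awMeasure d s)
        (fun _ x => ∑ j, awEnergy d s (x j)) ∧
      ((euclid d s β).symm (expVec (awMeasure d s) v), (euclid d s β).symm κ)
        ∈ (derivSub d s β).topologicalClosure := by
  have hsupp : v ∈ suppIn (awMeasure d s) (awShell d s n) :=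
    (isTestFamily_coherentFamily h0).supp n v hv
  obtain ⟨C, hC⟩ := exists_bound_awEnergy (d := d) (s := s) n
  refine ⟨_, mem_dGamma_of_suppIn measurable_awEnergy hC hsupp, ?_⟩
  obtain ⟨c, hc, rfl⟩ := exists_waveVec_of_mem_coherent hv
  have h2 := (derivSub d s β).le_topologicalClosure (exists_mem_derivSub h0 h1 hc hsupp)
  have h3 := (derivSub d s β).topologicalClosure.smul_mem (cexp ((‖testVec c‖ ^ 2 / 4 : ℝ) : ℂ)) h2
  rw [Prod.smul_mk, ← map_smul, ← map_smul, ← expVec_eq_smul_fockVec, smul_smul,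
    ← Complex.exp_add, add_neg_cancel, Complex.exp_zero, one_smul] at h3
  exact h3

theorem mem_dGamma_of_mem_liouvillian {x y : Phys d s β} (h : (x, y) ∈ liouvillian d s β) :
    (euclid d s β x, euclid d s β y) ∈ dGamma (awMeasure d s) (awEnergy d s) := by
  let f : Phys d s β × Phys d s β → AWFock d s × AWFock d s :=
    fun p => (euclid d s β p.1, euclid d s β p.2)
  have hf : Continuous f := by fun_prop
  have h1 : IsClosed (f ⁻¹' dGamma (awMeasure d s) (awEnergy d s)) := isClosed_dGamma.preimage hf
  have h2 : (derivSub d s β : Set (Phys d s β × Phys d s β))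
      ⊆ f ⁻¹' dGamma (awMeasure d s) (awEnergy d s) := fun p hp => mem_dGamma_of_mem_derivSub hp
  rw [liouvillian_eq, Submodule.topologicalClosure_coe] at h
  have h3 := closure_minimal h2 h1 h
  exact h3

theorem exists_time_lt :
    ∃ t₀ : Set.Icc (0 : ℝ) (β / 2), 0 < (t₀ : ℝ) ∧ (t₀ : ℝ) < β / 2 := by
  have hβ' := hβ.out
  have h0 : 0 < β / 4 := by positivity
  have h1 : β / 4 < β / 2 := by linarith
  exact ⟨⟨β / 4, h0.le, h1.le⟩, h0, h1⟩

/-- The exponential vectors of hermitian functions at the times 0 and t₀ in the energy shells form a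
core, for any t₀ strictly between 0 and β/2. -/
theorem dGamma_subset {S : Submodule ℂ (AWFock d s × AWFock d s)}
    (hS : IsClosed (S : Set (AWFock d s × AWFock d s)))
    (h : ∀ x y, ((euclid d s β).symm x, (euclid d s β).symm y) ∈ (derivSub d s β).topologicalClosure →
      (x, y) ∈ S) : dGamma (awMeasure d s) (awEnergy d s) ⊆ S := by
  obtain ⟨t₀, ht₀, ht₁⟩ := exists_time_lt (β := β)
  have hcore := hasExpCore_sum isExhaustion_awShell
    (isTestFamily_coherentFamily (d := d) (s := s) ht₀) measurable_awEnergy exists_bound_awEnergy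
  refine hcore.subset_of_mem hS fun k v hv => ?_
  obtain ⟨κ, hκ, h2⟩ := exists_core_derivSub ht₀ ht₁ hv
  have h3 := h _ _ h2
  exact ⟨κ, hκ, h3⟩

/-- One inclusion is the derivative of the semigroup, with closedness of dΓ(ε̃); the other holds
because a core lies in the domain. -/
theorem intertwinesLiouvillian_euclid : IntertwinesLiouvillian (euclid d s β) := by
  intro x y
  refine ⟨mem_dGamma_of_mem_liouvillian, fun h => ?_⟩
  obtain ⟨S, hS, hSD, hDS⟩ := exists_transport_submodule (euclid d s β)
    (derivSub d s β).isClosed_topologicalClosure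
  have h1 := dGamma_subset hS hSD h
  exact hDS x y h1

theorem expI_awEnergy : IsUnitaryGroup (dGamma (awMeasure d s) (awEnergy d s))
      (expI (dGamma (awMeasure d s) (awEnergy d s))) ∧
    ∀ t u, expI (dGamma (awMeasure d s) (awEnergy d s)) t (expVec _ u)
      = expVec _ (phase (awMeasure d s) (awEnergy d s) t u) :=
  isUnitaryGroup_expI_dGamma isExhaustion_awShell measurable_awEnergy exists_bound_awEnergy

/-- A unitary that intertwines two generators intertwines their groups, by uniqueness of the group.
-/
theorem conjOp_expI_liouvillian {T : Phys d s β ≃ₗᵢ[ℂ] AWFock d s} (hT : IntertwinesLiouvillian T)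
    (t : ℝ) : conjOp T (expI (liouvillian d s β) t)
      = expI (dGamma (awMeasure d s) (awEnergy d s)) t := by
  have h1 := expI_awEnergy.1.transport T hT
  have he := (isExhaustion_awShell (d := d) (s := s)).isTestFamily.total isExhaustion_awShell
  rw [expI_eq h1 (he.map_symm T) ?_ t]
  · ext x
    simp [conjOp_apply]
  · rintro ⟨v, k, hv⟩
    obtain ⟨C, hC⟩ := exists_bound_awEnergy (d := d) (s := s) k
    have h2 := mem_dGamma_of_suppIn measurable_awEnergy hC hv
    refine ⟨T.symm (dExpVec (awMeasure d s) v
      (mulFun (awMeasure d s) (fun x => (awEnergy d s x : ℂ)) v)), (hT _ _).2 ?_⟩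
    rw [T.apply_symm_apply, T.apply_symm_apply]
    exact h2

end Liouvillian

theorem smul_mem_doubleCommutant {H : Type*} [NormedAddCommGroup H] [InnerProductSpace ℂ H]
    {N : Set (H →L[ℂ] H)} (c : ℂ) {A : H →L[ℂ] H} (hA : A ∈ doubleCommutant N) :
    c • A ∈ doubleCommutant N := fun C hC => by
  rw [mul_smul_comm, smul_mul_assoc, hA C hC]

theorem mul_conj_commute {R : Type*} [Monoid R] {V V' X W : R} (h : V * V' = 1)
    (hX : X * (V' * W * V) = V' * W * V * X) : V * X * V' * W = W * (V * X * V') := by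
  calc V * X * V' * W = V * (X * (V' * W * V)) * V' := by simp only [mul_assoc, h, mul_one]
    _ = V * (V' * W * V * X) * V' := by rw [hX]
    _ = (V * V') * W * V * X * V' := by simp only [mul_assoc]
    _ = W * (V * X * V') := by rw [h, one_mul]; simp only [mul_assoc]

/-! ### The von Neumann algebra of the path space -/

section PhysAlgebra

variable {d : ℕ} {s β : ℝ} [hd : Fact (0 < d)] [hs : Fact (0 < s)] [hβ : Fact (0 < β)]

theorem waveVec_restrictIndex (c : ({0} : Set ℝ) × TimeZero d s β →₀ ℝ) :
    waveVec (restrictIndex c)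
      = timeVec timeZero (Finsupp.linearCombination ℝ (fun y => y.2.1) c) := by
  rw [waveVec, restrictIndex, Finsupp.linearCombination_mapDomain,
    Finsupp.linearCombination_apply, Finsupp.linearCombination_apply, Finsupp.sum, Finsupp.sum,
    map_sum]
  refine Finset.sum_congr rfl fun y _ => ?_
  rw [map_smul, Function.comp_apply]
  have h : timeOf ((y.1 : ℝ)) = (timeZero : Set.Icc (0 : ℝ) (β / 2)) := by
    rw [show (y.1 : ℝ) = 0 from y.1.2]
    exact timeOf_coe timeZero
  rw [h]

variable (d s β) in
theorem zero_subset_pair : ({0} : Set ℝ) ⊆ {0, β / 2} := by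
  rintro t rfl
  exact Or.inl rfl

/-- The right Weyl operators on the physical Hilbert space. -/
noncomputable def rightWeyl (h : Lp ℂ 2 (thermalMeasure d s β)) : Phys d s β →L[ℂ] Phys d s β :=
  conjOp (euclid d s β).symm (weylL (awMeasure d s) (timeVec timeHalf h))

theorem euclid_rightWeyl (h : Lp ℂ 2 (thermalMeasure d s β)) (F : Phys d s β) :
    euclid d s β (rightWeyl h F)
      = weylL (awMeasure d s) (timeVec timeHalf h) (euclid d s β F) := by
  rw [rightWeyl, conjOp_apply, LinearIsometryEquiv.apply_symm_apply]
  rfl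

theorem inner_rightWeyl (h : Lp ℂ 2 (thermalMeasure d s β)) (F G : Phys d s β) :
    inner ℂ F (rightWeyl h G) = inner ℂ (rightWeyl (-h) F) G := by
  rw [← (euclid d s β).inner_map_map, euclid_rightWeyl, inner_weylL_left, ← map_neg,
    ← euclid_rightWeyl, (euclid d s β).inner_map_map]

theorem integrable_conj_mul_path (F G : Lp ℂ 2 (pathMeasure d s β)) :
    Integrable (fun φ => starRingEnd ℂ (F φ) * G φ) (pathMeasure d s β) := integrable_conj_mul F G

/-- The time-zero characters commute with the right Weyl operators, in the weak form. -/
theorem integral_rightWeyl_mul_character (h : Lp ℂ 2 (thermalMeasure d s β)) (F G : Phys d s β)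
    (c : ({0} : Set ℝ) × TimeZero d s β →₀ ℝ) :
    ∫ φ, (starRingEnd ℂ (F.1 φ) * (rightWeyl h G).1 φ
      - starRingEnd ℂ ((rightWeyl (-h) F).1 φ) * G.1 φ) * character c (fieldsIn {0} φ)
      ∂(pathMeasure d s β) = 0 := by
  let e : timesIn d s β {0, β / 2} :=
    ⟨restrictIndex c, timesIn_mono (zero_subset_pair β) (restrictIndex_mem c)⟩
  obtain ⟨G₁, hG₁, e₁⟩ := exists_mul_pathExp e (rightWeyl h G)
  obtain ⟨G₂, hG₂, e₂⟩ := exists_mul_pathExp e G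
  have hcomm : G₁ = rightWeyl h G₂ := by
    apply (euclid d s β).injective
    rw [e₁, euclid_rightWeyl, euclid_rightWeyl, e₂, ← mul_apply_eq_comp, ← mul_apply_eq_comp,
      show waveVec e.1 = _ from waveVec_restrictIndex c, weylL_commute_timeHalf]
  have h1 : inner ℂ F.1 G₁.1 = inner ℂ (rightWeyl (-h) F).1 G₂.1 := by
    rw [hcomm]
    exact inner_rightWeyl h F G₂
  rw [inner_eq_integral, inner_eq_integral, ← sub_eq_zero,
    ← integral_sub (integrable_conj_mul_path _ _) (integrable_conj_mul_path _ _)] at h1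
  rw [← h1]
  refine integral_congr_ae ?_
  filter_upwards [hG₁, hG₂] with φ h2 h3
  rw [h2, h3, pathExp_restrictIndex]
  ring

/-- The weak commutation relation holds for characters of the time-zero fields; an integrable
function orthogonal to these is orthogonal to every bounded time-zero function. -/
theorem timeZeroAlgebra_commute {A : Phys d s β →L[ℂ] Phys d s β} (hA : A ∈ timeZeroAlgebra d s β)
    (h : Lp ℂ 2 (thermalMeasure d s β)) : A * rightWeyl h = rightWeyl h * A := by
  obtain ⟨b, hb, ⟨C, hC⟩, hAb⟩ := hA
  ext1 G
  refine ext_inner_left ℂ fun F => ?_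
  rw [mul_apply_eq_comp, mul_apply_eq_comp, inner_rightWeyl]
  have h1 := integral_mul_eq_zero_of_characters (measurable_fieldsIn {0})
    ((integrable_conj_mul_path F.1 (rightWeyl h G).1).sub
      (integrable_conj_mul_path (rightWeyl (-h) F).1 G.1)) sigmaZero_le_comap
    (integral_rightWeyl_mul_character h F G) hb hC
  change inner ℂ F.1 (A (rightWeyl h G)).1 = inner ℂ (rightWeyl (-h) F).1 (A G).1
  rw [inner_eq_integral, inner_eq_integral, ← sub_eq_zero,
    ← integral_sub (integrable_conj_mul_path _ _) (integrable_conj_mul_path _ _), ← h1]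
  refine integral_congr_ae ?_
  filter_upwards [hAb (rightWeyl h G), hAb G] with φ h2 h3
  rw [h2, h3, Pi.sub_apply]
  ring

/-- The left Weyl operators of hermitian functions on the physical Hilbert space. -/
theorem conjOp_symm_weylL_mem {T : Phys d s β ≃ₗᵢ[ℂ] AWFock d s} (hT : IntertwinesFields T)
    {g : Lp ℂ 2 (thermalMeasure d s β)} (hg : g ∈ hermitian (thermalMeasure d s β)) :
    conjOp T.symm (weylL (awMeasure d s) (timeVec timeZero g)) ∈ timeZeroAlgebra d s β := by
  refine ⟨expField ⟨g, hg⟩, Measurable.of_comap_le (le_iSup (fun g : TimeZero d s β =>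
    MeasurableSpace.comap (expField g) inferInstance) ⟨g, hg⟩), ⟨1, fun φ => ?_⟩, fun F => ?_⟩
  · rw [expField_eq, norm_pathExp]
  · obtain ⟨G, h1, h2⟩ := hT ⟨g, hg⟩ F
    have h3 : conjOp T.symm (weylL (awMeasure d s) (timeVec timeZero g)) F = G := by
      apply T.injective
      rw [h2, awWeyl_eq, conjOp_apply, LinearIsometryEquiv.apply_symm_apply]
      rfl
    rw [h3]
    exact h1

theorem conjOp_conjOp_symm (T : Phys d s β ≃ₗᵢ[ℂ] AWFock d s) (A : AWFock d s →L[ℂ] AWFock d s) :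
    conjOp T (conjOp T.symm A) = A := by
  ext1 x
  rw [conjOp_apply, conjOp_apply, LinearIsometryEquiv.symm_symm, T.apply_symm_apply,
    T.apply_symm_apply]

theorem conjOp_symm_conjOp (T : Phys d s β ≃ₗᵢ[ℂ] AWFock d s)
    (A : Phys d s β →L[ℂ] Phys d s β) : conjOp T.symm (conjOp T A) = A := by
  ext1 x
  rw [conjOp_apply, conjOp_apply, LinearIsometryEquiv.symm_symm, T.symm_apply_apply,
    T.symm_apply_apply]

/-- The real-time evolution on the Araki-Woods Fock space. -/
noncomputable abbrev evolution (d : ℕ) (s t : ℝ) : AWFock d s →L[ℂ] AWFock d s :=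
  expI (dGamma (awMeasure d s) (awEnergy d s)) t

theorem conj_evolution (t : ℝ) (f : Lp ℂ 2 (awMeasure d s)) :
    evolution d s t * weylL (awMeasure d s) f * evolution d s (-t)
      = weylL (awMeasure d s) (phase (awMeasure d s) (awEnergy d s) t f) :=
  conj_weylL measurable_awEnergy expI_awEnergy.2 t f

theorem evolution_mul_neg (t : ℝ) : evolution d s t * evolution d s (-t) = 1 := by
  have h := (expI_awEnergy (d := d) (s := s)).1
  rw [← h.map_add, add_neg_cancel, h.map_zero]

theorem image_physAlgebra : conjOp (euclid d s β) '' physAlgebra d s β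
    = doubleCommutant {B | ∃ t : ℝ, ∃ A ∈ timeZeroAlgebra d s β,
        B = evolution d s t * conjOp (euclid d s β) A * evolution d s (-t)} := by
  rw [physAlgebra, image_doubleCommutant]
  congr 1
  have key : ∀ t A, conjOp (euclid d s β) (expI (liouvillian d s β) t * A
      * expI (liouvillian d s β) (-t))
      = evolution d s t * conjOp (euclid d s β) A * evolution d s (-t) := fun t A => by
    rw [conjOp_mul, conjOp_mul, conjOp_expI_liouvillian intertwinesLiouvillian_euclid,
      conjOp_expI_liouvillian intertwinesLiouvillian_euclid]
  ext B
  constructor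
  · rintro ⟨_, ⟨t, A, hA, rfl⟩, rfl⟩
    exact ⟨t, A, hA, key t A⟩
  · rintro ⟨t, A, hA, rfl⟩
    exact ⟨_, ⟨t, A, hA, rfl⟩, key t A⟩

/-- A set of operators that contains the evolved Weyl operators of hermitian functions and is closed
under products and multiples contains the Weyl operators of complex functions. -/
theorem weylL_mem_of_phase {N : Set (AWFock d s →L[ℂ] AWFock d s)}
    (hmul : ∀ A ∈ N, ∀ B ∈ N, A * B ∈ N) (hsmul : ∀ (c : ℂ), ∀ A ∈ N, c • A ∈ N)
    (hmem : ∀ t, ∀ g ∈ hermitian (thermalMeasure d s β), weylL (awMeasure d s)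
      (phase (awMeasure d s) (awEnergy d s) t (timeVec timeZero g)) ∈ N)
    {n : ℕ} {h : Lp ℂ 2 (thermalMeasure d s β)} (hh : h ∈ shellFun d s β n) :
    weylL (awMeasure d s) (timeVec timeZero h) ∈ N := by
  have hadd : ∀ f f', weylL (awMeasure d s) f ∈ N → weylL (awMeasure d s) f' ∈ N →
      weylL (awMeasure d s) (f + f') ∈ N := by
    intro f f' hf hf'
    have h1 := hsmul (cexp (-((inner ℂ f' f - inner ℂ f f') / 4))) _ (hmul _ hf _ hf')
    rwa [weylL_mul, smul_smul, ← Complex.exp_add, neg_add_cancel, Complex.exp_zero, one_smul] at h1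
  -- The function is a sum of three real-time translates of hermitian functions, and the Weyl
  -- operator of a sum is a multiple of a product.
  obtain ⟨τ, g, g', hg, hg', rfl⟩ := exists_phase_decomposition hh
  have h0 := hmem 0 g hg
  rw [phase_zero measurable_awEnergy] at h0
  have h1 := hmem τ g' hg'
  have h2 := hmem (-τ) (-g') (Submodule.neg_mem _ hg')
  rw [phase_timeVec] at h1 h2
  rw [map_add, map_add]
  exact hadd _ _ (hadd _ _ h0 h1) h2

/-- The general criterion applies: real-time evolution of the hermitian Weyl operators generates
those of complex functions, and the evolution maps right Weyl operators to right Weyl operators. -/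
theorem isModularConjugation_image : IsModularConjugation
    (conjOp (euclid d s β) '' physAlgebra d s β) (vacuum (awMeasure d s)) (modularJ d s) := by
  rw [image_physAlgebra]
  refine isModularConjugation_of_weyl (β := β) (fun A hA B hB => Set.add_mem_centralizer hA hB)
    (fun c A hA => smul_mem_doubleCommutant c hA) (fun n h hh => ?_)
    (fun A hA n h hh => ?_)
  · refine weylL_mem_of_phase (fun A hA B hB => Set.mul_mem_centralizer hA hB)
      (fun c A hA => smul_mem_doubleCommutant c hA) (fun t g hg => ?_) hh
    refine Set.subset_centralizer_centralizer ⟨t, _,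
      conjOp_symm_weylL_mem intertwinesFields_euclid hg, ?_⟩
    rw [conjOp_conjOp_symm, conj_evolution]
  · refine (hA _ ?_).symm
    rintro _ ⟨t, B, hB, rfl⟩
    -- Evolving a right Weyl operator by -t only evolves its function, so it suffices that the
    -- time-zero operator commutes with all right Weyl operators.
    have h1 : conjOp (euclid d s β) B * weylL (awMeasure d s)
        (phase (awMeasure d s) (awEnergy d s) (-t) (timeVec timeHalf h))
        = weylL (awMeasure d s) (phase (awMeasure d s) (awEnergy d s) (-t) (timeVec timeHalf h))
          * conjOp (euclid d s β) B := by
      have h2 := congrArg (conjOp (euclid d s β)) (timeZeroAlgebra_commute hB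
        (phase (thermalMeasure d s β) (energy s) (-t) h))
      rw [conjOp_mul, conjOp_mul, rightWeyl, conjOp_conjOp_symm] at h2
      rw [phase_timeVec]
      exact h2
    rw [← conj_evolution, neg_neg] at h1
    exact mul_conj_commute (evolution_mul_neg t) h1

variable (d s β) in
/-- The modular conjugation of the path space. -/
noncomputable def physJ : Phys d s β ≃ₗᵢ⋆[ℂ] Phys d s β :=
  ((euclid d s β).trans (modularJ d s)).trans (euclid d s β).symm

theorem euclid_physJ (x : Phys d s β) :
    euclid d s β (physJ d s β x) = modularJ d s (euclid d s β x) :=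
  (euclid d s β).apply_symm_apply _

theorem isModularConjugation_physAlgebra :
    IsModularConjugation (physAlgebra d s β) (thermalVacuum d s β) (physJ d s β) := by
  refine isModularConjugation_transport (euclid d s β) ?_ euclid_physJ
  rw [show euclid d s β (thermalVacuum d s β) = _ from mapsVacuum_euclid]
  exact isModularConjugation_image

end PhysAlgebra

theorem eq_of_total {ι H K : Type*} [NormedAddCommGroup H] [InnerProductSpace ℂ H]
    [NormedAddCommGroup K] [InnerProductSpace ℂ K] [CompleteSpace K] {T T' : H ≃ₗᵢ[ℂ] K} {e : ι → K}
    (he : Total e)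
    (h : ∀ i, T' (T.symm (e i)) = e i) : T' = T := by
  have h1 : ((T.symm.trans T').toContinuousLinearEquiv : K →L[ℂ] K) = ContinuousLinearMap.id ℂ K :=
    he.ext_map h
  ext x
  have h2 := congrArg (fun f : K →L[ℂ] K => f (T x)) h1
  have h3 : T' (T.symm (T x)) = T x := h2
  rwa [T.symm_apply_apply] at h3

/-! ### Uniqueness of the unitary -/

section Uniqueness

variable {d : ℕ} {s β : ℝ} [hd : Fact (0 < d)] [hs : Fact (0 < s)] [hβ : Fact (0 < β)]
  {T T' : Phys d s β ≃ₗᵢ[ℂ] AWFock d s}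

theorem conjOp_symm_weylL_eq (hT : IntertwinesFields T) (hT' : IntertwinesFields T')
    {g : Lp ℂ 2 (thermalMeasure d s β)} (hg : g ∈ hermitian (thermalMeasure d s β)) :
    conjOp T.symm (weylL (awMeasure d s) (timeVec timeZero g))
      = conjOp T'.symm (weylL (awMeasure d s) (timeVec timeZero g)) := by
  ext1 F
  obtain ⟨G, h1, h2⟩ := hT ⟨g, hg⟩ F
  obtain ⟨G', h1', h2'⟩ := hT' ⟨g, hg⟩ F
  have h3 : G = G' := Subtype.ext (Lp.ext (h1.trans h1'.symm))
  rw [awWeyl_eq] at h2 h2'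
  have h4 : conjOp T.symm (weylL (awMeasure d s) (timeVec timeZero g)) F = G := by
    rw [← T.symm_apply_apply G, h2]
    rfl
  have h5 : conjOp T'.symm (weylL (awMeasure d s) (timeVec timeZero g)) F = G' := by
    rw [← T'.symm_apply_apply G', h2']
    rfl
  rw [h4, h5, h3]

theorem conjOp_conjOp_symm_weylL (hT : IntertwinesFields T) (hT' : IntertwinesFields T')
    {g : Lp ℂ 2 (thermalMeasure d s β)} (hg : g ∈ hermitian (thermalMeasure d s β)) :
    conjOp T' (conjOp T.symm (weylL (awMeasure d s) (timeVec timeZero g)))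
      = weylL (awMeasure d s) (timeVec timeZero g) := by
  rw [conjOp_symm_weylL_eq hT hT' hg, conjOp_conjOp_symm]

theorem conjOp_conjOp_evolution (hT : IntertwinesLiouvillian T) (hT' : IntertwinesLiouvillian T')
    (t : ℝ) : conjOp T' (conjOp T.symm (evolution d s t)) = evolution d s t := by
  have h1 := conjOp_expI_liouvillian hT t
  have h2 := conjOp_expI_liouvillian hT' t
  rw [evolution, ← h1, conjOp_symm_conjOp, h1, h2]

theorem map_symm_apply {A : AWFock d s →L[ℂ] AWFock d s} (hA : conjOp T' (conjOp T.symm A) = A)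
    (x : AWFock d s) : T' (T.symm (A x)) = A (T' (T.symm x)) := by
  have h := congrArg (fun f : AWFock d s →L[ℂ] AWFock d s => f (T' (T.symm x))) hA
  have h1 : T' (T.symm (A (T (T'.symm (T' (T.symm x)))))) = A (T' (T.symm x)) := h
  rwa [T'.symm_apply_apply, T.apply_symm_apply] at h1

theorem map_symm_vacuum (hT : MapsVacuum T) (hT' : MapsVacuum T') :
    T' (T.symm (vacuum (awMeasure d s))) = vacuum (awMeasure d s) := by
  rw [MapsVacuum] at hT hT'
  rw [← hT, T.symm_apply_apply, hT', hT]

theorem expVec_eq_smul_weylL_vacuum (f : Lp ℂ 2 (awMeasure d s)) :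
    expVec (awMeasure d s) ((I / √2 : ℂ) • f)
      = cexp (inner ℂ f f / 4) • weylL (awMeasure d s) f (vacuum (awMeasure d s)) := by
  rw [weylL_vacuum, smul_smul, ← Complex.exp_add, add_neg_cancel, Complex.exp_zero, one_smul]

/-- The operators commuting with T'T⁻¹ contain the evolved Weyl operators of hermitian functions,
hence the left Weyl operators of complex functions in the shells. Applied to the fixed vacuum, these
give a total set. -/
theorem eq_of_intertwinesLiouvillian (hΩ : MapsVacuum T) (hΩ' : MapsVacuum T')
    (hT : IntertwinesFields T) (hT' : IntertwinesFields T') (hL : IntertwinesLiouvillian T)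
    (hL' : IntertwinesLiouvillian T') : T' = T := by
  have htot := (isTestFamily_weylFamily (d := d) (s := s) (β := β)).total isExhaustion_awShell
  refine eq_of_total htot ?_
  rintro ⟨_, n, ⟨_, ⟨h, hh, rfl⟩, rfl⟩⟩
  have hmem : weylL (awMeasure d s) (timeVec timeZero h) ∈
      {A : AWFock d s →L[ℂ] AWFock d s | conjOp T' (conjOp T.symm A) = A} := by
    refine weylL_mem_of_phase (fun A hA B hB => ?_) (fun c A hA => ?_) (fun t g hg => ?_) hh
    · rw [Set.mem_ofPred_eq] at hA hB ⊢
      rw [conjOp_mul, conjOp_mul, hA, hB]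
    · rw [Set.mem_ofPred_eq] at hA ⊢
      ext1 x
      have h1 : conjOp T' (conjOp T.symm (c • A)) x = c • conjOp T' (conjOp T.symm A) x := by
        simp only [conjOp_apply, smul_apply, map_smul]
      rw [h1, hA, smul_apply]
    · rw [Set.mem_ofPred_eq, ← conj_evolution, conjOp_mul, conjOp_mul, conjOp_mul, conjOp_mul,
        conjOp_conjOp_evolution hL hL', conjOp_conjOp_evolution hL hL',
        conjOp_conjOp_symm_weylL hT hT' hg]
  change T' (T.symm (expVec _ ((I / √2 : ℂ) • timeVec timeZero h)))
    = expVec _ ((I / √2 : ℂ) • timeVec timeZero h)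
  rw [expVec_eq_smul_weylL_vacuum, map_smul, map_smul, map_symm_apply hmem, map_symm_vacuum hΩ hΩ']

/-- Here T'T⁻¹ fixes the exponential vectors at the time 0 and, by commuting with J, those at the
time β/2. Applying time-zero Weyl operators to the latter produces all exponents with both times, a
total set. -/
theorem eq_of_intertwinesModularJ (hΩ : MapsVacuum T) (hΩ' : MapsVacuum T')
    (hT : IntertwinesFields T) (hT' : IntertwinesFields T')
    (hJ : ∀ x, T' (T.symm (modularJ d s x)) = modularJ d s (T' (T.symm x))) : T' = T := by
  have hpos : (0 : ℝ) < (timeHalf : Set.Icc (0 : ℝ) (β / 2)) := half_pos hβ.out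
  have htot := (isTestFamily_coherentFamily (d := d) (s := s) hpos).total isExhaustion_awShell
  refine eq_of_total htot ?_
  rintro ⟨_, n, ⟨_, hv, rfl⟩⟩
  obtain ⟨_, ⟨g, hg, rfl⟩, _, ⟨g', hg', rfl⟩, rfl⟩ := Submodule.mem_sup.1 hv
  have hg'' : -g' ∈ hermitian (thermalMeasure d s β) := Submodule.neg_mem _ hg'.1
  have hW : ∀ g ∈ hermitian (thermalMeasure d s β), ∀ x,
      T' (T.symm (weylL (awMeasure d s) (timeVec timeZero g) x))
        = weylL (awMeasure d s) (timeVec timeZero g) (T' (T.symm x)) := fun g hg x =>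
    map_symm_apply (conjOp_conjOp_symm_weylL hT hT' hg) x
  have h1 : T' (T.symm (expVec (awMeasure d s) ((I / √2 : ℂ) • timeVec timeHalf g')))
      = expVec (awMeasure d s) ((I / √2 : ℂ) • timeVec timeHalf g') := by
    have h2 : expVec (awMeasure d s) ((I / √2 : ℂ) • timeVec timeHalf g')
        = modularJ d s (expVec (awMeasure d s) ((I / √2 : ℂ) • timeVec timeZero (-g'))) := by
      rw [modularJ_expVec, swapConj_smul, conj_I_div_sqrt_two, swapConj_timeVec, map_neg, smul_neg,
        neg_smul, neg_neg]
    have h3 : T' (T.symm (expVec (awMeasure d s) ((I / √2 : ℂ) • timeVec timeZero (-g'))))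
        = expVec (awMeasure d s) ((I / √2 : ℂ) • timeVec timeZero (-g')) := by
      rw [expVec_eq_smul_weylL_vacuum, map_smul, map_smul, hW _ hg'', map_symm_vacuum hΩ hΩ']
    rw [h2, hJ, h3]
  change T' (T.symm (expVec _ ((I / √2 : ℂ) • (timeVec timeZero g + timeVec timeHalf g'))))
    = expVec _ ((I / √2 : ℂ) • (timeVec timeZero g + timeVec timeHalf g'))
  obtain ⟨c, hc⟩ : ∃ c : ℂ, expVec (awMeasure d s)
      ((I / √2 : ℂ) • (timeVec timeZero g + timeVec timeHalf g'))
      = c • weylL (awMeasure d s) (timeVec timeZero g)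
        (expVec (awMeasure d s) ((I / √2 : ℂ) • timeVec timeHalf g')) := by
    rw [weylL_expVec, weylExp, ← smul_add, add_comm (timeVec timeHalf g')]
    exact ⟨_, by rw [smul_smul, ← Complex.exp_add, neg_add_cancel, Complex.exp_zero, one_smul]⟩
  rw [hc, map_smul, map_smul, hW g hg.1, h1]

end Uniqueness

end ThermalPath

theorem mainTheorem7 (d : ℕ) (s β : ℝ) (hd : 0 < d) (hs : 0 < s) (hβ : 0 < β) :
    ∃ (J : ThermalPath.Phys d s β ≃ₗᵢ⋆[ℂ] ThermalPath.Phys d s β)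
      (J' : ThermalPath.AWFock d s ≃ₗᵢ⋆[ℂ] ThermalPath.AWFock d s),
      ThermalPath.IsModularConjugation (ThermalPath.physAlgebra d s β)
        (ThermalPath.thermalVacuum d s β) J ∧
      ThermalPath.IsModularConjugation (ThermalPath.awAlgebra d s β)
        (ThermalPath.vacuum (ThermalPath.awMeasure d s)) J' ∧
      ∃ T : ThermalPath.Phys d s β ≃ₗᵢ[ℂ] ThermalPath.AWFock d s,
        ThermalPath.MapsVacuum T ∧
        ThermalPath.IntertwinesFields T ∧
        ThermalPath.IntertwinesLiouvillian T ∧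
        (∀ x, T (J x) = J' (T x)) ∧
        ∀ T' : ThermalPath.Phys d s β ≃ₗᵢ[ℂ] ThermalPath.AWFock d s,
          ThermalPath.MapsVacuum T' →
          ThermalPath.IntertwinesFields T' →
          (ThermalPath.IntertwinesLiouvillian T' ∨ ∀ x, T' (J x) = J' (T' x)) →
          T' = T := by
  have : Fact (0 < d) := ⟨hd⟩
  have : Fact (0 < s) := ⟨hs⟩
  have : Fact (0 < β) := ⟨hβ⟩
  refine ⟨ThermalPath.physJ d s β, ThermalPath.modularJ d s,
    ThermalPath.isModularConjugation_physAlgebra, ThermalPath.isModularConjugation_awAlgebra,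
    ThermalPath.euclid d s β, ThermalPath.mapsVacuum_euclid, ThermalPath.intertwinesFields_euclid,
    ThermalPath.intertwinesLiouvillian_euclid, ThermalPath.euclid_physJ, fun T' hΩ hF h => ?_⟩
  rcases h with hL | hJ
  · exact ThermalPath.eq_of_intertwinesLiouvillian ThermalPath.mapsVacuum_euclid hΩ
      ThermalPath.intertwinesFields_euclid hF ThermalPath.intertwinesLiouvillian_euclid hL
  · refine ThermalPath.eq_of_intertwinesModularJ ThermalPath.mapsVacuum_euclid hΩ
      ThermalPath.intertwinesFields_euclid hF fun x => ?_
    -- The path space conjugation is the Fock conjugation transported by T, so intertwining by T'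
    -- makes T'T⁻¹ commute with the Fock conjugation.
    rw [← hJ]
    congr 1
    rw [LinearIsometryEquiv.symm_apply_eq, ThermalPath.euclid_physJ,
      LinearIsometryEquiv.apply_symm_apply]
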